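/- Let $(M,g,J)$ be a nearly Kähler manifold of real dimension $2n$, that is, $(M,g)$ is a smooth Riemannian manifold with an orthogonal almost complex structure $J$ such that $(\nabla_XJ)Y=-(\nabla_YJ)X$ for all vector fields $X,Y$, where $\nabla$ is the Levi-Civita connection. Let $\omega(X,Y)=g(JX,Y)$, and on the space $\Omega^\bullet_{\mathbb C}(M)$ of smooth complex-valued differential forms let $d=\mu+\partial+\overline\partial+\overline\mu$ be the decomposition of the exterior derivative into its components of bidegrees $(2,-1)$, $(1,0)$, $(0,1)$ and $(-1,2)$. For a form $\beta$ put $L_\beta\alpha=\beta\wedge\alpha$, and let $L=L_\omega$. Let $P^*$ denote the metric adjoint of an operator $P$, i.e. its formal adjoint with respect to the $L^2$ Hermitian inner product (tested against compactly supported forms), let $\Lambda=L^*$, let $[P,Q]=PQ-(-1)^{|P||Q|}QP$ be the graded commutator of operators of degrees $|P|$, $|Q|$, where $|P^*|=-|P|$, and let $\Delta_P=[P^*,P]$. Then the adjoints of $L$, $L_{\mu\omega}$, $L_{\overline\mu\omega}$, $\mu$, $\overline\mu$, $\partial$, $\overline\partial$ exist, and on $\Omega^\bullet_{\mathbb C}(M)$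 $$[\overline\mu,\mu]=\frac i9\,\bigl[\Delta_{L_{\mu\omega}}-\Delta_{L_{\overline\mu\omega}},\,L\bigr],$$ $$\bigl[\Lambda,[\mu,L_{\overline\mu\omega}]\bigr]=-\frac i3\,\bigl[\Delta_{L_{\mu\omega}}+\Delta_{L_{\overline\mu\omega}},\,L\bigr],$$ $$\Delta_\partial-\Delta_{\overline\partial}=-2\,(\Delta_\mu-\Delta_{\overline\mu})=-\frac29\,\bigl(\Delta_{L_{\mu\omega}}-\Delta_{L_{\overline\mu\omega}}\bigr).$$ -/

import Mathlib

open Bundle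
open scoped Manifold ContDiff Bundle ComplexConjugate

noncomputable section

namespace NearlyKahler

/-! ### Multilinear algebra on a single real vector space -/

section Algebra

variable {V : Type*} [AddCommGroup V] [Module ℝ V] [TopologicalSpace V]

/-- The wedge product of two complex-valued alternating forms on a real vector space
(the signed sum over `(k, l)`-shuffles), as a form of degree `m = k + l`. -/
def wedge {k l m : ℕ} (h : k + l = m) (a : V [⋀^Fin k]→L[ℝ] ℂ) (b : V [⋀^Fin l]→L[ℝ] ℂ) :
    V [⋀^Fin m]→L[ℝ] ℂ :=
  let w : V [⋀^Fin m]→ₗ[ℝ] ℂ :=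
    ((LinearMap.mul' ℝ ℂ).compAlternatingMap
      (a.toAlternatingMap.domCoprod b.toAlternatingMap)).domDomCongr
        (finSumFinEquiv.trans (finCongr h))
  { w with
    cont := by
      change Continuous fun v : Fin m → V =>
        LinearMap.mul' ℝ ℂ ((a.toAlternatingMap.domCoprod b.toAlternatingMap)
          (fun i => v ((finSumFinEquiv.trans (finCongr h)) i)))
      simp only [AlternatingMap.domCoprod_apply, map_sum, sum_apply]
      refine continuous_finsetSum _ fun σ _ => ?_
      induction σ using Quotient.inductionOn' with | _ σ => ?_
      simp only [AlternatingMap.domCoprod.summand_mk'', smul_apply,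
        MultilinearMap.domDomCongr_apply, MultilinearMap.domCoprod_apply, map_zsmul_unit,
        LinearMap.mul'_apply]
      refine Continuous.const_smul (Continuous.mul ?_ ?_) _
      · exact a.cont.comp (continuous_pi fun i => continuous_apply _)
      · exact b.cont.comp (continuous_pi fun i => continuous_apply _) }

/-- The part of type `(p, k - p)` of a complex-valued alternating `k`-form `a` on `V`, with
respect to a complex structure `J` on `V`. Write `v^{1,0} = (v - iJv)/2`, `v^{0,1} = (v + iJv)/2`
and extend `a` complex multilinearly to the complexification of `V`; then the value on
`v₁, …, v_k` is the sum over all `S ⊆ {1, …, k}` with `p` elements of `a(w₁, …, w_k)`, where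
`w_i = v_i^{1,0}` for `i ∈ S` and `w_i = v_i^{0,1}` for `i ∉ S`. The inner sum over `T` expands
this by multilinearity (`T` is the set of slots in which the term containing `J` is chosen). -/
def typePart (J : V →L[ℝ] V) {k : ℕ} (p : ℤ) (a : V [⋀^Fin k]→L[ℝ] ℂ) : V [⋀^Fin k]→L[ℝ] ℂ :=
  let m : ContinuousMultilinearMap ℝ (fun _ : Fin k => V) ℂ :=
    ∑ S : Finset (Fin k), ∑ T : Finset (Fin k),
      (if (S.card : ℤ) = p then
        ∏ i, (if i ∈ T then (if i ∈ S then -Complex.I else Complex.I) else 1) / 2 else 0) •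
      a.toContinuousMultilinearMap.compContinuousLinearMap
        (fun i => if i ∈ T then J else ContinuousLinearMap.id ℝ V)
  { m with
    map_eq_zero_of_eq' := by
      intro v i j hv hij
      have hvs : ∀ l, v (Equiv.swap i j l) = v l := fun l => Equiv.apply_swap_eq_self hv l
      let F : Finset (Fin k) → Finset (Fin k) → ℂ := fun S T =>
        (if (S.card : ℤ) = p then
          ∏ l, (if l ∈ T then (if l ∈ S then -Complex.I else Complex.I) else 1) / 2 else 0) *
        a (fun l => if l ∈ T then J (v l) else v l)
      have hm : m.toFun v = ∑ S, ∑ T, F S T := by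
        change m v = _
        simp only [m, F, sum_apply, smul_apply,
          ContinuousMultilinearMap.compContinuousLinearMap_apply, smul_eq_mul]
        refine Finset.sum_congr rfl fun S _ => Finset.sum_congr rfl fun T _ => ?_
        congr 1
        change a _ = a _
        congr 1
        funext l
        split_ifs <;> rfl
      let e : Finset (Fin k) ≃ Finset (Fin k) := (Equiv.swap i j).finsetCongr
      have he : ∀ (S : Finset (Fin k)) l, l ∈ e S ↔ Equiv.swap i j l ∈ S := fun S l => by
        simp [e, Finset.mem_map_equiv]
      have hF : ∀ S T, F (e S) (e T) = - F S T := fun S T => by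
        have h1 : (e S).card = S.card := by simp [e]
        have h2 : (∏ l, (if l ∈ e T then (if l ∈ e S then -Complex.I else Complex.I) else 1) / 2) =
            ∏ l, (if l ∈ T then (if l ∈ S then -Complex.I else Complex.I) else 1) / 2 := by
          simp only [he]
          exact Equiv.prod_comp (Equiv.swap i j)
            (fun l => (if l ∈ T then (if l ∈ S then -Complex.I else Complex.I) else 1) / 2)
        have h3 : a (fun l => if l ∈ e T then J (v l) else v l) =
            - a (fun l => if l ∈ T then J (v l) else v l) := by
          have h4 : a ((fun l => if l ∈ T then J (v l) else v l) ∘ Equiv.swap i j) =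
              - a (fun l => if l ∈ T then J (v l) else v l) :=
            a.toAlternatingMap.map_swap _ hij
          rw [← h4]
          congr 1
          funext l
          simp only [he, Function.comp_apply, hvs]
        simp only [F, h1, h2, h3, mul_neg]
      have hs : (∑ S, ∑ T, F S T) = - ∑ S, ∑ T, F S T := by
        conv_lhs => rw [← Equiv.sum_comp e]
        rw [← Finset.sum_neg_distrib]
        refine Finset.sum_congr rfl fun S _ => ?_
        rw [← Equiv.sum_comp e, ← Finset.sum_neg_distrib]
        exact Finset.sum_congr rfl fun T _ => hF S T
      change m.toFun v = 0
      rw [hm]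
      exact self_eq_neg.mp hs }

end Algebra

/-! ### Differential forms on manifolds -/

section Forms

variable (n : ℕ) (M : Type*) [TopologicalSpace M] [ChartedSpace (EuclideanSpace ℝ (Fin (2 * n))) M]

/-- Complex-valued differential forms on the `2n`-dimensional manifold `M`, not necessarily smooth
nor homogeneous: the component `α k` of degree `k` assigns to each point `x` an alternating
`k`-form on the tangent space at `x`. (Components of degree `k > 2n` vanish automatically.)
The space `Ω^•(M; ℂ)` consists of those `α` with `IsSmooth α`. -/
abbrev Form : Type _ :=
  (k : ℕ) → (x : M) → (TangentSpace (𝓡 (2 * n)) x) [⋀^Fin k]→L[ℝ] ℂ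

/-- Operators on forms. Only their values on smooth forms are meaningful. -/
abbrev Operator : Type _ := Form n M → Form n M

variable {n M}

/-- The pullback of the degree `k` component of `α` under the inverse of the chart at `c`,
a `k`-form on the target of this chart in `ℝ^{2n}`. -/
def chartRep (α : Form n M) (k : ℕ) (c : M) (y : EuclideanSpace ℝ (Fin (2 * n))) :
    EuclideanSpace ℝ (Fin (2 * n)) [⋀^Fin k]→L[ℝ] ℂ :=
  (α k ((extChartAt (𝓡 (2 * n)) c).symm y)).compContinuousLinearMap
    (mfderiv 𝓘(ℝ, EuclideanSpace ℝ (Fin (2 * n))) (𝓡 (2 * n)) (extChartAt (𝓡 (2 * n)) c).symm y)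

/-- A form is smooth if all its components are smooth in every chart. -/
def IsSmooth (α : Form n M) : Prop :=
  ∀ (k : ℕ) (c : M), ContDiffOn ℝ ∞ (chartRep α k c) (extChartAt (𝓡 (2 * n)) c).target

/-- A form has compact support if it vanishes outside a compact set. -/
def IsCompactlySupported (α : Form n M) : Prop :=
  ∃ K : Set M, IsCompact K ∧ ∀ x ∉ K, ∀ k, α k x = 0

/-- The exterior derivative, computed at `x` in the chart at `x`. -/
def extd : Operator n M := fun α k x =>
  match k with
  | 0 => 0
  | k + 1 =>
    (extDeriv (chartRep α k x) (extChartAt (𝓡 (2 * n)) x x)).compContinuousLinearMap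
      (mfderiv (𝓡 (2 * n)) 𝓘(ℝ, EuclideanSpace ℝ (Fin (2 * n))) (extChartAt (𝓡 (2 * n)) x) x)

/-- The operator `L_β` of left multiplication by `β`, `L_β α = β ∧ α`. -/
def mulLeft (β : Form n M) : Operator n M := fun α m x =>
  ∑ k : Fin (m + 1), wedge (Nat.add_sub_of_le (Nat.le_of_lt_succ k.2)) (β k x) (α (m - k) x)

/-- The graded commutator `PQ - (-1)^{pq} QP` of operators `P`, `Q` of degrees `p`, `q`. -/
def gradedComm (p q : ℤ) (P Q : Operator n M) : Operator n M := fun α =>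
  P (Q α) - ((-1 : ℂ) ^ (p * q)) • Q (P α)

/-- The integral over `M`, with respect to the volume `√det(g_{ab}) dx` of the Riemannian metric
`g`, of a function with compact support, computed by means of a smooth partition of unity which is
subordinate to the domains of the charts. -/
def integral [T2Space M] [SigmaCompactSpace M] [IsManifold (𝓡 (2 * n)) ∞ M]
    [RiemannianBundle (fun x : M => TangentSpace (𝓡 (2 * n)) x)] (f : M → ℂ) : ℂ :=
  ∑ᶠ c : M, ∫ y in (extChartAt (𝓡 (2 * n)) c).target,
    (((SmoothPartitionOfUnity.exists_isSubordinate_chartAt_source (𝓡 (2 * n)) M).choose c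
        ((extChartAt (𝓡 (2 * n)) c).symm y) *
      Real.sqrt (Matrix.det (Matrix.of fun a b : Fin (2 * n) =>
        inner ℝ
          (mfderiv 𝓘(ℝ, EuclideanSpace ℝ (Fin (2 * n))) (𝓡 (2 * n))
            (extChartAt (𝓡 (2 * n)) c).symm y (EuclideanSpace.single a 1))
          (mfderiv 𝓘(ℝ, EuclideanSpace ℝ (Fin (2 * n))) (𝓡 (2 * n))
            (extChartAt (𝓡 (2 * n)) c).symm y (EuclideanSpace.single b 1)))) : ℝ) : ℂ) *
      f ((extChartAt (𝓡 (2 * n)) c).symm y)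

instance (x : M) : FiniteDimensional ℝ (TangentSpace (𝓡 (2 * n)) x) :=
  inferInstanceAs (FiniteDimensional ℝ (EuclideanSpace ℝ (Fin (2 * n))))

/-- The Hermitian inner product of two forms at `x` induced by the Riemannian metric: forms of
different degrees are orthogonal, and if `e` is an orthonormal basis of the tangent space at `x`
with dual basis `e^1, …, e^{2n}`, then the `e^{i₁} ∧ … ∧ e^{i_k}` with `i₁ < … < i_k` are
orthonormal. (The sum runs over all `k`-tuples of indices, whence the factor `1/k!`.) -/
def hermInner [RiemannianBundle (fun x : M => TangentSpace (𝓡 (2 * n)) x)]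
    (α β : Form n M) (x : M) : ℂ :=
  let e := stdOrthonormalBasis ℝ (TangentSpace (𝓡 (2 * n)) x)
  ∑ k ∈ Finset.range (2 * n + 1), (k.factorial : ℂ)⁻¹ *
    ∑ i : Fin k → Fin (Module.finrank ℝ (TangentSpace (𝓡 (2 * n)) x)),
      α k x (fun j => e (i j)) * conj (β k x (fun j => e (i j)))

section Adjoint

variable [T2Space M] [SigmaCompactSpace M] [IsManifold (𝓡 (2 * n)) ∞ M]
  [RiemannianBundle (fun x : M => TangentSpace (𝓡 (2 * n)) x)]

/-- `Q` is a (formal) metric adjoint of `P`: it maps smooth forms to smooth forms, and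
`(Pα, β)_{L²} = (α, Qβ)_{L²}` for all smooth forms `α`, `β` with `α` of compact support. -/
def IsMetricAdjoint (P Q : Operator n M) : Prop :=
  (∀ β, IsSmooth β → IsSmooth (Q β)) ∧
  ∀ α β : Form n M, IsSmooth α → IsCompactlySupported α → IsSmooth β →
    integral (n := n) (hermInner (P α) β) = integral (n := n) (hermInner α (Q β))

open Classical in
/-- The metric adjoint `P^*` of an operator `P` that has one (its values on smooth forms are then
uniquely determined), and `0` otherwise. -/
def metricAdjoint (P : Operator n M) : Operator n M :=
  if h : ∃ Q, IsMetricAdjoint P Q then h.choose else 0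

/-- The Laplacian `Δ_P = [P^*, P]` (graded commutator) of an operator `P` of degree `p`. -/
def laplacian (p : ℤ) (P : Operator n M) : Operator n M :=
  gradedComm (-p) p (metricAdjoint P) P

end Adjoint

end Forms

/-! ### Almost Hermitian and nearly Kähler manifolds -/

section AlmostHermitian

variable (n : ℕ) (M : Type*) [TopologicalSpace M] [ChartedSpace (EuclideanSpace ℝ (Fin (2 * n))) M]
  [IsManifold (𝓡 (2 * n)) ∞ M]
  [RiemannianBundle (fun x : M => TangentSpace (𝓡 (2 * n)) x)]

/-- A smooth almost complex structure on the Riemannian manifold `M` which is orthogonal for the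
Riemannian metric, that is, which makes `M` into an almost Hermitian manifold. -/
structure AlmostHermitianStructure where
  /-- The almost complex structure. -/
  J : (x : M) → TangentSpace (𝓡 (2 * n)) x →L[ℝ] TangentSpace (𝓡 (2 * n)) x
  contMDiff : ContMDiff (𝓡 (2 * n))
    ((𝓡 (2 * n)).prod
      𝓘(ℝ, EuclideanSpace ℝ (Fin (2 * n)) →L[ℝ] EuclideanSpace ℝ (Fin (2 * n)))) ∞
    (fun x => Bundle.TotalSpace.mk'
      (EuclideanSpace ℝ (Fin (2 * n)) →L[ℝ] EuclideanSpace ℝ (Fin (2 * n)))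
      (E := fun x : M => TangentSpace (𝓡 (2 * n)) x →L[ℝ] TangentSpace (𝓡 (2 * n)) x) x (J x))
  sq : ∀ x v, J x (J x v) = -v
  inner_map : ∀ x v w, inner ℝ (J x v) (J x w) = inner ℝ v w

variable {n M}

/-- The Levi-Civita connection: compatible with the metric and torsion-free. -/
def IsLeviCivita [IsContMDiffRiemannianBundle (𝓡 (2 * n)) ∞ (EuclideanSpace ℝ (Fin (2 * n)))
      (fun x : M => TangentSpace (𝓡 (2 * n)) x)]
    (nabla : CovariantDerivative (𝓡 (2 * n)) (EuclideanSpace ℝ (Fin (2 * n)))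
      (fun x : M => TangentSpace (𝓡 (2 * n)) x)) : Prop :=
  haveI : IsContMDiffRiemannianBundle (𝓡 (2 * n)) 1 (EuclideanSpace ℝ (Fin (2 * n)))
      (fun x : M => TangentSpace (𝓡 (2 * n)) x) :=
    IsContMDiffRiemannianBundle.of_le (n := ∞) (by simp)
  nabla.IsMetricCompatible ∧ nabla.torsion = 0

namespace AlmostHermitianStructure

variable (A : AlmostHermitianStructure n M)

/-- `(M, g, J)` is nearly Kähler if `(∇_X J) Y = - (∇_Y J) X` for all smooth vector fields `X`, `Y`,
where `∇` is the Levi-Civita connection and `(∇_X J) Y = ∇_X (J Y) - J (∇_X Y)`.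
(Mathlib writes `∇_X Y` at the point `x` as `nabla Y x (X x)`.) -/
def IsNearlyKahler [IsContMDiffRiemannianBundle (𝓡 (2 * n)) ∞ (EuclideanSpace ℝ (Fin (2 * n)))
      (fun x : M => TangentSpace (𝓡 (2 * n)) x)] : Prop :=
  ∃ nabla : CovariantDerivative (𝓡 (2 * n)) (EuclideanSpace ℝ (Fin (2 * n)))
      (fun x : M => TangentSpace (𝓡 (2 * n)) x),
    IsLeviCivita nabla ∧
    ∀ X Y : (x : M) → TangentSpace (𝓡 (2 * n)) x,
      ContMDiff (𝓡 (2 * n)) (𝓡 (2 * n)).tangent ∞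
        (fun x => (⟨x, X x⟩ : TangentBundle (𝓡 (2 * n)) M)) →
      ContMDiff (𝓡 (2 * n)) (𝓡 (2 * n)).tangent ∞
        (fun x => (⟨x, Y x⟩ : TangentBundle (𝓡 (2 * n)) M)) →
      ∀ x, nabla (fun z => A.J z (Y z)) x (X x) - A.J x (nabla Y x (X x)) =
        -(nabla (fun z => A.J z (X z)) x (Y x) - A.J x (nabla X x (Y x)))

theorem inner_swap (x : M) (v w : TangentSpace (𝓡 (2 * n)) x) :
    inner ℝ (A.J x v) w = - inner ℝ (A.J x w) v := by
  rw [← A.inner_map x (A.J x v) w, A.sq, inner_neg_left, real_inner_comm]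

/-- The fundamental form `ω(v, w) = g(Jv, w)`. -/
def fundamentalForm : Form n M := fun k x =>
  match k with
  | 2 =>
    { toFun := fun v => ((inner ℝ (A.J x (v 0)) (v 1) : ℝ) : ℂ)
      map_update_add' := by
        intro _ v i a b
        fin_cases i <;> simp [Function.update, inner_add_left, inner_add_right]
      map_update_smul' := by
        intro _ v i c a
        fin_cases i <;> simp [Function.update, inner_smul_left, inner_smul_right]
      map_eq_zero_of_eq' := by
        intro v i j hv hij
        have h01 : v 0 = v 1 := by
          fin_cases i <;> fin_cases j <;> simp_all
        have h := A.inner_swap x (v 1) (v 1)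
        rw [h01, self_eq_neg.mp h, Complex.ofReal_zero]
      cont := Complex.continuous_ofReal.comp
        (((A.J x).continuous.comp (continuous_apply 0)).inner (continuous_apply 1)) }
  | _ => 0

/-- The Lefschetz operator `L = L_ω`. -/
def lefschetz : Operator n M := mulLeft A.fundamentalForm

/-- The projection `α ↦ α^{p,q}` of forms to their part of type `(p, q)` (zero unless
`p, q ≥ 0`). -/
def typeProj (p q : ℤ) : Operator n M := fun α k x =>
  if p + q = (k : ℤ) then typePart (A.J x) p (α k x) else 0

/-- The component of bidegree `(a, b)` of the exterior derivative: on forms of type `(p, q)` it is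
the `(p + a, q + b)`-part of `d`. Here `(p + a, q + b) = (r, k - r)` is the type of the output. -/
def dPart (a b : ℤ) : Operator n M := fun α k x =>
  ∑ r ∈ Finset.Icc (0 : ℤ) k,
    A.typeProj r (k - r) (extd (A.typeProj (r - a) (k - r - b) α)) k x

/-- The component `μ` of `d`, of bidegree `(2, -1)`. -/
def mu : Operator n M := A.dPart 2 (-1)

/-- The component `∂` of `d`, of bidegree `(1, 0)`. -/
def del : Operator n M := A.dPart 1 0

/-- The component `∂̄` of `d`, of bidegree `(0, 1)`. -/
def delbar : Operator n M := A.dPart 0 1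

/-- The component `μ̄` of `d`, of bidegree `(-1, 2)`. -/
def mubar : Operator n M := A.dPart (-1) 2

end AlmostHermitianStructure

end AlmostHermitian

end NearlyKahler

end

/-! On a nearly Kähler manifold the connection ∇' = ∇ − ½ J∇J preserves both g and J. Its torsion
T(X,Y) = −J(∇_X J)Y is totally skew of type (3,0)+(0,3). Hence d = Σ e^j ∧ ∇'_j + τ, where τ = ½ Σ
T_ijk e^i ∧ e^j ∧ ι_k is of order zero. Since ∇' preserves types, the (3,0) and (0,3) parts of T
give exactly μ and μ̄, while ∂ and ∂̄ are the two halves of Σ e^j ∧ ∇'_j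
(`exists_hermitian_connection`, `IsHermConn.rep_dPart`).

Write e = L_{μω}, f = L_{μ̄ω}, E_k = (ad Λ)^k e and F_k = (ad Λ)^k f. In an orthonormal frame these
are cubic expressions in exterior and interior multiplications, and each bracket with Λ turns one
exterior factor into an interior one (`br_lefΛ_tri` and its companions). Comparing coefficients
gives μ = −⅓E₁, μ̄ = −⅓F₁, μ* = −(i/6)F₂, μ̄* = (i/6)E₂, e* = −(i/6)F₃ and f* = (i/6)E₃. Moreover
[L,e] = [L,f] = 0, both e and f have weight 3 for [L,Λ], and {e,f} = 0.

The first two identities are then formal. The sl₂-string gives [L,E₃] = 3E₂ and [L,F₃] = 3F₂, and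
(ad Λ)²{e,f} = 0 reads {E₂,f} + 2{E₁,F₁} + {e,F₂} = 0 (`acomm_mubar_mu`, `br_acomm_mu`).

For the last line, all three differences of Laplacians are multiples of X = [Λ,{E₁,F₁}]. Those of e,
f give (i/2)X by (ad Λ)³{e,f} = 0; those of μ, μ̄ give (i/18)X by the Leibniz rule; those of ∂, ∂̄
give −(i/9)X. The last case rests on ∂* = i[Λ,∂̄], ∂̄* = −i[Λ,∂], and on the (1,1) component {∂,∂̄}
+ {μ,μ̄} = 0 of d² = 0 (`acomm_add_acomm_eq_zero`).

The formulas for ∂* and ∂̄* hold because Λ is ∇'-parallel and the adjoint of e^{1,0}∧ is −i[Λ,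
e^{0,1}∧]. The defect of adjointness is then the divergence of a vector field, with no extra term
because a skew torsion has zero trace (`divergence_identity`). A partition of unity reduces its
integral to charts, where it vanishes. Formal adjoints are unique on smooth forms, so all formulas
apply to the chosen `metricAdjoint`.

Derivatives are taken along lines through a single point of a chart, in the coordinate basis and
with variable metric; algebra at that point uses a frame orthonormal there. The resulting operators
are compared in the endomorphism ring of the space of smooth forms. -/

noncomputable section

namespace NearlyKahler

set_option linter.unusedSectionVars false

/-! ### The fibre of the bundle of forms: interior and exterior multiplication -/

section Fibre

variable {V : Type*} [AddCommGroup V] [Module ℝ V] [TopologicalSpace V]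

variable (V) in
/-- The inhomogeneous complex-valued alternating forms on `V`. -/
def Fib : Type _ := (k : ℕ) → V [⋀^Fin k]→L[ℝ] ℂ

instance : AddCommGroup (Fib V) :=
  inferInstanceAs (AddCommGroup ((k : ℕ) → V [⋀^Fin k]→L[ℝ] ℂ))

instance : Module ℂ (Fib V) :=
  inferInstanceAs (Module ℂ ((k : ℕ) → V [⋀^Fin k]→L[ℝ] ℂ))

namespace Fib

theorem ext {a b : Fib V} (h : ∀ k, a k = b k) : a = b := funext h

theorem ext_apply {a b : Fib V} (h : ∀ k w, a k w = b k w) : a = b :=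
  funext fun k => ContinuousAlternatingMap.ext (h k)

theorem add_apply (a b : Fib V) (k : ℕ) : (a + b) k = a k + b k := rfl

theorem sub_apply (a b : Fib V) (k : ℕ) : (a - b) k = a k - b k := rfl

theorem smul_apply (c : ℂ) (a : Fib V) (k : ℕ) : (c • a) k = c • a k := rfl

@[simp] theorem add_apply_apply (a b : Fib V) (k : ℕ) (w : Fin k → V) :
    (a + b) k w = a k w + b k w := rfl

@[simp] theorem zero_apply_apply (k : ℕ) (w : Fin k → V) : (0 : Fib V) k w = 0 := rfl

@[simp] theorem sub_apply_apply (a b : Fib V) (k : ℕ) (w : Fin k → V) :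
    (a - b) k w = a k w - b k w := rfl

@[simp] theorem neg_apply_apply (a : Fib V) (k : ℕ) (w : Fin k → V) :
    (-a) k w = -a k w := rfl

@[simp] theorem smul_apply_apply (c : ℂ) (a : Fib V) (k : ℕ) (w : Fin k → V) :
    (c • a) k w = c * a k w := rfl

/-- Evaluation of the component of degree `k` on `k` vectors. -/
def eval (k : ℕ) (w : Fin k → V) : Fib V →ₗ[ℂ] ℂ where
  toFun a := a k w
  map_add' _ _ := rfl
  map_smul' _ _ := rfl

@[simp] theorem sum_apply_apply {ι : Type*} (s : Finset ι) (a : ι → Fib V) (k : ℕ)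
    (w : Fin k → V) : (∑ i ∈ s, a i) k w = ∑ i ∈ s, a i k w := map_sum (eval k w) a s

end Fib

/-- Interior multiplication of a form of positive degree by a vector. -/
def iotaForm {k : ℕ} (v : V) (a : V [⋀^Fin (k + 1)]→L[ℝ] ℂ) : V [⋀^Fin k]→L[ℝ] ℂ :=
  { a.toAlternatingMap.curryLeft v with
    cont := by
      change Continuous fun w : Fin k → V => a (Fin.cons v w)
      exact a.cont.comp (continuous_pi fun i => by
        refine Fin.cases ?_ (fun j => ?_) i
        · simpa using! continuous_const
        · simpa using! continuous_apply j) }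

@[simp] theorem iotaForm_apply {k : ℕ} (v : V) (a : V [⋀^Fin (k + 1)]→L[ℝ] ℂ) (w : Fin k → V) :
    iotaForm v a w = a (Fin.cons v w) := rfl

/-- Interior multiplication by a vector. -/
def iota (v : V) : Module.End ℂ (Fib V) where
  toFun a := fun k => iotaForm v (a (k + 1))
  map_add' _ _ := rfl
  map_smul' _ _ := rfl

theorem iota_apply (v : V) (a : Fib V) (k : ℕ) : iota v a k = iotaForm v (a (k + 1)) := rfl

@[simp] theorem iota_apply_apply (v : V) (a : Fib V) (k : ℕ) (w : Fin k → V) :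
    iota v a k w = a (k + 1) (Fin.cons v w) := rfl

theorem iota_add (v w : V) : iota (v + w) = iota v + iota w := by
  refine LinearMap.ext fun a => Fib.ext_apply fun k u => ?_
  exact (a (k + 1)).cons_add u v w

theorem iota_smul (c : ℝ) (v : V) : iota (c • v) = (c : ℂ) • iota v := by
  refine LinearMap.ext fun a => Fib.ext_apply fun k u => ?_
  exact ((a (k + 1)).cons_smul u c v).trans (Complex.real_smul)

theorem iota_neg (v : V) : iota (-v) = -iota v := by
  have := iota_smul (-1) v
  simpa using this

theorem iota_zero : iota (0 : V) = 0 := by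
  have := iota_smul 0 (0 : V)
  simpa using this

theorem iota_sum {ι : Type*} (s : Finset ι) (v : ι → V) :
    iota (∑ i ∈ s, v i) = ∑ i ∈ s, iota (v i) := by
  classical
  induction s using Finset.induction_on with
  | empty => simp [iota_zero]
  | insert i s hi ih => rw [Finset.sum_insert hi, Finset.sum_insert hi, iota_add, ih]

/-- The device behind most inductions on the degree below: contract both sides with an arbitrary
vector, commute the contraction inwards, and use the identity one degree lower. -/
theorem form_ext_iota {k : ℕ} {a b : V [⋀^Fin (k + 1)]→L[ℝ] ℂ}
    (h : ∀ v, iotaForm v a = iotaForm v b) : a = b := by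
  ext w
  have := congrArg (fun f : V [⋀^Fin k]→L[ℝ] ℂ => f (Fin.tail w)) (h (w 0))
  simpa using this

theorem form_ext_zero {a b : V [⋀^Fin 0]→L[ℝ] ℂ} (h : a Fin.elim0 = b Fin.elim0) : a = b := by
  ext w
  rwa [Subsingleton.elim w Fin.elim0]

theorem iota_mul_iota (v w : V) : iota v * iota w = -(iota w * iota v) := by
  refine LinearMap.ext fun a => Fib.ext_apply fun k u => ?_
  have := (a (k + 2)).toAlternatingMap.map_swap
    (v := (Fin.cons v (Fin.cons w u) : Fin (k + 2) → V)) (i := 0) (j := 1) (by simp)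
  simp only [Module.End.mul_apply, iota_apply_apply, LinearMap.neg_apply, Fib.neg_apply_apply]
  refine Eq.trans ?_ this
  change a (k + 2) _ = a (k + 2) _
  congr 1
  funext i
  refine Fin.cases ?_ (fun i => Fin.cases ?_ (fun i => ?_) i) i
  · simp
  · simp
  · simp only [Fin.cons_succ, Function.comp_apply]
    rw [Equiv.swap_apply_of_ne_of_ne (by simp [Fin.ext_iff]) (by simp [Fin.ext_iff])]
    simp

end Fibre

/-! ### Exterior multiplication and the canonical anticommutation relations. -/

section Exterior

variable {E : Type*} [NormedAddCommGroup E] [NormedSpace ℝ E]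

/-- Exterior multiplication of a form by a covector. -/
def epsForm {k : ℕ} (θ : E →L[ℝ] ℂ) (a : E [⋀^Fin k]→L[ℝ] ℂ) : E [⋀^Fin (k + 1)]→L[ℝ] ℂ :=
  ContinuousAlternatingMap.alternatizeUncurryFin (θ.smulRight a)

theorem epsForm_apply {k : ℕ} (θ : E →L[ℝ] ℂ) (a : E [⋀^Fin k]→L[ℝ] ℂ) (w : Fin (k + 1) → E) :
    epsForm θ a w = ∑ i : Fin (k + 1), (-1) ^ (i : ℕ) * (θ (w i) * a (i.removeNth w)) := by
  rw [epsForm, ContinuousAlternatingMap.alternatizeUncurryFin_apply]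
  simp [zsmul_eq_mul]

/-- Exterior multiplication by a covector, as a function. -/
def epsFun (θ : E →L[ℝ] ℂ) (a : Fib E) : Fib E
  | 0 => 0
  | k + 1 => epsForm θ (a k)

/-- Exterior multiplication by a covector. -/
def eps (θ : E →L[ℝ] ℂ) : Module.End ℂ (Fib E) where
  toFun := epsFun θ
  map_add' a b := by
    refine Fib.ext_apply fun k w => ?_
    cases k with
    | zero => simp [epsFun]
    | succ k => simp [epsFun, epsForm_apply, mul_add, Finset.sum_add_distrib]
  map_smul' c a := by
    refine Fib.ext_apply fun k w => ?_
    cases k with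
    | zero => simp [epsFun]
    | succ k =>
      simp only [epsFun, epsForm_apply, Fib.smul_apply_apply, RingHom.id_apply, Finset.mul_sum]
      exact Finset.sum_congr rfl fun i _ => by ring

@[simp] theorem eps_apply_zero (θ : E →L[ℝ] ℂ) (a : Fib E) : eps θ a 0 = 0 := rfl

@[simp] theorem eps_apply_succ (θ : E →L[ℝ] ℂ) (a : Fib E) (k : ℕ) :
    eps θ a (k + 1) = epsForm θ (a k) := rfl

theorem eps_add (θ φ : E →L[ℝ] ℂ) : eps (θ + φ) = eps θ + eps φ := by
  refine LinearMap.ext fun a => Fib.ext_apply fun k w => ?_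
  cases k with
  | zero => simp
  | succ k => simp [epsForm_apply, add_mul, mul_add, Finset.sum_add_distrib]

theorem eps_smul (c : ℂ) (θ : E →L[ℝ] ℂ) : eps (c • θ) = c • eps θ := by
  refine LinearMap.ext fun a => Fib.ext_apply fun k w => ?_
  cases k with
  | zero => simp
  | succ k =>
    simp only [eps_apply_succ, epsForm_apply, LinearMap.smul_apply, Fib.smul_apply_apply,
      smul_eq_mul, Finset.mul_sum, smul_apply]
    exact Finset.sum_congr rfl fun i _ => by ring

/-- Exterior multiplication by a covector depends linearly on the covector. -/
def epsLin : (E →L[ℝ] ℂ) →ₗ[ℂ] Module.End ℂ (Fib E) where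
  toFun := eps
  map_add' := eps_add
  map_smul' := eps_smul

theorem eps_neg (θ : E →L[ℝ] ℂ) : eps (-θ) = -eps θ := map_neg epsLin θ

theorem eps_sum {ι : Type*} (s : Finset ι) (θ : ι → E →L[ℝ] ℂ) :
    eps (∑ i ∈ s, θ i) = ∑ i ∈ s, eps (θ i) := map_sum epsLin θ s

theorem iotaForm_epsForm_zero (v : E) (θ : E →L[ℝ] ℂ) (a : E [⋀^Fin 0]→L[ℝ] ℂ) :
    iotaForm v (epsForm θ a) = θ v • a := by
  ext w
  rw [iotaForm_apply, epsForm_apply, Fin.sum_univ_succ]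
  simp only [Finset.univ_eq_empty, Finset.sum_empty, add_zero, Fin.val_zero, pow_zero, one_mul,
    Fin.cons_zero, ContinuousAlternatingMap.smul_apply, smul_eq_mul]
  congr 2

theorem iotaForm_epsForm {k : ℕ} (v : E) (θ : E →L[ℝ] ℂ) (a : E [⋀^Fin (k + 1)]→L[ℝ] ℂ) :
    iotaForm v (epsForm θ a) = θ v • a - epsForm θ (iotaForm v a) := by
  ext w
  simp only [iotaForm_apply, epsForm_apply, ContinuousAlternatingMap.sub_apply,
    ContinuousAlternatingMap.smul_apply, smul_eq_mul]
  rw [Fin.sum_univ_succ, sub_eq_add_neg, ← Finset.sum_neg_distrib]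
  congr 1
  · simp only [Fin.val_zero, pow_zero, one_mul, Fin.cons_zero]
    rfl
  · refine Finset.sum_congr rfl fun i _ => ?_
    have : i.succ.removeNth (Fin.cons v w : Fin (k + 2) → E) = Fin.cons v (i.removeNth w) := by
      funext j
      refine Fin.cases ?_ (fun j => ?_) j
      · simp [Fin.removeNth]
      · simp [Fin.removeNth]
    rw [this, Fin.cons_succ, Fin.val_succ, pow_succ]
    ring

/-- The canonical anticommutation relation. -/
theorem iota_mul_eps (v : E) (θ : E →L[ℝ] ℂ) :
    iota v * eps θ = θ v • (1 : Module.End ℂ (Fib E)) - eps θ * iota v := by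
  refine LinearMap.ext fun a => funext fun k => ?_
  cases k with
  | zero =>
    change iotaForm v (epsForm θ (a 0)) = θ v • a 0 - 0
    rw [sub_zero, iotaForm_epsForm_zero]
  | succ k => exact iotaForm_epsForm v θ (a (k + 1))

theorem iota_eps (v : E) (θ : E →L[ℝ] ℂ) (a : Fib E) :
    iota v (eps θ a) = θ v • a - eps θ (iota v a) :=
  LinearMap.congr_fun (iota_mul_eps v θ) a

/-- Induction on the degree. Contracting with v produces the terms with θ(v) and φ(v), which already
match, and otherwise the same relation for the contracted form. -/
theorem eps_mul_eps (θ φ : E →L[ℝ] ℂ) : eps θ * eps φ = -(eps φ * eps θ) := by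
  have key : ∀ (k : ℕ) (a : Fib E), eps θ (eps φ a) k = -(eps φ (eps θ a) k) := by
    intro k
    induction k with
    | zero => intro a; ext w; simp
    | succ k ih =>
      intro a
      refine form_ext_iota fun v => ?_
      change iota v (eps θ (eps φ a)) k = -iota v (eps φ (eps θ a)) k
      ext w
      simp only [iota_eps, map_sub, map_smul, Fib.sub_apply_apply, Fib.smul_apply_apply,
        ih (iota v a), ContinuousAlternatingMap.neg_apply]
      ring
  exact LinearMap.ext fun a => funext fun k => key k a

end Exterior

/-! ### Expansions in a basis. -/

section Bases

variable {E : Type*} [NormedAddCommGroup E] [NormedSpace ℝ E] [FiniteDimensional ℝ E]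
  {ι : Type*} [Fintype ι]

/-- The coordinate functionals of a basis, as complex-valued functionals. -/
def coordC (b : Module.Basis ι ℝ E) (j : ι) : E →L[ℝ] ℂ :=
  Complex.ofRealCLM.comp (LinearMap.toContinuousLinearMap (b.coord j))

@[simp] theorem coordC_apply (b : Module.Basis ι ℝ E) (j : ι) (v : E) :
    coordC b j v = (b.repr v j : ℂ) := rfl

theorem sum_coordC_smul (b : Module.Basis ι ℝ E) (θ : E →L[ℝ] ℂ) :
    ∑ j, θ (b j) • coordC b j = θ := by
  ext v
  conv_rhs => rw [← b.sum_repr v]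
  rw [map_sum]
  simp [mul_comm]

theorem sum_coordC_smul_iota (b : Module.Basis ι ℝ E) (v : E) :
    ∑ j, coordC b j v • iota (b j) = iota v := by
  conv_rhs => rw [← b.sum_repr v, iota_sum]
  simp [iota_smul]

theorem sum_coordC_smul_eps (b : Module.Basis ι ℝ E) (θ : E →L[ℝ] ℂ) :
    ∑ j, θ (b j) • eps (coordC b j) = eps θ := by
  conv_rhs => rw [← sum_coordC_smul b θ, eps_sum]
  simp [eps_smul]

/-- Euler's identity: Σ ε^j ι_j multiplies by the degree. The sum is the alternatization of the
curried form, to which each of the k + 1 slots contributes one copy of the form. -/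
theorem sum_epsForm_iotaForm (b : Module.Basis ι ℝ E) {k : ℕ} (a : E [⋀^Fin (k + 1)]→L[ℝ] ℂ) :
    ∑ j, epsForm (coordC b j) (iotaForm (b j) a) = ((k : ℂ) + 1) • a := by
  have h : ∑ j, (coordC b j).smulRight (iotaForm (b j) a) = a.curryLeft := by
    ext v w
    let a' : Fib E := Function.update (fun _ => 0) (k + 1) a
    have ha : a' (k + 1) = a := Function.update_self ..
    have := congrArg (fun f : Module.End ℂ (Fib E) => f a' k w) (sum_coordC_smul_iota b v)
    simp only [LinearMap.sum_apply, LinearMap.smul_apply, Fib.sum_apply_apply,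
      Fib.smul_apply_apply, iota_apply_apply, ha] at this
    simpa using! this
  have h2 := ContinuousAlternatingMap.alternatizeUncurryFin_curryLeft a
  have h3 : ∑ j, epsForm (coordC b j) (iotaForm (b j) a) = (k + 1) • a := by
    rw [← h2, ← h]
    exact (map_sum (ContinuousAlternatingMap.alternatizeUncurryFinCLM ℝ E ℂ).toLinearMap _ _).symm
  rw [h3]
  ext w
  simp

end Bases

/-! ### The wedge product -/

section Wedge

variable {V : Type*} [AddCommGroup V] [Module ℝ V] [TopologicalSpace V]

/-- A shuffle is a class of permutations modulo those of the two blocks. Each class has k! l!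
members with equal contributions, which gives the normalizing factor of the sum over all
permutations. -/
theorem wedge_apply {k l m : ℕ} (h : k + l = m) (a : V [⋀^Fin k]→L[ℝ] ℂ) (b : V [⋀^Fin l]→L[ℝ] ℂ)
    (v : Fin m → V) :
    wedge h a b v = ((k.factorial * l.factorial : ℕ) : ℂ)⁻¹ *
      ∑ σ : Equiv.Perm (Fin m), ((Equiv.Perm.sign σ : ℤ) : ℂ) *
        (a (fun i => v (σ (Fin.cast h (Fin.castAdd l i)))) *
          b (fun j => v (σ (Fin.cast h (Fin.natAdd k j))))) := by
  subst h
  have h1 := MultilinearMap.domCoprod_alternization_eq a.toAlternatingMap b.toAlternatingMap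
  have h2 := congrArg (fun f => LinearMap.mul' ℝ ℂ (f (v ∘ finSumFinEquiv))) h1
  simp only [AlternatingMap.smul_apply, map_nsmul, MultilinearMap.alternatization_apply, map_sum,
    map_zsmul_unit, MultilinearMap.domDomCongr_apply, MultilinearMap.domCoprod_apply,
    LinearMap.mul'_apply, Fintype.card_fin] at h2
  change LinearMap.mul' ℝ ℂ ((a.toAlternatingMap.domCoprod b.toAlternatingMap)
    (v ∘ finSumFinEquiv)) = _
  rw [eq_inv_mul_iff_mul_eq₀ (by exact_mod_cast (by positivity : k.factorial * l.factorial ≠ 0)),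
    ← nsmul_eq_mul, ← h2, ← Equiv.sum_comp (Equiv.permCongr (finSumFinEquiv (m := k) (n := l)))]
  refine Finset.sum_congr rfl fun σ _ => ?_
  simp only [Equiv.Perm.sign_permCongr, Equiv.permCongr_apply, Function.comp_apply, Fin.cast_eq_self,
    finSumFinEquiv_symm_apply_castAdd, finSumFinEquiv_symm_apply_natAdd]
  rw [Units.smul_def, zsmul_eq_mul]
  rfl

theorem wedge_add_right {k l m : ℕ} (h : k + l = m) (a : V [⋀^Fin k]→L[ℝ] ℂ)
    (b c : V [⋀^Fin l]→L[ℝ] ℂ) : wedge h a (b + c) = wedge h a b + wedge h a c := by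
  ext v
  simp only [wedge_apply, ContinuousAlternatingMap.add_apply, mul_add, Finset.sum_add_distrib]

theorem wedge_smul_right {k l m : ℕ} (h : k + l = m) (a : V [⋀^Fin k]→L[ℝ] ℂ)
    (z : ℂ) (b : V [⋀^Fin l]→L[ℝ] ℂ) : wedge h a (z • b) = z • wedge h a b := by
  ext v
  simp only [wedge_apply, ContinuousAlternatingMap.smul_apply, smul_eq_mul, Finset.mul_sum]
  exact Finset.sum_congr rfl fun i _ => by ring

theorem wedge_add_left {k l m : ℕ} (h : k + l = m) (a c : V [⋀^Fin k]→L[ℝ] ℂ)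
    (b : V [⋀^Fin l]→L[ℝ] ℂ) : wedge h (a + c) b = wedge h a b + wedge h c b := by
  ext v
  simp only [wedge_apply, ContinuousAlternatingMap.add_apply, mul_add, add_mul,
    Finset.sum_add_distrib]

theorem wedge_smul_left {k l m : ℕ} (h : k + l = m) (a : V [⋀^Fin k]→L[ℝ] ℂ)
    (z : ℂ) (b : V [⋀^Fin l]→L[ℝ] ℂ) : wedge h (z • a) b = z • wedge h a b := by
  ext v
  simp only [wedge_apply, ContinuousAlternatingMap.smul_apply, smul_eq_mul, Finset.mul_sum]
  exact Finset.sum_congr rfl fun i _ => by ring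

theorem wedge_zero_left {k l m : ℕ} (h : k + l = m) (b : V [⋀^Fin l]→L[ℝ] ℂ) :
    wedge h (0 : V [⋀^Fin k]→L[ℝ] ℂ) b = 0 := by
  ext v
  simp [wedge_apply]

theorem wedge_degree_zero {l m : ℕ} (h : 0 + l = m) (h' : l = m) (a : V [⋀^Fin 0]→L[ℝ] ℂ)
    (b : V [⋀^Fin l]→L[ℝ] ℂ) (v : Fin m → V) :
    wedge h a b v = a Fin.elim0 * b (v ∘ Fin.cast h') := by
  subst h'
  rw [wedge_apply]
  have : ∀ σ : Equiv.Perm (Fin l), ((Equiv.Perm.sign σ : ℤ) : ℂ) *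
        (a (fun i => v (σ (Fin.cast h (Fin.castAdd l i)))) *
          b (fun j => v (σ (Fin.cast h (Fin.natAdd 0 j))))) = a Fin.elim0 * b v := by
    intro σ
    have h1 : (fun i : Fin 0 => v (σ (Fin.cast h (Fin.castAdd l i)))) = Fin.elim0 :=
      Subsingleton.elim _ _
    have h2 : (fun j => v (σ (Fin.cast h (Fin.natAdd 0 j)))) = v ∘ σ := by
      funext j; simp
    have h3 := b.toAlternatingMap.map_perm v σ
    simp only [ContinuousAlternatingMap.coe_toAlternatingMap] at h3
    rw [h1, h2, h3, Units.smul_def, zsmul_eq_mul, mul_left_comm, ← mul_assoc ((_ : ℤ) : ℂ),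
      ← Int.cast_mul, Int.units_coe_mul_self]
    simp
  rw [Finset.sum_congr rfl fun σ _ => this σ]
  simp only [Nat.factorial_zero, one_mul, Finset.sum_const, Finset.card_univ, Fintype.card_perm,
    Fintype.card_fin, nsmul_eq_mul]
  rw [inv_mul_cancel_left₀ (by exact_mod_cast l.factorial_ne_zero)]
  rfl

/-- Left multiplication by a homogeneous form, as a function. -/
def wedgeLeftFun {p : ℕ} (β : V [⋀^Fin p]→L[ℝ] ℂ) (a : Fib V) : Fib V :=
  fun m => if h : p ≤ m then wedge (Nat.add_sub_of_le h) β (a (m - p)) else 0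

/-- Left multiplication by a homogeneous form. -/
def wedgeLeft {p : ℕ} (β : V [⋀^Fin p]→L[ℝ] ℂ) : Module.End ℂ (Fib V) where
  toFun := wedgeLeftFun β
  map_add' a b := by
    refine Fib.ext_apply fun m w => ?_
    by_cases h : p ≤ m <;> simp [wedgeLeftFun, h, wedge_add_right, Fib.add_apply]
  map_smul' c a := by
    refine Fib.ext_apply fun m w => ?_
    by_cases h : p ≤ m <;> simp [wedgeLeftFun, h, wedge_smul_right, Fib.smul_apply]

theorem wedgeLeft_apply_of_eq {p l m : ℕ} (h : p + l = m) (β : V [⋀^Fin p]→L[ℝ] ℂ) (a : Fib V) :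
    wedgeLeft β a m = wedge h β (a l) := by
  have hpm : p ≤ m := by omega
  have hl : m - p = l := by omega
  change (if h : p ≤ m then wedge (Nat.add_sub_of_le h) β (a (m - p)) else 0) = _
  rw [dif_pos hpm]
  subst hl
  rfl

theorem wedgeLeft_apply_of_lt {p m : ℕ} (h : m < p) (β : V [⋀^Fin p]→L[ℝ] ℂ) (a : Fib V) :
    wedgeLeft β a m = 0 := dif_neg (not_le.mpr h)

theorem wedgeLeft_add {p : ℕ} (β γ : V [⋀^Fin p]→L[ℝ] ℂ) :
    wedgeLeft (β + γ) = wedgeLeft β + wedgeLeft γ := by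
  refine LinearMap.ext fun a => funext fun m => ?_
  by_cases h : p ≤ m
  · obtain ⟨l, rfl⟩ := Nat.exists_eq_add_of_le h
    simp [wedgeLeft_apply_of_eq rfl, wedge_add_left, Fib.add_apply]
  · ext v
    simp [wedgeLeft_apply_of_lt (not_le.mp h), Fib.add_apply]

theorem wedgeLeft_smul {p : ℕ} (z : ℂ) (β : V [⋀^Fin p]→L[ℝ] ℂ) :
    wedgeLeft (z • β) = z • wedgeLeft β := by
  refine LinearMap.ext fun a => funext fun m => ?_
  by_cases h : p ≤ m
  · obtain ⟨l, rfl⟩ := Nat.exists_eq_add_of_le h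
    simp [wedgeLeft_apply_of_eq rfl, wedge_smul_left, Fib.smul_apply]
  · ext v
    simp [wedgeLeft_apply_of_lt (not_le.mp h), Fib.smul_apply]

/-- Left multiplication by a homogeneous form depends linearly on that form. -/
def wedgeLeftLin (p : ℕ) : (V [⋀^Fin p]→L[ℝ] ℂ) →ₗ[ℂ] Module.End ℂ (Fib V) where
  toFun := wedgeLeft
  map_add' := wedgeLeft_add
  map_smul' := wedgeLeft_smul

theorem wedgeLeft_degree_zero (β : V [⋀^Fin 0]→L[ℝ] ℂ) :
    wedgeLeft β = β Fin.elim0 • (1 : Module.End ℂ (Fib V)) := by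
  refine LinearMap.ext fun a => funext fun m => ?_
  rw [wedgeLeft_apply_of_eq (Nat.zero_add m)]
  ext v
  rw [wedge_degree_zero _ rfl]
  rfl

end Wedge

/-! ### Wedge products and exterior multiplication -/

section WedgeEps

variable {E : Type*} [NormedAddCommGroup E] [NormedSpace ℝ E]

/-- A permutation is determined by the image i of 0 and a permutation of the remaining slots. The
inverse cycle sends 0 to i and keeps the others in order, so it matches the expansion of `epsForm`
along `removeNth`, including the sign (−1)^i. -/
theorem sum_perm_succ {m : ℕ} {R : Type*} [AddCommMonoid R] (F : Equiv.Perm (Fin (m + 1)) → R) :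
    ∑ σ, F σ = ∑ i : Fin (m + 1), ∑ e : Equiv.Perm (Fin m),
      F (i.cycleRange⁻¹ * Equiv.Perm.decomposeFin.symm (0, e)) := by
  rw [← Finset.sum_product', Finset.univ_product_univ]
  symm
  refine Fintype.sum_bijective
    (fun x : Fin (m + 1) × Equiv.Perm (Fin m) =>
      x.1.cycleRange⁻¹ * Equiv.Perm.decomposeFin.symm (0, x.2)) ?_ _ _ (fun _ => rfl)
  rw [Fintype.bijective_iff_injective_and_card]
  refine ⟨?_, ?_⟩
  · rintro ⟨i, e⟩ ⟨j, f⟩ h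
    have h0 : i = j := by
      have := congrArg (fun σ : Equiv.Perm (Fin (m + 1)) => σ 0) h
      simpa [Equiv.Perm.mul_apply, Equiv.Perm.inv_def] using this
    subst h0
    have h1 : Equiv.Perm.decomposeFin.symm (0, e) = Equiv.Perm.decomposeFin.symm (0, f) :=
      mul_left_cancel h
    have h2 := Equiv.Perm.decomposeFin.symm.injective h1
    simpa using h2
  · simp [Fintype.card_perm, Nat.factorial_succ]

/-- Associativity for a covector factor. Both sides reduce to one sum over permutations in which θ
occupies the first slot. Iterated, this turns wedge multiplication into products of the operators
`eps`. -/
theorem wedge_epsForm {k l m : ℕ} (h : k + 1 + l = m + 1) (h' : k + l = m) (θ : E →L[ℝ] ℂ)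
    (a : E [⋀^Fin k]→L[ℝ] ℂ) (b : E [⋀^Fin l]→L[ℝ] ℂ) :
    wedge h (epsForm θ a) b = epsForm θ (wedge h' a b) := by
  ext v
  let G : Equiv.Perm (Fin (m + 1)) → ℂ := fun τ =>
    ((Equiv.Perm.sign τ : ℤ) : ℂ) * (θ (v (τ 0)) *
      (a (fun i => v (τ (Fin.cast h' (Fin.castAdd l i)).succ)) *
        b (fun j => v (τ (Fin.cast h' (Fin.natAdd k j)).succ))))
  have hL : wedge h (epsForm θ a) b v = ((k.factorial * l.factorial : ℕ) : ℂ)⁻¹ * ∑ τ, G τ := by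
    rw [wedge_apply]
    simp only [epsForm_apply, Finset.sum_mul, Finset.mul_sum]
    rw [Finset.sum_comm]
    -- Composing σ with the cycle that moves slot i to the front shows that the sum does not depend
    -- on i. The k + 1 equal contributions then reduce (k + 1)! to k!.
    have key : ∀ i : Fin (k + 1), ∑ σ : Equiv.Perm (Fin (m + 1)),
        (((k + 1).factorial * l.factorial : ℕ) : ℂ)⁻¹ * (((Equiv.Perm.sign σ : ℤ) : ℂ) *
          ((-1) ^ (i : ℕ) * (θ (v (σ (Fin.cast h (Fin.castAdd l i)))) *
            a (i.removeNth fun i => v (σ (Fin.cast h (Fin.castAdd l i))))) *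
          b (fun j => v (σ (Fin.cast h (Fin.natAdd (k + 1) j)))))) =
        (((k + 1).factorial * l.factorial : ℕ) : ℂ)⁻¹ * ∑ τ, G τ := by
      intro i
      rw [Finset.mul_sum]
      set c : Equiv.Perm (Fin (m + 1)) := (Fin.cast h (Fin.castAdd l i)).cycleRange with hc
      rw [← Equiv.sum_comp (Equiv.mulRight c)]
      refine Finset.sum_congr rfl fun τ _ => ?_
      have e0 : c (Fin.cast h (Fin.castAdd l i)) = 0 := Fin.cycleRange_self _
      have e1 : ∀ j : Fin k, c (Fin.cast h (Fin.castAdd l (i.succAbove j))) =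
          (Fin.cast h' (Fin.castAdd l j)).succ := by
        intro j
        rw [← Fin.cycleRange_succAbove (Fin.cast h (Fin.castAdd l i)), hc]
        congr 1
        ext
        simp only [Fin.succAbove, Fin.lt_def]
        split_ifs <;> simp_all <;> omega
      have e2 : ∀ j : Fin l, c (Fin.cast h (Fin.natAdd (k + 1) j)) =
          (Fin.cast h' (Fin.natAdd k j)).succ := by
        intro j
        rw [hc, Fin.cycleRange_of_gt]
        · ext
          simp
          omega
        · rw [Fin.lt_def]
          simp
          omega
      have es : (Equiv.Perm.sign c : ℤ) = (-1) ^ (i : ℕ) := by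
        rw [hc, Fin.sign_cycleRange]
        simp
      have hrem : ∀ f : Fin (k + 1) → E, i.removeNth f = fun j => f (i.succAbove j) :=
        fun _ => rfl
      simp only [G, Equiv.coe_mulRight, Equiv.Perm.mul_apply, hrem, e0, e1, e2,
        Equiv.Perm.sign_mul, Units.val_mul, Int.cast_mul, es]
      have : ((-1 : ℂ) ^ (i : ℕ)) * (-1) ^ (i : ℕ) = 1 := by
        rw [← mul_pow]; simp
      push_cast
      linear_combination ((k + 1).factorial * l.factorial : ℂ)⁻¹ *
        ((Equiv.Perm.sign τ : ℤ) : ℂ) * (θ (v (τ 0)) *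
      (a (fun i => v (τ (Fin.cast h' (Fin.castAdd l i)).succ)) *
        b (fun j => v (τ (Fin.cast h' (Fin.natAdd k j)).succ)))) * this
    rw [Finset.sum_congr rfl fun i _ => key i]
    rw [Finset.sum_const, Finset.card_univ, Fintype.card_fin, nsmul_eq_mul, ← mul_assoc,
      ← Finset.mul_sum]
    congr 1
    have h1 : (k.factorial : ℂ) ≠ 0 := by exact_mod_cast k.factorial_ne_zero
    have h2 : (l.factorial : ℂ) ≠ 0 := by exact_mod_cast l.factorial_ne_zero
    have h3 : (k : ℂ) + 1 ≠ 0 := by exact_mod_cast k.succ_ne_zero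
    rw [Nat.factorial_succ]
    push_cast
    field_simp
  rw [hL, sum_perm_succ, epsForm_apply, Finset.mul_sum]
  refine Finset.sum_congr rfl fun i _ => ?_
  rw [wedge_apply, Finset.mul_sum, Finset.mul_sum, Finset.mul_sum, Finset.mul_sum]
  refine Finset.sum_congr rfl fun e _ => ?_
  have es : ((Equiv.Perm.sign (i.cycleRange⁻¹ * Equiv.Perm.decomposeFin.symm (0, e)) : ℤ) : ℂ) =
      (-1) ^ (i : ℕ) * ((Equiv.Perm.sign e : ℤ) : ℂ) := by
    rw [Equiv.Perm.sign_mul, Equiv.Perm.sign_inv, Fin.sign_cycleRange,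
      Equiv.Perm.decomposeFin.symm_sign]
    simp
  simp only [G]
  rw [es]
  simp only [Equiv.Perm.mul_apply, Equiv.Perm.decomposeFin_symm_apply_zero,
    Equiv.Perm.decomposeFin_symm_apply_succ, Equiv.swap_self, Equiv.refl_apply, Equiv.Perm.inv_def,
    Fin.cycleRange_symm_zero, Fin.cycleRange_symm_succ, Fin.removeNth]
  ring

theorem wedgeLeft_epsForm {p : ℕ} (θ : E →L[ℝ] ℂ) (β : E [⋀^Fin p]→L[ℝ] ℂ) :
    wedgeLeft (epsForm θ β) = eps θ * wedgeLeft β := by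
  refine LinearMap.ext fun a => Fib.ext fun m => ?_
  cases m with
  | zero => exact wedgeLeft_apply_of_lt (Nat.succ_pos p) _ _
  | succ m =>
    rw [Module.End.mul_apply, eps_apply_succ]
    by_cases h : p ≤ m
    · obtain ⟨l, rfl⟩ := Nat.exists_eq_add_of_le h
      rw [wedgeLeft_apply_of_eq (by omega : p + 1 + l = p + l + 1), wedgeLeft_apply_of_eq rfl,
        wedge_epsForm _ rfl]
    · rw [wedgeLeft_apply_of_lt (by omega), wedgeLeft_apply_of_lt (by omega)]
      ext w
      simp [epsForm_apply]

variable [FiniteDimensional ℝ E] {ι : Type*} [Fintype ι]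

/-- Wedge multiplication applied to Euler's identity for β. Iterating down to degree 0 writes
multiplication by a form as a polynomial in the `eps`. -/
theorem succ_smul_wedgeLeft (b : Module.Basis ι ℝ E) {p : ℕ} (β : E [⋀^Fin (p + 1)]→L[ℝ] ℂ) :
    ((p : ℂ) + 1) • wedgeLeft β = ∑ i, eps (coordC b i) * wedgeLeft (iotaForm (b i) β) := by
  rw [← wedgeLeft_smul, ← sum_epsForm_iotaForm b β]
  exact (map_sum (wedgeLeftLin (p + 1)) _ _).trans
    (Finset.sum_congr rfl fun i _ => wedgeLeft_epsForm _ _)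

theorem wedgeLeft_one (b : Module.Basis ι ℝ E) (β : E [⋀^Fin 1]→L[ℝ] ℂ) :
    wedgeLeft β = ∑ i, β ![b i] • eps (coordC b i) := by
  have h := succ_smul_wedgeLeft b β
  simp only [Nat.cast_zero, zero_add, one_smul] at h
  rw [h]
  refine Finset.sum_congr rfl fun i _ => ?_
  rw [wedgeLeft_degree_zero, mul_smul_comm, mul_one, iotaForm_apply]
  congr 2

theorem wedgeLeft_two (b : Module.Basis ι ℝ E) (β : E [⋀^Fin 2]→L[ℝ] ℂ) :
    wedgeLeft β = (1 / 2 : ℂ) •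
      ∑ i, ∑ j, β ![b i, b j] • (eps (coordC b i) * eps (coordC b j)) := by
  have h := succ_smul_wedgeLeft b β
  refine smul_right_injective (Module.End ℂ (Fib E)) (by norm_num : ((1 : ℕ) : ℂ) + 1 ≠ 0) ?_
  change (((1 : ℕ) : ℂ) + 1) • _ = (((1 : ℕ) : ℂ) + 1) • _
  rw [h, smul_smul]
  norm_num
  refine Finset.sum_congr rfl fun i _ => ?_
  rw [wedgeLeft_one b, Finset.mul_sum]
  refine Finset.sum_congr rfl fun j _ => ?_
  rw [mul_smul_comm, iotaForm_apply]
  rfl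

end WedgeEps

/-! ### Decomposition into types -/

section Types

variable {V : Type*} [AddCommGroup V] [Module ℝ V] [TopologicalSpace V]

theorem typePart_apply (J : V →L[ℝ] V) {k : ℕ} (p : ℤ) (a : V [⋀^Fin k]→L[ℝ] ℂ) (w : Fin k → V) :
    typePart J p a w = ∑ S : Finset (Fin k), ∑ T : Finset (Fin k),
      (if (S.card : ℤ) = p then
        ∏ i, (if i ∈ T then (if i ∈ S then -Complex.I else Complex.I) else 1) / 2 else 0) *
      a (fun i => if i ∈ T then J (w i) else w i) := by
  simp only [typePart]
  change (∑ S : Finset (Fin k), ∑ T : Finset (Fin k),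
      (if (S.card : ℤ) = p then
        ∏ i, (if i ∈ T then (if i ∈ S then -Complex.I else Complex.I) else 1) / 2 else 0) •
      a.toContinuousMultilinearMap.compContinuousLinearMap
        (fun i => if i ∈ T then J else ContinuousLinearMap.id ℝ V) :
          ContinuousMultilinearMap ℝ (fun _ : Fin k => V) ℂ) w = _
  simp only [sum_apply, smul_apply, ContinuousMultilinearMap.compContinuousLinearMap_apply,
    smul_eq_mul]
  refine Finset.sum_congr rfl fun S _ => Finset.sum_congr rfl fun T _ => ?_
  congr 1
  change a _ = a _
  congr 1
  funext l
  split_ifs <;> rfl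

/-- The subset of `Fin (k + 1)` with given trace on the successors, which contains `0` or not. -/
def finsetCons {k : ℕ} (x : Bool × Finset (Fin k)) : Finset (Fin (k + 1)) :=
  if x.1 then insert 0 (x.2.map (Fin.succEmb k)) else x.2.map (Fin.succEmb k)

theorem zero_mem_finsetCons {k : ℕ} (s : Bool) (S : Finset (Fin k)) :
    0 ∈ finsetCons (s, S) ↔ s = true := by
  cases s <;> simp [finsetCons]

theorem succ_mem_finsetCons {k : ℕ} (s : Bool) (S : Finset (Fin k)) (i : Fin k) :
    i.succ ∈ finsetCons (s, S) ↔ i ∈ S := by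
  cases s <;> simp [finsetCons]

theorem card_finsetCons {k : ℕ} (s : Bool) (S : Finset (Fin k)) :
    (finsetCons (s, S)).card = S.card + if s then 1 else 0 := by
  cases s
  · simp [finsetCons]
  · simp only [finsetCons, if_true]
    rw [Finset.card_insert_of_notMem (by simp)]
    simp

theorem sum_finset_succ {k : ℕ} {R : Type*} [AddCommMonoid R] (F : Finset (Fin (k + 1)) → R) :
    ∑ S, F S = ∑ s : Bool, ∑ S : Finset (Fin k), F (finsetCons (s, S)) := by
  rw [← Finset.sum_product', Finset.univ_product_univ]
  symm
  refine Fintype.sum_bijective finsetCons ?_ _ _ (fun _ => rfl)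
  rw [Fintype.bijective_iff_injective_and_card]
  refine ⟨?_, ?_⟩
  · rintro ⟨s, S⟩ ⟨t, T⟩ h
    have h1 : s = t := by
      rw [Bool.eq_iff_iff, ← zero_mem_finsetCons s S, h, zero_mem_finsetCons]
    have h2 : S = T := by
      ext i
      rw [← succ_mem_finsetCons s S, h, succ_mem_finsetCons]
    rw [h1, h2]
  · simp [pow_succ, mul_comm]

/-- Interior multiplication by the `(1,0)`-part of a vector. -/
def iota10 (J : V →L[ℝ] V) (v : V) : Module.End ℂ (Fib V) :=
  (1 / 2 : ℂ) • (iota v - Complex.I • iota (J v))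

/-- Interior multiplication by the `(0,1)`-part of a vector. -/
def iota01 (J : V →L[ℝ] V) (v : V) : Module.End ℂ (Fib V) :=
  (1 / 2 : ℂ) • (iota v + Complex.I • iota (J v))

/-- The projection to the forms of type `(p, *)`, in all degrees, as a function. -/
def typeFun (J : V →L[ℝ] V) (p : ℤ) (a : Fib V) : Fib V := fun k => typePart J p (a k)

/-- The projection to the forms of type `(p, *)`, in all degrees. -/
def typeEnd (J : V →L[ℝ] V) (p : ℤ) : Module.End ℂ (Fib V) where
  toFun := typeFun J p
  map_add' a b := by
    refine Fib.ext_apply fun k w => ?_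
    rw [Fib.add_apply_apply]
    simp only [typeFun, typePart_apply, Fib.add_apply_apply, mul_add, Finset.sum_add_distrib]
  map_smul' c a := by
    refine Fib.ext_apply fun k w => ?_
    rw [RingHom.id_apply, Fib.smul_apply_apply]
    simp only [typeFun, typePart_apply, Fib.smul_apply_apply, Finset.mul_sum]
    exact Finset.sum_congr rfl fun _ _ => Finset.sum_congr rfl fun _ _ => by ring

theorem typeEnd_apply (J : V →L[ℝ] V) (p : ℤ) (a : Fib V) (k : ℕ) :
    typeEnd J p a k = typePart J p (a k) := rfl

theorem typeEnd_apply_zero (J : V →L[ℝ] V) (p : ℤ) (a : Fib V) :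
    typeEnd J p a 0 = if p = 0 then a 0 else 0 := by
  ext w
  rw [typeEnd_apply, typePart_apply]
  have huniv : (Finset.univ : Finset (Finset (Fin 0))) = {∅} := by
    ext S
    simp only [Finset.mem_univ, Finset.mem_singleton, true_iff]
    exact Subsingleton.elim _ _
  rw [huniv]
  by_cases hp : p = 0
  · simp only [Finset.sum_singleton, Finset.card_empty, Nat.cast_zero, hp, if_true,
      Finset.univ_eq_empty, Finset.prod_empty, one_mul]
    congr 1
  · simp [hp, Ne.symm hp]

/-- Split the sets S and T according to whether they contain slot 0. If 0 ∈ S, the vector enters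
through its (1,0)-part and p − 1 further such slots remain; otherwise it enters through its
(0,1)-part. This recursion replaces the explicit double sum from here on. -/
theorem iota_typeEnd (J : V →L[ℝ] V) (p : ℤ) (v : V) :
    iota v * typeEnd J p = typeEnd J (p - 1) * iota10 J v + typeEnd J p * iota01 J v := by
  refine LinearMap.ext fun a => Fib.ext_apply fun k w => ?_
  simp only [Module.End.mul_apply, LinearMap.add_apply, Fib.add_apply_apply, iota_apply_apply,
    typeEnd_apply]
  rw [typePart_apply, typePart_apply, typePart_apply, sum_finset_succ]
  simp only [sum_finset_succ]
  have harg : ∀ (t : Bool) (T : Finset (Fin k)),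
      (fun i => if i ∈ finsetCons (t, T) then J ((Fin.cons v w : Fin (k + 1) → V) i) else
        (Fin.cons v w : Fin (k + 1) → V) i) =
      Fin.cons (if t then J v else v) (fun i => if i ∈ T then J (w i) else w i) := by
    intro t T
    funext i
    refine Fin.cases ?_ (fun j => ?_) i
    · simp [zero_mem_finsetCons]
    · simp [succ_mem_finsetCons]
  simp only [Fintype.sum_bool, harg, Fin.prod_univ_succ, zero_mem_finsetCons, succ_mem_finsetCons,
    card_finsetCons, if_true, Bool.false_eq_true, if_false, Nat.cast_add, Nat.cast_one,
    Nat.cast_zero, iota10, iota01, LinearMap.smul_apply, LinearMap.sub_apply,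
    LinearMap.add_apply, Fib.smul_apply_apply, Fib.sub_apply_apply, Fib.add_apply_apply,
    iota_apply_apply, ← eq_sub_iff_add_eq, ← Finset.sum_add_distrib]
  refine Finset.sum_congr rfl fun S _ => Finset.sum_congr rfl fun T _ => ?_
  split_ifs <;> first | (exfalso; omega) | ring

theorem typeEnd_eq_zero (J : V →L[ℝ] V) (p : ℤ) (a : Fib V) (k : ℕ) (hp : p < 0 ∨ (k : ℤ) < p) :
    typeEnd J p a k = 0 := by
  ext w
  rw [typeEnd_apply, typePart_apply]
  change _ = (0 : ℂ)
  refine Finset.sum_eq_zero fun S _ => Finset.sum_eq_zero fun T _ => ?_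
  have : (S.card : ℤ) ≠ p := by
    have := Finset.card_le_univ S
    rw [Fintype.card_fin] at this
    omega
  simp [this]

theorem iota10_add_iota01 (J : V →L[ℝ] V) (v : V) : iota10 J v + iota01 J v = iota v := by
  rw [iota10, iota01]
  module

theorem sum_typeEnd_apply (J : V →L[ℝ] V) (k : ℕ) (a : Fib V) :
    ∑ p ∈ Finset.range (k + 1), typeEnd J (p : ℤ) a k = a k := by
  induction k generalizing a with
  | zero => simp [typeEnd_apply_zero]
  | succ k ih =>
    refine form_ext_iota fun v => ?_
    have h1 : ∀ p : ℕ, iotaForm v (typeEnd J (p : ℤ) a (k + 1)) =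
        typeEnd J ((p : ℤ) - 1) (iota10 J v a) k + typeEnd J (p : ℤ) (iota01 J v a) k := fun p =>
      congrFun (LinearMap.congr_fun (iota_typeEnd J p v) a) k
    have h2 : iotaForm v (∑ p ∈ Finset.range (k + 2), typeEnd J (p : ℤ) a (k + 1)) =
        ∑ p ∈ Finset.range (k + 2), iotaForm v (typeEnd J (p : ℤ) a (k + 1)) := by
      ext w
      simp [ContinuousAlternatingMap.sum_apply]
    rw [h2, Finset.sum_congr rfl fun p _ => h1 p, Finset.sum_add_distrib, Finset.sum_range_succ',
      Finset.sum_range_succ _ (k + 1)]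
    rw [typeEnd_eq_zero J _ _ _ (Or.inl (by simp)), typeEnd_eq_zero J _ _ _ (Or.inr (by simp))]
    have h3 := ih (iota10 J v a)
    have h4 := ih (iota01 J v a)
    simp only [Nat.cast_add, Nat.cast_one, add_sub_cancel_right, add_zero]
    rw [h3, h4, ← Fib.add_apply, ← LinearMap.add_apply, iota10_add_iota01]
    rfl

variable {J : V →L[ℝ] V} (hJ : ∀ v, J (J v) = -v)

include hJ

theorem iota10_J (v : V) : iota10 J (J v) = Complex.I • iota10 J v := by
  have h : Complex.I • Complex.I • iota (J v) = -iota (J v) := by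
    rw [smul_smul, Complex.I_mul_I, neg_one_smul]
  rw [iota10, iota10, hJ, iota_neg, smul_comm Complex.I, smul_sub Complex.I, h]
  module

theorem iota01_J (v : V) : iota01 J (J v) = -(Complex.I • iota01 J v) := by
  have h : Complex.I • Complex.I • iota (J v) = -iota (J v) := by
    rw [smul_smul, Complex.I_mul_I, neg_one_smul]
  rw [iota01, iota01, hJ, iota_neg, smul_comm Complex.I, smul_add Complex.I, h]
  module

/-- In the recursion for v and for Jv the two summands are multiplied by i and −i respectively, so a
linear combination of both recursions isolates the (1,0) summand. -/
theorem iota10_typeEnd (p : ℤ) (v : V) :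
    iota10 J v * typeEnd J p = typeEnd J (p - 1) * iota10 J v := by
  have h1 := iota_typeEnd J p v
  have h2 := iota_typeEnd J p (J v)
  have h3 : ∀ x : Module.End ℂ (Fib V), Complex.I • Complex.I • x = -x := fun x => by
    rw [smul_smul, Complex.I_mul_I, neg_one_smul]
  rw [iota10_J hJ, iota01_J hJ, mul_smul_comm, mul_neg, mul_smul_comm] at h2
  have h4 : iota10 J v * typeEnd J p =
      (1 / 2 : ℂ) • (iota v * typeEnd J p - Complex.I • (iota (J v) * typeEnd J p)) := by
    rw [iota10, smul_mul_assoc, sub_mul, smul_mul_assoc]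
  rw [h4, h1, h2, smul_add Complex.I, smul_neg Complex.I, h3, h3]
  module

theorem iota01_typeEnd (p : ℤ) (v : V) :
    iota01 J v * typeEnd J p = typeEnd J p * iota01 J v := by
  have h1 := iota_typeEnd J p v
  rw [← iota10_add_iota01 J v, add_mul, iota10_typeEnd hJ] at h1
  exact add_left_cancel h1

theorem typeEnd_mul_typeEnd_apply (p q : ℤ) (k : ℕ) (a : Fib V) :
    typeEnd J p (typeEnd J q a) k = if p = q then typeEnd J p a k else 0 := by
  induction k generalizing a p q with
  | zero =>
    simp only [typeEnd_apply_zero]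
    split_ifs <;> simp_all
  | succ k ih =>
    refine form_ext_iota fun v => ?_
    have h1 : ∀ (r : ℤ) (b : Fib V), iotaForm v (typeEnd J r b (k + 1)) =
        typeEnd J (r - 1) (iota10 J v b) k + typeEnd J r (iota01 J v b) k := fun r b =>
      congrFun (LinearMap.congr_fun (iota_typeEnd J r v) b) k
    have h2 := LinearMap.congr_fun (iota10_typeEnd hJ q v) a
    have h3 := LinearMap.congr_fun (iota01_typeEnd hJ q v) a
    rw [Module.End.mul_apply, Module.End.mul_apply] at h2 h3
    rw [h1, h2, h3, ih, ih]
    by_cases h : p = q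
    · rw [if_pos (by omega), if_pos h, if_pos h, h1]
    · rw [if_neg (by omega), if_neg h, if_neg h]
      ext w
      simp

end Types

/-! ### Types and exterior multiplication. -/

section TypesExterior

variable {E : Type*} [NormedAddCommGroup E] [NormedSpace ℝ E] {J : E →L[ℝ] E}

/-- The flag `s` tells whether θ has type (1,0) or (0,1). Under contraction only the part of v of
the same type sees θ, so both sides satisfy the same recursion in the degree. -/
theorem typeEnd_mul_eps_apply (s : Bool) (θ : E →L[ℝ] ℂ)
    (hθ : ∀ v, θ (J v) = (if s then Complex.I else -Complex.I) * θ v) (p : ℤ) (k : ℕ) (a : Fib E) :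
    typeEnd J p (eps θ a) k = eps θ (typeEnd J (if s then p - 1 else p) a) k := by
  induction k generalizing a p with
  | zero =>
    rw [typeEnd_apply_zero]
    ext w
    simp
  | succ k ih =>
    refine form_ext_iota fun v => ?_
    change iota v _ k = iota v _ k
    have h1 : ∀ (r : ℤ) (b : Fib E), iota v (typeEnd J r b) =
        typeEnd J (r - 1) (iota10 J v b) + typeEnd J r (iota01 J v b) := fun r b =>
      LinearMap.congr_fun (iota_typeEnd J r v) b
    have hI := Complex.I_mul_I
    have h2 : iota10 J v (eps θ a) = (if s then θ v else 0) • a - eps θ (iota10 J v a) := by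
      have hc : (if s then θ v else 0) = (1 / 2) * (θ v - Complex.I * θ (J v)) := by
        rw [hθ]
        cases s
        · simp only [Bool.false_eq_true, if_false]
          linear_combination (-(1 / 2 : ℂ) * θ v) * hI
        · simp only [if_true]
          linear_combination ((1 / 2 : ℂ) * θ v) * hI
      rw [hc]
      simp only [iota10, LinearMap.smul_apply, LinearMap.sub_apply, iota_eps, map_smul, map_sub]
      module
    have h3 : iota01 J v (eps θ a) = (if s then 0 else θ v) • a - eps θ (iota01 J v a) := by
      have hc : (if s then 0 else θ v) = (1 / 2) * (θ v + Complex.I * θ (J v)) := by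
        rw [hθ]
        cases s
        · simp only [Bool.false_eq_true, if_false]
          linear_combination ((1 / 2 : ℂ) * θ v) * hI
        · simp only [if_true]
          linear_combination (-(1 / 2 : ℂ) * θ v) * hI
      rw [hc]
      simp only [iota01, LinearMap.smul_apply, LinearMap.add_apply, iota_eps, map_smul, map_add]
      module
    rw [h1, h2, h3, iota_eps, h1, map_sub, map_sub, Fib.add_apply, Fib.sub_apply, Fib.sub_apply,
      ih, ih, map_add, map_smul, map_smul, Fib.sub_apply, Fib.add_apply]
    cases s <;> (ext w; simp; try ring)

end TypesExterior

/-! ### Identities in associative algebras -/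

section Algebraic

variable {R : Type*} [Ring R] [Algebra ℂ R]

/-- The commutator. -/
def br (a b : R) : R := a * b - b * a

omit [Algebra ℂ R] in
theorem br_mul (a b c : R) : br a (b * c) = br a b * c + b * br a c := by
  simp only [br]
  noncomm_ring

omit [Algebra ℂ R] in
theorem br_br (a b c : R) : br a (br b c) = br (br a b) c + br b (br a c) := by
  simp only [br]
  noncomm_ring

omit [Algebra ℂ R] in
theorem neg_br (a b : R) : -br a b = br b a := neg_sub _ _

omit [Algebra ℂ R] in
theorem br_add (a b c : R) : br a (b + c) = br a b + br a c := by
  simp only [br]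
  noncomm_ring

omit [Algebra ℂ R] in
theorem br_sub (a b c : R) : br a (b - c) = br a b - br a c := by
  simp only [br]
  noncomm_ring

omit [Algebra ℂ R] in
theorem br_zero (a : R) : br a 0 = 0 := by simp [br]

omit [Algebra ℂ R] in
theorem br_neg (a b : R) : br a (-b) = -br a b := by
  simp only [br]
  noncomm_ring

theorem br_smul (c : ℂ) (a b : R) : br a (c • b) = c • br a b := by
  simp only [br, mul_smul_comm, smul_mul_assoc, smul_sub]

theorem smul_br (c : ℂ) (a b : R) : br (c • a) b = c • br a b := by
  simp only [br, mul_smul_comm, smul_mul_assoc, smul_sub]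

omit [Algebra ℂ R] in
theorem br_sum {κ : Type*} (s : Finset κ) (a : R) (b : κ → R) :
    br a (∑ i ∈ s, b i) = ∑ i ∈ s, br a (b i) := by
  simp only [br, Finset.mul_sum, Finset.sum_mul, Finset.sum_sub_distrib]

/-- The anticommutator. -/
def acomm (a b : R) : R := a * b + b * a

omit [Algebra ℂ R] in
theorem acomm_comm (a b : R) : acomm a b = acomm b a := add_comm _ _

theorem acomm_smul_left (c : ℂ) (a b : R) : acomm (c • a) b = c • acomm a b := by
  simp only [acomm, smul_mul_assoc, mul_smul_comm, smul_add]

theorem acomm_smul_right (c : ℂ) (a b : R) : acomm a (c • b) = c • acomm a b := by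
  rw [acomm_comm, acomm_smul_left, acomm_comm]

omit [Algebra ℂ R] in
theorem br_acomm (a b c : R) : (br a (acomm b c)) = acomm (br a b) c + acomm b (br a c) := by
  simp only [acomm, br_add, br_mul]
  abel

/-! ### Consequences of the sl₂ relations for two anticommuting elements of weight 3. -/

section Lefschetz

variable {L Λ e f : R}

theorem br_br_of_weight (x : R) (c : ℂ) (hx : (br (br L Λ) x) = c • x) :
    (br L (br Λ x)) = c • x + (br Λ (br L x)) := by
  rw [← hx, br_br L Λ x]

theorem weight_br (x : R) (c : ℂ) (hΛ : (br (br L Λ) Λ) = (-2 : ℂ) • Λ) (hx : (br (br L Λ) x) = c • x) :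
    (br (br L Λ) (br Λ x)) = (c - 2) • (br Λ x) := by
  rw [br_br, hΛ, hx, smul_br, br_smul]
  module

/-- The action of `L` on the string generated by a primitive element of weight `3`. -/
theorem br_string (hΛ : (br (br L Λ) Λ) = (-2 : ℂ) • Λ) (he : (br (br L Λ) e) = (3 : ℂ) • e)
    (hLe : (br L e) = 0) :
    (br L (br Λ e)) = (3 : ℂ) • e ∧ (br L (br Λ (br Λ e))) = (4 : ℂ) • (br Λ e) ∧
      (br L (br Λ (br Λ (br Λ e)))) = (3 : ℂ) • (br Λ (br Λ e)) := by
  -- The coefficients 3, 4, 3 are the partial sums 3, 3 + 1, 3 + 1 − 1 of the weights along the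
  -- string.
  have h1 : (br L (br Λ e)) = (3 : ℂ) • e := by
    rw [br_br_of_weight e 3 he, hLe, br_zero, add_zero]
  have w1 := weight_br e 3 hΛ he
  have h2 : (br L (br Λ (br Λ e))) = (4 : ℂ) • (br Λ e) := by
    rw [br_br_of_weight _ _ w1, h1, br_smul]
    module
  have w2 := weight_br _ _ hΛ w1
  refine ⟨h1, h2, ?_⟩
  rw [br_br_of_weight _ _ w2, h2, br_smul]
  module

variable (hΛ : (br (br L Λ) Λ) = (-2 : ℂ) • Λ) (he : (br (br L Λ) e) = (3 : ℂ) • e)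
  (hf : (br (br L Λ) f) = (3 : ℂ) • f) (hLe : (br L e) = 0) (hLf : (br L f) = 0) (hef : acomm e f = 0)

include hef

/-- Bracketing with Λ is a derivation of the anticommutator; this is the Leibniz rule for its
square, applied to {e,f} = 0. -/
theorem acomm_string_two :
    acomm (br Λ (br Λ e)) f + (2 : ℂ) • acomm (br Λ e) (br Λ f) + acomm e (br Λ (br Λ f)) = 0 := by
  have h := congrArg (fun x => (br Λ (br Λ x))) hef
  simp only [br_acomm, br_zero, br_add] at h
  rw [← h]
  module

/-- One more bracket. The mixed terms 3{E₂,F₁} + 3{E₁,F₂} of the cubic Leibniz rule are three times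
the bracket of Λ with {E₁,F₁}. -/
theorem acomm_string_three :
    acomm (br Λ (br Λ (br Λ e))) f + acomm e (br Λ (br Λ (br Λ f))) =
      (-3 : ℂ) • (br Λ (acomm (br Λ e) (br Λ f))) := by
  have h := congrArg (fun x => (br Λ x)) (acomm_string_two (Λ := Λ) hef)
  simp only [br_acomm, br_zero, br_add, br_smul] at h ⊢
  rw [← sub_eq_zero, ← h]
  module

include hΛ he hf hLe hLf

/-- The arguments are μ̄, μ, e* and f* for e = L_{μω} and f = L_{μ̄ω}. Bracketing with L kills e and
f and lowers E₃, F₃ to 3E₂, 3F₂, so the right side is a multiple of {E₂,f} + {F₂,e}, which equals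
−2{E₁,F₁}. -/
theorem acomm_mubar_mu :
    acomm (-(1 / 3 : ℂ) • (br Λ f)) (-(1 / 3 : ℂ) • (br Λ e)) = (Complex.I / 9) •
      (br (acomm (-(Complex.I / 6) • (br Λ (br Λ (br Λ f)))) e -
        acomm ((Complex.I / 6) • (br Λ (br Λ (br Λ e)))) f) L) := by
  obtain ⟨he1, he2, he3⟩ := br_string hΛ he hLe
  obtain ⟨hf1, hf2, hf3⟩ := br_string hΛ hf hLf
  have h2 := acomm_string_two (Λ := Λ) hef
  have hI : Complex.I / 9 * (Complex.I / 6) = -(1 / 54) := by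
    linear_combination (1 / 54 : ℂ) * Complex.I_mul_I
  rw [← neg_br L]
  simp only [acomm_smul_left, acomm_smul_right, br_sub, br_smul, br_acomm, hLe, hLf, he3, hf3]
  rw [acomm_comm e (br Λ (br Λ f))] at h2
  have z : ∀ x : R, acomm x 0 = 0 := fun x => by simp [acomm]
  rw [z, z, add_zero, add_zero, acomm_comm (br Λ f)]
  have h3 : acomm (br Λ e) (br Λ f) = -(1 / 2 : ℂ) • (acomm (br Λ (br Λ e)) f + acomm (br Λ (br Λ f)) e) := by
    linear_combination (norm := module) (1 / 2 : ℂ) • h2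
  rw [h3]
  set x := acomm (br Λ (br Λ e)) f
  set y := acomm (br Λ (br Λ f)) e
  have h4 : (Complex.I / 9) • -(-(Complex.I / 6) • (3 : ℂ) • y - (Complex.I / 6) • (3 : ℂ) • x) =
      (Complex.I / 9 * (Complex.I / 6)) • (3 : ℂ) • (x + y) := by module
  rw [h4, hI]
  module

/-- The left side is −⅓({E₂,f} + {E₁,F₁}). Eliminating {E₁,F₁} leaves the difference {E₂,f} −
{F₂,e}, which the sum of the two Laplacians also produces after a bracket with L. -/
theorem br_acomm_mu :
    (br Λ (acomm (-(1 / 3 : ℂ) • (br Λ e)) f)) = (-(Complex.I / 3)) •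
      (br (acomm (-(Complex.I / 6) • (br Λ (br Λ (br Λ f)))) e +
        acomm ((Complex.I / 6) • (br Λ (br Λ (br Λ e)))) f) L) := by
  obtain ⟨he1, he2, he3⟩ := br_string hΛ he hLe
  obtain ⟨hf1, hf2, hf3⟩ := br_string hΛ hf hLf
  have h2 := acomm_string_two (Λ := Λ) hef
  have hI : Complex.I / 3 * (Complex.I / 6) = -(1 / 18) := by
    linear_combination (1 / 18 : ℂ) * Complex.I_mul_I
  rw [← neg_br L]
  simp only [acomm_smul_left, br_add, br_smul, br_acomm, hLe, hLf, he3, hf3]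
  rw [acomm_comm e (br Λ (br Λ f))] at h2
  have z : ∀ x : R, acomm x 0 = 0 := fun x => by simp [acomm]
  rw [z, z, add_zero, add_zero]
  have h3 : acomm (br Λ e) (br Λ f) = -(1 / 2 : ℂ) • (acomm (br Λ (br Λ e)) f + acomm (br Λ (br Λ f)) e) := by
    linear_combination (norm := module) (1 / 2 : ℂ) • h2
  rw [h3]
  set x := acomm (br Λ (br Λ e)) f
  set y := acomm (br Λ (br Λ f)) e
  have h4 : (-(Complex.I / 3)) • -(-(Complex.I / 6) • (3 : ℂ) • y + (Complex.I / 6) • (3 : ℂ) • x) =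
      (Complex.I / 3 * (Complex.I / 6)) • (3 : ℂ) • (x - y) := by module
  rw [h4, hI]
  module

omit hΛ he hf hLe hLf in
-- The scalars of e* and f* are opposite, so their difference of Laplacians becomes a multiple of
-- the sum of the two outer terms in the cubic Leibniz relation. The result [Λ,{E₁,F₁}] is the
-- common reference for all three differences of Laplacians.
theorem laplacian_diff_string :
    acomm (-(Complex.I / 6) • (br Λ (br Λ (br Λ f)))) e - acomm ((Complex.I / 6) • (br Λ (br Λ (br Λ e)))) f =
      (Complex.I / 2) • (br Λ (acomm (br Λ e) (br Λ f))) := by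
  have h := acomm_string_three (Λ := Λ) hef
  rw [acomm_comm e] at h
  rw [acomm_smul_left, acomm_smul_left]
  have : (Complex.I / 2) • (br Λ (acomm (br Λ e) (br Λ f))) =
      -(Complex.I / 6) • (-3 : ℂ) • (br Λ (acomm (br Λ e) (br Λ f))) := by module
  rw [this, ← h]
  module

omit hef hΛ he hf hLe hLf in
-- Only the Leibniz rule for ad Λ on {E₁,F₁} enters here; no relation between e and f is needed.
theorem laplacian_diff_mu :
    acomm (-(Complex.I / 6) • (br Λ (br Λ f))) (-(1 / 3 : ℂ) • (br Λ e)) -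
      acomm ((Complex.I / 6) • (br Λ (br Λ e))) (-(1 / 3 : ℂ) • (br Λ f)) =
      (Complex.I / 18) • (br Λ (acomm (br Λ e) (br Λ f))) := by
  rw [br_acomm]
  simp only [acomm_smul_left, acomm_smul_right]
  rw [acomm_comm (br Λ (br Λ f))]
  module

omit hef hΛ he hf hLe hLf in
-- For p = ∂ and q = ∂̄, the adjoints i[Λ,q] and −i[Λ,p] make the difference equal to i[Λ,{p,q}].
-- The hypothesis, which is the (1,1) part of d² = 0, replaces {p,q} by −{μ,μ̄} = −(1/9){E₁,F₁}.
theorem laplacian_diff_del (p q : R)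
    (hpq : acomm p q + acomm (-(1 / 3 : ℂ) • (br Λ e)) (-(1 / 3 : ℂ) • (br Λ f)) = 0) :
    acomm (Complex.I • (br Λ q)) p - acomm (-Complex.I • (br Λ p)) q =
      -(Complex.I / 9) • (br Λ (acomm (br Λ e) (br Λ f))) := by
  rw [acomm_smul_left, acomm_smul_right, smul_smul] at hpq
  have h1 : acomm p q = -(1 / 9 : ℂ) • acomm (br Λ e) (br Λ f) := by
    rw [eq_neg_of_add_eq_zero_left hpq]
    module
  have h2 := congrArg (fun x => Complex.I • (br Λ x)) h1
  simp only [br_acomm, br_smul] at h2 ⊢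
  rw [acomm_smul_left, acomm_smul_left, acomm_comm (br Λ q)]
  linear_combination (norm := module) h2

end Lefschetz

/-! ### Cubic expressions in exterior and interior multiplications. -/

section CanonicalAnticommutation

variable {ι : Type*} [Fintype ι]

/-- The contraction of a tensor of order three with three families of elements of an algebra. -/
def tri (T : ι → ι → ι → ℂ) (x y z : ι → R) : R := ∑ i, ∑ j, ∑ k, T i j k • (x i * y j * z k)

theorem br_tri (a : R) (T : ι → ι → ι → ℂ) (x y z : ι → R) :
    (br a (tri T x y z)) = tri T (fun i => (br a (x i))) y z + tri T x (fun i => (br a (y i))) z +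
      tri T x y (fun i => (br a (z i))) := by
  simp only [tri, br_sum, br_smul, br_mul, ← Finset.sum_add_distrib, add_mul, smul_add]

/-- The sign from reordering x and y cancels against the sign from exchanging the indices of T, and
the diagonal correction meets T_iik = 0. -/
theorem tri_swap_left [DecidableEq ι] (T : ι → ι → ι → ℂ) (hT : ∀ i j k, T i j k = -T j i k)
    (x y z : ι → R) (r : ℂ)
    (h : ∀ i j, x i * y j = (if i = j then r else 0) • (1 : R) - y j * x i) :
    tri T x y z = tri T y x z := by
  have h0 : ∀ i k, T i i k = 0 := fun i k => self_eq_neg.mp (hT i i k)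
  rw [tri, tri, Finset.sum_comm]
  refine Finset.sum_congr rfl fun i _ => Finset.sum_congr rfl fun j _ =>
    Finset.sum_congr rfl fun k _ => ?_
  rw [h]
  by_cases hij : j = i
  · subst hij
    simp [h0]
  · rw [if_neg hij, hT i j k]
    simp

theorem tri_swap_right [DecidableEq ι] (T : ι → ι → ι → ℂ) (hT : ∀ i j k, T i j k = -T i k j)
    (x y z : ι → R) (r : ℂ)
    (h : ∀ i j, y i * z j = (if i = j then r else 0) • (1 : R) - z j * y i) :
    tri T x y z = tri T x z y := by
  have h0 : ∀ i k, T i k k = 0 := fun i k => self_eq_neg.mp (hT i k k)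
  rw [tri, tri]
  refine Finset.sum_congr rfl fun i _ => ?_
  rw [Finset.sum_comm]
  refine Finset.sum_congr rfl fun j _ => Finset.sum_congr rfl fun k _ => ?_
  rw [mul_assoc, h]
  by_cases hij : k = j
  · subst hij
    simp [h0]
  · rw [if_neg hij, hT i j k]
    simp [mul_assoc]

/-- The family of elements obtained from a family by applying a matrix. -/
def rot (J : ι → ι → ℂ) (x : ι → R) (k : ι) : R := ∑ l, J l k • x l

/-- Moving the matrix from the operators to the tensor transposes it. Since J is skew this costs a
sign, so the eigenvalue c of T becomes −c. -/
theorem tri_rot_right (J : ι → ι → ℂ) (hJ : ∀ i j, J i j = -J j i) (T : ι → ι → ι → ℂ) (c : ℂ)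
    (hc : ∀ i j l, ∑ k, T i j k * J k l = c * T i j l) (x y z : ι → R) :
    tri T x y (rot J z) = -c • tri T x y z := by
  simp only [tri, rot, Finset.smul_sum, Finset.mul_sum]
  refine Finset.sum_congr rfl fun i _ => Finset.sum_congr rfl fun j _ => ?_
  rw [Finset.sum_comm]
  refine Finset.sum_congr rfl fun l _ => ?_
  have h := congrArg (fun r : ℂ => -r • (x i * y j * z l)) (hc i j l)
  simp only [← Finset.sum_neg_distrib, Finset.sum_smul] at h
  rw [smul_smul, neg_mul, ← h]
  refine Finset.sum_congr rfl fun k _ => ?_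
  rw [hJ l k, mul_smul_comm, smul_smul]
  congr 1
  ring

theorem tri_rot_mid (J : ι → ι → ℂ) (hJ : ∀ i j, J i j = -J j i) (T : ι → ι → ι → ℂ) (c : ℂ)
    (hT : ∀ i j k, T i j k = -T i k j)
    (hc : ∀ i j l, ∑ k, T i j k * J k l = c * T i j l) (x y z : ι → R) :
    tri T x (rot J y) z = -c • tri T x y z := by
  simp only [tri, rot, Finset.smul_sum, Finset.mul_sum, Finset.sum_mul]
  refine Finset.sum_congr rfl fun i _ => ?_
  rw [Finset.sum_comm, Finset.sum_comm (f := fun j k => -c • T i j k • (x i * y j * z k))]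
  refine Finset.sum_congr rfl fun k _ => ?_
  rw [Finset.sum_comm]
  refine Finset.sum_congr rfl fun l _ => ?_
  have h := congrArg (fun r : ℂ => r • (x i * y l * z k)) (hc i k l)
  simp only [Finset.sum_smul] at h
  rw [smul_smul, hT i l k, neg_mul_neg, ← h]
  refine Finset.sum_congr rfl fun j _ => ?_
  rw [hJ l j, hT i j k, mul_smul_comm, smul_mul_assoc, smul_smul]
  congr 1
  ring

theorem tri_rot_left (J : ι → ι → ℂ) (hJ : ∀ i j, J i j = -J j i) (T : ι → ι → ι → ℂ) (c : ℂ)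
    (hT : ∀ i j k, T i j k = -T j i k) (hT' : ∀ i j k, T i j k = -T i k j)
    (hc : ∀ i j l, ∑ k, T i j k * J k l = c * T i j l) (x y z : ι → R) :
    tri T (rot J x) y z = -c • tri T x y z := by
  simp only [tri, rot, Finset.smul_sum, Finset.sum_mul]
  rw [Finset.sum_comm, Finset.sum_comm (f := fun i j => ∑ k, -c • T i j k • (x i * y j * z k))]
  refine Finset.sum_congr rfl fun j _ => ?_
  rw [Finset.sum_comm, Finset.sum_comm (f := fun i k => -c • T i j k • (x i * y j * z k))]
  refine Finset.sum_congr rfl fun k _ => ?_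
  have hcyc : ∀ i, T i j k = T j k i := fun i => by rw [hT, hT', neg_neg]
  rw [Finset.sum_comm]
  refine Finset.sum_congr rfl fun l _ => ?_
  have h := congrArg (fun r : ℂ => -r • (x l * y j * z k)) (hc j k l)
  simp only [← Finset.sum_neg_distrib, Finset.sum_smul] at h
  rw [smul_smul, hcyc, neg_mul, ← h]
  refine Finset.sum_congr rfl fun i _ => ?_
  rw [hJ l i, hcyc, smul_mul_assoc, smul_mul_assoc, smul_smul]
  congr 1
  ring

section Relations

variable [DecidableEq ι] {ε i : ι → R} (hεε : ∀ j k, ε j * ε k = -(ε k * ε j))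
  (hii : ∀ j k, i j * i k = -(i k * i j))
  (hiε : ∀ j k, i j * ε k = (if j = k then (1 : ℂ) else 0) • (1 : R) - ε k * i j)
  {J : ι → ι → ℂ} (hJ : ∀ j k, J j k = -J k j)
  (hJJ : ∀ j k, ∑ l, J j l * J l k = if j = k then -1 else 0)

/-- The Lefschetz operator in terms of an orthonormal frame. -/
def lefL (J : ι → ι → ℂ) (ε : ι → R) : R := (1 / 2 : ℂ) • ∑ k, ε k * rot J ε k

/-- The dual Lefschetz operator in terms of an orthonormal frame. -/
def lefΛ (J : ι → ι → ℂ) (i : ι → R) : R := (1 / 2 : ℂ) • ∑ k, rot J i k * i k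

theorem rot_mul_comm (x y : ι → R) (hxy : ∀ j k, x j * y k = -(y k * x j)) (j k : ι) :
    rot J x j * y k = -(y k * rot J x j) := by
  simp only [rot, Finset.sum_mul, Finset.mul_sum, smul_mul_assoc, mul_smul_comm, hxy,
    ← Finset.sum_neg_distrib, smul_neg]

theorem br_eq_zero_of_anticomm (x y z : R) (h1 : x * z = -(z * x)) (h2 : y * z = -(z * y)) :
    br (x * y) z = 0 := by
  rw [br, mul_assoc, h2, mul_neg, ← mul_assoc, h1]
  simp [mul_assoc]

theorem sum_br {κ : Type*} (s : Finset κ) (a : R) (b : κ → R) :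
    br (∑ i ∈ s, b i) a = ∑ i ∈ s, br (b i) a := by
  simp only [br, Finset.mul_sum, Finset.sum_mul, Finset.sum_sub_distrib]

include hεε in
theorem br_lefL_eps (j : ι) : br (lefL J ε) (ε j) = 0 := by
  rw [lefL, smul_br, sum_br, Finset.sum_eq_zero, smul_zero]
  exact fun k _ => br_eq_zero_of_anticomm _ _ _ (hεε _ _) (rot_mul_comm _ _ hεε _ _)

include hii in
theorem br_lefΛ_iota (j : ι) : br (lefΛ J i) (i j) = 0 := by
  rw [lefΛ, smul_br, sum_br, Finset.sum_eq_zero, smul_zero]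
  exact fun k _ => br_eq_zero_of_anticomm _ _ _ (rot_mul_comm _ _ hii _ _) (hii _ _)

include hiε hJ in
-- The two factors of each summand of Λ contribute equally because J is skew, which absorbs the
-- factor ½.
theorem br_lefΛ_eps (j : ι) : br (lefΛ J i) (ε j) = rot J i j := by
  have h1 : ∀ k, rot J i k * ε j = J j k • (1 : R) - ε j * rot J i k := by
    intro k
    simp only [rot, Finset.sum_mul, smul_mul_assoc, hiε, smul_sub, Finset.sum_sub_distrib,
      Finset.mul_sum, mul_smul_comm]
    simp
  have h2 : ∀ k, br (rot J i k * i k) (ε j) = (if k = j then (1 : ℂ) else 0) • rot J i k - J j k • i k := by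
    intro k
    rw [br, mul_assoc, hiε, mul_sub, ← mul_assoc, h1, mul_smul_comm, mul_one, sub_mul, mul_assoc,
      smul_mul_assoc, one_mul]
    abel
  rw [lefΛ, smul_br, sum_br]
  simp only [h2, Finset.sum_sub_distrib]
  have h3 : ∑ k, J j k • i k = -rot J i j := by
    simp only [rot, hJ j, neg_smul, Finset.sum_neg_distrib]
  rw [h3]
  simp only [ite_smul, one_smul, zero_smul, Finset.sum_ite_eq', Finset.mem_univ, if_true]
  module

include hiε hJ in
theorem br_lefL_iota (j : ι) : br (lefL J ε) (i j) = -rot J ε j := by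
  have h1 : ∀ k, i j * rot J ε k = J j k • (1 : R) - rot J ε k * i j := by
    intro k
    simp only [rot, Finset.sum_mul, smul_mul_assoc, hiε, smul_sub, Finset.sum_sub_distrib,
      Finset.mul_sum, mul_smul_comm]
    simp
  have h2 : ∀ k, br (ε k * rot J ε k) (i j) = J j k • ε k - (if j = k then (1 : ℂ) else 0) • rot J ε k := by
    intro k
    rw [br, ← mul_assoc (i j), hiε, sub_mul, mul_assoc (ε k) (i j), h1, mul_sub, smul_mul_assoc,
      one_mul, mul_smul_comm, mul_one, mul_assoc]
    abel
  rw [lefL, smul_br, sum_br]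
  simp only [h2, Finset.sum_sub_distrib]
  have h3 : ∑ k, J j k • ε k = -rot J ε j := by
    simp only [rot, hJ j, neg_smul, Finset.sum_neg_distrib]
  rw [h3]
  simp only [ite_smul, one_smul, zero_smul, Finset.sum_ite_eq, Finset.mem_univ, if_true]
  module

include hJJ in
theorem rot_rot (x : ι → R) (k : ι) : rot J (rot J x) k = -x k := by
  simp only [rot, Finset.smul_sum]
  rw [Finset.sum_comm]
  have : ∀ l, ∑ m, J m k • J l m • x l = (if l = k then (-1 : ℂ) else 0) • x l := by
    intro l
    rw [← hJJ, Finset.sum_smul]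
    exact Finset.sum_congr rfl fun m _ => by rw [smul_smul, mul_comm]
  simp only [this, ite_smul, zero_smul, neg_one_smul]
  simp

theorem br_rot (a : R) (x : ι → R) (k : ι) : br a (rot J x k) = rot J (fun l => br a (x l)) k := by
  simp only [rot, br_sum, br_smul]

theorem rot_neg (x : ι → R) (k : ι) : rot J (fun l => -x l) k = -rot J x k := by
  simp [rot]

include hεε hiε hJ hJJ in
-- By the Jacobi identity and [L,ε_j] = 0, the bracket with [L,Λ] first turns ε_j into the rotated
-- ι_j and then back; J² = −1 yields weight 1.
theorem weight_eps (j : ι) : br (br (lefL J ε) (lefΛ J i)) (ε j) = ε j := by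
  have h := br_br (lefL J ε) (lefΛ J i) (ε j)
  rw [br_lefΛ_eps hiε hJ, br_lefL_eps hεε, br_zero, add_zero, br_rot] at h
  rw [← h]
  simp only [br_lefL_iota hiε hJ]
  rw [rot_neg, rot_rot hJJ, neg_neg]

include hii hiε hJ hJJ in
theorem weight_iota (j : ι) : br (br (lefL J ε) (lefΛ J i)) (i j) = -i j := by
  have h := br_br (lefL J ε) (lefΛ J i) (i j)
  rw [br_lefΛ_iota hii, br_lefL_iota hiε hJ, br_zero, br_neg, br_rot] at h
  simp only [br_lefΛ_eps hiε hJ] at h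
  rw [rot_rot hJJ, neg_neg] at h
  rw [eq_neg_iff_add_eq_zero, ← h]

include hii hiε hJ hJJ in
theorem weight_lefΛ : br (br (lefL J ε) (lefΛ J i)) (lefΛ J i) = (-2 : ℂ) • lefΛ J i := by
  have h1 := weight_iota hii hiε hJ hJJ
  generalize br (lefL J ε) (lefΛ J i) = H at h1
  rw [lefΛ, br_smul, br_sum]
  simp only [br_mul, br_rot, h1, rot_neg, neg_mul, mul_neg]
  rw [smul_comm (-2 : ℂ)]
  congr 1
  rw [Finset.smul_sum]
  refine Finset.sum_congr rfl fun k _ => ?_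
  module

theorem tri_zero_left (T : ι → ι → ι → ℂ) (y z : ι → R) : tri T (fun _ => 0) y z = 0 := by
  simp [tri]

theorem tri_zero_mid (T : ι → ι → ι → ℂ) (x z : ι → R) : tri T x (fun _ => 0) z = 0 := by
  simp [tri]

theorem tri_zero_right (T : ι → ι → ι → ℂ) (x y : ι → R) : tri T x y (fun _ => 0) = 0 := by
  simp [tri]

section Tensor

variable {T : ι → ι → ι → ℂ} (hT : ∀ i j k, T i j k = -T j i k) (hT' : ∀ i j k, T i j k = -T i k j)
  {c : ℂ} (hc : ∀ i j l, ∑ k, T i j k * J k l = c * T i j l)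

include hεε in
theorem br_lefL_tri : br (lefL J ε) (tri T ε ε ε) = 0 := by
  rw [br_tri]
  simp only [br_lefL_eps hεε, tri_zero_left, tri_zero_mid, tri_zero_right, add_zero]

include hεε hiε hJ hJJ in
theorem weight_tri : br (br (lefL J ε) (lefΛ J i)) (tri T ε ε ε) = (3 : ℂ) • tri T ε ε ε := by
  rw [br_tri]
  simp only [weight_eps hεε hiε hJ hJJ]
  module

include hiε hJ hT hT' hc in
-- Each slot contributes the same term: J comes out as −c by the eigentensor property, and skewness
-- lets the new contraction be moved to the last slot. In the two companions below, slots that are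
-- already contractions commute with Λ, which leaves the factors 2 and 1.
theorem br_lefΛ_tri : br (lefΛ J i) (tri T ε ε ε) = (-3 * c) • tri T ε ε i := by
  rw [br_tri]
  simp only [br_lefΛ_eps hiε hJ]
  change tri T (rot J i) ε ε + tri T ε (rot J i) ε + tri T ε ε (rot J i) = _
  rw [tri_rot_left J hJ T c hT hT' hc, tri_rot_mid J hJ T c hT' hc, tri_rot_right J hJ T c hc,
    tri_swap_left T hT i ε ε 1 hiε, tri_swap_right T hT' ε i ε 1 hiε]
  module

include hii hiε hJ hT hT' hc in
theorem br_lefΛ_tri_two : br (lefΛ J i) (tri T ε ε i) = (-2 * c) • tri T ε i i := by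
  rw [br_tri]
  simp only [br_lefΛ_eps hiε hJ, br_lefΛ_iota hii, tri_zero_right]
  change tri T (rot J i) ε i + tri T ε (rot J i) i + _ = _
  rw [tri_rot_left J hJ T c hT hT' hc, tri_rot_mid J hJ T c hT' hc,
    tri_swap_left T hT i ε i 1 hiε]
  module

include hii hiε hJ hT hT' hc in
theorem br_lefΛ_tri_one : br (lefΛ J i) (tri T ε i i) = (-c) • tri T i i i := by
  rw [br_tri]
  simp only [br_lefΛ_eps hiε hJ, br_lefΛ_iota hii, tri_zero_right, tri_zero_mid]
  change tri T (rot J i) i i + _ + _ = _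
  rw [tri_rot_left J hJ T c hT hT' hc]
  module

include hεε hiε hJ hc in
-- Only the contraction fails to commute with L. This evaluates [μ,L], which is multiplication by
-- μω.
theorem br_tri_lefL : br (tri T ε ε i) (lefL J ε) = (-c) • tri T ε ε ε := by
  rw [← neg_br, br_tri]
  simp only [br_lefL_eps hεε, br_lefL_iota hiε hJ, tri_zero_left, tri_zero_mid]
  have : tri T ε ε (fun k => -rot J ε k) = -tri T ε ε (rot J ε) := by
    simp [tri, Finset.sum_neg_distrib]
  rw [this, tri_rot_right J hJ T c hc]
  module

/-- Moving three odd factors past three odd factors produces nine signs. -/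
theorem acomm_tri (S : ι → ι → ι → ℂ) (x y : ι → R) (hxy : ∀ j k, x j * y k = -(y k * x j)) :
    acomm (tri T x x x) (tri S y y y) = 0 := by
  have h1 : ∀ j, tri T x x x * y j = -(y j * tri T x x x) := by
    intro j
    simp only [tri, Finset.sum_mul, Finset.mul_sum, ← Finset.sum_neg_distrib]
    refine Finset.sum_congr rfl fun a _ => Finset.sum_congr rfl fun b _ =>
      Finset.sum_congr rfl fun d _ => ?_
    rw [smul_mul_assoc, mul_smul_comm, ← smul_neg]
    congr 1
    rw [mul_assoc, hxy, mul_neg, ← mul_assoc, mul_assoc (x a), hxy, mul_neg, neg_mul, neg_neg,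
      ← mul_assoc, hxy]
    simp only [neg_mul, mul_assoc]
  rw [acomm, ← eq_neg_iff_add_eq_zero]
  generalize tri T x x x = X at h1
  simp only [tri, Finset.sum_mul, Finset.mul_sum, ← Finset.sum_neg_distrib]
  refine Finset.sum_congr rfl fun a _ => Finset.sum_congr rfl fun b _ =>
    Finset.sum_congr rfl fun d _ => ?_
  rw [smul_mul_assoc, mul_smul_comm, ← smul_neg]
  congr 1
  rw [← mul_assoc, ← mul_assoc, h1, neg_mul, neg_mul, mul_assoc (y a), h1, mul_neg, neg_mul, neg_neg,
    mul_assoc, mul_assoc, h1]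
  simp only [mul_neg, mul_assoc]

end Tensor

end Relations

end CanonicalAnticommutation

end Algebraic

/-! ### The Hermitian inner product on forms -/

section Hermitian

variable {E : Type*} [NormedAddCommGroup E] [NormedSpace ℝ E] {ι : Type*} [Fintype ι]

/-- The Hermitian product of the components of degree `k` of two forms which is determined by the
inner product `∑ i j, γ i j • b i ⊗ b j` on covectors. -/
def hermDeg (b : ι → E) (γ : ι → ι → ℝ) : ℕ → Fib E →ₗ[ℂ] Fib E →ₛₗ[starRingEnd ℂ] ℂ
  | 0 => LinearMap.mk₂'ₛₗ (RingHom.id ℂ) (starRingEnd ℂ)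
      (fun a c => a 0 Fin.elim0 * conj (c 0 Fin.elim0))
      (fun _ _ _ => add_mul _ _ _) (fun _ _ _ => mul_assoc _ _ _)
      (fun _ _ _ => by rw [Fib.add_apply_apply, map_add, mul_add])
      (fun _ _ _ => by rw [Fib.smul_apply_apply, map_mul, smul_eq_mul]; ring)
  | k + 1 => LinearMap.mk₂'ₛₗ (RingHom.id ℂ) (starRingEnd ℂ)
      (fun a c => ((k : ℂ) + 1)⁻¹ *
        ∑ i, ∑ j, (γ i j : ℂ) * hermDeg b γ k (iota (b i) a) (iota (b j) c))
      (fun _ _ _ => by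
        simp only [map_add, LinearMap.add_apply, mul_add, Finset.sum_add_distrib])
      (fun z _ _ => by
        simp only [map_smul, LinearMap.smul_apply, smul_eq_mul, Finset.mul_sum, RingHom.id_apply]
        exact Finset.sum_congr rfl fun _ _ => Finset.sum_congr rfl fun _ _ => by ring)
      (fun _ _ _ => by
        simp only [map_add, mul_add, Finset.sum_add_distrib])
      (fun z _ _ => by
        simp only [map_smul, map_smulₛₗ, smul_eq_mul, Finset.mul_sum]
        exact Finset.sum_congr rfl fun _ _ => Finset.sum_congr rfl fun _ _ => by ring)

theorem hermDeg_zero (b : ι → E) (γ : ι → ι → ℝ) (a c : Fib E) :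
    hermDeg b γ 0 a c = a 0 Fin.elim0 * conj (c 0 Fin.elim0) := rfl

theorem hermDeg_succ (b : ι → E) (γ : ι → ι → ℝ) (k : ℕ) (a c : Fib E) :
    hermDeg b γ (k + 1) a c = ((k : ℂ) + 1)⁻¹ *
        ∑ i, ∑ j, (γ i j : ℂ) * hermDeg b γ k (iota (b i) a) (iota (b j) c) := rfl

theorem succ_mul_hermDeg_succ (b : ι → E) (γ : ι → ι → ℝ) (k : ℕ) (a c : Fib E) :
    ((k : ℂ) + 1) * hermDeg b γ (k + 1) a c =
        ∑ i, ∑ j, (γ i j : ℂ) * hermDeg b γ k (iota (b i) a) (iota (b j) c) := by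
  rw [hermDeg_succ, mul_inv_cancel_left₀]
  exact_mod_cast k.succ_ne_zero

theorem hermDeg_congr (b : ι → E) (γ : ι → ι → ℝ) (k : ℕ) {a a' c c' : Fib E}
    (ha : a k = a' k) (hc : c k = c' k) : hermDeg b γ k a c = hermDeg b γ k a' c' := by
  induction k generalizing a a' c c' with
  | zero => rw [hermDeg_zero, hermDeg_zero, ha, hc]
  | succ k ih =>
    rw [hermDeg_succ, hermDeg_succ]
    congr 1
    refine Finset.sum_congr rfl fun i _ => Finset.sum_congr rfl fun j _ => ?_
    rw [ih (a' := iota (b i) a') (c' := iota (b j) c')]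
    · rw [iota_apply, iota_apply, ha]
    · rw [iota_apply, iota_apply, hc]

/-- Expand the contractions with the frame in the basis, degree by degree. It permits
differentiation in a fixed coordinate basis and algebra in an orthonormal frame at one point. -/
theorem hermDeg_frame {κ : Type*} [Fintype κ] [DecidableEq κ] (b : ι → E) (γ : ι → ι → ℝ) (f : κ → E)
    (C : κ → ι → ℝ) (hf : ∀ l, f l = ∑ i, C l i • b i) (hγ : ∀ i j, γ i j = ∑ l, C l i * C l j)
    (k : ℕ) (a c : Fib E) :
    hermDeg f (fun i j => if i = j then 1 else 0) k a c = hermDeg b γ k a c := by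
  induction k generalizing a c with
  | zero => rfl
  | succ k ih =>
    rw [hermDeg_succ, hermDeg_succ]
    congr 1
    have h1 : ∀ l, ∑ m, (((if l = m then 1 else 0 : ℝ)) : ℂ) *
        hermDeg f (fun i j => if i = j then 1 else 0) k (iota (f l) a) (iota (f m) c) =
        ∑ i, ∑ j, ((C l i * C l j : ℝ) : ℂ) * hermDeg b γ k (iota (b i) a) (iota (b j) c) := by
      intro l
      rw [Finset.sum_eq_single l (fun m _ hm => by simp [hm.symm]) (by simp), if_pos rfl, ih, hf l,
        iota_sum]
      simp only [iota_smul, LinearMap.sum_apply, LinearMap.smul_apply, map_sum, map_smul,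
        map_smulₛₗ, Complex.conj_ofReal, smul_eq_mul, Finset.mul_sum, Complex.ofReal_one,
        one_mul, Complex.ofReal_mul]
      rw [Finset.sum_comm]
      exact Finset.sum_congr rfl fun i _ => Finset.sum_congr rfl fun j _ => by ring
    rw [Finset.sum_congr rfl fun l _ => h1 l, Finset.sum_comm]
    refine Finset.sum_congr rfl fun i _ => ?_
    rw [Finset.sum_comm]
    refine Finset.sum_congr rfl fun j _ => ?_
    rw [← Finset.sum_mul, hγ]
    push_cast
    rfl

variable [DecidableEq ι]

/-- The Hermitian product of the components of degree `k` for which `f` is orthonormal. -/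
abbrev hermOn (f : ι → E) (k : ℕ) : Fib E →ₗ[ℂ] Fib E →ₛₗ[starRingEnd ℂ] ℂ :=
  hermDeg f (fun i j => if i = j then 1 else 0) k

theorem succ_mul_hermOn_succ (f : ι → E) (k : ℕ) (a c : Fib E) :
    ((k : ℂ) + 1) * hermOn f (k + 1) a c = ∑ i, hermOn f k (iota (f i) a) (iota (f i) c) := by
  rw [succ_mul_hermDeg_succ]
  refine Finset.sum_congr rfl fun i _ => ?_
  rw [Finset.sum_eq_single i (fun m _ hm => by simp [hm.symm]) (by simp)]
  simp

theorem hermOn_apply (f : ι → E) (k : ℕ) (a c : Fib E) :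
    hermOn f k a c = (k.factorial : ℂ)⁻¹ *
      ∑ i : Fin k → ι, a k (fun j => f (i j)) * conj (c k (fun j => f (i j))) := by
  induction k generalizing a c with
  | zero =>
    rw [hermDeg_zero, Fintype.sum_unique]
    simp only [Nat.factorial_zero, Nat.cast_one, inv_one, one_mul]
    congr 2
    · exact Subsingleton.elim _ _
    · congr 2
      exact Subsingleton.elim _ _
  | succ k ih =>
    have hk : (k : ℂ) + 1 ≠ 0 := by exact_mod_cast k.succ_ne_zero
    have hk' : (k.factorial : ℂ) ≠ 0 := by exact_mod_cast k.factorial_ne_zero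
    refine mul_left_cancel₀ hk ?_
    rw [succ_mul_hermOn_succ, Nat.factorial_succ, Finset.sum_congr rfl fun l _ => ih _ _,
      ← Finset.mul_sum, ← (Fin.consEquiv fun _ : Fin (k + 1) => ι).sum_comp, Fintype.sum_prod_type]
    push_cast
    rw [mul_inv, mul_assoc, mul_inv_cancel_left₀ hk]
    congr 1
    refine Finset.sum_congr rfl fun l _ => Finset.sum_congr rfl fun i _ => ?_
    have : (fun j => f ((Fin.consEquiv fun _ : Fin (k + 1) => ι) (l, i) j)) =
        Fin.cons (f l) (fun j => f (i j)) := by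
      funext j
      refine Fin.cases ?_ (fun j => ?_) j <;> simp [Fin.consEquiv]
    rw [this]
    rfl

theorem hermOn_conj (f : ι → E) (k : ℕ) (a c : Fib E) :
    conj (hermOn f k a c) = hermOn f k c a := by
  rw [hermOn_apply, hermOn_apply, map_mul, map_inv₀, map_natCast, map_sum]
  congr 1
  exact Finset.sum_congr rfl fun i _ => by rw [map_mul, Complex.conj_conj, mul_comm]

theorem hermOn_self (f : ι → E) (k : ℕ) (a : Fib E) :
    hermOn f k a a = (((k.factorial : ℝ)⁻¹ *
      ∑ i : Fin k → ι, ‖a k (fun j => f (i j))‖ ^ 2 : ℝ) : ℂ) := by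
  rw [hermOn_apply]
  push_cast
  refine congrArg _ (Finset.sum_congr rfl fun i _ => ?_)
  rw [Complex.mul_conj, Complex.normSq_eq_norm_sq]
  push_cast
  rfl

variable [FiniteDimensional ℝ E]

theorem form_eq_zero_of_basis (f : Module.Basis ι ℝ E) {k : ℕ} (a : E [⋀^Fin k]→L[ℝ] ℂ)
    (h : ∀ i : Fin k → ι, a (fun j => f (i j)) = 0) : a = 0 := by
  have : a.toAlternatingMap = 0 := by
    refine Module.Basis.ext_alternating f fun v _ => ?_
    exact h v
  ext w
  exact congrArg (fun g : E [⋀^Fin k]→ₗ[ℝ] ℂ => g w) this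

theorem eq_zero_of_hermOn_self (f : Module.Basis ι ℝ E) (k : ℕ) (a : Fib E)
    (h : hermOn f k a a = 0) : a k = 0 := by
  rw [hermOn_self, Complex.ofReal_eq_zero, mul_eq_zero] at h
  have h1 := h.resolve_left (inv_ne_zero (by exact_mod_cast k.factorial_ne_zero))
  rw [Finset.sum_eq_zero_iff_of_nonneg fun i _ => by positivity] at h1
  exact form_eq_zero_of_basis f _ fun i => by simpa using h1 i (Finset.mem_univ i)

theorem form_eq_zero_of_card_lt (f : Module.Basis ι ℝ E) {k : ℕ} (hk : Fintype.card ι < k)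
    (a : E [⋀^Fin k]→L[ℝ] ℂ) : a = 0 := by
  refine form_eq_zero_of_basis f a fun i => ?_
  obtain ⟨x, y, hxy, h⟩ := Fintype.exists_ne_map_eq_of_card_lt i (by simpa using hk)
  exact a.map_eq_zero_of_eq _ (by rw [h]) hxy

/-- Expanding the product in degree k + 2 over contractions, the diagonal term of the
anticommutation relation contributes once and the inductive hypothesis contributes k + 1 times,
which matches the factor k + 2. -/
theorem hermOn_eps (f : Module.Basis ι ℝ E) (k : ℕ) (l : ι) (a c : Fib E) :
    hermOn f (k + 1) (eps (coordC f l) a) c = hermOn f k a (iota (f l) c) := by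
  have hδ : ∀ i, coordC f l (f i) = if i = l then 1 else 0 := by
    intro i
    rw [coordC_apply, Module.Basis.repr_self, Finsupp.single_apply]
    split_ifs <;> simp
  have hk : ∀ k : ℕ, (k : ℂ) + 1 ≠ 0 := fun k => by exact_mod_cast k.succ_ne_zero
  induction k generalizing a c with
  | zero =>
    refine mul_left_cancel₀ (hk 0) ?_
    rw [succ_mul_hermOn_succ]
    simp only [iota_eps, hδ, map_sub, map_smul, LinearMap.sub_apply, LinearMap.smul_apply]
    have h0 : ∀ i, hermOn f 0 (eps (coordC f l) (iota (f i) a)) (iota (f i) c) = 0 := fun i => by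
      simp [hermDeg_zero]
    simp [h0]
  | succ k ih =>
    refine mul_left_cancel₀ (hk (k + 1)) ?_
    rw [succ_mul_hermOn_succ]
    simp only [iota_eps, hδ, map_sub, map_smul, LinearMap.sub_apply, LinearMap.smul_apply, ih]
    have h1 : ∀ i, hermOn f k (iota (f i) a) (iota (f l) (iota (f i) c)) =
        -hermOn f k (iota (f i) a) (iota (f i) (iota (f l) c)) := fun i => by
      rw [← Module.End.mul_apply, iota_mul_iota, LinearMap.neg_apply, map_neg]
      rfl
    simp only [h1, sub_neg_eq_add, Finset.sum_add_distrib]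
    rw [← succ_mul_hermOn_succ]
    simp
    ring

/-- The Hermitian inner product for which `f` is orthonormal. -/
def herm (f : ι → E) : Fib E →ₗ[ℂ] Fib E →ₛₗ[starRingEnd ℂ] ℂ :=
  ∑ k ∈ Finset.range (Fintype.card ι + 1), hermOn f k

theorem herm_apply (f : ι → E) (a c : Fib E) :
    herm f a c = ∑ k ∈ Finset.range (Fintype.card ι + 1), hermOn f k a c := by
  simp only [herm, LinearMap.sum_apply]

theorem herm_conj (f : ι → E) (a c : Fib E) : conj (herm f a c) = herm f c a := by
  simp only [herm_apply, map_sum, hermOn_conj]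

theorem herm_self (f : ι → E) (a : Fib E) : ∃ r : ℝ, 0 ≤ r ∧ herm f a a = r := by
  refine ⟨∑ k ∈ Finset.range (Fintype.card ι + 1), (k.factorial : ℝ)⁻¹ *
      ∑ i : Fin k → ι, ‖a k (fun j => f (i j))‖ ^ 2, by positivity, ?_⟩
  rw [herm_apply, Finset.sum_congr rfl fun k _ => hermOn_self f k a, ← Complex.ofReal_sum]

theorem eq_zero_of_herm_self (f : Module.Basis ι ℝ E) (a : Fib E) (h : herm f a a = 0) : a = 0 := by
  rw [herm_apply, Finset.sum_congr rfl fun k _ => hermOn_self f k a, ← Complex.ofReal_sum,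
    Complex.ofReal_eq_zero, Finset.sum_eq_zero_iff_of_nonneg fun k _ => by positivity] at h
  refine Fib.ext fun k => ?_
  by_cases hk : Fintype.card ι < k
  · exact form_eq_zero_of_card_lt f hk _
  · refine eq_zero_of_hermOn_self f k a ?_
    rw [hermOn_self, h k (by simp; omega), Complex.ofReal_zero]

/-- `Q` is the adjoint of `P` for a sesquilinear form `H`. -/
def IsAdj (H : Fib E →ₗ[ℂ] Fib E →ₛₗ[starRingEnd ℂ] ℂ) (P Q : Module.End ℂ (Fib E)) : Prop :=
  ∀ a c, H (P a) c = H a (Q c)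

namespace IsAdj

variable {H : Fib E →ₗ[ℂ] Fib E →ₛₗ[starRingEnd ℂ] ℂ} {P Q P' Q' : Module.End ℂ (Fib E)}

omit [FiniteDimensional ℝ E]

theorem add (h : IsAdj H P Q) (h' : IsAdj H P' Q') : IsAdj H (P + P') (Q + Q') := fun a c => by
  simp only [LinearMap.add_apply, map_add, h a c, h' a c]

theorem mul (h : IsAdj H P Q) (h' : IsAdj H P' Q') : IsAdj H (P * P') (Q' * Q) := fun a c => by
  simp only [Module.End.mul_apply, h _ c, h' a _]

theorem smul (z : ℂ) (h : IsAdj H P Q) : IsAdj H (z • P) (conj z • Q) := fun a c => by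
  simp only [LinearMap.smul_apply, map_smul, map_smulₛₗ, h a c, Complex.conj_conj]

theorem sum {κ : Type*} (s : Finset κ) {P Q : κ → Module.End ℂ (Fib E)}
    (h : ∀ i ∈ s, IsAdj H (P i) (Q i)) : IsAdj H (∑ i ∈ s, P i) (∑ i ∈ s, Q i) := fun a c => by
  simp only [LinearMap.sum_apply, map_sum]
  exact Finset.sum_congr rfl fun i hi => h i hi a c

/-- Taking adjoints reverses the three factors. Relabelling exchanges the outer indices, an odd
permutation of a skew tensor, whence the sign. -/
theorem tri {T : ι → ι → ι → ℂ} (hT : ∀ i j k, T i j k = -T j i k)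
    (hT' : ∀ i j k, T i j k = -T i k j) {x y z x' y' z' : ι → Module.End ℂ (Fib E)}
    (hx : ∀ i, IsAdj H (x i) (x' i)) (hy : ∀ i, IsAdj H (y i) (y' i))
    (hz : ∀ i, IsAdj H (z i) (z' i)) :
    IsAdj H (tri T x y z) (-NearlyKahler.tri (fun i j k => conj (T i j k)) z' y' x') := by
  have h : -NearlyKahler.tri (fun i j k => conj (T i j k)) z' y' x' =
      ∑ i, ∑ j, ∑ k, conj (T i j k) • (z' k * (y' j * x' i)) := by
    simp only [NearlyKahler.tri, ← Finset.sum_neg_distrib]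
    rw [Finset.sum_comm]
    conv_rhs => rw [Finset.sum_comm]
    refine Finset.sum_congr rfl fun j _ => ?_
    rw [Finset.sum_comm]
    refine Finset.sum_congr rfl fun i _ => Finset.sum_congr rfl fun k _ => ?_
    rw [hT k j i, hT' j k i, hT j i k, mul_assoc]
    simp
  rw [h]
  exact IsAdj.sum _ fun i _ => IsAdj.sum _ fun j _ => IsAdj.sum _ fun k _ =>
    (((hx i).mul (hy j)).mul (hz k)).smul _

end IsAdj

theorem isAdj_eps (f : Module.Basis ι ℝ E) (l : ι) :
    IsAdj (herm f) (eps (coordC f l)) (iota (f l)) := fun a c => by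
  rw [herm_apply, herm_apply, Finset.sum_range_succ', Finset.sum_range_succ _ (Fintype.card ι)]
  congr 1
  · exact Finset.sum_congr rfl fun k _ => hermOn_eps f k l a c
  -- `herm` stops at the dimension, so shifting degrees by one leaves a boundary term at each end.
  -- The top one vanishes because there are no forms of degree dimension + 1, the bottom one because
  -- `eps` has no component of degree 0.
  · have h1 : iota (f l) c (Fintype.card ι) = (0 : Fib E) (Fintype.card ι) := by
      rw [iota_apply, form_eq_zero_of_card_lt f (Nat.lt_succ_self _) (c (Fintype.card ι + 1))]
      ext w
      simp
    rw [hermDeg_congr _ _ _ rfl h1, map_zero, hermDeg_zero]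
    simp

theorem isAdj_iota (f : Module.Basis ι ℝ E) (l : ι) :
    IsAdj (herm f) (iota (f l)) (eps (coordC f l)) := fun a c => by
  rw [← herm_conj, ← isAdj_eps, herm_conj]

end Hermitian

/-! ### Adjoints of the Lefschetz and torsion operators in an orthonormal frame. -/

section PointwiseAdjoints

variable {E : Type*} [NormedAddCommGroup E] [NormedSpace ℝ E] [FiniteDimensional ℝ E]
  {ι : Type*} [Fintype ι] [DecidableEq ι] (f : Module.Basis ι ℝ E)

/-- Exterior multiplication by the elements of the dual basis. -/
abbrev epsB (k : ι) : Module.End ℂ (Fib E) := eps (coordC f k)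

/-- Interior multiplication by the elements of the basis. -/
abbrev iotaB (k : ι) : Module.End ℂ (Fib E) := iota (f k)

theorem epsB_mul_epsB (j k : ι) : epsB f j * epsB f k = -(epsB f k * epsB f j) := eps_mul_eps _ _

theorem iotaB_mul_iotaB (j k : ι) : iotaB f j * iotaB f k = -(iotaB f k * iotaB f j) :=
  iota_mul_iota _ _

theorem iotaB_mul_epsB (j k : ι) : iotaB f j * epsB f k =
    (if j = k then (1 : ℂ) else 0) • (1 : Module.End ℂ (Fib E)) - epsB f k * iotaB f j := by
  rw [iota_mul_eps, coordC_apply, Module.Basis.repr_self, Finsupp.single_apply]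
  split_ifs <;> simp

variable {J : ι → ι → ℂ} (hJ : ∀ j k, J j k = -J k j)
  (hJJ : ∀ j k, ∑ l, J j l * J l k = if j = k then -1 else 0) (hJr : ∀ j k, conj (J j k) = J j k)
  {T : ι → ι → ι → ℂ} (hT : ∀ i j k, T i j k = -T j i k) (hT' : ∀ i j k, T i j k = -T i k j)
  {c : ℂ} (hc : ∀ i j l, ∑ k, T i j k * J k l = c * T i j l) (hcc : c * c = -1)

include hJr in
theorem isAdj_lefL : IsAdj (herm f) (lefL J (epsB f)) (lefΛ J (iotaB f)) := by
  have h : lefΛ J (iotaB f) = conj (1 / 2 : ℂ) • ∑ k, rot J (iotaB f) k * iotaB f k := by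
    rw [lefΛ, map_div₀, map_one, map_ofNat]
  rw [h]
  refine IsAdj.smul _ (IsAdj.sum _ fun k _ => (isAdj_eps f k).mul ?_)
  exact IsAdj.sum _ fun l _ => by
    have := (isAdj_eps f l).smul (J l k)
    rwa [hJr] at this

include hJ hT hT' hc hcc

/-- The scalar is −(c/2)(−3c) = 3c²/2 = −3/2. The outcome, −3 times the torsion operator, accounts
for the factor −⅓ that relates μ to L_{μω}. -/
theorem br_lefΛ_torsion :
    br (lefΛ J (iotaB f)) (-(c / 2) • tri T (epsB f) (epsB f) (epsB f)) =
      (-3 : ℂ) • (1 / 2 : ℂ) • tri T (epsB f) (epsB f) (iotaB f) := by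
  rw [br_smul, br_lefΛ_tri (iotaB_mul_epsB f) hJ hT hT' hc, smul_smul, smul_smul]
  congr 1
  linear_combination (3 / 2 : ℂ) * hcc

theorem br_br_lefΛ_torsion :
    br (lefΛ J (iotaB f)) (br (lefΛ J (iotaB f)) (-(c / 2) • tri T (epsB f) (epsB f) (epsB f))) =
      (3 * c) • tri T (epsB f) (iotaB f) (iotaB f) := by
  rw [br_lefΛ_torsion f hJ hT hT' hc hcc, br_smul, br_smul,
    br_lefΛ_tri_two (iotaB_mul_iotaB f) (iotaB_mul_epsB f) hJ hT hT' hc, smul_smul, smul_smul]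
  congr 1
  ring

theorem br_br_br_lefΛ_torsion :
    br (lefΛ J (iotaB f)) (br (lefΛ J (iotaB f)) (br (lefΛ J (iotaB f))
      (-(c / 2) • tri T (epsB f) (epsB f) (epsB f)))) =
      (3 : ℂ) • tri T (iotaB f) (iotaB f) (iotaB f) := by
  rw [br_br_lefΛ_torsion f hJ hT hT' hc hcc, br_smul,
    br_lefΛ_tri_one (iotaB_mul_iotaB f) (iotaB_mul_epsB f) hJ hT hT' hc, smul_smul]
  congr 1
  linear_combination (-3 : ℂ) * hcc

omit hT hT' hc hcc

variable {S : ι → ι → ι → ℂ} {d : ℂ} (hS : ∀ i j k, S i j k = -S j i k)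
  (hS' : ∀ i j k, S i j k = -S i k j) (hd : ∀ i j l, ∑ k, S i j k * J k l = d * S i j l)
  (hdd : d * d = -1) (hTS : ∀ i j k, conj (T i j k) = S i j k) (hcd : conj c = d)

include hT hT' hS hS' hd hdd hTS hcd

/-- The adjoint is a cubic expression in contractions with the conjugate tensor, and such an
expression is the triple bracket of Λ with the conjugate cubic in exterior factors. Conjugation
exchanges the eigenvalues c and d, hence μω and μ̄ω. -/
theorem isAdj_tri_three :
    IsAdj (herm f) (-(c / 2) • tri T (epsB f) (epsB f) (epsB f))
      ((d / 6) • br (lefΛ J (iotaB f)) (br (lefΛ J (iotaB f)) (br (lefΛ J (iotaB f))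
        (-(d / 2) • tri S (epsB f) (epsB f) (epsB f))))) := by
  have h := (IsAdj.tri hT hT' (isAdj_eps f) (isAdj_eps f) (isAdj_eps f)).smul (-(c / 2))
  rw [br_br_br_lefΛ_torsion f hJ hS hS' hd hdd]
  convert h using 1
  simp only [hTS, map_neg, map_div₀, hcd, map_ofNat]
  module

theorem isAdj_tri_two :
    IsAdj (herm f) ((1 / 2 : ℂ) • tri T (epsB f) (epsB f) (iotaB f))
      ((d / 6) • br (lefΛ J (iotaB f)) (br (lefΛ J (iotaB f))
        (-(d / 2) • tri S (epsB f) (epsB f) (epsB f)))) := by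
  have h := (IsAdj.tri hT hT' (isAdj_eps f) (isAdj_eps f) (isAdj_iota f)).smul (1 / 2 : ℂ)
  rw [br_br_lefΛ_torsion f hJ hS hS' hd hdd, smul_smul]
  have hd3 : d / 6 * (3 * d) = -(1 / 2) := by linear_combination (1 / 2 : ℂ) * hdd
  rw [hd3]
  convert h using 1
  simp only [hTS, map_div₀, map_one, map_ofNat]
  module

end PointwiseAdjoints

/-! ### Covariant derivatives of forms along curves -/

section Curves

variable {E : Type*} [NormedAddCommGroup E] [NormedSpace ℝ E]

/-- The curve `a` of forms has the derivative `a'` at `0`. -/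
def HasD (a : ℝ → Fib E) (a' : Fib E) : Prop :=
  ∀ k w, HasDerivAt (fun t => a t k w) (a' k w) 0

namespace HasD

variable {a c : ℝ → Fib E} {a' c' : Fib E}

theorem add (ha : HasD a a') (hc : HasD c c') : HasD (fun t => a t + c t) (a' + c') :=
  fun k w => (ha k w).add (hc k w)

theorem sub (ha : HasD a a') (hc : HasD c c') : HasD (fun t => a t - c t) (a' - c') :=
  fun k w => (ha k w).sub (hc k w)

theorem smul {φ : ℝ → ℂ} {φ' : ℂ} (hφ : HasDerivAt φ φ' 0) (ha : HasD a a') :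
    HasD (fun t => φ t • a t) (φ' • a 0 + φ 0 • a') :=
  fun k w => hφ.mul (ha k w)

theorem const_smul (z : ℂ) (ha : HasD a a') : HasD (fun t => z • a t) (z • a') :=
  fun k w => (ha k w).const_mul z

theorem sum {ι : Type*} (s : Finset ι) {a : ι → ℝ → Fib E} {a' : ι → Fib E}
    (h : ∀ i ∈ s, HasD (a i) (a' i)) : HasD (fun t => ∑ i ∈ s, a i t) (∑ i ∈ s, a' i) := by
  intro k w
  simp only [Fib.sum_apply_apply]
  exact HasDerivAt.fun_sum fun i hi => h i hi k w

theorem iota_const (v : E) (ha : HasD a a') : HasD (fun t => iota v (a t)) (iota v a') :=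
  fun k w => ha (k + 1) (Fin.cons v w)

theorem eps_const (θ : E →L[ℝ] ℂ) (ha : HasD a a') : HasD (fun t => eps θ (a t)) (eps θ a') := by
  intro k w
  cases k with
  | zero => exact hasDerivAt_const _ _
  | succ k =>
    simp only [eps_apply_succ, epsForm_apply]
    exact HasDerivAt.fun_sum fun i _ => ((ha k _).const_mul _).const_mul _

variable [FiniteDimensional ℝ E]

theorem iota {X : ℝ → E} {X' : E} (hX : HasDerivAt X X' 0) (ha : HasD a a') :
    HasD (fun t => iota (X t) (a t)) (iota X' (a 0) + NearlyKahler.iota (X 0) a') := by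
  let b := Module.finBasis ℝ E
  have h : ∀ j, HasDerivAt (fun t => coordC b j (X t)) (coordC b j X') 0 := fun j =>
    ((coordC b j).hasFDerivAt.comp_hasDerivAt (0 : ℝ) hX)
  have h1 := HasD.sum Finset.univ fun j _ => HasD.smul (h j) (ha.iota_const (b j))
  have h2 : ∀ (v : E) (x : Fib E), ∑ j, coordC b j v • NearlyKahler.iota (b j) x =
      NearlyKahler.iota v x := fun v x => by
    conv_rhs => rw [← sum_coordC_smul_iota b v]
    simp only [LinearMap.sum_apply, LinearMap.smul_apply]
  simpa only [Finset.sum_add_distrib, h2] using h1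

theorem eps {θ : ℝ → E →L[ℝ] ℂ} {θ' : E →L[ℝ] ℂ}
    (hθ : ∀ v, HasDerivAt (fun t => θ t v) (θ' v) 0) (ha : HasD a a') :
    HasD (fun t => eps (θ t) (a t)) (eps θ' (a 0) + NearlyKahler.eps (θ 0) a') := by
  let b := Module.finBasis ℝ E
  have h1 := HasD.sum Finset.univ fun j _ => HasD.smul (hθ (b j)) (ha.eps_const (coordC b j))
  have h2 : ∀ (θ : E →L[ℝ] ℂ) (x : Fib E), ∑ j, θ (b j) • NearlyKahler.eps (coordC b j) x =
      NearlyKahler.eps θ x := fun θ x => by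
    conv_rhs => rw [← sum_coordC_smul_eps b θ]
    simp only [LinearMap.sum_apply, LinearMap.smul_apply]
  simpa only [Finset.sum_add_distrib, h2] using h1

end HasD

variable [FiniteDimensional ℝ E] {ι : Type*} [Fintype ι]

/-- The action of an endomorphism of the vector space on forms, as a derivation. -/
def rho (b : Module.Basis ι ℝ E) (S : E →L[ℝ] E) : Module.End ℂ (Fib E) :=
  ∑ j, eps ((coordC b j).comp S) * iota (b j)

theorem iota_mul_rho (b : Module.Basis ι ℝ E) (S : E →L[ℝ] E) (v : E) :
    iota v * rho b S = rho b S * iota v + iota (S v) := by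
  rw [← sum_coordC_smul_iota b (S v), rho, Finset.sum_mul, Finset.mul_sum, ← Finset.sum_add_distrib]
  refine Finset.sum_congr rfl fun j _ => ?_
  rw [← mul_assoc, iota_mul_eps, sub_mul, mul_assoc, mul_assoc, iota_mul_iota v]
  simp only [smul_mul_assoc, one_mul, mul_neg, sub_neg_eq_add, ContinuousLinearMap.comp_apply]
  abel

theorem rho_mul_eps (b : Module.Basis ι ℝ E) (S : E →L[ℝ] E) (θ : E →L[ℝ] ℂ) :
    rho b S * eps θ = eps θ * rho b S + eps (θ.comp S) := by
  have h : eps (θ.comp S) = ∑ j, θ (b j) • eps ((coordC b j).comp S) := by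
    have h1 : θ.comp S = ∑ j, θ (b j) • (coordC b j).comp S := by
      ext v
      have := congrArg (fun φ : E →L[ℝ] ℂ => φ (S v)) (sum_coordC_smul b θ)
      simp only [sum_apply, smul_apply] at this ⊢
      exact this.symm
    rw [h1, eps_sum]
    simp only [eps_smul]
  rw [h, rho, Finset.sum_mul, Finset.mul_sum, ← Finset.sum_add_distrib]
  refine Finset.sum_congr rfl fun j _ => ?_
  rw [mul_assoc, iota_mul_eps, mul_sub, ← mul_assoc, ← mul_assoc, eps_mul_eps θ]
  simp only [mul_smul_comm, mul_one, neg_mul]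
  abel

theorem rho_apply_zero (b : Module.Basis ι ℝ E) (S : E →L[ℝ] E) (a : Fib E) :
    rho b S a 0 = 0 := by
  refine form_ext_zero ?_
  simp only [rho, LinearMap.sum_apply, Fib.sum_apply_apply, Module.End.mul_apply, eps_apply_zero]
  simp

/-- The curve `a` of forms has the covariant derivative `a'` at `0`, with respect to a connection
whose matrix is `S`. -/
def HasNab (b : Module.Basis ι ℝ E) (S : E →L[ℝ] E) (a : ℝ → Fib E) (a' : Fib E) : Prop :=
  -- On vectors the covariant derivative is X' + S X, so on forms it is the derivative minus the
  -- derivation action of S.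
  HasD a (a' + rho b S (a 0))

namespace HasNab

variable {b : Module.Basis ι ℝ E} {S : E →L[ℝ] E} {a c : ℝ → Fib E} {a' c' : Fib E}

theorem congr (h : HasNab b S a a') (ha : ∀ t, c t = a t) (h' : c' = a') : HasNab b S c c' := by
  rw [h', funext ha]
  exact h

theorem add (ha : HasNab b S a a') (hc : HasNab b S c c') :
    HasNab b S (fun t => a t + c t) (a' + c') := by
  have := HasD.add ha hc
  rwa [add_add_add_comm, ← map_add] at this

theorem sub (ha : HasNab b S a a') (hc : HasNab b S c c') :
    HasNab b S (fun t => a t - c t) (a' - c') := by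
  have := HasD.sub ha hc
  rwa [add_sub_add_comm, ← map_sub] at this

theorem const_smul (z : ℂ) (ha : HasNab b S a a') : HasNab b S (fun t => z • a t) (z • a') := by
  have := HasD.const_smul z ha
  rwa [smul_add, ← map_smul] at this

theorem smul {φ : ℝ → ℂ} {φ' : ℂ} (hφ : HasDerivAt φ φ' 0) (ha : HasNab b S a a') :
    HasNab b S (fun t => φ t • a t) (φ' • a 0 + φ 0 • a') := by
  have := HasD.smul hφ ha
  rwa [smul_add, ← map_smul, ← add_assoc] at this

theorem sum {κ : Type*} (s : Finset κ) {a : κ → ℝ → Fib E} {a' : κ → Fib E}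
    (h : ∀ i ∈ s, HasNab b S (a i) (a' i)) :
    HasNab b S (fun t => ∑ i ∈ s, a i t) (∑ i ∈ s, a' i) := by
  have := HasD.sum s h
  rwa [Finset.sum_add_distrib, ← map_sum] at this

theorem iota {X : ℝ → E} {X' : E} (hX : HasDerivAt X X' 0) (ha : HasNab b S a a') :
    HasNab b S (fun t => iota (X t) (a t))
      (iota (X 0) a' + NearlyKahler.iota (X' + S (X 0)) (a 0)) := by
  have h := HasD.iota hX ha
  have h2 := LinearMap.congr_fun (iota_mul_rho b S (X 0)) (a 0)
  simp only [Module.End.mul_apply, LinearMap.add_apply] at h2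
  rw [map_add, h2] at h
  unfold HasNab
  convert h using 1
  rw [iota_add, LinearMap.add_apply]
  abel

theorem iota_const (v : E) (ha : HasNab b S a a') :
    HasNab b S (fun t => NearlyKahler.iota v (a t))
      (NearlyKahler.iota v a' + NearlyKahler.iota (S v) (a 0)) := by
  simpa using ha.iota (hasDerivAt_const (0 : ℝ) v)

theorem eps {θ : ℝ → E →L[ℝ] ℂ} {θ' : E →L[ℝ] ℂ}
    (hθ : ∀ v, HasDerivAt (fun t => θ t v) (θ' v) 0) (ha : HasNab b S a a') :
    HasNab b S (fun t => eps (θ t) (a t))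
      (eps (θ 0) a' + NearlyKahler.eps (θ' - (θ 0).comp S) (a 0)) := by
  have h := HasD.eps hθ ha
  have h2 := LinearMap.congr_fun (rho_mul_eps b S (θ 0)) (a 0)
  simp only [Module.End.mul_apply, LinearMap.add_apply] at h2
  unfold HasNab
  rw [h2]
  convert h using 1
  rw [sub_eq_add_neg θ', eps_add, eps_neg, LinearMap.add_apply, LinearMap.neg_apply, map_add]
  abel

variable {J : ℝ → E →L[ℝ] E}

/-- The hypothesis says that J is parallel. The recursion `iota_typeEnd` involves only contractions
with v and Jv, whose covariant derivatives are then known, so the claim follows by induction on the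
degree. -/
theorem typeEnd (hJ : ∀ v, HasDerivAt (fun t => J t v) (J 0 (S v) - S (J 0 v)) 0) (p : ℤ)
    (ha : HasNab b S a a') : HasNab b S (fun t => typeEnd (J t) p (a t)) (typeEnd (J 0) p a') := by
  intro k
  induction k generalizing a a' p with
  | zero =>
    intro w
    have h := ha 0 w
    simp only [Fib.add_apply, typeEnd_apply_zero, rho_apply_zero] at h ⊢
    split_ifs
    · exact h
    · exact (hasDerivAt_const (0 : ℝ) (0 : ℂ)).congr_deriv (by simp)
  | succ k ih =>
    intro w
    obtain ⟨v, w, rfl⟩ : ∃ v w', w = Fin.cons v w' := ⟨w 0, Fin.tail w, (Fin.cons_self_tail w).symm⟩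
    have h1 : HasNab b S (fun t => iota10 (J t) v (a t))
        (iota10 (J 0) v a' + iota10 (J 0) (S v) (a 0)) := by
      refine (((ha.iota_const v).sub ((ha.iota (hJ v)).const_smul Complex.I)).const_smul
        (1 / 2 : ℂ)).congr (fun _ => rfl) ?_
      simp only [iota10, LinearMap.smul_apply, LinearMap.sub_apply, sub_add_cancel]
      module
    have h2 : HasNab b S (fun t => iota01 (J t) v (a t))
        (iota01 (J 0) v a' + iota01 (J 0) (S v) (a 0)) := by
      refine (((ha.iota_const v).add ((ha.iota (hJ v)).const_smul Complex.I)).const_smul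
        (1 / 2 : ℂ)).congr (fun _ => rfl) ?_
      simp only [iota01, LinearMap.smul_apply, LinearMap.add_apply, sub_add_cancel]
      module
    have h3 := (ih (p - 1) h1 w).add (ih p h2 w)
    have h4 : ∀ t (u : E) (x : Fib E), NearlyKahler.iota u (NearlyKahler.typeEnd (J t) p x) =
        NearlyKahler.typeEnd (J t) (p - 1) (iota10 (J t) u x) +
          NearlyKahler.typeEnd (J t) p (iota01 (J t) u x) := fun t u x =>
      LinearMap.congr_fun (iota_typeEnd (J t) p u) x
    have h5 : ∀ t (x : Fib E), NearlyKahler.typeEnd (J t) p x (k + 1) (Fin.cons v w) =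
        NearlyKahler.typeEnd (J t) (p - 1) (iota10 (J t) v x) k w +
          NearlyKahler.typeEnd (J t) p (iota01 (J t) v x) k w := fun t x =>
      congrArg (fun y : Fib E => y k w) (h4 t v x)
    have h6 := LinearMap.congr_fun (iota_mul_rho b S v) (NearlyKahler.typeEnd (J 0) p (a 0))
    simp only [Module.End.mul_apply, LinearMap.add_apply, h4, map_add] at h6
    have h7 : rho b S (NearlyKahler.typeEnd (J 0) p (a 0)) (k + 1) (Fin.cons v w) = _ :=
      congrArg (fun y : Fib E => y k w) h6
    rw [Fib.add_apply_apply, h7]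
    refine (h3.congr_deriv ?_).congr_of_eventuallyEq (Filter.Eventually.of_forall fun t => h5 t _)
    rw [h5]
    simp only [map_add, Fib.add_apply_apply]
    ring

end HasNab

/-- The matrix of an endomorphism. -/
def matOf (b : Module.Basis ι ℝ E) (S : E →L[ℝ] E) (i j : ι) : ℝ := b.repr (S (b j)) i

theorem apply_eq_sum_matOf (b : Module.Basis ι ℝ E) (S : E →L[ℝ] E) (j : ι) :
    S (b j) = ∑ i, matOf b S i j • b i := (b.sum_repr _).symm

/-- The derivative of the inverse `γ` of a parallel metric. -/
def IsParallelInv (b : Module.Basis ι ℝ E) (S : E →L[ℝ] E) (γ : ℝ → ι → ι → ℝ) : Prop :=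
  ∀ i j, HasDerivAt (fun t => γ t i j)
    (-∑ k, (matOf b S i k * γ 0 k j + γ 0 i k * matOf b S j k)) 0

/-- Contraction with a parallel inverse metric is parallel: its derivative cancels the two terms in
which the connection acts on the basis vectors. This serves both Λ and the Hermitian product. -/
theorem sum_parallelInv_smul {F : Type*} [AddCommGroup F] [Module ℂ F] (m γ : ι → ι → ℝ)
    (φ : ι → ι → F) :
    ∑ i, ∑ j, ((-∑ k, (m i k * γ k j + γ i k * m j k) : ℝ) : ℂ) • φ i j +
      ∑ i, ∑ j, (γ i j : ℂ) • (∑ k, (m k i : ℂ) • φ k j + ∑ k, (m k j : ℂ) • φ i k) = 0 := by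
  have h1 : ∑ i, ∑ j, ∑ k, ((m i k * γ k j : ℝ) : ℂ) • φ i j =
      ∑ i, ∑ j, ∑ k, (γ i j : ℂ) • (m k i : ℂ) • φ k j := by
    rw [Finset.sum_comm, Finset.sum_comm (f := fun i j => ∑ k, (γ i j : ℂ) • (m k i : ℂ) • φ k j)]
    refine Finset.sum_congr rfl fun j _ => ?_
    rw [Finset.sum_comm]
    refine Finset.sum_congr rfl fun i _ => Finset.sum_congr rfl fun k _ => ?_
    rw [smul_smul, Complex.ofReal_mul, mul_comm]
  have h2 : ∑ i, ∑ j, ∑ k, ((γ i k * m j k : ℝ) : ℂ) • φ i j =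
      ∑ i, ∑ j, ∑ k, (γ i j : ℂ) • (m k j : ℂ) • φ i k := by
    refine Finset.sum_congr rfl fun i _ => ?_
    rw [Finset.sum_comm]
    refine Finset.sum_congr rfl fun j _ => Finset.sum_congr rfl fun k _ => ?_
    rw [smul_smul, Complex.ofReal_mul]
  simp only [smul_add, Finset.smul_sum, Finset.sum_add_distrib, ← h1, ← h2, Complex.ofReal_neg,
    Complex.ofReal_sum, Complex.ofReal_add, neg_smul, Finset.sum_smul, add_smul,
    Finset.sum_neg_distrib]
  abel

/-- The dual Lefschetz operator, in terms of the inverse of the metric. -/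
def lam (b : Module.Basis ι ℝ E) (γ : ι → ι → ℝ) (J : E →L[ℝ] E) : Module.End ℂ (Fib E) :=
  (1 / 2 : ℂ) • ∑ i, ∑ j, (γ i j : ℂ) • (iota (J (b i)) * iota (b j))

theorem lam_apply (b : Module.Basis ι ℝ E) (γ : ι → ι → ℝ) (J : E →L[ℝ] E) (a : Fib E) :
    lam b γ J a = (1 / 2 : ℂ) • ∑ i, ∑ j, (γ i j : ℂ) • iota (J (b i)) (iota (b j) a) := by
  simp only [lam, LinearMap.smul_apply, LinearMap.sum_apply, Module.End.mul_apply]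

theorem HasNab.lam {b : Module.Basis ι ℝ E} {S : E →L[ℝ] E} {a : ℝ → Fib E} {a' : Fib E}
    {J : ℝ → E →L[ℝ] E} {γ : ℝ → ι → ι → ℝ}
    (hJ : ∀ v, HasDerivAt (fun t => J t v) (J 0 (S v) - S (J 0 v)) 0)
    (hγ : IsParallelInv b S γ) (ha : HasNab b S a a') :
    HasNab b S (fun t => lam b (γ t) (J t) (a t)) (lam b (γ 0) (J 0) a') := by
  have h1 := (HasNab.sum Finset.univ fun i _ => HasNab.sum Finset.univ fun j _ =>
    HasNab.smul (hγ i j).ofReal_comp ((ha.iota_const (b j)).iota (hJ (b i)))).const_smul (1 / 2 : ℂ)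
  refine h1.congr (fun t => lam_apply _ _ _ _) ?_
  rw [lam_apply]
  congr 1
  have h2 := sum_parallelInv_smul (matOf b S) (γ 0)
    (fun i j => NearlyKahler.iota (J 0 (b i)) (NearlyKahler.iota (b j) (a 0)))
  have h3 : ∀ i (x : Fib E), ∑ k, (matOf b S k i : ℂ) • NearlyKahler.iota (J 0 (b k)) x =
      NearlyKahler.iota (J 0 (S (b i))) x := by
    intro i x
    conv_rhs => rw [apply_eq_sum_matOf b S i]
    simp only [map_sum, map_smul, iota_sum, iota_smul, LinearMap.sum_apply, LinearMap.smul_apply]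
  have h4 : ∀ i j, ∑ k, (matOf b S k j : ℂ) • NearlyKahler.iota (J 0 (b i))
      (NearlyKahler.iota (b k) (a 0)) =
      NearlyKahler.iota (J 0 (b i)) (NearlyKahler.iota (S (b j)) (a 0)) := by
    intro i j
    conv_rhs => rw [apply_eq_sum_matOf b S j]
    simp only [map_sum, map_smul, iota_sum, iota_smul, LinearMap.sum_apply, LinearMap.smul_apply]
  simp only [h3, h4] at h2
  simp only [sub_add_cancel, map_add, smul_add, Finset.sum_add_distrib] at h2 ⊢
  rw [← sub_eq_zero, ← neg_eq_zero, ← h2]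
  abel

theorem HasNab.hermDeg {b : Module.Basis ι ℝ E} {S : E →L[ℝ] E} {a c : ℝ → Fib E} {a' c' : Fib E}
    {γ : ℝ → ι → ι → ℝ} (hγ : IsParallelInv b S γ) (k : ℕ)
    (ha : HasNab b S a a') (hc : HasNab b S c c') :
    HasDerivAt (fun t => hermDeg b (γ t) k (a t) (c t))
      (hermDeg b (γ 0) k a' (c 0) + hermDeg b (γ 0) k (a 0) c') 0 := by
  induction k generalizing a c a' c' with
  | zero =>
    have h1 := ha 0 Fin.elim0
    have h2 := hc 0 Fin.elim0
    simp only [Fib.add_apply, rho_apply_zero, add_zero] at h1 h2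
    exact h1.mul (h2.star)
  | succ k ih =>
    have h1 := (HasDerivAt.fun_sum fun i (_ : i ∈ Finset.univ) =>
      HasDerivAt.fun_sum fun j (_ : j ∈ Finset.univ) =>
        (hγ i j).ofReal_comp.mul (ih (ha.iota_const (b i)) (hc.iota_const (b j)))).const_mul
          ((k : ℂ) + 1)⁻¹
    simp only [hermDeg_succ]
    refine h1.congr_deriv ?_
    rw [← mul_add]
    congr 1
    have h2 := sum_parallelInv_smul (matOf b S) (γ 0)
      (fun i j => NearlyKahler.hermDeg b (γ 0) k (NearlyKahler.iota (b i) (a 0))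
        (NearlyKahler.iota (b j) (c 0)))
    have h3 : ∀ i (x : Fib E), ∑ l, (matOf b S l i : ℂ) • NearlyKahler.hermDeg b (γ 0) k
        (NearlyKahler.iota (b l) (a 0)) x =
        NearlyKahler.hermDeg b (γ 0) k (NearlyKahler.iota (S (b i)) (a 0)) x := by
      intro i x
      conv_rhs => rw [apply_eq_sum_matOf b S i]
      simp only [map_sum, map_smul, iota_sum, iota_smul, LinearMap.sum_apply, LinearMap.smul_apply]
    have h4 : ∀ i (x : Fib E), ∑ l, (matOf b S l i : ℂ) • NearlyKahler.hermDeg b (γ 0) k x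
        (NearlyKahler.iota (b l) (c 0)) =
        NearlyKahler.hermDeg b (γ 0) k x (NearlyKahler.iota (S (b i)) (c 0)) := by
      intro i x
      conv_rhs => rw [apply_eq_sum_matOf b S i]
      simp only [map_sum, map_smulₛₗ, Complex.conj_ofReal, iota_sum, iota_smul,
        LinearMap.sum_apply, LinearMap.smul_apply]
    simp only [h3, h4] at h2
    simp only [smul_eq_mul] at h2
    simp only [map_add, LinearMap.add_apply, mul_add, Finset.sum_add_distrib] at h2 ⊢
    linear_combination h2

end Curves

/-! ### The torsion of the canonical Hermitian connection at a point -/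

section Shift

variable {E : Type*} [NormedAddCommGroup E] [NormedSpace ℝ E]

/-- The endomorphism `P` raises the type by `(s, *)`. -/
def IsShift (J : E →L[ℝ] E) (P : Module.End ℂ (Fib E)) (s : ℤ) : Prop :=
  ∀ p, typeEnd J p * P = P * typeEnd J (p - s)

namespace IsShift

variable {J : E →L[ℝ] E} {P Q : Module.End ℂ (Fib E)} {s t : ℤ}

theorem mul (hP : IsShift J P s) (hQ : IsShift J Q t) : IsShift J (P * Q) (s + t) := fun p => by
  rw [← mul_assoc, hP, mul_assoc, hQ, ← mul_assoc, sub_sub]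

theorem smul (c : ℂ) (hP : IsShift J P s) : IsShift J (c • P) s := fun p => by
  rw [mul_smul_comm, smul_mul_assoc, hP]

theorem sum {κ : Type*} (u : Finset κ) {P : κ → Module.End ℂ (Fib E)}
    (h : ∀ i ∈ u, IsShift J (P i) s) : IsShift J (∑ i ∈ u, P i) s := fun p => by
  rw [Finset.mul_sum, Finset.sum_mul]
  exact Finset.sum_congr rfl fun i hi => h i hi p

theorem tri {κ : Type*} [Fintype κ] (T : κ → κ → κ → ℂ) {x y z : κ → Module.End ℂ (Fib E)}
    {r s t : ℤ} (hx : ∀ i, IsShift J (x i) r) (hy : ∀ i, IsShift J (y i) s)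
    (hz : ∀ i, IsShift J (z i) t) : IsShift J (tri T x y z) (r + s + t) :=
  IsShift.sum _ fun i _ => IsShift.sum _ fun j _ => IsShift.sum _ fun k _ =>
    (((hx i).mul (hy j)).mul (hz k)).smul _

end IsShift

theorem sum_Icc_typeEnd_apply (J : E →L[ℝ] E) (k : ℕ) (a : Fib E) :
    ∑ p ∈ Finset.Icc (0 : ℤ) k, typeEnd J p a k = a k := by
  rw [← sum_typeEnd_apply J k a]
  symm
  refine Finset.sum_bij (fun p _ => (p : ℤ)) ?_ ?_ ?_ ?_
  · intro p hp
    simp only [Finset.mem_range, Finset.mem_Icc] at hp ⊢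
    omega
  · intro p _ q _ h
    exact_mod_cast h
  · intro p hp
    simp only [Finset.mem_Icc] at hp
    exact ⟨p.toNat, by simp only [Finset.mem_range]; omega, by omega⟩
  · exact fun _ _ => rfl

variable {J : E →L[ℝ] E} (hJ : ∀ v, J (J v) = -v)

include hJ

theorem typeEnd_mul_typeEnd (p q : ℤ) :
    typeEnd J p * typeEnd J q = if p = q then typeEnd J p else 0 := by
  refine LinearMap.ext fun a => Fib.ext fun k => ?_
  rw [Module.End.mul_apply, typeEnd_mul_typeEnd_apply hJ]
  split_ifs <;> rfl

/-- Moving the left projection through P leaves the product of the projections of index r − s and r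
− a, which vanishes unless a = s. -/
theorem sum_Icc_shift {P : Module.End ℂ (Fib E)} {s : ℤ} (hP : IsShift J P s) (a : ℤ) (k : ℕ)
    (x : Fib E) (w : Fin k → E) :
    ∑ r ∈ Finset.Icc (0 : ℤ) k, typeEnd J r (P (typeEnd J (r - a) x)) k w =
      (if a = s then P x else 0) k w := by
  have h : ∀ r, typeEnd J r (P (typeEnd J (r - a) x)) =
      if a = s then typeEnd J r (P x) else 0 := by
    intro r
    have h1 := LinearMap.congr_fun (hP r) (typeEnd J (r - a) x)
    have h2 := LinearMap.congr_fun (hP r) x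
    have h3 := LinearMap.congr_fun (typeEnd_mul_typeEnd hJ (r - s) (r - a)) x
    simp only [Module.End.mul_apply] at h1 h2 h3
    rw [h1, h3]
    by_cases has : a = s
    · rw [if_pos (by omega), if_pos has, h2]
    · rw [if_neg (by omega), if_neg has, LinearMap.zero_apply, map_zero]
  simp only [h]
  split_ifs
  · rw [← sum_Icc_typeEnd_apply J k (P x), ContinuousAlternatingMap.sum_apply]
  · simp

theorem isShift_iota01 (v : E) : IsShift J (iota01 J v) 0 := fun p => by
  rw [sub_zero, iota01_typeEnd hJ]

theorem isShift_iota10 (v : E) : IsShift J (iota10 J v) (-1) := fun p => by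
  rw [iota10_typeEnd hJ]
  congr 2
  ring

/-- Exterior multiplication by the part of a covector on which `J` acts by `c`. -/
def epsT (c : ℂ) (J : E →L[ℝ] E) (θ : E →L[ℝ] ℂ) : Module.End ℂ (Fib E) :=
  eps ((1 / 2 : ℂ) • (θ - c • θ.comp J))

omit hJ in
theorem epsT_eq (c : ℂ) (θ : E →L[ℝ] ℂ) :
    epsT c J θ = (1 / 2 : ℂ) • (eps θ - c • eps (θ.comp J)) := by
  rw [epsT, eps_smul, sub_eq_add_neg, eps_add, eps_neg, eps_smul, ← sub_eq_add_neg]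

theorem isShift_epsT_I (θ : E →L[ℝ] ℂ) : IsShift J (epsT Complex.I J θ) 1 := fun p => by
  refine LinearMap.ext fun a => Fib.ext fun k => ?_
  rw [Module.End.mul_apply, epsT, typeEnd_mul_eps_apply true _ fun v => ?_]
  · rfl
  simp only [smul_apply, sub_apply, ContinuousLinearMap.comp_apply, hJ, map_neg, smul_eq_mul,
    if_true]
  linear_combination (1 / 2 : ℂ) * θ (J v) * Complex.I_mul_I

theorem isShift_epsT_neg_I (θ : E →L[ℝ] ℂ) : IsShift J (epsT (-Complex.I) J θ) 0 := fun p => by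
  rw [sub_zero]
  refine LinearMap.ext fun a => Fib.ext fun k => ?_
  rw [Module.End.mul_apply, epsT, typeEnd_mul_eps_apply false _ fun v => ?_]
  · rfl
  simp only [smul_apply, sub_apply, ContinuousLinearMap.comp_apply, hJ, map_neg, smul_eq_mul,
    Bool.false_eq_true, if_false]
  linear_combination (1 / 2 : ℂ) * θ (J v) * Complex.I_mul_I

omit hJ in
theorem epsT_add_epsT (c : ℂ) (θ : E →L[ℝ] ℂ) : epsT c J θ + epsT (-c) J θ = eps θ := by
  rw [epsT_eq, epsT_eq]
  module

end Shift

/-! ### Splitting the torsion operator by type. -/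

section Torsion

variable {E : Type*} [NormedAddCommGroup E] [NormedSpace ℝ E] [FiniteDimensional ℝ E]
  {ι : Type*} [Fintype ι] (f : Module.Basis ι ℝ E) (J : E →L[ℝ] E) (B : E →L[ℝ] E →L[ℝ] E)

/-- The matrix of an endomorphism, with complex entries. -/
def matC (i j : ι) : ℂ := (matOf f J i j : ℂ)

theorem conj_matC (i j : ι) : conj (matC f J i j) = matC f J i j := Complex.conj_ofReal _

theorem coordC_comp (k : ι) : (coordC f k).comp J = ∑ l, matC f J k l • coordC f l := by
  rw [← sum_coordC_smul f ((coordC f k).comp J)]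
  rfl

theorem eps_coordC_comp (hJs : ∀ i j, matOf f J i j = -matOf f J j i) (k : ι) :
    eps ((coordC f k).comp J) = -rot (matC f J) (epsB f) k := by
  rw [coordC_comp, eps_sum, rot, ← Finset.sum_neg_distrib]
  refine Finset.sum_congr rfl fun l _ => ?_
  rw [eps_smul, matC, hJs, Complex.ofReal_neg, neg_smul]
  rfl

theorem iota_J_basis (k : ι) : iota (J (f k)) = rot (matC f J) (iotaB f) k := by
  rw [apply_eq_sum_matOf f J k, iota_sum, rot]
  simp only [iota_smul]
  rfl

theorem epsT_coordC (hJs : ∀ i j, matOf f J i j = -matOf f J j i) (c : ℂ) (k : ι) :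
    epsT c J (coordC f k) = (1 / 2 : ℂ) • (epsB f k + c • rot (matC f J) (epsB f) k) := by
  rw [epsT_eq, eps_coordC_comp f J hJs]
  module

theorem sum_matC_mul_matC [DecidableEq ι] (hJ : ∀ v, J (J v) = -v) (j k : ι) :
    ∑ l, matC f J j l * matC f J l k = if j = k then -1 else 0 := by
  have h := congrArg (fun v => f.repr v j) (hJ (f k))
  simp only [map_neg, Finsupp.neg_apply, Module.Basis.repr_self, Finsupp.single_apply] at h
  have h2 : ∑ l, matOf f J j l * matOf f J l k = f.repr (J (J (f k))) j := by
    conv_rhs => rw [apply_eq_sum_matOf f J k]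
    simp only [map_sum, map_smul, Finsupp.coe_finsetSum, Finset.sum_apply, Finsupp.smul_apply,
      smul_eq_mul]
    exact Finset.sum_congr rfl fun l _ => mul_comm _ _
  have h3 : ∑ l, matC f J j l * matC f J l k = ((∑ l, matOf f J j l * matOf f J l k : ℝ) : ℂ) := by
    push_cast
    rfl
  rw [h3, h2, h]
  by_cases hjk : j = k
  · simp [hjk]
  · simp [hjk, Ne.symm hjk]

/-- The components of the torsion. -/
def torsR (i j k : ι) : ℝ := f.repr (B (f i) (f j) - B (f j) (f i)) k

/-- The components of the torsion, composed with `J` in the last argument. -/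
def torsJ (i j k : ι) : ℝ := ∑ l, torsR f B i j l * matOf f J l k

/-- The components of the part of the torsion on which `J` acts by `c`. -/
def torsC (c : ℂ) (i j k : ι) : ℂ := (1 / 2) * (torsR f B i j k - c * torsJ f J B i j k)

theorem torsR_swap (i j k : ι) : torsR f B i j k = -torsR f B j i k := by
  rw [torsR, torsR, ← neg_sub, map_neg, Finsupp.neg_apply]

theorem torsC_swap_left (c : ℂ) (i j k : ι) : torsC f J B c i j k = -torsC f J B c j i k := by
  have h : torsJ f J B i j k = -torsJ f J B j i k := by
    simp only [torsJ, torsR_swap f B i j, neg_mul, Finset.sum_neg_distrib]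
  rw [torsC, torsC, h, torsR_swap f B i j]
  push_cast
  ring

theorem torsC_swap_right (hT : ∀ i j k, torsR f B i j k = -torsR f B i k j)
    (hTJ : ∀ i j k, torsJ f J B i j k = -torsJ f J B i k j) (c : ℂ) (i j k : ι) :
    torsC f J B c i j k = -torsC f J B c i k j := by
  rw [torsC, torsC, hT, hTJ]
  push_cast
  ring

/-- The map T ↦ ½(T − c·TJ) projects onto the c-eigenspace of J acting on the last slot, since c² =
−1. -/
theorem torsC_mul_matC (hJ : ∀ v, J (J v) = -v) {c : ℂ} (hc : c * c = -1) (i j l : ι) :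
    ∑ k, torsC f J B c i j k * matC f J k l = c * torsC f J B c i j l := by
  classical
  have h1 : ∑ k, (torsJ f J B i j k : ℂ) * matC f J k l = -(torsR f B i j l : ℂ) := by
    simp only [torsJ, Complex.ofReal_sum, Complex.ofReal_mul, Finset.sum_mul]
    rw [Finset.sum_comm]
    have : ∀ m, ∑ k, (torsR f B i j m : ℂ) * (matOf f J m k : ℂ) * matC f J k l =
        torsR f B i j m * if m = l then -1 else 0 := fun m => by
      rw [← sum_matC_mul_matC f J hJ m l, Finset.mul_sum]
      exact Finset.sum_congr rfl fun k _ => mul_assoc _ _ _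
    simp [this]
  have h2 : ∑ k, (torsR f B i j k : ℂ) * matC f J k l = (torsJ f J B i j l : ℂ) := by
    rw [torsJ]; push_cast; rfl
  have h3 : ∀ k, torsC f J B c i j k * matC f J k l = (1 / 2) * ((torsR f B i j k : ℂ) * matC f J k l) -
      (c / 2) * ((torsJ f J B i j k : ℂ) * matC f J k l) := fun k => by rw [torsC]; ring
  rw [Finset.sum_congr rfl fun k _ => h3 k, Finset.sum_sub_distrib, ← Finset.mul_sum,
    ← Finset.mul_sum, h1, h2, torsC]
  linear_combination ((1 / 2) * torsJ f J B i j l : ℂ) * hc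

theorem conj_torsC {c d : ℂ} (hcd : conj c = d) (i j k : ι) :
    conj (torsC f J B c i j k) = torsC f J B d i j k := by
  simp only [torsC, map_mul, map_sub, Complex.conj_ofReal, hcd, map_div₀, map_one, map_ofNat]

/-- The part of the torsion operator on which `J` acts by `c`. -/
def torsOp (c : ℂ) : Module.End ℂ (Fib E) :=
  (1 / 2 : ℂ) • tri (torsC f J B c) (epsB f) (epsB f) (iotaB f)

/-- The anticommutation of the two exterior factors retains only the antisymmetric part of B, which
is the torsion; the ½ in `torsOp` compensates the antisymmetrization, and the two eigenparts add up
to T. -/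
theorem sum_eps_rho (c : ℂ) :
    ∑ i, epsB f i * rho f (B (f i)) = torsOp f J B c + torsOp f J B (-c) := by
  have h1 : ∑ i, epsB f i * rho f (B (f i)) =
      tri (fun i j k => ((f.repr (B (f i) (f j)) k : ℝ) : ℂ)) (epsB f) (epsB f) (iotaB f) := by
    refine Finset.sum_congr rfl fun i _ => ?_
    rw [rho, Finset.mul_sum, Finset.sum_comm]
    refine Finset.sum_congr rfl fun k _ => ?_
    rw [coordC_comp, eps_sum, Finset.sum_mul, Finset.mul_sum]
    refine Finset.sum_congr rfl fun j _ => ?_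
    rw [eps_smul, smul_mul_assoc, mul_smul_comm, mul_assoc]
    rfl
  have h2 : tri (fun i j k => ((f.repr (B (f j) (f i)) k : ℝ) : ℂ)) (epsB f) (epsB f) (iotaB f) =
      -tri (fun i j k => ((f.repr (B (f i) (f j)) k : ℝ) : ℂ)) (epsB f) (epsB f) (iotaB f) := by
    simp only [tri]
    rw [Finset.sum_comm, ← Finset.sum_neg_distrib]
    refine Finset.sum_congr rfl fun i _ => ?_
    rw [← Finset.sum_neg_distrib]
    refine Finset.sum_congr rfl fun j _ => ?_
    rw [← Finset.sum_neg_distrib]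
    refine Finset.sum_congr rfl fun k _ => ?_
    rw [show epsB f j * epsB f i = -(epsB f i * epsB f j) from eps_mul_eps _ _, neg_mul, smul_neg]
  have h3 : torsOp f J B c + torsOp f J B (-c) = (1 / 2 : ℂ) •
      (tri (fun i j k => ((f.repr (B (f i) (f j)) k : ℝ) : ℂ)) (epsB f) (epsB f) (iotaB f) -
      tri (fun i j k => ((f.repr (B (f j) (f i)) k : ℝ) : ℂ)) (epsB f) (epsB f) (iotaB f)) := by
    rw [torsOp, torsOp, ← smul_add]
    congr 1
    simp only [tri, ← Finset.sum_add_distrib, ← Finset.sum_sub_distrib, ← add_smul, ← sub_smul]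
    refine Finset.sum_congr rfl fun i _ => Finset.sum_congr rfl fun j _ =>
      Finset.sum_congr rfl fun k _ => ?_
    congr 1
    simp only [torsC, torsR, map_sub, Finsupp.sub_apply, Complex.ofReal_sub]
    ring
  rw [h3, h1, h2]
  module

variable (hJ : ∀ v, J (J v) = -v) (hJs : ∀ i j, matOf f J i j = -matOf f J j i)
  (hT : ∀ i j k, torsR f B i j k = -torsR f B i k j)
  (hTJ : ∀ i j k, torsJ f J B i j k = -torsJ f J B i k j)

include hJ hJs hT hTJ

theorem matC_swap_of (i j : ι) : matC f J i j = -matC f J j i := by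
  rw [matC, hJs, Complex.ofReal_neg]
  rfl

/-- Because J acts on every slot by c, each family of operators may be replaced by its projection to
one type. The bidegree of the contraction can then be read off from its factors. -/
theorem tri_torsC {c : ℂ} (hc : c * c = -1) (x y z : ι → Module.End ℂ (Fib E)) :
    tri (torsC f J B c) x y z = tri (torsC f J B c)
      (fun k => (1 / 2 : ℂ) • (x k + c • rot (matC f J) x k))
      (fun k => (1 / 2 : ℂ) • (y k + c • rot (matC f J) y k))
      (fun k => (1 / 2 : ℂ) • (z k + c • rot (matC f J) z k)) := by
  have hJm := matC_swap_of f J B hJ hJs hT hTJ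
  have hl := torsC_swap_left f J B c
  have hr := torsC_swap_right f J B hT hTJ c
  have hm := torsC_mul_matC f J B hJ hc
  have l1 : ∀ x y z : ι → Module.End ℂ (Fib E), tri (torsC f J B c)
      (fun k => (1 / 2 : ℂ) • (x k + c • rot (matC f J) x k)) y z = tri (torsC f J B c) x y z := by
    intro x y z
    have := tri_rot_left (matC f J) hJm _ c hl hr hm x y z
    have e : tri (torsC f J B c) (fun k => (1 / 2 : ℂ) • (x k + c • rot (matC f J) x k)) y z =
        (1 / 2 : ℂ) • (tri (torsC f J B c) x y z +
          c • tri (torsC f J B c) (rot (matC f J) x) y z) := by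
      simp only [tri, Finset.smul_sum, ← Finset.sum_add_distrib]
      refine Finset.sum_congr rfl fun i _ => Finset.sum_congr rfl fun j _ =>
        Finset.sum_congr rfl fun k _ => ?_
      simp only [smul_mul_assoc, add_mul]
      module
    rw [e, this, smul_smul, mul_neg, hc]
    module
  have l2 : ∀ x y z : ι → Module.End ℂ (Fib E), tri (torsC f J B c) x
      (fun k => (1 / 2 : ℂ) • (y k + c • rot (matC f J) y k)) z = tri (torsC f J B c) x y z := by
    intro x y z
    have := tri_rot_mid (matC f J) hJm _ c hr hm x y z
    have e : tri (torsC f J B c) x (fun k => (1 / 2 : ℂ) • (y k + c • rot (matC f J) y k)) z =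
        (1 / 2 : ℂ) • (tri (torsC f J B c) x y z +
          c • tri (torsC f J B c) x (rot (matC f J) y) z) := by
      simp only [tri, Finset.smul_sum, ← Finset.sum_add_distrib]
      refine Finset.sum_congr rfl fun i _ => Finset.sum_congr rfl fun j _ =>
        Finset.sum_congr rfl fun k _ => ?_
      simp only [smul_mul_assoc, add_mul, mul_add, mul_smul_comm]
      module
    rw [e, this, smul_smul, mul_neg, hc]
    module
  have l3 : ∀ x y z : ι → Module.End ℂ (Fib E), tri (torsC f J B c) x y
      (fun k => (1 / 2 : ℂ) • (z k + c • rot (matC f J) z k)) = tri (torsC f J B c) x y z := by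
    intro x y z
    have := tri_rot_right (matC f J) hJm _ c hm x y z
    have e : tri (torsC f J B c) x y (fun k => (1 / 2 : ℂ) • (z k + c • rot (matC f J) z k)) =
        (1 / 2 : ℂ) • (tri (torsC f J B c) x y z +
          c • tri (torsC f J B c) x y (rot (matC f J) z)) := by
      simp only [tri, Finset.smul_sum, ← Finset.sum_add_distrib]
      refine Finset.sum_congr rfl fun i _ => Finset.sum_congr rfl fun j _ =>
        Finset.sum_congr rfl fun k _ => ?_
      simp only [mul_add, mul_smul_comm]
      module
    rw [e, this, smul_smul, mul_neg, hc]
    module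
  rw [l1, l2, l3]

/-- For c = i the tensor has type (3,0). Both exterior factors become of type (1,0), and the metric
turns the third slot into contraction with a (0,1)-vector, which does not change p. -/
theorem isShift_torsOp_I : IsShift J (torsOp f J B Complex.I) 2 := by
  refine IsShift.smul _ ?_
  rw [tri_torsC f J B hJ hJs hT hTJ Complex.I_mul_I]
  rw [show (2 : ℤ) = 1 + 1 + 0 by norm_num]
  refine IsShift.tri (r := 1) (s := 1) (t := 0) _ (fun k => ?_) (fun k => ?_) (fun k => ?_)
  · rw [← epsT_coordC f J hJs]; exact isShift_epsT_I hJ _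
  · rw [← epsT_coordC f J hJs]; exact isShift_epsT_I hJ _
  · rw [← iota_J_basis]; exact isShift_iota01 hJ _

theorem isShift_torsOp_neg_I : IsShift J (torsOp f J B (-Complex.I)) (-1) := by
  refine IsShift.smul _ ?_
  rw [tri_torsC f J B hJ hJs hT hTJ (by rw [neg_mul_neg, Complex.I_mul_I])]
  rw [show (-1 : ℤ) = 0 + 0 + -1 by norm_num]
  refine IsShift.tri (r := 0) (s := 0) (t := -1) _ (fun k => ?_) (fun k => ?_) (fun k => ?_)
  · rw [← epsT_coordC f J hJs]; exact isShift_epsT_neg_I hJ _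
  · rw [← epsT_coordC f J hJs]; exact isShift_epsT_neg_I hJ _
  · rw [← iota_J_basis, neg_smul, ← sub_eq_add_neg]; exact isShift_iota10 hJ _

/-- The components of the exterior derivative, in terms of a covariant derivative. -/
theorem sum_typeEnd_extd (a : ℤ) (k : ℕ) (N : ι → Fib E) (x : Fib E) (w : Fin k → E) :
    ∑ r ∈ Finset.Icc (0 : ℤ) k, typeEnd J r (∑ j, epsB f j (typeEnd J (r - a) (N j)) +
      ∑ j, epsB f j (rho f (B (f j)) (typeEnd J (r - a) x))) k w =
      ((if a = 1 then ∑ j, epsT Complex.I J (coordC f j) (N j) else 0) +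
        (if a = 0 then ∑ j, epsT (-Complex.I) J (coordC f j) (N j) else 0) +
        (if a = 2 then torsOp f J B Complex.I x else 0) +
        (if a = -1 then torsOp f J B (-Complex.I) x else 0) : Fib E) k w := by
  have h1 : ∀ y : Fib E, ∑ j, epsB f j (rho f (B (f j)) y) =
      torsOp f J B Complex.I y + torsOp f J B (-Complex.I) y := fun y => by
    rw [← LinearMap.add_apply, ← sum_eps_rho f J B Complex.I, LinearMap.sum_apply]
    rfl
  have h2 : ∀ y : ι → Fib E, ∑ j, epsB f j (y j) = ∑ j, epsT Complex.I J (coordC f j) (y j) +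
      ∑ j, epsT (-Complex.I) J (coordC f j) (y j) := fun y => by
    rw [← Finset.sum_add_distrib]
    refine Finset.sum_congr rfl fun j _ => ?_
    rw [← LinearMap.add_apply, epsT_add_epsT]
  have h3 : ∀ (c : ℂ) (s : ℤ), (∀ j, IsShift J (epsT c J (coordC f j)) s) →
      ∑ r ∈ Finset.Icc (0 : ℤ) k, typeEnd J r
        (∑ j, epsT c J (coordC f j) (typeEnd J (r - a) (N j))) k w =
      (if a = s then ∑ j, epsT c J (coordC f j) (N j) else 0 : Fib E) k w := by
    intro c s hs
    simp only [map_sum, Fib.sum_apply_apply]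
    rw [Finset.sum_comm, Finset.sum_congr rfl fun j _ => sum_Icc_shift hJ (hs j) a k (N j) w]
    split_ifs
    · rw [Fib.sum_apply_apply]
    · simp
  have h4 : ∀ r, typeEnd J r (∑ j, epsB f j (typeEnd J (r - a) (N j)) +
      ∑ j, epsB f j (rho f (B (f j)) (typeEnd J (r - a) x))) k w =
      typeEnd J r (∑ j, epsT Complex.I J (coordC f j) (typeEnd J (r - a) (N j))) k w +
      typeEnd J r (∑ j, epsT (-Complex.I) J (coordC f j) (typeEnd J (r - a) (N j))) k w +
      typeEnd J r (torsOp f J B Complex.I (typeEnd J (r - a) x)) k w +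
      typeEnd J r (torsOp f J B (-Complex.I) (typeEnd J (r - a) x)) k w := fun r => by
    rw [h1, h2]
    simp only [map_add, Fib.add_apply_apply]
    ring
  rw [Finset.sum_congr rfl fun r _ => h4 r]
  simp only [Finset.sum_add_distrib, Fib.add_apply_apply]
  rw [h3 _ _ fun j => isShift_epsT_I hJ _,
    h3 _ _ fun j => isShift_epsT_neg_I hJ _, sum_Icc_shift hJ (isShift_torsOp_I f J B hJ hJs hT hTJ),
    sum_Icc_shift hJ (isShift_torsOp_neg_I f J B hJ hJs hT hTJ)]

end Torsion

/-! ### Pointwise identities in an orthonormal frame -/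

section Frame

variable {E : Type*} [NormedAddCommGroup E] [NormedSpace ℝ E] [FiniteDimensional ℝ E]
  {ι : Type*} [Fintype ι] [DecidableEq ι] (b f : Module.Basis ι ℝ E) (J : E →L[ℝ] E)

theorem rho_eq_rho (S : E →L[ℝ] E) : rho b S = rho f S := by
  have h : ∀ j, eps ((coordC b j).comp S) = ∑ i, coordC b j (f i) • eps ((coordC f i).comp S) := by
    intro j
    have h1 : (coordC b j).comp S = ∑ i, coordC b j (f i) • (coordC f i).comp S := by
      ext v
      have := congrArg (fun φ : E →L[ℝ] ℂ => φ (S v)) (sum_coordC_smul f (coordC b j))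
      simp only [sum_apply, smul_apply] at this ⊢
      exact this.symm
    rw [h1, eps_sum]
    simp only [eps_smul]
  simp only [rho, h, Finset.sum_mul, smul_mul_assoc]
  rw [Finset.sum_comm]
  refine Finset.sum_congr rfl fun i _ => ?_
  conv_rhs => rw [← sum_coordC_smul_iota b (f i), Finset.mul_sum]
  simp only [mul_smul_comm]

/-- The frame `f` is orthonormal for the metric whose inverse is `γ`. -/
def IsFrame (γ : ι → ι → ℝ) : Prop :=
  ∀ i j, γ i j = ∑ l, b.repr (f l) i * b.repr (f l) j

/-- The Hermitian inner product on forms in terms of the inverse of the metric. -/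
def hermG (γ : ι → ι → ℝ) : Fib E →ₗ[ℂ] Fib E →ₛₗ[starRingEnd ℂ] ℂ :=
  ∑ k ∈ Finset.range (Fintype.card ι + 1), hermDeg b γ k

theorem hermG_apply (γ : ι → ι → ℝ) (a c : Fib E) :
    hermG b γ a c = ∑ k ∈ Finset.range (Fintype.card ι + 1), hermDeg b γ k a c := by
  simp only [hermG, LinearMap.sum_apply]

variable {b f J}

theorem IsFrame.herm_eq {γ : ι → ι → ℝ} (h : IsFrame b f γ) : herm f = hermG b γ := by
  refine LinearMap.ext fun a => LinearMap.ext fun c => ?_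
  rw [herm_apply, hermG_apply]
  exact Finset.sum_congr rfl fun k _ => hermDeg_frame b γ f (fun l i => b.repr (f l) i)
    (fun l => (b.sum_repr _).symm) h k a c

theorem IsFrame.lam_eq {γ : ι → ι → ℝ} (h : IsFrame b f γ) :
    lam b γ J = lefΛ (matC f J) (iotaB f) := by
  rw [lam, lefΛ]
  congr 1
  have h1 : ∀ l, rot (matC f J) (iotaB f) l * iotaB f l = ∑ i, ∑ j,
      ((b.repr (f l) i * b.repr (f l) j : ℝ) : ℂ) • (iota (J (b i)) * iota (b j)) := by
    intro l
    have h2 : iota (J (f l)) = ∑ i, (b.repr (f l) i : ℂ) • iota (J (b i)) := by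
      conv_lhs => rw [← b.sum_repr (f l)]
      simp only [map_sum, map_smul, iota_sum, iota_smul]
    have h3 : iota (f l) = ∑ i, (b.repr (f l) i : ℂ) • iota (b i) := by
      conv_lhs => rw [← b.sum_repr (f l)]
      simp only [iota_sum, iota_smul]
    rw [← iota_J_basis, h2]
    change _ * iota (f l) = _
    rw [h3, Finset.sum_mul]
    refine Finset.sum_congr rfl fun i _ => ?_
    rw [Finset.mul_sum]
    refine Finset.sum_congr rfl fun j _ => ?_
    rw [smul_mul_smul_comm, Complex.ofReal_mul]
  simp only [h1, h _ _, Complex.ofReal_sum, Finset.sum_smul]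
  rw [Finset.sum_comm (f := fun l i => ∑ j,
    ((b.repr (f l) i * b.repr (f l) j : ℝ) : ℂ) • (iota (J (b i)) * iota (b j)))]
  refine Finset.sum_congr rfl fun i _ => ?_
  rw [Finset.sum_comm]

theorem wedgeLeft_eq_lefL (om : E [⋀^Fin 2]→L[ℝ] ℂ) (hom : ∀ i j, om ![f i, f j] = matC f J j i) :
    wedgeLeft om = lefL (matC f J) (epsB f) := by
  rw [wedgeLeft_two f, lefL]
  congr 1
  refine Finset.sum_congr rfl fun i _ => ?_
  rw [rot, Finset.mul_sum]
  exact Finset.sum_congr rfl fun j _ => by rw [hom, mul_smul_comm]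

variable (E) in
/-- The constant function `1`, as a form. -/
def oneFib : Fib E
  | 0 => ContinuousAlternatingMap.constOfIsEmpty ℝ E (Fin 0) (1 : ℂ)
  | _ + 1 => 0

theorem iota_oneFib (v : E) : iota v (oneFib E) = 0 := by
  refine Fib.ext_apply fun k w => ?_
  cases k <;> rfl

theorem wedgeLeft_oneFib_apply {p : ℕ} (β : E [⋀^Fin p]→L[ℝ] ℂ) : wedgeLeft β (oneFib E) p = β := by
  rw [wedgeLeft_apply_of_eq (Nat.add_zero p)]
  ext v
  rw [wedge_apply]
  have : ∀ σ : Equiv.Perm (Fin p), ((Equiv.Perm.sign σ : ℤ) : ℂ) *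
      (β (fun i => v (σ (Fin.cast (Nat.add_zero p) (Fin.castAdd 0 i)))) *
        oneFib E 0 (fun j => v (σ (Fin.cast (Nat.add_zero p) (Fin.natAdd p j))))) = β v := by
    intro σ
    have h2 : (fun i => v (σ (Fin.cast (Nat.add_zero p) (Fin.castAdd 0 i)))) = v ∘ σ := by
      funext j; simp
    have h3 := β.toAlternatingMap.map_perm v σ
    simp only [ContinuousAlternatingMap.coe_toAlternatingMap] at h3
    have h4 : ∀ w, oneFib E 0 w = 1 := fun _ => rfl
    rw [h2, h3, h4, Units.smul_def, zsmul_eq_mul, mul_one, ← mul_assoc, ← Int.cast_mul,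
      Int.units_coe_mul_self]
    simp
  rw [Finset.sum_congr rfl fun σ _ => this σ]
  simp only [Nat.factorial_zero, mul_one, Finset.sum_const, Finset.card_univ, Fintype.card_perm,
    Fintype.card_fin, nsmul_eq_mul]
  rw [inv_mul_cancel_left₀ (by exact_mod_cast p.factorial_ne_zero)]

variable (E) in
/-- The component of degree `k` of a form. -/
def compDeg (k : ℕ) : Fib E →ₗ[ℂ] E [⋀^Fin k]→L[ℝ] ℂ where
  toFun a := a k
  map_add' _ _ := rfl
  map_smul' _ _ := rfl

theorem wedgeLeft_tri (T : ι → ι → ι → ℂ) (c : ℂ) :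
    wedgeLeft ((c • tri T (epsB f) (epsB f) (epsB f) : Module.End ℂ (Fib E)) (oneFib E) 3) =
      c • tri T (epsB f) (epsB f) (epsB f) := by
  have h1 : ∀ i j k, wedgeLeftLin 3 (compDeg E 3 ((epsB f i * epsB f j * epsB f k) (oneFib E))) =
      epsB f i * epsB f j * epsB f k := by
    intro i j k
    change wedgeLeft (epsForm _ (epsForm _ (epsForm _ (oneFib E 0)))) = _
    rw [wedgeLeft_epsForm, wedgeLeft_epsForm, wedgeLeft_epsForm, wedgeLeft_degree_zero]
    have : oneFib E 0 Fin.elim0 = 1 := rfl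
    rw [this, one_smul, mul_one, mul_assoc]
  change wedgeLeftLin 3 (compDeg E 3 (c • tri T (epsB f) (epsB f) (epsB f) (oneFib E))) = _
  rw [map_smul, map_smul]
  congr 1
  simp only [tri, LinearMap.sum_apply, map_sum]
  refine Finset.sum_congr rfl fun i _ => Finset.sum_congr rfl fun j _ =>
    Finset.sum_congr rfl fun k _ => ?_
  rw [LinearMap.smul_apply, map_smul, map_smul, h1]

theorem tri_oneFib (T : ι → ι → ι → ℂ) (x y : ι → Module.End ℂ (Fib E)) :
    tri T x y (iotaB f) (oneFib E) = 0 := by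
  simp only [tri, LinearMap.sum_apply, LinearMap.smul_apply, Module.End.mul_apply, iota_oneFib,
    map_zero, smul_zero, Finset.sum_const_zero]

variable (hJ : ∀ v, J (J v) = -v) (hJs : ∀ i j, matOf f J i j = -matOf f J j i)

include hJs in
theorem matC_swap (i j : ι) : matC f J i j = -matC f J j i := by
  rw [matC, hJs, Complex.ofReal_neg]
  rfl

include hJ hJs in
-- A torsion operator annihilates the constant 1, so its value on ω is [torsion, L] applied to 1.
-- The bracket is known from `br_tri_lefL`, and a cubic in exterior factors is multiplication by its
-- value on 1.
theorem wedgeLeft_torsOp (B : E →L[ℝ] E →L[ℝ] E) {c : ℂ} (hc : c * c = -1)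
    (om : E [⋀^Fin 2]→L[ℝ] ℂ) (hom : ∀ i j, om ![f i, f j] = matC f J j i) (x : Fib E)
    (hx : x = wedgeLeft om (oneFib E)) :
    wedgeLeft (torsOp f J B c x 3) =
      -(c / 2) • tri (torsC f J B c) (epsB f) (epsB f) (epsB f) := by
  have h1 := LinearMap.congr_fun (br_tri_lefL (epsB_mul_epsB f) (iotaB_mul_epsB f)
    (matC_swap hJs) (torsC_mul_matC f J B hJ hc)) (oneFib E)
  rw [← wedgeLeft_tri]
  congr 1
  rw [hx, wedgeLeft_eq_lefL om hom]
  simp only [br, LinearMap.sub_apply, Module.End.mul_apply, tri_oneFib, map_zero, sub_zero] at h1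
  rw [torsOp, LinearMap.smul_apply, h1, LinearMap.smul_apply, LinearMap.smul_apply, smul_smul]
  rw [show (1 / 2 : ℂ) * -c = -(c / 2) by ring]

theorem epsT_eq_sum (c : ℂ) (θ : E →L[ℝ] ℂ) :
    epsT c J θ = ∑ k, θ (f k) • epsT c J (coordC f k) := by
  have h : ∀ θ : E →L[ℝ] ℂ, eps (θ.comp J) = ∑ k, θ (f k) • eps ((coordC f k).comp J) := by
    intro θ
    have h1 : θ.comp J = ∑ k, θ (f k) • (coordC f k).comp J := by
      ext v
      have := congrArg (fun φ : E →L[ℝ] ℂ => φ (J v)) (sum_coordC_smul f θ)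
      simp only [sum_apply, smul_apply] at this ⊢
      exact this.symm
    rw [h1, eps_sum]
    simp only [eps_smul]
  simp only [epsT_eq]
  rw [← sum_coordC_smul_eps f θ, h, Finset.smul_sum, ← Finset.sum_sub_distrib, Finset.smul_sum]
  exact Finset.sum_congr rfl fun k _ => by module

include hJ hJs in
-- On a frame covector the operator is ½(ε_k + c·rot ε_k), with adjoint ½(ι_k − c·rot ι_k).
-- Bracketing with Λ turns ε_k into rot ι_k and rot ε_k into −ι_k, so the adjoint is recovered from
-- the opposite type.
theorem isAdj_epsT {c : ℂ} (hc : c * c = -1) (hcc : conj c = -c) (θ : E →L[ℝ] ℂ)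
    (hθ : ∀ v, conj (θ v) = θ v) :
    IsAdj (herm f) (epsT c J θ) (-c • br (lefΛ (matC f J) (iotaB f)) (epsT (-c) J θ)) := by
  rw [epsT_eq_sum (f := f) c θ, epsT_eq_sum (f := f) (-c) θ, br_sum, Finset.smul_sum]
  refine IsAdj.sum _ fun k _ => ?_
  have h1 : IsAdj (herm f) (epsT c J (coordC f k))
      (-c • br (lefΛ (matC f J) (iotaB f)) (epsT (-c) J (coordC f k))) := by
    have h2 : IsAdj (herm f) (rot (matC f J) (epsB f) k) (rot (matC f J) (iotaB f) k) :=
      IsAdj.sum _ fun l _ => by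
        have := (isAdj_eps f l).smul (matC f J l k)
        rwa [conj_matC] at this
    have h3 := ((isAdj_eps f k).add (h2.smul c)).smul (1 / 2 : ℂ)
    rw [epsT_coordC f J hJs, epsT_coordC f J hJs, br_smul, br_add, br_smul, br_rot]
    simp only [br_lefΛ_eps (iotaB_mul_epsB f) (matC_swap hJs)]
    rw [rot_rot (sum_matC_mul_matC f J hJ)]
    convert h3 using 1
    rw [hcc, map_div₀, map_one, map_ofNat]
    have h4 : ∀ y : Module.End ℂ (Fib E), c • c • y = -y := fun y => by
      rw [smul_smul, hc, neg_one_smul]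
    have h5 : -c • (1 / 2 : ℂ) • (rot (matC f J) (iotaB f) k + -c • -iotaB f k) =
        (1 / 2 : ℂ) • (-(c • c • iotaB f k) - c • rot (matC f J) (iotaB f) k) := by module
    rw [h5, h4]
    module
  have h2 := h1.smul (θ (f k))
  rw [hθ] at h2
  convert h2 using 1
  rw [br_smul, smul_comm]

theorem sum_epsT_eq (N : E → Fib E) (hN : ∀ u, N u = ∑ j, coordC f j u • N (f j)) (c : ℂ) :
    ∑ j, epsT c J (coordC f j) (N (f j)) = ∑ j, epsT c J (coordC b j) (N (b j)) := by
  simp only [hN (b _), map_sum, map_smul]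
  rw [Finset.sum_comm]
  refine Finset.sum_congr rfl fun i _ => ?_
  rw [epsT_eq_sum (f := b) c (coordC f i), LinearMap.sum_apply]
  rfl

/-- The two sides trace B over its two different lower indices. Their difference is the trace of the
torsion, which vanishes by skewness. -/
theorem sum_coordC_comp (B : E →L[ℝ] E →L[ℝ] E)
    (hT : ∀ i j k, torsR f B i j k = -torsR f B i k j) :
    ∑ j, (coordC b j).comp (B (b j)) =
      ∑ k, ((LinearMap.trace ℝ E (B (b k)).toLinearMap : ℝ) : ℂ) • coordC b k := by
  have htr : ∀ A : E →ₗ[ℝ] E, LinearMap.trace ℝ E A = ∑ j, f.repr (A (f j)) j := by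
    intro A
    rw [LinearMap.trace_eq_matrix_trace ℝ f, Matrix.trace]
    simp [LinearMap.toMatrix_apply]
  have htrb : ∀ A : E →ₗ[ℝ] E, LinearMap.trace ℝ E A = ∑ j, b.repr (A (b j)) j := by
    intro A
    rw [LinearMap.trace_eq_matrix_trace ℝ b, Matrix.trace]
    simp [LinearMap.toMatrix_apply]
  have h1 : ∀ w, LinearMap.trace ℝ E (B.flip w).toLinearMap =
      LinearMap.trace ℝ E (B w).toLinearMap := by
    intro w
    let φ : E →ₗ[ℝ] ℝ := (LinearMap.trace ℝ E).comp
      ((ContinuousLinearMap.coeLM ℝ : (E →L[ℝ] E) →ₗ[ℝ] E →ₗ[ℝ] E).comp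
        (B.flip.toLinearMap - B.toLinearMap))
    have hφ : φ = 0 := by
      refine f.ext fun k => ?_
      change LinearMap.trace ℝ E ((B.flip (f k) - B (f k) : E →L[ℝ] E) : E →ₗ[ℝ] E) = 0
      rw [htr]
      refine Finset.sum_eq_zero fun j _ => ?_
      have h2 := hT j k j
      have h3 := torsR_swap f B j j k
      change torsR f B j k j = 0
      linarith
    have := LinearMap.congr_fun hφ w
    change LinearMap.trace ℝ E ((B.flip w - B w : E →L[ℝ] E) : E →ₗ[ℝ] E) = 0 at this
    rw [ContinuousLinearMap.toLinearMap_sub, map_sub] at this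
    linarith
  ext w
  have h2 := congrArg (fun r : ℝ => (r : ℂ)) (h1 w)
  have h3 : LinearMap.trace ℝ E (B w).toLinearMap =
      ∑ k, b.repr w k * LinearMap.trace ℝ E (B (b k)).toLinearMap := by
    conv_lhs => rw [← b.sum_repr w]
    rw [map_sum, ContinuousLinearMap.toLinearMap_sum, map_sum]
    simp
  rw [h3, htrb] at h2
  simp only [sum_apply, smul_apply, ContinuousLinearMap.comp_apply, coordC_apply, smul_eq_mul]
  push_cast at h2
  simp only [ContinuousLinearMap.flip_apply] at h2
  rw [h2]
  exact Finset.sum_congr rfl fun k _ => mul_comm _ _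

include hJ hJs in
/-- The defect of formal adjointness, as a divergence. -/
theorem divergence_identity (B : E →L[ℝ] E →L[ℝ] E) {γ : ι → ι → ℝ} (hf : IsFrame b f γ)
    (hT : ∀ i j k, torsR f B i j k = -torsR f B i k j) {c : ℂ} (hc : c * c = -1)
    (hcc : conj c = -c) (Jt : ι → ℝ → E →L[ℝ] E) (γt : ι → ℝ → ι → ι → ℝ) (at' ct : ι → ℝ → Fib E)
    (x z : Fib E) (N K : ι → Fib E) (hJ0 : ∀ j, Jt j 0 = J) (hγ0 : ∀ j, γt j 0 = γ)
    (ha0 : ∀ j, at' j 0 = x) (hc0 : ∀ j, ct j 0 = z)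
    (hJt : ∀ j v, HasDerivAt (fun t => Jt j t v) (J (B (b j) v) - B (b j) (J v)) 0)
    (hγt : ∀ j, IsParallelInv b (B (b j)) (γt j))
    (ha : ∀ j, HasNab b (B (b j)) (at' j) (N j)) (hct : ∀ j, HasNab b (B (b j)) (ct j) (K j)) :
    ∃ D : ι → ℂ, (∀ j, HasDerivAt
      (fun t => hermG b (γt j t) (epsT c (Jt j t) (coordC b j) (at' j t)) (ct j t)) (D j) 0) ∧
      ∑ j, (D j + ((LinearMap.trace ℝ E (B (b j)).toLinearMap : ℝ) : ℂ) *
        hermG b γ (epsT c J (coordC b j) x) z) =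
      hermG b γ (∑ j, epsT c J (coordC b j) (N j)) z -
        hermG b γ x (c • ∑ j, br (lam b γ J) (epsT (-c) J (coordC b j)) (K j)) := by
  -- Leibniz rule for a parallel Hermitian product. The covector is constant in coordinates, so its
  -- covariant derivative is −θ^j∘B(b_j), and J is parallel.
  refine ⟨fun j => hermG b γ (epsT c J (coordC b j) (N j) -
    epsT c J ((coordC b j).comp (B (b j))) x) z + hermG b γ (epsT c J (coordC b j) x) (K j),
    fun j => ?_, ?_⟩
  · have h1 : HasNab b (B (b j)) (fun t => epsT c (Jt j t) (coordC b j) (at' j t))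
        (epsT c J (coordC b j) (N j) - epsT c J ((coordC b j).comp (B (b j))) x) := by
      have h2 := (ha j).eps (θ := fun t => (1 / 2 : ℂ) • (coordC b j - c • (coordC b j).comp (Jt j t)))
        (θ' := (1 / 2 : ℂ) • (0 - c • (coordC b j).comp (J.comp (B (b j)) - (B (b j)).comp J)))
        (fun v => by
          have h3 : HasDerivAt (fun t => coordC b j (Jt j t v))
              (coordC b j (J (B (b j) v) - B (b j) (J v))) 0 :=
            (coordC b j).hasFDerivAt.comp_hasDerivAt (0 : ℝ) (hJt j v)
          exact ((hasDerivAt_const (0 : ℝ) (coordC b j v)).sub (h3.const_mul c)).const_mul _)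
      refine h2.congr (fun _ => rfl) ?_
      rw [hJ0, ha0]
      change _ = epsT c J (coordC b j) (N j) + _
      rw [sub_eq_add_neg, epsT, epsT, ← LinearMap.neg_apply, ← eps_neg]
      congr 3
      ext v
      simp only [ContinuousLinearMap.comp_apply, sub_apply, smul_apply, neg_apply, smul_eq_mul,
        zero_apply, map_sub]
      ring
    have h2 := HasDerivAt.fun_sum fun k (_ : k ∈ Finset.range (Fintype.card ι + 1)) =>
      HasNab.hermDeg (hγt j) k h1 (hct j)
    simp only [hermG_apply, ← Finset.sum_add_distrib]
    refine h2.congr_deriv ?_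
    simp only [hγ0, hc0, hJ0, ha0]
  · have h1 : ∀ j, hermG b γ (epsT c J (coordC b j) x) (K j) =
        -hermG b γ x (c • br (lam b γ J) (epsT (-c) J (coordC b j)) (K j)) := by
      intro j
      rw [← hf.herm_eq, isAdj_epsT hJ hJs hc hcc (coordC b j) (fun v => Complex.conj_ofReal _),
        hf.lam_eq, LinearMap.smul_apply, neg_smul, map_neg]
    -- The derivatives of the coordinate covectors cancel the trace terms, which are those coming
    -- from the volume density.
    have h2 : ∑ j, hermG b γ (epsT c J ((coordC b j).comp (B (b j))) x) z =
        ∑ j, ((LinearMap.trace ℝ E (B (b j)).toLinearMap : ℝ) : ℂ) *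
          hermG b γ (epsT c J (coordC b j) x) z := by
      have h3 : ∀ θ : ι → E →L[ℝ] ℂ, epsT c J (∑ j, θ j) = ∑ j, epsT c J (θ j) := by
        intro θ
        rw [epsT_eq_sum (f := b)]
        simp only [sum_apply, Finset.sum_smul]
        rw [Finset.sum_comm]
        exact Finset.sum_congr rfl fun j _ => (epsT_eq_sum (f := b) c (θ j)).symm
      have h4 : ∀ (r : ℂ) (θ : E →L[ℝ] ℂ), epsT c J (r • θ) = r • epsT c J θ := by
        intro r θ
        rw [epsT_eq_sum (f := b), epsT_eq_sum (f := b) c θ, Finset.smul_sum]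
        exact Finset.sum_congr rfl fun j _ => by rw [smul_apply, smul_eq_mul, mul_smul]
      have h5 := congrArg (fun θ => hermG b γ (epsT c J θ x) z) (sum_coordC_comp (b := b) B hT)
      simp only [h3, h4, LinearMap.sum_apply, map_sum, LinearMap.smul_apply, map_smul,
        smul_eq_mul] at h5
      exact h5
    simp only [Finset.sum_add_distrib, map_sub, LinearMap.sub_apply, Finset.sum_sub_distrib, h1, h2,
      Finset.smul_sum, map_sum, LinearMap.sum_apply, Finset.sum_neg_distrib]
    ring

end Frame

/-! ### Smooth families of forms on open subsets of a vector space -/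

section SmoothFamilies

variable {E : Type*} [NormedAddCommGroup E] [NormedSpace ℝ E]

/-- A family of forms on `U` all of whose values are smooth functions. -/
def SmoothF (U : Set E) (a : E → Fib E) : Prop :=
  ∀ k w, ContDiffOn ℝ ∞ (fun z => a z k w) U

/-- In finite dimension a form is recovered linearly from its values on tuples of basis vectors,
through a left inverse of that evaluation map. -/
theorem contDiffOn_form_iff [FiniteDimensional ℝ E] {U : Set E} {k : ℕ}
    {a : E → E [⋀^Fin k]→L[ℝ] ℂ} :
    ContDiffOn ℝ ∞ a U ↔ ∀ w, ContDiffOn ℝ ∞ (fun z => a z w) U := by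
  constructor
  · intro h w
    exact (ContinuousAlternatingMap.apply ℝ E ℂ w).contDiff.comp_contDiffOn h
  · intro h
    let b := Module.finBasis ℝ E
    let ev : E [⋀^Fin k]→L[ℝ] ℂ →ₗ[ℝ] ((Fin k → Fin (Module.finrank ℝ E)) → ℂ) :=
      { toFun := fun a i => a fun j => b (i j)
        map_add' := fun _ _ => rfl
        map_smul' := fun _ _ => rfl }
    have hev : LinearMap.ker ev = ⊥ := by
      refine LinearMap.ker_eq_bot.mpr fun a c hac => ?_
      refine ContinuousAlternatingMap.toAlternatingMap_injective ?_
      exact Module.Basis.ext_alternating b fun v _ => congrFun hac v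
    obtain ⟨g, hg⟩ := ev.exists_leftInverse_of_injective hev
    have h1 : a = fun z => g.toContinuousLinearMap (ev (a z)) :=
      funext fun z => (LinearMap.congr_fun hg (a z)).symm
    rw [h1]
    refine g.toContinuousLinearMap.contDiff.comp_contDiffOn ?_
    exact contDiffOn_pi.mpr fun i => h _

/-- The derivative of a family of forms. -/
def dd (a : E → Fib E) (y u : E) : Fib E := fun k => fderiv ℝ (fun z => a z k) y u

namespace SmoothF

variable {U : Set E} {a c : E → Fib E}

theorem congr (ha : SmoothF U a) (h : ∀ z ∈ U, c z = a z) : SmoothF U c :=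
  fun k w => (ha k w).congr fun z hz => by rw [h z hz]

theorem add (ha : SmoothF U a) (hc : SmoothF U c) : SmoothF U (fun z => a z + c z) :=
  fun k w => (ha k w).add (hc k w)

theorem smul {φ : E → ℂ} (hφ : ContDiffOn ℝ ∞ φ U) (ha : SmoothF U a) :
    SmoothF U (fun z => φ z • a z) :=
  fun k w => hφ.mul (ha k w)

theorem const_smul (r : ℂ) (ha : SmoothF U a) : SmoothF U (fun z => r • a z) :=
  smul contDiffOn_const ha

theorem sum {ι : Type*} (s : Finset ι) {a : ι → E → Fib E} (h : ∀ i ∈ s, SmoothF U (a i)) :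
    SmoothF U (fun z => ∑ i ∈ s, a i z) := by
  intro k w
  simp only [Fib.sum_apply_apply]
  exact ContDiffOn.sum fun i hi => h i hi k w

theorem iota_const (v : E) (ha : SmoothF U a) : SmoothF U (fun z => iota v (a z)) :=
  fun k w => ha (k + 1) (Fin.cons v w)

theorem eps {θ : E → E →L[ℝ] ℂ} (hθ : ∀ v, ContDiffOn ℝ ∞ (fun z => θ z v) U) (ha : SmoothF U a) :
    SmoothF U (fun z => eps (θ z) (a z)) := by
  intro k w
  cases k with
  | zero => exact contDiffOn_const
  | succ k =>
    simp only [eps_apply_succ, epsForm_apply]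
    exact ContDiffOn.sum fun i _ => contDiffOn_const.mul ((hθ _).mul (ha k _))

theorem wedgeLeft {p : ℕ} {β : E → E [⋀^Fin p]→L[ℝ] ℂ}
    (hβ : ∀ w, ContDiffOn ℝ ∞ (fun z => β z w) U) (ha : SmoothF U a) :
    SmoothF U (fun z => wedgeLeft (β z) (a z)) := by
  intro m w
  rcases lt_or_ge m p with h | h
  · simp only [wedgeLeft_apply_of_lt h]
    exact contDiffOn_const
  · obtain ⟨l, rfl⟩ := Nat.exists_eq_add_of_le h
    simp only [wedgeLeft_apply_of_eq rfl, wedge_apply]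
    exact contDiffOn_const.mul (ContDiffOn.sum fun σ _ => contDiffOn_const.mul
      ((hβ _).mul (ha l _)))

variable [FiniteDimensional ℝ E]

theorem form (ha : SmoothF U a) (k : ℕ) : ContDiffOn ℝ ∞ (fun z => a z k) U :=
  contDiffOn_form_iff.mpr fun w => ha k w

theorem iota {X : E → E} (hX : ContDiffOn ℝ ∞ X U) (ha : SmoothF U a) :
    SmoothF U (fun z => NearlyKahler.iota (X z) (a z)) := by
  let b := Module.finBasis ℝ E
  refine (SmoothF.sum Finset.univ fun j _ => smul (φ := fun z => coordC b j (X z))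
    ((coordC b j).contDiff.comp_contDiffOn hX) (ha.iota_const (b j))).congr fun z _ => ?_
  conv_lhs => rw [← sum_coordC_smul_iota b (X z)]
  simp only [LinearMap.sum_apply, LinearMap.smul_apply]

theorem typeEnd {J : E → E →L[ℝ] E} (hJ : ∀ v, ContDiffOn ℝ ∞ (fun z => J z v) U) (p : ℤ)
    (ha : SmoothF U a) : SmoothF U (fun z => typeEnd (J z) p (a z)) := by
  intro k
  induction k generalizing a p with
  | zero =>
    intro w
    simp only [typeEnd_apply_zero]
    split_ifs
    · exact ha 0 w
    · exact contDiffOn_const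
  | succ k ih =>
    intro w
    have h1 : SmoothF U fun z => iota10 (J z) (w 0) (a z) := by
      refine (((ha.iota_const (w 0)).add ((ha.iota (hJ (w 0))).const_smul
        (-Complex.I))).const_smul (1 / 2 : ℂ)).congr fun z _ => ?_
      simp only [iota10, LinearMap.smul_apply, LinearMap.sub_apply, neg_smul, ← sub_eq_add_neg]
    have h2 : SmoothF U fun z => iota01 (J z) (w 0) (a z) := by
      refine (((ha.iota_const (w 0)).add ((ha.iota (hJ (w 0))).const_smul
        Complex.I)).const_smul (1 / 2 : ℂ)).congr fun z _ => ?_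
      simp only [iota01, LinearMap.smul_apply, LinearMap.add_apply]
    refine ((ih (p - 1) h1 (Fin.tail w)).add (ih p h2 (Fin.tail w))).congr fun z _ => ?_
    have h4 := LinearMap.congr_fun (iota_typeEnd (J z) p (w 0)) (a z)
    have h5 := congrArg (fun y : Fib E => y k (Fin.tail w)) h4
    simp only [Module.End.mul_apply, iota_apply_apply, Fin.cons_self_tail] at h5
    exact h5

theorem hermDeg {ι : Type*} [Fintype ι] {b : Module.Basis ι ℝ E} {γ : E → ι → ι → ℝ}
    (hγ : ∀ i j, ContDiffOn ℝ ∞ (fun z => γ z i j) U) (k : ℕ) (ha : SmoothF U a)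
    (hc : SmoothF U c) : ContDiffOn ℝ ∞ (fun z => hermDeg b (γ z) k (a z) (c z)) U := by
  induction k generalizing a c with
  | zero => exact (ha 0 Fin.elim0).mul (Complex.conjCLE.contDiff.comp_contDiffOn (hc 0 Fin.elim0))
  | succ k ih =>
    simp only [hermDeg_succ]
    exact contDiffOn_const.mul (ContDiffOn.sum fun i _ => ContDiffOn.sum fun j _ =>
      (Complex.ofRealCLM.contDiff.comp_contDiffOn (hγ i j)).mul
        (ih (ha.iota_const _) (hc.iota_const _)))

theorem hermG {ι : Type*} [Fintype ι] [DecidableEq ι] {b : Module.Basis ι ℝ E} {γ : E → ι → ι → ℝ}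
    (hγ : ∀ i j, ContDiffOn ℝ ∞ (fun z => γ z i j) U) (ha : SmoothF U a)
    (hc : SmoothF U c) : ContDiffOn ℝ ∞ (fun z => hermG b (γ z) (a z) (c z)) U := by
  have h : (fun z => NearlyKahler.hermG b (γ z) (a z) (c z)) = _ :=
    funext fun z => hermG_apply b (γ z) (a z) (c z)
  rw [h]
  exact ContDiffOn.sum fun k _ => hermDeg hγ k ha hc

theorem lam {ι : Type*} [Fintype ι] {b : Module.Basis ι ℝ E} {γ : E → ι → ι → ℝ}
    (hγ : ∀ i j, ContDiffOn ℝ ∞ (fun z => γ z i j) U)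
    {J : E → E →L[ℝ] E} (hJ : ∀ v, ContDiffOn ℝ ∞ (fun z => J z v) U) (ha : SmoothF U a) :
    SmoothF U (fun z => lam b (γ z) (J z) (a z)) := by
  simp only [lam_apply]
  exact (SmoothF.sum _ fun i _ => SmoothF.sum _ fun j _ =>
    smul (Complex.ofRealCLM.contDiff.comp_contDiffOn (hγ i j))
      ((ha.iota_const (b j)).iota (hJ (b i)))).const_smul _

theorem epsT {J : E → E →L[ℝ] E} (hJ : ∀ v, ContDiffOn ℝ ∞ (fun z => J z v) U) (r : ℂ)
    (θ : E →L[ℝ] ℂ) (ha : SmoothF U a) : SmoothF U (fun z => epsT r (J z) θ (a z)) := by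
  refine SmoothF.eps (θ := fun z => (1 / 2 : ℂ) • (θ - r • θ.comp (J z))) (fun v => ?_) ha
  exact contDiffOn_const.mul (contDiffOn_const.sub (contDiffOn_const.mul
    (θ.contDiff.comp_contDiffOn (hJ v))))

variable {y : E}

theorem differentiableAt (hU : IsOpen U) (ha : SmoothF U a) (hy : y ∈ U) (k : ℕ) :
    DifferentiableAt ℝ (fun z => a z k) y :=
  ((ha.form k).differentiableOn (by simp)).differentiableAt (hU.mem_nhds hy)

theorem dd (hU : IsOpen U) (ha : SmoothF U a) (u : E) : SmoothF U (fun z => dd a z u) := by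
  intro k
  rw [← contDiffOn_form_iff]
  exact ((ha.form k).fderiv_of_isOpen hU (by simp)).clm_apply contDiffOn_const

theorem hasD (hU : IsOpen U) (ha : SmoothF U a) (hy : y ∈ U) (u : E) :
    HasD (fun t => a (y + t • u)) (NearlyKahler.dd a y u) := by
  intro k w
  have h1 := (ha.differentiableAt hU hy k).hasFDerivAt
  have h2 : HasDerivAt (fun t : ℝ => y + t • u) u 0 := by
    simpa using ((hasDerivAt_id (0 : ℝ)).smul_const u).const_add y
  have h3 : HasDerivAt (fun t : ℝ => a (y + t • u) k) (NearlyKahler.dd a y u k) 0 :=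
    HasFDerivAt.comp_hasDerivAt (l := fun z => a z k) (0 : ℝ) (by simpa using h1) h2
  exact (ContinuousAlternatingMap.apply ℝ E ℂ w).hasFDerivAt.comp_hasDerivAt (0 : ℝ) h3

end SmoothF

/-- The exterior derivative of a family of forms. -/
def extDerivF (a : E → Fib E) (y : E) : Fib E
  | 0 => 0
  | k + 1 => extDeriv (fun z => a z k) y

theorem extDerivF_eq [FiniteDimensional ℝ E] {ι : Type*} [Fintype ι] (b : Module.Basis ι ℝ E)
    (a : E → Fib E) (y : E) : extDerivF a y = ∑ j, eps (coordC b j) (dd a y (b j)) := by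
  refine Fib.ext_apply fun k w => ?_
  rw [Fib.sum_apply_apply]
  cases k with
  | zero => simp [extDerivF]
  | succ k =>
    simp only [extDerivF, eps_apply_succ, epsForm_apply, extDeriv,
      ContinuousAlternatingMap.alternatizeUncurryFin_apply]
    rw [Finset.sum_comm]
    refine Finset.sum_congr rfl fun i _ => ?_
    conv_lhs => rw [← b.sum_repr (w i)]
    rw [map_sum, ContinuousAlternatingMap.sum_apply, Finset.smul_sum]
    refine Finset.sum_congr rfl fun j _ => ?_
    rw [map_smul, ContinuousAlternatingMap.smul_apply, zsmul_eq_mul, coordC_apply]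
    simp [dd]

theorem SmoothF.extDerivF [FiniteDimensional ℝ E] {U : Set E} (hU : IsOpen U) {a : E → Fib E}
    (ha : SmoothF U a) : SmoothF U (extDerivF a) := by
  let b := Module.finBasis ℝ E
  refine (SmoothF.sum Finset.univ fun j _ => SmoothF.eps (θ := fun _ => coordC b j)
    (fun v => contDiffOn_const) (ha.dd hU (b j))).congr fun z _ => extDerivF_eq b a z

/-- The pullback of forms under a linear map. -/
def pull {V W : Type*} [AddCommGroup V] [Module ℝ V] [TopologicalSpace V] [AddCommGroup W]
    [Module ℝ W] [TopologicalSpace W] (φ : V →L[ℝ] W) : Fib W →ₗ[ℂ] Fib V where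
  toFun a := fun k => (a k).compContinuousLinearMap φ
  map_add' _ _ := rfl
  map_smul' _ _ := rfl

/-! ### Pullback by linear maps. -/

section Pull

variable {V W : Type*} [AddCommGroup V] [Module ℝ V] [TopologicalSpace V] [AddCommGroup W]
  [Module ℝ W] [TopologicalSpace W] (φ : V →L[ℝ] W)

theorem pull_apply (a : Fib W) (k : ℕ) : pull φ a k = (a k).compContinuousLinearMap φ := rfl

@[simp] theorem pull_apply_apply (a : Fib W) (k : ℕ) (w : Fin k → V) :
    pull φ a k w = a k (fun i => φ (w i)) := rfl

theorem pull_iota (v : V) (a : Fib W) : pull φ (iota (φ v) a) = iota v (pull φ a) := by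
  refine Fib.ext_apply fun k w => ?_
  simp only [pull_apply_apply, iota_apply_apply]
  congr 1
  funext i
  cases i using Fin.cases <;> rfl

theorem pull_typeEnd {I : V →L[ℝ] V} {J : W →L[ℝ] W} (h : ∀ v, φ (I v) = J (φ v)) (p : ℤ)
    (a : Fib W) : pull φ (typeEnd J p a) = typeEnd I p (pull φ a) := by
  refine Fib.ext fun k => ?_
  induction k generalizing p a with
  | zero =>
    rw [pull_apply, typeEnd_apply_zero, typeEnd_apply_zero]
    split_ifs <;> rfl
  | succ k ih =>
    refine form_ext_iota fun v => ?_
    have h1 := LinearMap.congr_fun (iota_typeEnd J p (φ v)) a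
    have h2 := LinearMap.congr_fun (iota_typeEnd I p v) (pull φ a)
    have h3 : pull φ (iota10 J (φ v) a) = iota10 I v (pull φ a) := by
      simp only [iota10, LinearMap.smul_apply, LinearMap.sub_apply, map_smul, map_sub, ← h,
        pull_iota]
    have h4 : pull φ (iota01 J (φ v) a) = iota01 I v (pull φ a) := by
      simp only [iota01, LinearMap.smul_apply, LinearMap.add_apply, map_smul, map_add, ← h,
        pull_iota]
    have h5 : iota v (pull φ (typeEnd J p a)) k = iota v (typeEnd I p (pull φ a)) k := by
      rw [← pull_iota]
      simp only [Module.End.mul_apply, LinearMap.add_apply] at h1 h2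
      rw [h1, h2, map_add, Fib.add_apply, Fib.add_apply, ih, ih, h3, h4]
    exact h5

theorem pull_wedgeLeft {p : ℕ} (β : W [⋀^Fin p]→L[ℝ] ℂ) (a : Fib W) :
    pull φ (wedgeLeft β a) = wedgeLeft (β.compContinuousLinearMap φ) (pull φ a) := by
  refine Fib.ext_apply fun m w => ?_
  rcases lt_or_ge m p with h | h
  · rw [pull_apply_apply, wedgeLeft_apply_of_lt h, wedgeLeft_apply_of_lt h]
    rfl
  · obtain ⟨l, rfl⟩ := Nat.exists_eq_add_of_le h
    rw [pull_apply_apply, wedgeLeft_apply_of_eq rfl, wedgeLeft_apply_of_eq rfl, wedge_apply,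
      wedge_apply]
    rfl

theorem pull_injective {ψ : W →L[ℝ] V} (h : ∀ w, φ (ψ w) = w) : Function.Injective (pull φ) := by
  intro a c hac
  refine Fib.ext_apply fun k w => ?_
  have := congrArg (fun x : Fib V => x k fun i => ψ (w i)) hac
  simpa only [pull_apply_apply, h] using this

end Pull

end SmoothFamilies

/-! ### Forms in charts -/

section Charts

theorem minSmoothness_two_le : minSmoothness ℝ 2 ≤ (∞ : WithTop ℕ∞) := by
  rw [minSmoothness_of_isRCLikeNormedField]
  exact WithTop.coe_le_coe.mpr le_top

/-- The model space of `2n`-dimensional manifolds. -/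
abbrev Model (n : ℕ) : Type := EuclideanSpace ℝ (Fin (2 * n))

variable {n : ℕ} {M : Type*} [TopologicalSpace M] [ChartedSpace (Model n) M]

/-- The target of the chart at `c`. -/
def chartTarget (c : M) : Set (Model n) := (extChartAt (𝓡 (2 * n)) c).target

/-- The inverse of the chart at `c`. -/
def par (c : M) (y : Model n) : M := (extChartAt (𝓡 (2 * n)) c).symm y

/-- The derivative of the inverse of the chart at `c`. -/
def dpar (c : M) (y : Model n) : Model n →L[ℝ] TangentSpace (𝓡 (2 * n)) (par c y) :=
  mfderiv 𝓘(ℝ, EuclideanSpace ℝ (Fin (2 * n))) (𝓡 (2 * n)) (extChartAt (𝓡 (2 * n)) c).symm y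

/-- The derivative of the chart at `c`. -/
def dchart (c : M) (y : Model n) : TangentSpace (𝓡 (2 * n)) (par c y) →L[ℝ] Model n :=
  mfderiv (𝓡 (2 * n)) 𝓘(ℝ, EuclideanSpace ℝ (Fin (2 * n))) (extChartAt (𝓡 (2 * n)) c) (par c y)

/-- The value of a form at a point. -/
def fib (α : Form n M) (x : M) : Fib (TangentSpace (𝓡 (2 * n)) x) := fun k => α k x

/-- A form in the chart at `c`. -/
def rep (c : M) (α : Form n M) (y : Model n) : Fib (Model n) := pull (dpar c y) (fib α (par c y))

theorem rep_apply (c : M) (α : Form n M) (y : Model n) (k : ℕ) :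
    rep c α y k = chartRep α k c y := rfl

theorem isSmooth_iff {α : Form n M} : IsSmooth α ↔ ∀ c, SmoothF (chartTarget c) (rep c α) := by
  constructor
  · intro h c k
    exact contDiffOn_form_iff.mp (h k c)
  · intro h k c
    exact (h c).form k

theorem isOpen_chartTarget (c : M) : IsOpen (chartTarget (n := n) c) :=
  isOpen_extChartAt_target c

theorem chart_mem_chartTarget (x : M) : extChartAt (𝓡 (2 * n)) x x ∈ chartTarget x :=
  mem_extChartAt_target x

theorem par_chart (x : M) : par x (extChartAt (𝓡 (2 * n)) x x) = x :=
  extChartAt_to_inv (I := 𝓡 (2 * n)) x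

theorem par_mem_source {c : M} {y : Model n} (hy : y ∈ chartTarget c) :
    par c y ∈ (extChartAt (𝓡 (2 * n)) c).source :=
  (extChartAt (𝓡 (2 * n)) c).map_target hy

theorem rep_add (c : M) (α β : Form n M) (y : Model n) :
    rep c (α + β) y = rep c α y + rep c β y := rfl

theorem rep_sub (c : M) (α β : Form n M) (y : Model n) :
    rep c (α - β) y = rep c α y - rep c β y := rfl

theorem rep_smul (z : ℂ) (c : M) (α : Form n M) (y : Model n) :
    rep c (z • α) y = z • rep c α y := rfl

theorem rep_zero (c : M) (y : Model n) : rep c (0 : Form n M) y = 0 := rfl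

theorem rep_sum {ι : Type*} (s : Finset ι) (c : M) (α : ι → Form n M) (y : Model n) :
    rep c (∑ i ∈ s, α i) y = ∑ i ∈ s, rep c (α i) y :=
  map_sum (⟨⟨fun α => rep c α y, rfl⟩, fun _ _ => rfl⟩ : Form n M →+ Fib (Model n)) α s

theorem rep_congr {α β : Form n M} {c : M} {y : Model n} (h : ∀ k, α k (par c y) = β k (par c y)) :
    rep c α y = rep c β y := by
  have : fib α (par c y) = fib β (par c y) := funext h
  rw [rep, rep, this]

variable [IsManifold (𝓡 (2 * n)) ∞ M]

theorem dchart_dpar {c : M} {y : Model n} (hy : y ∈ chartTarget c) (v : Model n) :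
    dchart c y (dpar c y v) = v := by
  have : IsManifold (𝓡 (2 * n)) 1 M := IsManifold.of_le (n := ∞) (by simp)
  have h := mfderiv_extChartAt_comp_mfderivWithin_extChartAt_symm (I := 𝓡 (2 * n)) hy
  rw [ModelWithCorners.range_eq_univ, mfderivWithin_univ] at h
  exact congrArg (fun f => f v) h

theorem dpar_dchart {c : M} {y : Model n} (hy : y ∈ chartTarget c)
    (v : TangentSpace (𝓡 (2 * n)) (par c y)) : dpar c y (dchart c y v) = v := by
  have : IsManifold (𝓡 (2 * n)) 1 M := IsManifold.of_le (n := ∞) (by simp)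
  have h := mfderivWithin_extChartAt_symm_comp_mfderiv_extChartAt (I := 𝓡 (2 * n)) hy
  rw [ModelWithCorners.range_eq_univ, mfderivWithin_univ] at h
  exact congrArg (fun f => f v) h

theorem form_ext_rep {α β : Form n M}
    (h : ∀ c, ∀ y ∈ chartTarget c, rep c α y = rep c β y) : α = β := by
  funext k x
  have h1 := pull_injective _ (dpar_dchart (chart_mem_chartTarget (n := n) x))
    (h x _ (chart_mem_chartTarget x))
  rw [par_chart] at h1
  exact congrFun h1 k

theorem contMDiffAt_par {c : M} {y : Model n} (hy : y ∈ chartTarget c) :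
    ContMDiffAt 𝓘(ℝ, Model n) (𝓡 (2 * n)) ∞ (par c) y :=
  (contMDiffOn_extChartAt_symm c).contMDiffAt ((isOpen_chartTarget c).mem_nhds hy)

theorem contMDiffAt_chart {c x : M} (hx : x ∈ (extChartAt (𝓡 (2 * n)) c).source) :
    ContMDiffAt (𝓡 (2 * n)) 𝓘(ℝ, Model n) ∞ (extChartAt (𝓡 (2 * n)) c) x :=
  contMDiffAt_extChartAt' (by rwa [extChartAt_source] at hx)

/-- The change of charts. -/
def trans (c c' : M) (y : Model n) : Model n := extChartAt (𝓡 (2 * n)) c' (par c y)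

section Trans

variable {c c' : M} {y : Model n} (hy : y ∈ chartTarget c)
  (hy' : par c y ∈ (extChartAt (𝓡 (2 * n)) c').source)

include hy hy'

theorem contDiffAt_trans : ContDiffAt ℝ ∞ (trans c c') y :=
  contMDiffAt_iff_contDiffAt.mp ((contMDiffAt_chart hy').comp y (contMDiffAt_par hy))

omit [IsManifold (𝓡 (2 * n)) ∞ M] hy in
theorem trans_mem : trans c c' y ∈ chartTarget c' :=
  (extChartAt (𝓡 (2 * n)) c').map_source hy'

omit [IsManifold (𝓡 (2 * n)) ∞ M] hy in
theorem par_trans : par c' (trans c c' y) = par c y :=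
  (extChartAt (𝓡 (2 * n)) c').left_inv hy'

theorem fderiv_trans (v : Model n) : fderiv ℝ (trans c c') y v =
    mfderiv (𝓡 (2 * n)) 𝓘(ℝ, Model n) (extChartAt (𝓡 (2 * n)) c') (par c y) (dpar c y v) := by
  rw [← mfderiv_eq_fderiv]
  have h := mfderiv_comp y ((contMDiffAt_chart hy').mdifferentiableAt (by simp))
    ((contMDiffAt_par hy).mdifferentiableAt (by simp))
  exact congrArg (fun f => f v) h

theorem dpar_fderiv_trans (v : Model n) :
    (dpar c' (trans c c' y) (fderiv ℝ (trans c c') y v) : Model n) = dpar c y v := by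
  have : IsManifold (𝓡 (2 * n)) 1 M := IsManifold.of_le (n := ∞) (by simp)
  rw [fderiv_trans hy hy']
  have h := mfderivWithin_extChartAt_symm_comp_mfderiv_extChartAt' (I := 𝓡 (2 * n)) hy'
  rw [ModelWithCorners.range_eq_univ, mfderivWithin_univ] at h
  exact congrArg (fun f => f (dpar c y v)) h

theorem rep_eq_pull (α : Form n M) :
    rep c α y = pull (fderiv ℝ (trans c c') y) (rep c' α (trans c c' y)) := by
  refine Fib.ext_apply fun k w => ?_
  -- The tangent spaces at the two equal points all unfold to the model space, so values are
  -- transported along an equality of points.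
  have h : ∀ x' x : M, x' = x → ∀ u : Fin k → Model n, α k x' u = α k x u := by
    rintro x' x rfl u
    rfl
  have h1 : (fun i => (dpar c' (trans c c' y) (fderiv ℝ (trans c c') y (w i)) : Model n)) =
      fun i => dpar c y (w i) := funext fun i => dpar_fderiv_trans hy hy' (w i)
  exact ((h _ _ (par_trans hy') _).trans (congrArg (α k (par c y)) h1)).symm

end Trans

theorem eventually_mem_source {c c' : M} {y : Model n} (hy : y ∈ chartTarget c)
    (hy' : par c y ∈ (extChartAt (𝓡 (2 * n)) c').source) :
    ∀ᶠ z in nhds y, z ∈ chartTarget c ∧ par c z ∈ (extChartAt (𝓡 (2 * n)) c').source :=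
  Filter.Eventually.and ((isOpen_chartTarget c).mem_nhds hy)
    ((contMDiffAt_par hy).continuousAt.preimage_mem_nhds
      ((isOpen_extChartAt_source c').mem_nhds hy'))

/-- `extd` uses a different chart at each point. Naturality of the exterior derivative under the
change of charts shows that any single chart computes it. -/
theorem rep_extd {α : Form n M} (hα : IsSmooth α) {c : M} {y : Model n} (hy : y ∈ chartTarget c) :
    rep c (extd α) y = extDerivF (rep c α) y := by
  refine Fib.ext fun k => ?_
  cases k with
  | zero =>
    refine form_ext_zero ?_
    rfl
  | succ k =>
    have hy' : par c y ∈ (extChartAt (𝓡 (2 * n)) (par c y)).source := mem_extChartAt_source _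
    have h1 : extDerivF (rep c α) y (k + 1) =
        (extDeriv (chartRep α k (par c y)) (trans c (par c y) y)).compContinuousLinearMap
          (fderiv ℝ (trans c (par c y)) y) := by
      change extDeriv (fun z => rep c α z k) y = _
      refine Eq.trans ?_ (extDeriv_pullback
        (show DifferentiableAt ℝ (chartRep α k (par c y)) (trans c (par c y) y) from
          (isSmooth_iff.mp hα (par c y)).differentiableAt (isOpen_chartTarget _)
            (trans_mem hy') k) (contDiffAt_trans hy hy') minSmoothness_two_le)
      refine Filter.EventuallyEq.extDeriv_eq ?_
      filter_upwards [eventually_mem_source hy hy'] with z hz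
      rw [rep_eq_pull hz.1 hz.2]
      rfl
    rw [h1]
    ext w
    change extDeriv (chartRep α k (par c y)) (trans c (par c y) y) _ =
      extDeriv (chartRep α k (par c y)) (trans c (par c y) y) _
    congr 1
    funext i
    exact (fderiv_trans hy hy' (w i)).symm

theorem isSmooth_extd {α : Form n M} (hα : IsSmooth α) : IsSmooth (extd α) :=
  isSmooth_iff.mpr fun c => ((isSmooth_iff.mp hα c).extDerivF (isOpen_chartTarget c)).congr
    fun _ hz => rep_extd hα hz

theorem extd_extd {α : Form n M} (hα : IsSmooth α) : extd (extd α) = 0 := by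
  refine form_ext_rep fun c y hy => ?_
  rw [rep_extd (isSmooth_extd hα) hy, rep_zero]
  refine Fib.ext fun k => ?_
  match k with
  | 0 => rfl
  | 1 =>
    -- In degree 1 the inner derivative enters through its component of degree 0, which is zero by
    -- definition.
    change extDeriv (fun z => rep c (extd α) z 0) y = 0
    have h : (fun z => rep c (extd α) z 0) = fun _ => 0 := by
      funext z
      refine form_ext_zero ?_
      rfl
    have h2 := extDeriv_smul (x := y) (0 : ℝ) (fun _ : Model n => (0 : Model n [⋀^Fin 0]→L[ℝ] ℂ))
    rw [zero_smul, zero_smul] at h2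
    exact h ▸ h2
  | k + 2 =>
    change extDeriv (fun z => rep c (extd α) z (k + 1)) y = 0
    refine Eq.trans ?_ (extDeriv_extDeriv_apply (((isSmooth_iff.mp hα c).form k).contDiffAt
      ((isOpen_chartTarget c).mem_nhds hy)) minSmoothness_two_le)
    refine Filter.EventuallyEq.extDeriv_eq ?_
    filter_upwards [(isOpen_chartTarget c).mem_nhds hy] with z hz
    rw [rep_extd hα hz]
    rfl

theorem rep_extd_eq {ι : Type*} [Fintype ι] (b : Module.Basis ι ℝ (Model n)) {α : Form n M}
    (hα : IsSmooth α) {c : M} {y : Model n} (hy : y ∈ chartTarget c) :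
    rep c (extd α) y = ∑ j, eps (coordC b j) (dd (rep c α) y (b j)) := by
  rw [rep_extd hα hy, extDerivF_eq b]

end Charts

/-! ### Almost Hermitian structures in charts -/

section HermitianCharts

variable {n : ℕ} {M : Type*} [TopologicalSpace M] [ChartedSpace (Model n) M]

theorem mulLeft_eq_wedgeLeft {β : Form n M} {p : ℕ} (hβ : ∀ k ≠ p, β k = 0) (α : Form n M) (x : M) :
    fib (mulLeft β α) x = wedgeLeft (β p x) (fib α x) := by
  refine Fib.ext_apply fun m w => ?_
  have h0 : ∀ k : Fin (m + 1), (k : ℕ) ≠ p →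
      wedge (Nat.add_sub_of_le (Nat.le_of_lt_succ k.2)) (β k x) (α (m - k) x) = 0 := by
    intro k hk
    rw [hβ k hk]
    exact wedge_zero_left _ _
  change (∑ k : Fin (m + 1), wedge (Nat.add_sub_of_le (Nat.le_of_lt_succ k.2)) (β k x)
    (α (m - k) x)) w = _
  rcases lt_or_ge m p with h | h
  · rw [wedgeLeft_apply_of_lt h, Finset.sum_eq_zero fun k _ => h0 k (by omega)]
  · rw [Finset.sum_eq_single (⟨p, Nat.lt_succ_of_le h⟩ : Fin (m + 1))
      (fun k _ hk => h0 k fun h => hk (Fin.ext h)) (by simp),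
      wedgeLeft_apply_of_eq (Nat.add_sub_of_le h)]
    rfl

theorem rep_mulLeft {β : Form n M} {p : ℕ} (hβ : ∀ k ≠ p, β k = 0) (α : Form n M) (c : M)
    (y : Model n) : rep c (mulLeft β α) y = wedgeLeft (rep c β y p) (rep c α y) := by
  rw [rep, mulLeft_eq_wedgeLeft hβ, pull_wedgeLeft]
  rfl

theorem isSmooth_mulLeft {β α : Form n M} {p : ℕ} (hβ : ∀ k ≠ p, β k = 0) (hs : IsSmooth β)
    (hα : IsSmooth α) : IsSmooth (mulLeft β α) :=
  isSmooth_iff.mpr fun c => (SmoothF.wedgeLeft (fun w => isSmooth_iff.mp hs c p w)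
    (isSmooth_iff.mp hα c)).congr fun z _ => rep_mulLeft hβ α c z

theorem extd_apply_zero (α : Form n M) : extd α 0 = 0 := rfl

theorem extd_apply_succ {α : Form n M} {k : ℕ} (h : α k = 0) : extd α (k + 1) = 0 := by
  funext x
  have h1 : chartRep α k x = 0 := by
    funext z
    change (α k _).compContinuousLinearMap _ = _
    rw [h]
    rfl
  have h2 := extDeriv_smul (x := extChartAt (𝓡 (2 * n)) x x) (0 : ℝ)
    (0 : Model n → Model n [⋀^Fin k]→L[ℝ] ℂ)
  rw [zero_smul, zero_smul, ← h1] at h2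
  change (extDeriv (chartRep α k x) (extChartAt (𝓡 (2 * n)) x x)).compContinuousLinearMap _ = 0
  rw [h2]
  rfl

variable [IsManifold (𝓡 (2 * n)) ∞ M]
  [RiemannianBundle (fun x : M => TangentSpace (𝓡 (2 * n)) x)]

namespace AlmostHermitianStructure

variable (A : AlmostHermitianStructure n M)

/-- The almost complex structure in the chart at `c`. -/
def chartJ (c : M) (y : Model n) : Model n →L[ℝ] Model n :=
  (dchart c y).comp ((A.J (par c y)).comp (dpar c y))

theorem dpar_chartJ {c : M} {y : Model n} (hy : y ∈ chartTarget c) (v : Model n) :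
    dpar c y (A.chartJ c y v) = A.J (par c y) (dpar c y v) :=
  dpar_dchart hy _

theorem chartJ_chartJ {c : M} {y : Model n} (hy : y ∈ chartTarget c) (v : Model n) :
    A.chartJ c y (A.chartJ c y v) = -v := by
  rw [chartJ, ContinuousLinearMap.comp_apply, ContinuousLinearMap.comp_apply]
  change dchart c y (A.J (par c y) (dpar c y (A.chartJ c y v))) = -v
  rw [A.dpar_chartJ hy, A.sq, map_neg, dchart_dpar hy]

theorem rep_typeProj (p q : ℤ) (α : Form n M) {c : M} {y : Model n} (hy : y ∈ chartTarget c)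
    (k : ℕ) : rep c (A.typeProj p q α) y k =
      if p + q = k then typeEnd (A.chartJ c y) p (rep c α y) k else 0 := by
  have h := congrFun (pull_typeEnd (dpar c y) (A.dpar_chartJ hy) p (fib α (par c y))) k
  split_ifs with hk
  · rw [← rep] at h
    rw [← h]
    change (A.typeProj p q α k (par c y)).compContinuousLinearMap _ = _
    rw [typeProj, if_pos hk]
    rfl
  · change (A.typeProj p q α k (par c y)).compContinuousLinearMap _ = _
    rw [typeProj, if_neg hk]
    rfl

theorem typeProj_apply_eq_zero (p q : ℤ) {α : Form n M} {k : ℕ} (h : α k = 0) :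
    A.typeProj p q α k = 0 := by
  funext x
  rw [typeProj, h]
  split_ifs
  · exact congrFun ((typeEnd (A.J x) p).map_zero) k
  · rfl

theorem dPart_apply_eq_zero (a b : ℤ) {α : Form n M} {p : ℕ} (hα : ∀ k ≠ p, α k = 0) {k : ℕ}
    (hk : k ≠ p + 1) : A.dPart a b α k = 0 := by
  funext x
  rw [dPart]
  refine Finset.sum_eq_zero fun r _ => ?_
  refine congrFun (A.typeProj_apply_eq_zero _ _ ?_) x
  cases k with
  | zero => exact extd_apply_zero _
  | succ k => exact extd_apply_succ (A.typeProj_apply_eq_zero _ _ (hα k (by omega)))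

variable [IsContMDiffRiemannianBundle (𝓡 (2 * n)) ∞ (EuclideanSpace ℝ (Fin (2 * n)))
      (fun x : M => TangentSpace (𝓡 (2 * n)) x)]

omit A in
omit [RiemannianBundle (fun x : M => TangentSpace (𝓡 (2 * n)) x)] in
omit [IsContMDiffRiemannianBundle (𝓡 (2 * n)) ∞ (EuclideanSpace ℝ (Fin (2 * n)))
      (fun x : M => TangentSpace (𝓡 (2 * n)) x)] in
theorem contMDiffOn_dpar (c : M) (v : Model n) :
    ContMDiffOn 𝓘(ℝ, Model n) (𝓡 (2 * n)).tangent ∞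
      (fun y => (⟨par c y, dpar c y v⟩ : TangentBundle (𝓡 (2 * n)) M)) (chartTarget c) := by
  have h1 := (contMDiffOn_extChartAt_symm (I := 𝓡 (2 * n)) (n := ∞) c).contMDiffOn_tangentMapWithin
    (m := ∞) (by simp) (isOpen_chartTarget c).uniqueMDiffOn
  have h2 : ContMDiff 𝓘(ℝ, Model n) 𝓘(ℝ, Model n).tangent ∞
      (fun y : Model n => (⟨y, v⟩ : TangentBundle 𝓘(ℝ, Model n) (Model n))) := by
    intro y
    rw [contMDiffAt_totalSpace]
    refine ⟨contMDiffAt_id, ?_⟩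
    simp only [trivializationAt_model_space_apply]
    exact contMDiffAt_const
  refine (h1.comp h2.contMDiffOn fun y hy => hy).congr fun y hy => ?_
  have h3 := mfderivWithin_of_isOpen (I := 𝓘(ℝ, Model n)) (I' := 𝓡 (2 * n))
    (f := (extChartAt (𝓡 (2 * n)) c).symm) (isOpen_chartTarget c) hy
  exact congrArg (fun φ : Model n →L[ℝ] Model n =>
    (⟨par c y, φ v⟩ : TangentBundle (𝓡 (2 * n)) M)) h3.symm

theorem contMDiffOn_J_dpar (c : M) (v : Model n) :
    ContMDiffOn 𝓘(ℝ, Model n) (𝓡 (2 * n)).tangent ∞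
      (fun y => (⟨par c y, A.J (par c y) (dpar c y v)⟩ : TangentBundle (𝓡 (2 * n)) M))
      (chartTarget c) :=
  ContMDiffOn.clm_bundle_apply
    (A.contMDiff.comp_contMDiffOn (contMDiffOn_extChartAt_symm c))
    (contMDiffOn_dpar c v)

end AlmostHermitianStructure

end HermitianCharts

/-! ### The metric in charts -/

section MetricCharts

variable {n : ℕ} {M : Type*} [TopologicalSpace M] [ChartedSpace (Model n) M]

/-- The standard basis of the model space. -/
def stdB (n : ℕ) : Module.Basis (Fin (2 * n)) ℝ (Model n) :=
  (EuclideanSpace.basisFun (Fin (2 * n)) ℝ).toBasis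

theorem stdB_apply (i : Fin (2 * n)) : stdB n i = EuclideanSpace.single i 1 := by
  simp [stdB]

variable [RiemannianBundle (fun x : M => TangentSpace (𝓡 (2 * n)) x)]

/-- The metric in the chart at `c`. -/
def gram (c : M) (y v w : Model n) : ℝ := inner ℝ (dpar c y v) (dpar c y w)

/-- The matrix of the metric in the chart at `c`. -/
def gramM (c : M) (y : Model n) : Matrix (Fin (2 * n)) (Fin (2 * n)) ℝ :=
  Matrix.of fun i j => gram c y (stdB n i) (stdB n j)

/-- The density of the Riemannian volume in the chart at `c`. -/
def vol (c : M) (y : Model n) : ℝ := Real.sqrt (gramM c y).det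

/-- The inverse of the metric in the chart at `c`. -/
def gamma (c : M) (y : Model n) : Fin (2 * n) → Fin (2 * n) → ℝ :=
  fun i j => (gramM c y)⁻¹ i j

theorem gram_comm (c : M) (y v w : Model n) : gram c y v w = gram c y w v := real_inner_comm _ _

theorem gram_sum_left {ι : Type*} (s : Finset ι) (c : M) (y : Model n) (r : ι → ℝ)
    (v : ι → Model n) (w : Model n) :
    gram c y (∑ i ∈ s, r i • v i) w = ∑ i ∈ s, r i * gram c y (v i) w := by
  simp only [gram, map_sum, map_smul, sum_inner, real_inner_smul_left]

theorem gram_sum_right {ι : Type*} (s : Finset ι) (c : M) (y : Model n) (r : ι → ℝ)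
    (v : ι → Model n) (w : Model n) :
    gram c y w (∑ i ∈ s, r i • v i) = ∑ i ∈ s, r i * gram c y w (v i) := by
  simp only [gram_comm c y w, gram_sum_left]

variable (n) in
/-- An orthonormal basis of the tangent space at a point. -/
def onb (x : M) : OrthonormalBasis (Fin (2 * n)) ℝ (TangentSpace (𝓡 (2 * n)) x) :=
  (stdOrthonormalBasis ℝ (TangentSpace (𝓡 (2 * n)) x)).reindex
    (finCongr (finrank_euclideanSpace_fin (𝕜 := ℝ) (n := 2 * n)))

variable [IsManifold (𝓡 (2 * n)) ∞ M]

omit [RiemannianBundle (fun x : M => TangentSpace (𝓡 (2 * n)) x)] in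
/-- The derivative of the inverse of a chart, as an equivalence. -/
def dparEquiv {c : M} {y : Model n} (hy : y ∈ chartTarget c) :
    Model n ≃ₗ[ℝ] TangentSpace (𝓡 (2 * n)) (par c y) :=
  LinearEquiv.ofLinearMap (dpar c y).toLinearMap (dchart c y).toLinearMap
    (LinearMap.ext fun v => dpar_dchart hy v) (LinearMap.ext fun v => dchart_dpar hy v)

/-- The basis of the model space which corresponds to an orthonormal basis of the tangent space. -/
def frame {c : M} {y : Model n} (hy : y ∈ chartTarget c) :
    Module.Basis (Fin (2 * n)) ℝ (Model n) :=
  (onb n (par c y)).toBasis.map (dparEquiv hy).symm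

section Frame

variable {c : M} {y : Model n} (hy : y ∈ chartTarget c)

theorem dpar_frame (i : Fin (2 * n)) : dpar c y (frame hy i) = onb n (par c y) i := by
  rw [frame, Module.Basis.map_apply, OrthonormalBasis.coe_toBasis]
  exact (dparEquiv hy).apply_symm_apply _

theorem frame_repr (v : Model n) (i : Fin (2 * n)) :
    (frame hy).repr v i = inner ℝ (onb n (par c y) i) (dpar c y v) := by
  rw [frame, Module.Basis.map_repr, LinearEquiv.trans_apply, LinearEquiv.symm_symm,
    OrthonormalBasis.coe_toBasis_repr_apply, OrthonormalBasis.repr_apply_apply]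
  rfl

theorem frame_repr_eq_gram (v : Model n) (i : Fin (2 * n)) :
    (frame hy).repr v i = gram c y (frame hy i) v := by
  rw [frame_repr, gram, dpar_frame]

theorem gram_eq_sum (v w : Model n) :
    gram c y v w = ∑ l, (frame hy).repr v l * (frame hy).repr w l := by
  rw [gram, ← OrthonormalBasis.sum_inner_mul_inner (onb n (par c y))]
  exact Finset.sum_congr rfl fun l _ => by rw [frame_repr, frame_repr, real_inner_comm]

theorem gramM_eq : gramM c y = ((frame hy).toMatrix (stdB n)).transpose *
    (frame hy).toMatrix (stdB n) := by
  ext i j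
  rw [gramM, Matrix.of_apply, gram_eq_sum hy, Matrix.mul_apply]
  rfl

theorem det_gramM_eq : (gramM c y).det = ((frame hy).toMatrix (stdB n)).det ^ 2 := by
  rw [gramM_eq hy, Matrix.det_mul, Matrix.det_transpose, sq]

/-- With P the matrix of the standard basis in the frame, the Gram matrix is PᵀP, so its inverse is
P⁻¹P⁻ᵀ. This identifies `gamma` with the inverse metric of the frame. -/
theorem gramM_mul_frame : gramM c y * ((stdB n).toMatrix (frame hy) *
    ((stdB n).toMatrix (frame hy)).transpose) = 1 := by
  rw [gramM_eq hy, Matrix.mul_assoc, ← Matrix.mul_assoc ((frame hy).toMatrix (stdB n)),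
    Module.Basis.toMatrix_mul_toMatrix_flip, Matrix.one_mul, ← Matrix.transpose_mul,
    Module.Basis.toMatrix_mul_toMatrix_flip, Matrix.transpose_one]

include hy in
theorem det_gramM_pos : 0 < (gramM c y).det := by
  rw [det_gramM_eq hy]
  refine sq_pos_of_ne_zero fun h => ?_
  have h1 := congrArg Matrix.det (Module.Basis.toMatrix_mul_toMatrix_flip (frame hy) (stdB n))
  rw [Matrix.det_mul, h, zero_mul, Matrix.det_one] at h1
  exact zero_ne_one h1

include hy in
theorem vol_pos : 0 < vol c y := Real.sqrt_pos.mpr (det_gramM_pos hy)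

theorem isFrame_gamma : IsFrame (stdB n) (frame hy) (gamma c y) := by
  intro i j
  rw [gamma, Matrix.inv_eq_right_inv (gramM_mul_frame hy), Matrix.mul_apply]
  rfl

include hy in
-- The frame is the preimage of the same orthonormal basis as in `hermInner`, so the two sums agree
-- term by term after reindexing.
theorem hermInner_par (α β : Form n M) :
    hermInner α β (par c y) = hermG (stdB n) (gamma c y) (rep c α y) (rep c β y) := by
  rw [← (isFrame_gamma hy).herm_eq, herm_apply, hermInner]
  simp only [Fintype.card_fin, hermOn_apply]
  refine Finset.sum_congr rfl fun k _ => ?_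
  congr 1
  refine Fintype.sum_equiv ((Equiv.refl _).arrowCongr
    (finCongr (finrank_euclideanSpace_fin (𝕜 := ℝ) (n := 2 * n)))) _ _ fun i => ?_
  have h : (fun j => dpar c y (frame hy (((Equiv.refl (Fin k)).arrowCongr
      (finCongr (finrank_euclideanSpace_fin (𝕜 := ℝ) (n := 2 * n)))) i j))) =
      fun j => stdOrthonormalBasis ℝ (TangentSpace (𝓡 (2 * n)) (par c y)) (i j) := by
    funext j
    rw [dpar_frame, onb, OrthonormalBasis.reindex_apply]
    rfl
  rw [← h]
  rfl

end Frame

variable [IsContMDiffRiemannianBundle (𝓡 (2 * n)) ∞ (EuclideanSpace ℝ (Fin (2 * n)))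
      (fun x : M => TangentSpace (𝓡 (2 * n)) x)]

theorem contDiffOn_gram (c : M) (v w : Model n) :
    ContDiffOn ℝ ∞ (fun y => gram c y v w) (chartTarget c) :=
  contMDiffOn_iff_contDiffOn.mp
    ((AlmostHermitianStructure.contMDiffOn_dpar c v).inner_bundle
      (AlmostHermitianStructure.contMDiffOn_dpar c w))

theorem contDiffOn_det {E ι : Type*} [NormedAddCommGroup E] [NormedSpace ℝ E] [Fintype ι]
    [DecidableEq ι] {U : Set E} {G : E → Matrix ι ι ℝ}
    (hG : ∀ i j, ContDiffOn ℝ ∞ (fun y => G y i j) U) :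
    ContDiffOn ℝ ∞ (fun y => (G y).det) U := by
  simp only [Matrix.det_apply']
  exact ContDiffOn.sum fun σ _ => contDiffOn_const.mul (contDiffOn_prod fun i _ => hG _ _)

/-- Cramer's rule: an entry of the inverse is a quotient of determinants of smooth matrices with
nonvanishing denominator. -/
theorem contDiffOn_gamma (c : M) (i j : Fin (2 * n)) :
    ContDiffOn ℝ ∞ (fun y => gamma c y i j) (chartTarget c) := by
  have hG : ∀ i j, ContDiffOn ℝ ∞ (fun y => gramM c y i j) (chartTarget c) :=
    fun i j => contDiffOn_gram c (stdB n i) (stdB n j)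
  have h : ∀ y ∈ chartTarget c, gamma c y i j =
      (gramM c y).det⁻¹ * ((gramM c y).updateRow j (Pi.single i 1)).det := by
    intro y hy
    rw [gamma, Matrix.inv_def, Matrix.smul_apply, Matrix.adjugate_apply, Ring.inverse_eq_inv',
      smul_eq_mul]
  refine ContDiffOn.congr ?_ h
  refine ((contDiffOn_det hG).inv fun y hy => (det_gramM_pos hy).ne').mul (contDiffOn_det ?_)
  intro k l
  simp only [Matrix.updateRow_apply]
  split_ifs
  · exact contDiffOn_const
  · exact hG k l

theorem contDiffOn_vol (c : M) : ContDiffOn ℝ ∞ (fun y => vol (n := n) c y) (chartTarget c) :=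
  (contDiffOn_det (G := fun y => gramM c y)
    fun i j => contDiffOn_gram c (stdB n i) (stdB n j)).sqrt
    fun _ hy => (det_gramM_pos (M := M) hy).ne'

theorem contDiffOn_hermInner {α β : Form n M} (hα : IsSmooth α) (hβ : IsSmooth β) (c : M) :
    ContDiffOn ℝ ∞ (fun y : Model n => hermInner α β (par c y)) (chartTarget c) :=
  (SmoothF.hermG (b := stdB n) (γ := gamma (M := M) c) (contDiffOn_gamma c)
    (isSmooth_iff.mp hα c) (isSmooth_iff.mp hβ c)).congr fun _ hy => hermInner_par hy α β

namespace AlmostHermitianStructure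

variable (A : AlmostHermitianStructure n M)

theorem gram_chartJ {c : M} {y : Model n} (hy : y ∈ chartTarget c) (v w : Model n) :
    gram c y (A.chartJ c y v) w = inner ℝ (A.J (par c y) (dpar c y v)) (dpar c y w) := by
  rw [gram, A.dpar_chartJ hy]

theorem gram_chartJ_swap {c : M} {y : Model n} (hy : y ∈ chartTarget c) (v w : Model n) :
    gram c y (A.chartJ c y v) w = -gram c y (A.chartJ c y w) v := by
  rw [A.gram_chartJ hy, A.gram_chartJ hy, A.inner_swap]

theorem matOf_chartJ {c : M} {y : Model n} (hy : y ∈ chartTarget c) (i j : Fin (2 * n)) :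
    matOf (frame hy) (A.chartJ c y) i j = gram c y (A.chartJ c y (frame hy j)) (frame hy i) := by
  rw [matOf, frame_repr_eq_gram, gram_comm]

theorem matOf_chartJ_swap {c : M} {y : Model n} (hy : y ∈ chartTarget c) (i j : Fin (2 * n)) :
    matOf (frame hy) (A.chartJ c y) i j = -matOf (frame hy) (A.chartJ c y) j i := by
  rw [matOf_chartJ, matOf_chartJ, A.gram_chartJ_swap hy]

theorem contDiffOn_gram_chartJ (c : M) (v w : Model n) :
    ContDiffOn ℝ ∞ (fun y => gram c y (A.chartJ c y v) w) (chartTarget c) :=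
  ContDiffOn.congr (contMDiffOn_iff_contDiffOn.mp
    ((A.contMDiffOn_J_dpar c v).inner_bundle (contMDiffOn_dpar c w)))
    fun _ hy => A.gram_chartJ hy v w

/-- Smoothness of J as a section yields smoothness of the functions g(Jv,w) on coordinate fields.
Raising an index with the inverse metric recovers the coordinates of Jv. -/
theorem chartJ_eq_sum {c : M} {y : Model n} (hy : y ∈ chartTarget c) (v : Model n) :
    A.chartJ c y v = ∑ i, (∑ j, gamma c y i j * gram c y (A.chartJ c y v) (stdB n j)) •
      stdB n i := by
  have h1 : (gramM c y)⁻¹ * gramM c y = 1 := Matrix.nonsing_inv_mul _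
    (isUnit_iff_ne_zero.mpr (det_gramM_pos hy).ne')
  conv_lhs => rw [← (stdB n).sum_repr (A.chartJ c y v)]
  refine Finset.sum_congr rfl fun i _ => ?_
  congr 1
  have h2 : ∀ j, gram c y (A.chartJ c y v) (stdB n j) =
      ∑ k, gramM c y j k * (stdB n).repr (A.chartJ c y v) k := by
    intro j
    conv_lhs => rw [← (stdB n).sum_repr (A.chartJ c y v), gram_sum_left]
    refine Finset.sum_congr rfl fun k _ => ?_
    rw [mul_comm, gram_comm]
    rfl
  have h3 : ((gramM c y)⁻¹.mulVec ((gramM c y).mulVec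
      fun k => (stdB n).repr (A.chartJ c y v) k)) i = (stdB n).repr (A.chartJ c y v) i := by
    rw [Matrix.mulVec_mulVec, h1, Matrix.one_mulVec]
  rw [← h3]
  simp only [h2]
  rfl

theorem contDiffOn_chartJ (c : M) (v : Model n) :
    ContDiffOn ℝ ∞ (fun y => A.chartJ c y v) (chartTarget c) :=
  ContDiffOn.congr (ContDiffOn.sum fun i _ => (ContDiffOn.sum fun j _ =>
    (contDiffOn_gamma c i j).mul (A.contDiffOn_gram_chartJ c v _)).smul contDiffOn_const)
    fun _ hy => A.chartJ_eq_sum hy v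

theorem isSmooth_typeProj (p q : ℤ) {α : Form n M} (hα : IsSmooth α) :
    IsSmooth (A.typeProj p q α) := by
  refine isSmooth_iff.mpr fun c k w => ?_
  by_cases h : p + q = k
  · refine ((isSmooth_iff.mp hα c).typeEnd (A.contDiffOn_chartJ c) p k w).congr fun y hy => ?_
    rw [A.rep_typeProj p q α hy, if_pos h]
  · refine (contDiffOn_const (c := (0 : ℂ))).congr fun y hy => ?_
    rw [A.rep_typeProj p q α hy, if_neg h]
    rfl

omit [IsContMDiffRiemannianBundle (𝓡 (2 * n)) ∞ (EuclideanSpace ℝ (Fin (2 * n)))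
      (fun x : M => TangentSpace (𝓡 (2 * n)) x)] in
omit [IsContMDiffRiemannianBundle (𝓡 (2 * n)) ∞ (EuclideanSpace ℝ (Fin (2 * n)))
      (fun x : M => TangentSpace (𝓡 (2 * n)) x)] in
theorem rep_dPart_apply (a b : ℤ) (α : Form n M) {c : M} (y : Model n) (k : ℕ)
    (w : Fin k → Model n) : rep c (A.dPart a b α) y k w = ∑ r ∈ Finset.Icc (0 : ℤ) k,
      rep c (A.typeProj r (k - r) (extd (A.typeProj (r - a) (k - r - b) α))) y k w := by
  change (∑ r ∈ Finset.Icc (0 : ℤ) k,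
    A.typeProj r (k - r) (extd (A.typeProj (r - a) (k - r - b) α)) k (par c y)) _ = _
  rw [ContinuousAlternatingMap.sum_apply]
  rfl

theorem isSmooth_dPart (a b : ℤ) {α : Form n M} (hα : IsSmooth α) : IsSmooth (A.dPart a b α) := by
  refine isSmooth_iff.mpr fun c k w => ?_
  simp only [rep_dPart_apply]
  exact ContDiffOn.sum fun r _ => isSmooth_iff.mp
    (A.isSmooth_typeProj _ _ (isSmooth_extd (A.isSmooth_typeProj _ _ hα))) c k w

theorem extDerivF_congr_degree {a a' : Model n → Fib (Model n)} {y : Model n} {k : ℕ}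
    (h : ∀ᶠ z in nhds y, a z k = a' z k) : extDerivF a y (k + 1) = extDerivF a' y (k + 1) :=
  Filter.EventuallyEq.extDeriv_eq h

theorem rep_dPart (a b : ℤ) (hab : a + b = 1) {α : Form n M} (hα : IsSmooth α) {c : M}
    {y : Model n} (hy : y ∈ chartTarget c) (k : ℕ) (w : Fin k → Model n) :
    rep c (A.dPart a b α) y k w = ∑ r ∈ Finset.Icc (0 : ℤ) k, typeEnd (A.chartJ c y) r
      (extDerivF (fun z => typeEnd (A.chartJ c z) (r - a) (rep c α z)) y) k w := by
  rw [rep_dPart_apply]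
  refine Finset.sum_congr rfl fun r _ => ?_
  rw [A.rep_typeProj _ _ _ hy, if_pos (by ring), typeEnd_apply, typeEnd_apply,
    rep_extd (A.isSmooth_typeProj _ _ hα) hy]
  congr 2
  -- The degree k + 1 part of d depends only on the degree k component. There the condition p + q =
  -- k built into `typeProj` is met, because a + b = 1.
  cases k with
  | zero => rfl
  | succ k =>
    refine extDerivF_congr_degree ?_
    filter_upwards [(isOpen_chartTarget c).mem_nhds hy] with z hz
    rw [A.rep_typeProj _ _ _ hz, if_pos (by push_cast; linarith)]

theorem fundamentalForm_apply_eq_zero {k : ℕ} (hk : k ≠ 2) : A.fundamentalForm k = 0 := by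
  funext x
  match k, hk with
  | 0, _ => rfl
  | 1, _ => rfl
  | k + 3, _ => rfl

theorem rep_fundamentalForm (c : M) {y : Model n} (hy : y ∈ chartTarget c)
    (w : Fin 2 → Model n) :
    rep c A.fundamentalForm y 2 w = (gram c y (A.chartJ c y (w 0)) (w 1) : ℝ) := by
  rw [A.gram_chartJ hy]
  rfl

theorem isSmooth_fundamentalForm : IsSmooth A.fundamentalForm := by
  refine isSmooth_iff.mpr fun c k w => ?_
  by_cases hk : k = 2
  · subst hk
    exact (Complex.ofRealCLM.contDiff.comp_contDiffOn
      (A.contDiffOn_gram_chartJ c (w 0) (w 1))).congr fun y hy => A.rep_fundamentalForm c hy w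
  · refine (contDiffOn_const (c := (0 : ℂ))).congr fun y _ => ?_
    rw [rep_apply, chartRep, A.fundamentalForm_apply_eq_zero hk]
    rfl

end AlmostHermitianStructure

end MetricCharts

/-! ### The canonical Hermitian connection of a nearly Kähler structure -/

section HermitianConnection

variable {E : Type*} [NormedAddCommGroup E] [NormedSpace ℝ E]

/-- The covariant derivative of an endomorphism `J` with derivative `DJ`. -/
def nablaEnd (J : E →L[ℝ] E) (Γ DJ : E →L[ℝ] E →L[ℝ] E) : E →L[ℝ] E →L[ℝ] E :=
  DJ + ((ContinuousLinearMap.compL ℝ E E E).flip J).comp Γ -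
    (ContinuousLinearMap.compL ℝ E E E J).comp Γ

theorem nablaEnd_apply (J : E →L[ℝ] E) (Γ DJ : E →L[ℝ] E →L[ℝ] E) (u v : E) :
    nablaEnd J Γ DJ u v = DJ u v + Γ u (J v) - J (Γ u v) := rfl

/-- The connection `∇ - J ∇J / 2`. -/
def hermConn (J : E →L[ℝ] E) (Γ DJ : E →L[ℝ] E →L[ℝ] E) : E →L[ℝ] E →L[ℝ] E :=
  Γ - (1 / 2 : ℝ) • (ContinuousLinearMap.compL ℝ E E E J).comp (nablaEnd J Γ DJ)

theorem hermConn_apply (J : E →L[ℝ] E) (Γ DJ : E →L[ℝ] E →L[ℝ] E) (u v : E) :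
    hermConn J Γ DJ u v = Γ u v - (1 / 2 : ℝ) • J (nablaEnd J Γ DJ u v) := rfl

variable {J : E →L[ℝ] E} {Γ DJ : E →L[ℝ] E →L[ℝ] E} (hJ : ∀ v, J (J v) = -v)
  (hDJ : ∀ u v, DJ u (J v) + J (DJ u v) = 0)

include hJ hDJ in
theorem nablaEnd_J (u v : E) : nablaEnd J Γ DJ u (J v) = -J (nablaEnd J Γ DJ u v) := by
  have h := hDJ u v
  rw [nablaEnd_apply, nablaEnd_apply, hJ, map_neg, map_sub, map_add, hJ,
    eq_neg_of_add_eq_zero_left h]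
  abel

include hJ hDJ in
-- This says that J is parallel for ∇ − ½ J∇J: as ∇J anticommutes with J, the correction contributes
-- exactly −∇J to the derivative of J.
theorem hermConn_comm_J (u v : E) :
    J (hermConn J Γ DJ u v) - hermConn J Γ DJ u (J v) = DJ u v := by
  rw [hermConn_apply, hermConn_apply, map_sub, map_smul, hJ, nablaEnd_J hJ hDJ, map_neg, hJ,
    nablaEnd_apply]
  module

variable (hΓ : ∀ u v, Γ u v = Γ v u)
  (hN : ∀ u v, nablaEnd J Γ DJ u v = -nablaEnd J Γ DJ v u)

include hΓ hN in
-- The Levi-Civita part is symmetric, and the nearly Kähler condition makes the two halves of the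
-- correction add up.
theorem hermConn_torsion (u v : E) :
    hermConn J Γ DJ u v - hermConn J Γ DJ v u = -J (nablaEnd J Γ DJ u v) := by
  rw [hermConn_apply, hermConn_apply, hΓ u v, hN v u, map_neg]
  module

variable {g : E → E → ℝ} (hgJ : ∀ v w, g (J v) w = -g v (J w))
  (hgN : ∀ u v w, g (nablaEnd J Γ DJ u v) w = -g v (nablaEnd J Γ DJ u w))
  (hgl : ∀ (r s : ℝ) (v v' w : E), g (r • v + s • v') w = r * g v w + s * g v' w)
  (hgr : ∀ (r s : ℝ) (v v' w : E), g w (r • v + s • v') = r * g w v + s * g w v')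

include hgr in
theorem bilin_neg_right (v w : E) : g v (-w) = -g v w := by
  have h1 := hgr (-1) 0 w 0 v
  simpa using h1

include hJ hDJ hgJ hgN hgr in
theorem gram_J_nablaEnd (u v w : E) :
    g (J (nablaEnd J Γ DJ u v)) w = -g v (J (nablaEnd J Γ DJ u w)) := by
  have h1 := nablaEnd_J (Γ := Γ) hJ hDJ u w
  rw [hgJ, hgN, h1, bilin_neg_right hgr]
  ring

include hJ hDJ hgJ hgN hgl hgr in
theorem gram_hermConn (u v w : E) :
    g (hermConn J Γ DJ u v) w + g v (hermConn J Γ DJ u w) = g (Γ u v) w + g v (Γ u w) := by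
  have h1 : ∀ v, hermConn J Γ DJ u v = (1 : ℝ) • Γ u v + (-(1 / 2) : ℝ) •
      J (nablaEnd J Γ DJ u v) := fun v => by
    rw [hermConn_apply]
    module
  rw [h1, h1, hgl, hgr, gram_J_nablaEnd hJ hDJ hgJ hgN hgr]
  ring

variable [FiniteDimensional ℝ E] {ι : Type*} [Fintype ι] {f : Module.Basis ι ℝ E}
  (hf : ∀ v i, f.repr v i = g v (f i))

include hJ hDJ hΓ hN hgJ hgN hgr hf in
-- ∇_uJ is skew for g and anticommutes with J, hence J∇_uJ is skew as well. Together with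
-- antisymmetry in the first two slots this makes the torsion totally skew.
theorem torsR_hermConn (hg : ∀ v w, g v w = g w v) (i j k : ι) :
    torsR f (hermConn J Γ DJ) i j k = -torsR f (hermConn J Γ DJ) i k j := by
  have h1 : ∀ v w : E, g (-v) w = -g v w := fun v w => by
    rw [hg, bilin_neg_right hgr, hg]
  have h2 := gram_J_nablaEnd (Γ := Γ) hJ hDJ hgJ hgN hgr (f i) (f j) (f k)
  rw [torsR, torsR, hermConn_torsion hΓ hN, hermConn_torsion hΓ hN, hf, hf, h1, h1, h2, hg (f j)]

include hJ hDJ hΓ hN hgJ hgN hgr hf in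
-- Since J is orthogonal, g(T(u,v),Jw) = −g((∇_uJ)v,w), which is again skew in v and w. Skewness of
-- both T and TJ is what makes the two J-eigenparts totally skew, of types (3,0) and (0,3).
theorem torsJ_hermConn (hg : ∀ v w, g v w = g w v)
    (hgs : ∀ (r : ι → ℝ) (w : E), g w (∑ l, r l • f l) = ∑ l, r l * g w (f l)) (i j k : ι) :
    torsJ f J (hermConn J Γ DJ) i j k = -torsJ f J (hermConn J Γ DJ) i k j := by
  have h1 : ∀ v w : E, g (-v) w = -g v w := fun v w => by
    rw [hg, bilin_neg_right hgr, hg]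
  have h2 : ∀ j k, torsJ f J (hermConn J Γ DJ) i j k = -g (nablaEnd J Γ DJ (f i) (f j)) (f k) := by
    intro j k
    have h3 : torsJ f J (hermConn J Γ DJ) i j k =
        g (-J (nablaEnd J Γ DJ (f i) (f j))) (J (f k)) := by
      conv_rhs => rw [apply_eq_sum_matOf f J k, hgs]
      refine Finset.sum_congr rfl fun l _ => ?_
      rw [torsR, hermConn_torsion hΓ hN, hf]
      ring
    rw [h3, h1, hgJ, hJ, bilin_neg_right hgr, neg_neg]
  rw [h2, h2, hgN, hg (f j)]

end HermitianConnection

/-! ### Coordinate vector fields and their global extensions. -/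

section CoordinateFields

variable {n : ℕ} {M : Type*} [TopologicalSpace M] [ChartedSpace (Model n) M]

/-- The coordinate vector fields of the chart at `c`. -/
def coordField (c : M) (v : Model n) (x : M) : TangentSpace (𝓡 (2 * n)) x :=
  (dpar c (extChartAt (𝓡 (2 * n)) c x) v : Model n)

theorem mk_coordField {c : M} (v : Model n) {x : M}
    (hx : x ∈ (extChartAt (𝓡 (2 * n)) c).source) :
    (⟨x, coordField c v x⟩ : TangentBundle (𝓡 (2 * n)) M) =
      ⟨par c (extChartAt (𝓡 (2 * n)) c x), dpar c (extChartAt (𝓡 (2 * n)) c x) v⟩ :=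
  congrArg (fun x' => (⟨x', (dpar c (extChartAt (𝓡 (2 * n)) c x) v : Model n)⟩ :
    TangentBundle (𝓡 (2 * n)) M)) ((extChartAt (𝓡 (2 * n)) c).left_inv hx).symm

theorem coordField_par {c : M} (v : Model n) {y : Model n} (hy : y ∈ chartTarget c) :
    coordField c v (par c y) = dpar c y v := by
  have h : extChartAt (𝓡 (2 * n)) c (par c y) = y := (extChartAt (𝓡 (2 * n)) c).right_inv hy
  have h1 : ∀ y' : Model n, y' = y → (dpar c y' v : Model n) = dpar c y v := by
    rintro y' rfl
    rfl
  exact h1 _ h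

variable [IsManifold (𝓡 (2 * n)) ∞ M]

theorem contMDiffOn_coordField (c : M) (v : Model n) :
    ContMDiffOn (𝓡 (2 * n)) (𝓡 (2 * n)).tangent ∞
      (fun x => (⟨x, coordField c v x⟩ : TangentBundle (𝓡 (2 * n)) M))
      (extChartAt (𝓡 (2 * n)) c).source :=
  ((AlmostHermitianStructure.contMDiffOn_dpar c v).comp
    (fun _ hx => (contMDiffAt_chart hx).contMDiffWithinAt)
    (fun _ hx => (extChartAt (𝓡 (2 * n)) c).map_source hx)).congr
    fun _ hx => mk_coordField v hx

variable [T2Space M]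

/-- The nearly Kähler condition is tested on globally defined smooth fields, so coordinate fields
are cut off by a bump function that equals 1 near the point. -/
theorem exists_coordinate_fields {c : M} {y : Model n} (hy : y ∈ chartTarget c) :
    ∃ W : Fin (2 * n) → (x : M) → TangentSpace (𝓡 (2 * n)) x,
      (∀ j, ContMDiff (𝓡 (2 * n)) (𝓡 (2 * n)).tangent ∞
        (fun x => (⟨x, W j x⟩ : TangentBundle (𝓡 (2 * n)) M))) ∧
      ∀ᶠ x in nhds (par c y), ∀ j, W j x = coordField c (stdB n j) x := by
  have hs : (extChartAt (𝓡 (2 * n)) c).source ∈ nhds (par c y) :=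
    (isOpen_extChartAt_source c).mem_nhds (par_mem_source hy)
  obtain ⟨f, -, hf⟩ := (SmoothBumpFunction.nhds_basis_tsupport (I := 𝓡 (2 * n))
    (par c y)).mem_iff.mp hs
  refine ⟨fun j x => f x • coordField c (stdB n j) x, fun j => ?_, ?_⟩
  · exact ContMDiffOn.smul_section_of_tsupport f.contMDiff.contMDiffOn
      (isOpen_extChartAt_source c) hf (contMDiffOn_coordField c (stdB n j))
  · filter_upwards [f.eventuallyEq_one] with x hx j
    rw [hx, Pi.one_apply, one_smul]

end CoordinateFields

/-! ### Christoffel symbols of the Levi-Civita connection. -/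

section Christoffel

variable {n : ℕ} {M : Type*} [TopologicalSpace M] [ChartedSpace (Model n) M]
  [IsManifold (𝓡 (2 * n)) ∞ M]

omit [IsManifold (𝓡 (2 * n)) ∞ M] in
theorem mlieBracket_const {E : Type*} [NormedAddCommGroup E] [NormedSpace ℝ E] (v w y : E) :
    VectorField.mlieBracket 𝓘(ℝ, E) (fun _ : E => (v : E)) (fun _ : E => (w : E)) y = 0 := by
  have h := congrFun (VectorField.mlieBracketWithin_eq_lieBracketWithin (𝕜 := ℝ)
    (V := fun _ : E => (v : E)) (W := fun _ : E => (w : E)) (s := Set.univ)) y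
  refine h.trans ?_
  simp [VectorField.lieBracketWithin]
  rfl

/-- Pulled back to the chart the fields are constant near the point, and the Lie bracket is natural.
-/
theorem mlieBracket_coordinate_fields {c : M} {y : Model n} (hy : y ∈ chartTarget c)
    {W : Fin (2 * n) → (x : M) → TangentSpace (𝓡 (2 * n)) x}
    (hW : ∀ j, ContMDiff (𝓡 (2 * n)) (𝓡 (2 * n)).tangent ∞
        (fun x => (⟨x, W j x⟩ : TangentBundle (𝓡 (2 * n)) M)))
    (hWc : ∀ᶠ x in nhds (par c y), ∀ j, W j x = coordField c (stdB n j) x) (i j : Fin (2 * n)) :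
    VectorField.mlieBracket (𝓡 (2 * n)) (W i) (W j) (par c y) = 0 := by
  have hm : IsManifold (𝓡 (2 * n)) (minSmoothness ℝ 3) M :=
    IsManifold.of_le (n := ∞) (by
      rw [minSmoothness_of_isRCLikeNormedField]
      exact WithTop.coe_le_coe.mpr le_top)
  have h1 := VectorField.mpullback_mlieBracket (I := 𝓘(ℝ, Model n)) (I' := 𝓡 (2 * n))
    (x₀ := y) (f := par c) ((hW i).mdifferentiable (by simp) (par c y))
    ((hW j).mdifferentiable (by simp) (par c y)) (contMDiffAt_par hy) minSmoothness_two_le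
  have hpull : ∀ i, VectorField.mpullback 𝓘(ℝ, Model n) (𝓡 (2 * n)) (par c) (W i) =ᶠ[nhds y]
      fun _ => stdB n i := by
    intro i
    filter_upwards [(isOpen_chartTarget c).mem_nhds hy,
      (contMDiffAt_par hy).continuousAt.eventually hWc] with z hz hz'
    rw [VectorField.mpullback_apply, hz', coordField_par _ hz]
    have hinv : (mfderiv 𝓘(ℝ, Model n) (𝓡 (2 * n)) (par c) z).inverse = dchart c z :=
      ContinuousLinearMap.inverse_eq (ContinuousLinearMap.ext fun v => dpar_dchart hz v)
        (ContinuousLinearMap.ext fun v => dchart_dpar hz v)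
    rw [hinv]
    exact dchart_dpar hz _
  have h2 : VectorField.mlieBracket 𝓘(ℝ, Model n)
      (VectorField.mpullback 𝓘(ℝ, Model n) (𝓡 (2 * n)) (par c) (W i))
      (VectorField.mpullback 𝓘(ℝ, Model n) (𝓡 (2 * n)) (par c) (W j)) y = 0 := by
    rw [(hpull i).mlieBracket_vectorField_eq (hpull j)]
    exact mlieBracket_const _ _ y
  rw [h2, VectorField.mpullback_apply] at h1
  have hinv : (mfderiv 𝓘(ℝ, Model n) (𝓡 (2 * n)) (par c) y).inverse = dchart c y :=
    ContinuousLinearMap.inverse_eq (ContinuousLinearMap.ext fun v => dpar_dchart hy v)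
      (ContinuousLinearMap.ext fun v => dchart_dpar hy v)
  rw [hinv] at h1
  exact (dpar_dchart hy _).symm.trans ((congrArg (dpar c y) h1).trans (map_zero (dpar c y)))

theorem covariantDerivative_sum (nabla : CovariantDerivative (𝓡 (2 * n))
      (EuclideanSpace ℝ (Fin (2 * n))) (fun x : M => TangentSpace (𝓡 (2 * n)) x))
    {ι : Type*} (s : Finset ι) (σ : ι → (x : M) → TangentSpace (𝓡 (2 * n)) x) (x : M)
    (hσ : ∀ i, MDifferentiableAt (𝓡 (2 * n)) (𝓡 (2 * n)).tangent
      (fun x => (⟨x, σ i x⟩ : TangentBundle (𝓡 (2 * n)) M)) x) :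
    nabla (fun x => ∑ i ∈ s, σ i x) x = ∑ i ∈ s, nabla (σ i) x := by
  have hm : IsManifold (𝓡 (2 * n)) 1 M := IsManifold.of_le (n := ∞) (by simp)
  classical
  induction s using Finset.induction_on with
  | empty =>
    simp only [Finset.sum_empty]
    exact congrFun nabla.zero x
  | insert i s hi ih =>
    simp only [Finset.sum_insert hi]
    rw [← ih]
    exact nabla.isCovariantDerivativeOnUniv.add (hσ i)
      (MDifferentiableAt.sum_section fun i _ => hσ i)

variable [T2Space M] [RiemannianBundle (fun x : M => TangentSpace (𝓡 (2 * n)) x)]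
  [IsContMDiffRiemannianBundle (𝓡 (2 * n)) ∞ (EuclideanSpace ℝ (Fin (2 * n)))
    (fun x : M => TangentSpace (𝓡 (2 * n)) x)]

namespace AlmostHermitianStructure

variable (A : AlmostHermitianStructure n M)

theorem contDiffOn_chartJ_clm (c : M) : ContDiffOn ℝ ∞ (A.chartJ c) (chartTarget c) :=
  contDiffOn_clm_apply.mpr fun v => A.contDiffOn_chartJ c v

/-- The derivative of the almost complex structure in the chart at `c`. -/
def chartDJ (c : M) (y : Model n) : Model n →L[ℝ] Model n →L[ℝ] Model n :=
  fderiv ℝ (A.chartJ c) y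

theorem hasFDerivAt_chartJ {c : M} {y : Model n} (hy : y ∈ chartTarget c) :
    HasFDerivAt (A.chartJ c) (A.chartDJ c y) y :=
  (((A.contDiffOn_chartJ_clm c).differentiableOn (by simp)).differentiableAt
    ((isOpen_chartTarget c).mem_nhds hy)).hasFDerivAt

/-- Γ is ∇ of the extended coordinate fields, read in the chart. Metric compatibility, vanishing
torsion with commuting coordinate fields, and the nearly Kähler condition give the three clauses in
this order. -/
theorem exists_christoffel (hA : A.IsNearlyKahler) {c : M} {y : Model n}
    (hy : y ∈ chartTarget c) : ∃ Γ : Model n →L[ℝ] Model n →L[ℝ] Model n,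
      (∀ i j k, fderiv ℝ (fun z => gram c z (stdB n i) (stdB n j)) y (stdB n k) =
        gram c y (Γ (stdB n k) (stdB n i)) (stdB n j) +
          gram c y (stdB n i) (Γ (stdB n k) (stdB n j))) ∧
      (∀ i j, Γ (stdB n i) (stdB n j) = Γ (stdB n j) (stdB n i)) ∧
      ∀ i j, nablaEnd (A.chartJ c y) Γ (A.chartDJ c y) (stdB n i) (stdB n j) =
        -nablaEnd (A.chartJ c y) Γ (A.chartDJ c y) (stdB n j) (stdB n i) := by
  obtain ⟨nabla, ⟨hmet, htor⟩, hNK⟩ := hA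
  obtain ⟨W, hW, hWc⟩ := exists_coordinate_fields hy
  have hm1 : IsManifold (𝓡 (2 * n)) 1 M := IsManifold.of_le (n := ∞) (by simp)
  have hm2 : IsManifold (𝓡 (2 * n)) 2 M :=
    IsManifold.of_le (n := ∞) (WithTop.coe_le_coe.mpr le_top)
  have hr1 : IsContMDiffRiemannianBundle (𝓡 (2 * n)) 1 (EuclideanSpace ℝ (Fin (2 * n)))
      (fun x : M => TangentSpace (𝓡 (2 * n)) x) :=
    IsContMDiffRiemannianBundle.of_le (n := ∞) (by simp)
  have hWd : ∀ j, MDifferentiableAt (𝓡 (2 * n)) (𝓡 (2 * n)).tangent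
      (fun x => (⟨x, W j x⟩ : TangentBundle (𝓡 (2 * n)) M)) (par c y) :=
    fun j => (hW j).mdifferentiable (by simp) (par c y)
  have hWz : ∀ᶠ z in nhds y, ∀ j, W j (par c z) = dpar c z (stdB n j) := by
    filter_upwards [(isOpen_chartTarget c).mem_nhds hy,
      (contMDiffAt_par hy).continuousAt.eventually hWc] with z hz hz' j
    rw [hz', coordField_par _ hz]
  have hWy : ∀ j, W j (par c y) = dpar c y (stdB n j) := hWz.self_of_nhds
  let G : Fin (2 * n) → Model n →L[ℝ] Model n := fun j =>
    (dchart c y).comp ((nabla (W j) (par c y)).comp (dpar c y))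
  let Γ : Model n →L[ℝ] Model n →L[ℝ] Model n := ContinuousLinearMap.flip
    (∑ j, ((stdB n).coord j).toContinuousLinearMap.smulRight (G j))
  have hΓ : ∀ u j, Γ u (stdB n j) = G j u := by
    intro u j
    change (∑ k, ((stdB n).coord k).toContinuousLinearMap.smulRight (G k)) (stdB n j) u = _
    rw [sum_apply, sum_apply, Finset.sum_eq_single j]
    · simp
    · intro k _ hk
      simp [hk.symm]
    · simp
  have hφΓ : ∀ u j, dpar c y (Γ u (stdB n j)) = nabla (W j) (par c y) (dpar c y u) := by
    intro u j
    rw [hΓ]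
    exact dpar_dchart hy _
  refine ⟨Γ, fun i j k => ?_, fun i j => ?_, fun i j => ?_⟩
  · have h1 := hmet.mvfderiv_inner_eq (W k) (hWd i) (hWd j)
    have h2 : MDifferentiableAt (𝓡 (2 * n)) 𝓘(ℝ, ℝ) (fun x => inner ℝ (W i x) (W j x))
        (par c y) := (hWd i).inner_bundle (hWd j)
    have h3 := mvfderiv_comp_apply y h2
      ((contMDiffAt_par hy).mdifferentiableAt (by simp)) (stdB n k)
    have h4 : fderiv ℝ (fun z => gram c z (stdB n i) (stdB n j)) y =
        fderiv ℝ ((fun x => inner ℝ (W i x) (W j x)) ∘ par c) y := by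
      refine Filter.EventuallyEq.fderiv_eq ?_
      filter_upwards [hWz] with z hz
      rw [gram, Function.comp_apply, hz, hz]
    rw [h4]
    simp only [gram, hφΓ]
    rw [← hWy i, ← hWy j, ← hWy k]
    refine Eq.trans ?_ h1
    rw [hWy k]
    refine Eq.trans ?_ h3
    rw [← mfderiv_eq_fderiv]
    rfl
  · have h1 := nabla.torsion_eq_zero_iff.mp htor (hWd i) (hWd j)
    rw [mlieBracket_coordinate_fields hy hW hWc, sub_eq_zero, hWy i, hWy j] at h1
    rw [hΓ, hΓ]
    exact congrArg (dchart c y) h1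
  · have hJW : ∀ j, MDifferentiableAt (𝓡 (2 * n)) (𝓡 (2 * n)).tangent
        (fun x => (⟨x, A.J x (W j x)⟩ : TangentBundle (𝓡 (2 * n)) M)) (par c y) := fun j =>
      (ContMDiff.clm_bundle_apply A.contMDiff (hW j)).mdifferentiable (by simp) (par c y)
    -- The coefficients of J W_j in the coordinate fields, as functions on the manifold. The Leibniz
    -- rule for ∇(J W_j) then produces both Γ and the derivative of J.
    let co : Fin (2 * n) → Fin (2 * n) → M → ℝ := fun j k x =>
      ((stdB n).coord k).toContinuousLinearMap
        (A.chartJ c (extChartAt (𝓡 (2 * n)) c x) (stdB n j))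
    have hext : ∀ z ∈ chartTarget c, extChartAt (𝓡 (2 * n)) c (par c z) = z := fun z hz =>
      (extChartAt (𝓡 (2 * n)) c).right_inv hz
    have hcoy : ∀ j k, co j k (par c y) = (stdB n).repr (A.chartJ c y (stdB n j)) k := by
      intro j k
      simp only [co]
      rw [hext y hy]
      rfl
    have hfd : ∀ j k, HasFDerivAt (fun z => ((stdB n).coord k).toContinuousLinearMap
        (A.chartJ c z (stdB n j))) (((stdB n).coord k).toContinuousLinearMap.comp
          ((ContinuousLinearMap.apply ℝ (Model n) (stdB n j)).comp (A.chartDJ c y))) y :=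
      fun j k => ((stdB n).coord k).toContinuousLinearMap.hasFDerivAt.comp y
        ((ContinuousLinearMap.apply ℝ (Model n) (stdB n j)).hasFDerivAt.comp y
          (A.hasFDerivAt_chartJ hy))
    have hco : ∀ j k, MDifferentiableAt (𝓡 (2 * n)) 𝓘(ℝ, ℝ) (co j k) (par c y) := by
      intro j k
      refine MDifferentiableAt.comp (par c y) (g := fun z => ((stdB n).coord k).toContinuousLinearMap
        (A.chartJ c z (stdB n j))) (f := extChartAt (𝓡 (2 * n)) c) (I' := 𝓘(ℝ, Model n)) ?_
        ((contMDiffAt_chart (par_mem_source hy)).mdifferentiableAt (by simp))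
      rw [hext y hy]
      exact (hfd j k).differentiableAt.mdifferentiableAt
    have hdco : ∀ j k u, mvfderiv (𝓡 (2 * n)) (co j k) (par c y) (dpar c y u) =
        (stdB n).repr (A.chartDJ c y u (stdB n j)) k := by
      intro j k u
      have h3 := mvfderiv_comp_apply y (hco j k)
        ((contMDiffAt_par hy).mdifferentiableAt (by simp)) u
      refine h3.symm.trans ?_
      have h4 : fderiv ℝ (co j k ∘ par c) y = _ :=
        (((hfd j k).congr_of_eventuallyEq (by
          filter_upwards [(isOpen_chartTarget c).mem_nhds hy] with z hz
          simp only [Function.comp_apply, co]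
          rw [hext z hz])).fderiv)
      have h5 : mvfderiv 𝓘(ℝ, Model n) (co j k ∘ par c) y u = fderiv ℝ (co j k ∘ par c) y u := by
        rw [← mfderiv_eq_fderiv]
        rfl
      rw [h5, h4]
      rfl
    have hcoW : ∀ j, ∀ᶠ x in nhds (par c y), A.J x (W j x) = ∑ k, co j k x • W k x := by
      intro j
      filter_upwards [hWc, (isOpen_extChartAt_source c).mem_nhds (par_mem_source hy)] with x hx hx'
      obtain ⟨z, hz, rfl⟩ : ∃ z ∈ chartTarget c, par c z = x :=
        ⟨_, (extChartAt (𝓡 (2 * n)) c).map_source hx', (extChartAt (𝓡 (2 * n)) c).left_inv hx'⟩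
      simp only [hx, coordField_par _ hz, co]
      rw [hext z hz, ← A.dpar_chartJ hz]
      conv_lhs => rw [← (stdB n).sum_repr (A.chartJ c z (stdB n j))]
      rw [map_sum]
      exact Finset.sum_congr rfl fun k _ => map_smul _ _ _
    have hnJ : ∀ j u, nabla (fun x => A.J x (W j x)) (par c y) (dpar c y u) =
        dpar c y (Γ u (A.chartJ c y (stdB n j)) + A.chartDJ c y u (stdB n j)) := by
      intro j u
      have hcW : ∀ k, MDifferentiableAt (𝓡 (2 * n)) (𝓡 (2 * n)).tangent
          (fun x => (⟨x, co j k x • W k x⟩ : TangentBundle (𝓡 (2 * n)) M)) (par c y) :=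
        fun k => (hco j k).smul_section (hWd k)
      have h1 := nabla.isCovariantDerivativeOnUniv.congr_of_eventuallyEq (hJW j)
        (MDifferentiableAt.sum_section fun k (_ : k ∈ Finset.univ) => hcW k) Filter.univ_mem
        (hcoW j)
      have h2 := covariantDerivative_sum nabla Finset.univ (fun k x => co j k x • W k x)
        (par c y) hcW
      have h3 : ∀ k, nabla (fun x => co j k x • W k x) (par c y) (dpar c y u) =
          dpar c y ((stdB n).repr (A.chartJ c y (stdB n j)) k • Γ u (stdB n k) +
            (stdB n).repr (A.chartDJ c y u (stdB n j)) k • stdB n k) := by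
        intro k
        have h4 := nabla.isCovariantDerivativeOnUniv.leibniz (hWd k) (hco j k)
        have h5 := congrArg (fun φ => φ (dpar c y u)) h4
        refine h5.trans ?_
        rw [map_add, map_smul, map_smul, hφΓ, ← hWy, ← hcoy, ← hdco]
        rfl
      refine (congrArg (fun φ => φ (dpar c y u)) (h1.trans h2)).trans ?_
      refine (sum_apply _ _ _).trans ?_
      rw [Finset.sum_congr rfl fun k _ => h3 k, ← map_sum, Finset.sum_add_distrib,
        (stdB n).sum_repr]
      congr 2
      conv_rhs => rw [← (stdB n).sum_repr (A.chartJ c y (stdB n j))]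
      rw [map_sum]
      exact Finset.sum_congr rfl fun k _ => (map_smul _ _ _).symm
    have hend : ∀ i j, dpar c y (nablaEnd (A.chartJ c y) Γ (A.chartDJ c y) (stdB n i) (stdB n j)) =
        nabla (fun x => A.J x (W j x)) (par c y) (W i (par c y)) -
          A.J (par c y) (nabla (W j) (par c y) (W i (par c y))) := by
      intro i j
      rw [hWy i, hnJ, ← hφΓ, ← A.dpar_chartJ hy, ← map_sub, nablaEnd_apply]
      congr 1
      abel
    have h1 := hNK (W i) (W j) (hW i) (hW j) (par c y)
    rw [← hend, ← hend, ← map_neg] at h1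
    have h2 := congrArg (dchart c y) h1
    rwa [dchart_dpar hy, dchart_dpar hy] at h2

end AlmostHermitianStructure

end Christoffel

/-! ### The canonical Hermitian connection at a point of a chart. -/

section LocalConnection

/-- Jacobi's formula: differentiating the permutation sum column by column gives the determinants
with one column replaced, which are Cramer's expressions for the adjugate. -/
theorem hasDerivAt_det {ι : Type*} [Fintype ι] [DecidableEq ι] {G : ℝ → Matrix ι ι ℝ}
    {G' : Matrix ι ι ℝ} {x : ℝ} (hG : ∀ i j, HasDerivAt (fun t => G t i j) (G' i j) x) :
    HasDerivAt (fun t => (G t).det) ((G x).adjugate * G').trace x := by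
  have h1 : HasDerivAt (fun t => ∑ σ : Equiv.Perm ι, ((Equiv.Perm.sign σ : ℤ) : ℝ) *
      ∏ i, G t (σ i) i) (∑ σ : Equiv.Perm ι, ((Equiv.Perm.sign σ : ℤ) : ℝ) *
        ∑ i, (∏ j ∈ Finset.univ.erase i, G x (σ j) j) • G' (σ i) i) x :=
    HasDerivAt.fun_sum fun σ _ => (HasDerivAt.fun_finsetProd fun i _ => hG (σ i) i).const_mul _
  have h2 : (fun t => (G t).det) = fun t => ∑ σ : Equiv.Perm ι, ((Equiv.Perm.sign σ : ℤ) : ℝ) *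
      ∏ i, G t (σ i) i := funext fun t => Matrix.det_apply' _
  rw [h2]
  refine h1.congr_deriv ?_
  have h3 : ∀ i, ((G x).adjugate * G') i i = ∑ σ : Equiv.Perm ι,
      ((Equiv.Perm.sign σ : ℤ) : ℝ) * ((∏ j ∈ Finset.univ.erase i, G x (σ j) j) • G' (σ i) i) := by
    intro i
    have h4 : ((G x).adjugate * G') i i = Matrix.cramer (G x) (fun k => G' k i) i := by
      rw [Matrix.cramer_eq_adjugate_mulVec, Matrix.mul_apply]
      rfl
    rw [h4, Matrix.cramer_apply, Matrix.det_apply']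
    refine Finset.sum_congr rfl fun σ _ => ?_
    rw [← Finset.mul_prod_erase _ _ (Finset.mem_univ i), Matrix.updateCol_self, smul_eq_mul,
      mul_comm (G' (σ i) i)]
    congr 2
    exact Finset.prod_congr rfl fun j hj => Matrix.updateCol_ne (Finset.ne_of_mem_erase hj)
  simp only [Matrix.trace, Matrix.diag_apply, h3, Finset.mul_sum]
  exact Finset.sum_comm

theorem deriv_inverse_eq {ι : Type*} [Fintype ι] [DecidableEq ι] {G γ : ℝ → Matrix ι ι ℝ}
    {G' γ' S : Matrix ι ι ℝ} (hG : ∀ i j, HasDerivAt (fun t => G t i j) (G' i j) 0)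
    (hγ : ∀ i j, HasDerivAt (fun t => γ t i j) (γ' i j) 0)
    (hGγ : ∀ᶠ t in nhds 0, G t * γ t = 1) (hS : G' = S.transpose * G 0 + G 0 * S) :
    γ' = -(S * γ 0 + γ 0 * S.transpose) := by
  have h1 : G' * γ 0 + G 0 * γ' = 0 := by
    ext i j
    have h2 : HasDerivAt (fun t => ∑ k, G t i k * γ t k j)
        (∑ k, (G' i k * γ 0 k j + G 0 i k * γ' k j)) 0 :=
      HasDerivAt.fun_sum fun k _ => (hG i k).mul (hγ k j)
    have h3 : HasDerivAt (fun t => ∑ k, G t i k * γ t k j) 0 0 := by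
      refine (hasDerivAt_const (0 : ℝ) ((1 : Matrix ι ι ℝ) i j)).congr_of_eventuallyEq ?_
      filter_upwards [hGγ] with t ht
      rw [← ht, Matrix.mul_apply]
    rw [Matrix.add_apply, Matrix.mul_apply, Matrix.mul_apply, ← Finset.sum_add_distrib,
      h2.unique h3]
    rfl
  have h2 : G 0 * γ 0 = 1 := hGγ.self_of_nhds
  have h3 : γ 0 * G 0 = 1 := mul_eq_one_comm.mp h2
  have h4 := congrArg (γ 0 * ·) h1
  simp only [hS, Matrix.mul_add, Matrix.add_mul, Matrix.mul_zero, Matrix.mul_assoc, h2] at h4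
  rw [← Matrix.mul_assoc (γ 0) (G 0) (S * γ 0), h3, ← Matrix.mul_assoc (γ 0) (G 0) γ', h3,
    Matrix.one_mul, Matrix.one_mul, Matrix.mul_one] at h4
  rw [eq_neg_iff_add_eq_zero, ← h4]
  abel

/-- With G' = SᵀG + GS, both summands contribute det G · tr S to Jacobi's formula, and the square
root halves the total. Thus the volume density grows at the rate tr S. -/
theorem hasDerivAt_sqrt_det {ι : Type*} [Fintype ι] [DecidableEq ι] {G : ℝ → Matrix ι ι ℝ}
    {G' S : Matrix ι ι ℝ} (hG : ∀ i j, HasDerivAt (fun t => G t i j) (G' i j) 0)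
    (hdet : 0 < (G 0).det) (hS : G' = S.transpose * G 0 + G 0 * S) :
    HasDerivAt (fun t => Real.sqrt (G t).det) (S.trace * Real.sqrt (G 0).det) 0 := by
  refine ((hasDerivAt_det hG).sqrt hdet.ne').congr_deriv ?_
  have h1 : ((G 0).adjugate * G').trace = 2 * (G 0).det * S.trace := by
    rw [hS, Matrix.mul_add, Matrix.trace_add, ← Matrix.mul_assoc, Matrix.trace_mul_comm,
      ← Matrix.mul_assoc, Matrix.mul_adjugate, ← Matrix.mul_assoc, Matrix.adjugate_mul]
    simp only [Matrix.smul_mul, Matrix.one_mul, Matrix.trace_smul, Matrix.trace_transpose,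
      smul_eq_mul]
    ring
  rw [h1]
  have h2 : 0 < Real.sqrt (G 0).det := Real.sqrt_pos.mpr hdet
  have h3 := Real.mul_self_sqrt hdet.le
  field_simp
  rw [sq, h3]
  ring

variable {n : ℕ} {M : Type*} [TopologicalSpace M] [ChartedSpace (Model n) M]
  [RiemannianBundle (fun x : M => TangentSpace (𝓡 (2 * n)) x)]

/-- The metric in the chart at `c`, as a bilinear form. -/
def gramB (c : M) (y : Model n) : Model n →ₗ[ℝ] Model n →ₗ[ℝ] ℝ :=
  (innerₗ (TangentSpace (𝓡 (2 * n)) (par c y))).compl₁₂ (dpar c y).toLinearMap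
    (dpar c y).toLinearMap

theorem gramB_apply (c : M) (y v w : Model n) : gramB c y v w = gram c y v w := rfl

variable [IsManifold (𝓡 (2 * n)) ∞ M] [T2Space M]
  [IsContMDiffRiemannianBundle (𝓡 (2 * n)) ∞ (EuclideanSpace ℝ (Fin (2 * n)))
    (fun x : M => TangentSpace (𝓡 (2 * n)) x)]

theorem hasDerivAt_line {E F : Type*} [NormedAddCommGroup E] [NormedSpace ℝ E]
    [NormedAddCommGroup F] [NormedSpace ℝ F] {φ : E → F} {φ' : E →L[ℝ] F} {y : E}
    (h : HasFDerivAt φ φ' y) (u : E) : HasDerivAt (fun t : ℝ => φ (y + t • u)) (φ' u) 0 := by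
  have h2 : HasDerivAt (fun t : ℝ => y + t • u) u 0 := by
    simpa using ((hasDerivAt_id (0 : ℝ)).smul_const u).const_add y
  exact HasFDerivAt.comp_hasDerivAt (0 : ℝ) (by simpa using h) h2

theorem hasDerivAt_gram {c : M} {y : Model n} (hy : y ∈ chartTarget c)
    {Γ : Model n →L[ℝ] Model n →L[ℝ] Model n}
    (h : ∀ i j k, fderiv ℝ (fun z => gram c z (stdB n i) (stdB n j)) y (stdB n k) =
        gram c y (Γ (stdB n k) (stdB n i)) (stdB n j) +
          gram c y (stdB n i) (Γ (stdB n k) (stdB n j))) (u v w : Model n) :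
    HasDerivAt (fun t : ℝ => gram c (y + t • u) v w)
      (gram c y (Γ u v) w + gram c y v (Γ u w)) 0 := by
  have h1 : ∀ i j u, fderiv ℝ (fun z => gram c z (stdB n i) (stdB n j)) y u =
      gram c y (Γ u (stdB n i)) (stdB n j) + gram c y (stdB n i) (Γ u (stdB n j)) := by
    intro i j u
    have : (fderiv ℝ (fun z => gram c z (stdB n i) (stdB n j)) y).toLinearMap =
        ((gramB c y).flip (stdB n j)).comp (Γ.flip (stdB n i)).toLinearMap +
          (gramB c y (stdB n i)).comp (Γ.flip (stdB n j)).toLinearMap :=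
      (stdB n).ext fun k => h i j k
    exact LinearMap.congr_fun this u
  have h2 : ∀ z, gram c z v w = ∑ i, (stdB n).repr v i * ∑ j, (stdB n).repr w j *
      gram c z (stdB n i) (stdB n j) := by
    intro z
    conv_lhs => rw [← (stdB n).sum_repr v, gram_sum_left]
    refine Finset.sum_congr rfl fun i _ => ?_
    conv_lhs => rw [← (stdB n).sum_repr w, gram_sum_right]
  have h3 : ∀ i j, HasDerivAt (fun t : ℝ => gram c (y + t • u) (stdB n i) (stdB n j))
      (gram c y (Γ u (stdB n i)) (stdB n j) + gram c y (stdB n i) (Γ u (stdB n j))) 0 := by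
    intro i j
    rw [← h1]
    exact hasDerivAt_line (φ := fun z => gram c z (stdB n i) (stdB n j))
      ((((contDiffOn_gram c (stdB n i) (stdB n j)).differentiableOn (by simp)).differentiableAt
        ((isOpen_chartTarget c).mem_nhds hy)).hasFDerivAt) u
  simp only [h2 (_ + _)]
  refine (HasDerivAt.fun_sum fun i _ => (HasDerivAt.fun_sum fun j _ =>
    (h3 i j).const_mul _).const_mul _).congr_deriv ?_
  simp only [mul_add, Finset.sum_add_distrib]
  congr 1
  · conv_rhs => rw [← (stdB n).sum_repr v, ← (stdB n).sum_repr w, gram_sum_right]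
    simp only [map_sum, map_smul, gram_sum_left, Finset.mul_sum]
    rw [Finset.sum_comm]
    exact Finset.sum_congr rfl fun i _ => Finset.sum_congr rfl fun j _ => by ring
  · conv_rhs => rw [← (stdB n).sum_repr v, ← (stdB n).sum_repr w, gram_sum_left]
    simp only [map_sum, map_smul, gram_sum_right]

theorem hasDerivAt_gram_left {c : M} {y u : Model n} {Γ : Model n →L[ℝ] Model n}
    (h : ∀ v w, HasDerivAt (fun t : ℝ => gram c (y + t • u) v w)
      (gram c y (Γ v) w + gram c y v (Γ w)) 0) {X : ℝ → Model n} {X' : Model n}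
    (hX : HasDerivAt X X' 0) (w : Model n) :
    HasDerivAt (fun t : ℝ => gram c (y + t • u) (X t) w)
      (gram c y (Γ (X 0)) w + gram c y (X 0) (Γ w) + gram c y X' w) 0 := by
  have h1 : ∀ z v w, gram c z v w = ∑ i, (stdB n).repr v i * gram c z (stdB n i) w := by
    intro z v w
    conv_lhs => rw [← (stdB n).sum_repr v, gram_sum_left]
  have h2 : ∀ i, HasDerivAt (fun t => (stdB n).repr (X t) i) ((stdB n).repr X' i) 0 := fun i =>
    ((stdB n).coord i).toContinuousLinearMap.hasFDerivAt.comp_hasDerivAt (0 : ℝ) hX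
  simp only [h1 (_ + _) (X _)]
  refine (HasDerivAt.fun_sum fun i _ => (h2 i).mul (h (stdB n i) w)).congr_deriv ?_
  rw [h1 y X' w, h1 y (X 0) (Γ w)]
  have h3 : gram c y (Γ (X 0)) w = ∑ i, (stdB n).repr (X 0) i * gram c y (Γ (stdB n i)) w := by
    conv_lhs => rw [← (stdB n).sum_repr (X 0), map_sum]
    simp only [map_smul, gram_sum_left]
  rw [h3, ← Finset.sum_add_distrib, ← Finset.sum_add_distrib]
  refine Finset.sum_congr rfl fun i _ => ?_
  simp only [zero_smul, add_zero]
  ring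

namespace AlmostHermitianStructure

variable (A : AlmostHermitianStructure n M)

theorem exists_hermitian_connection (hA : A.IsNearlyKahler) {c : M} {y : Model n}
    (hy : y ∈ chartTarget c) : ∃ B : Model n →L[ℝ] Model n →L[ℝ] Model n,
      (∀ u v, HasDerivAt (fun t : ℝ => A.chartJ c (y + t • u) v)
        (A.chartJ c y (B u v) - B u (A.chartJ c y v)) 0) ∧
      (∀ u, IsParallelInv (stdB n) (B u) fun t => gamma c (y + t • u)) ∧
      (∀ u, HasDerivAt (fun t : ℝ => vol c (y + t • u))
        (LinearMap.trace ℝ (Model n) (B u).toLinearMap * vol c y) 0) ∧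
      (∀ i j k, torsR (frame hy) B i j k = -torsR (frame hy) B i k j) ∧
      ∀ i j k, torsJ (frame hy) (A.chartJ c y) B i j k =
        -torsJ (frame hy) (A.chartJ c y) B i k j := by
  obtain ⟨Γ, hΓg, hΓb, hNb⟩ := A.exists_christoffel hA hy
  set J := A.chartJ c y with hJdef
  set DJ := A.chartDJ c y with hDJdef
  have hJ : ∀ v, J (J v) = -v := A.chartJ_chartJ hy
  have hgJ : ∀ v w, gram c y (J v) w = -gram c y v (J w) := fun v w => by
    rw [A.gram_chartJ_swap hy, gram_comm]
  have hgl : ∀ (r s : ℝ) (v v' w : Model n),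
      gram c y (r • v + s • v') w = r * gram c y v w + s * gram c y v' w := by
    intro r s v v' w
    simp only [← gramB_apply, map_add, map_smul, LinearMap.add_apply, LinearMap.smul_apply,
      smul_eq_mul]
  have hgr : ∀ (r s : ℝ) (v v' w : Model n),
      gram c y w (r • v + s • v') = r * gram c y w v + s * gram c y w v' := by
    intro r s v v' w
    simp only [← gramB_apply, map_add, map_smul, smul_eq_mul]
  have hJd : ∀ u v, HasDerivAt (fun t : ℝ => A.chartJ c (y + t • u) v) (DJ u v) 0 := fun u v =>
    hasDerivAt_line (φ := fun z => A.chartJ c z v)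
      ((ContinuousLinearMap.apply ℝ (Model n) v).hasFDerivAt.comp y (A.hasFDerivAt_chartJ hy)) u
  have hline : ∀ u : Model n, ∀ᶠ t : ℝ in nhds 0, y + t • u ∈ chartTarget c := by
    intro u
    have h1 : ContinuousAt (fun t : ℝ => y + t • u) 0 := by fun_prop
    exact h1.eventually ((isOpen_chartTarget c).mem_nhds (by simpa using hy))
  have hDJ : ∀ u v, DJ u (J v) + J (DJ u v) = 0 := by
    intro u v
    have h1 := hasDerivAt_line (A.hasFDerivAt_chartJ hy) u
    have h2 := h1.clm_apply (hJd u v)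
    have h3 : HasDerivAt (fun t : ℝ => A.chartJ c (y + t • u) (A.chartJ c (y + t • u) v)) 0 0 := by
      refine (hasDerivAt_const (0 : ℝ) (-v)).congr_of_eventuallyEq ?_
      filter_upwards [hline u] with t ht
      exact A.chartJ_chartJ ht v
    have h4 := h2.unique h3
    simpa only [zero_smul, add_zero] using h4
  have hgd := fun u => hasDerivAt_gram hy hΓg u
  have hΓ : ∀ u v, Γ u v = Γ v u := by
    intro u v
    have : (ContinuousLinearMap.coeLM ℝ : (Model n →L[ℝ] Model n) →ₗ[ℝ] _).comp Γ.toLinearMap =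
        (ContinuousLinearMap.coeLM ℝ : (Model n →L[ℝ] Model n) →ₗ[ℝ] _).comp
          Γ.flip.toLinearMap :=
      (stdB n).ext fun i => (stdB n).ext fun j => hΓb i j
    exact LinearMap.congr_fun (LinearMap.congr_fun this u) v
  have hN : ∀ u v, nablaEnd J Γ DJ u v = -nablaEnd J Γ DJ v u := by
    intro u v
    have : (ContinuousLinearMap.coeLM ℝ : (Model n →L[ℝ] Model n) →ₗ[ℝ] _).comp
        (nablaEnd J Γ DJ).toLinearMap =
        (ContinuousLinearMap.coeLM ℝ : (Model n →L[ℝ] Model n) →ₗ[ℝ] _).comp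
          (-(nablaEnd J Γ DJ).flip).toLinearMap :=
      (stdB n).ext fun i => (stdB n).ext fun j => hNb i j
    exact LinearMap.congr_fun (LinearMap.congr_fun this u) v
  -- Differentiate the identity g(Jv,w) + g(Jw,v) = 0 along the line through y.
  have hgN : ∀ u v w, gram c y (nablaEnd J Γ DJ u v) w = -gram c y v (nablaEnd J Γ DJ u w) := by
    intro u v w
    have h1 := hasDerivAt_gram_left (hgd u) (hJd u v) w
    have h2 := hasDerivAt_gram_left (hgd u) (hJd u w) v
    have h3 : HasDerivAt (fun t : ℝ => gram c (y + t • u) (A.chartJ c (y + t • u) v) w +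
        gram c (y + t • u) (A.chartJ c (y + t • u) w) v) 0 0 := by
      refine (hasDerivAt_const (0 : ℝ) (0 : ℝ)).congr_of_eventuallyEq ?_
      filter_upwards [hline u] with t ht
      rw [A.gram_chartJ_swap ht v w, neg_add_cancel]
    have h4 := (h1.add h2).unique h3
    simp only [zero_smul, add_zero] at h4
    have h5 := hgJ v (Γ u w)
    have h6 := hgJ w (Γ u v)
    have h7 : ∀ v w, gram c y (nablaEnd J Γ DJ u v) w =
        gram c y (DJ u v) w + gram c y (Γ u (J v)) w - gram c y (J (Γ u v)) w := by
      intro v w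
      simp only [nablaEnd_apply, ← gramB_apply, map_add, map_sub, LinearMap.add_apply,
        LinearMap.sub_apply]
    rw [gram_comm c y v, h7, h7]
    simp only [← hJdef] at h4
    have h8 := gram_comm c y v (J (Γ u w))
    have h9 := gram_comm c y w (J (Γ u v))
    linarith
  have hgB : ∀ u v w, HasDerivAt (fun t : ℝ => gram c (y + t • u) v w)
      (gram c y (hermConn J Γ DJ u v) w + gram c y v (hermConn J Γ DJ u w)) 0 := by
    intro u v w
    rw [gram_hermConn hJ hDJ hgJ hgN hgl hgr]
    exact hgd u v w
  have hf : ∀ v i, (frame hy).repr v i = gram c y v (frame hy i) := fun v i => by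
    rw [frame_repr_eq_gram, gram_comm]
  have hGd : ∀ u i j, HasDerivAt (fun t : ℝ => gramM c (y + t • u) i j)
      (((Matrix.of fun i j => matOf (stdB n) (hermConn J Γ DJ u) i j).transpose * gramM c y +
        gramM c y * Matrix.of fun i j => matOf (stdB n) (hermConn J Γ DJ u) i j) i j) 0 := by
    intro u i j
    refine (hgB u (stdB n i) (stdB n j)).congr_deriv ?_
    rw [apply_eq_sum_matOf _ _ i, apply_eq_sum_matOf _ _ j, gram_sum_left, gram_sum_right,
      Matrix.add_apply, Matrix.mul_apply, Matrix.mul_apply]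
    congr 1
    exact Finset.sum_congr rfl fun k _ => mul_comm _ _
  have htr : ∀ u, LinearMap.trace ℝ (Model n) (hermConn J Γ DJ u).toLinearMap =
      (Matrix.of fun i j => matOf (stdB n) (hermConn J Γ DJ u) i j).trace := by
    intro u
    rw [LinearMap.trace_eq_matrix_trace ℝ (stdB n)]
    congr 1
    ext i j
    rw [LinearMap.toMatrix_apply]
    rfl
  refine ⟨hermConn J Γ DJ, fun u v => ?_, fun u i j => ?_, fun u => ?_, ?_, ?_⟩
  · rw [hermConn_comm_J hJ hDJ]
    exact hJd u v
  · have h1 : ∀ i j, HasDerivAt (fun t : ℝ => gamma c (y + t • u) i j)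
        (fderiv ℝ (fun z => gamma c z i j) y u) 0 := fun i j =>
      hasDerivAt_line (φ := fun z => gamma c z i j)
        ((((contDiffOn_gamma c i j).differentiableOn (by simp)).differentiableAt
          ((isOpen_chartTarget c).mem_nhds hy)).hasFDerivAt) u
    have h2 := deriv_inverse_eq (G := fun t => gramM c (y + t • u))
      (γ := fun t => (gramM c (y + t • u))⁻¹)
      (S := Matrix.of fun i j => matOf (stdB n) (hermConn J Γ DJ u) i j)
      (γ' := Matrix.of fun i j => fderiv ℝ (fun z => gamma c z i j) y u) (hGd u) h1
      (by
        filter_upwards [hline u] with t ht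
        exact Matrix.mul_nonsing_inv _ (isUnit_iff_ne_zero.mpr (det_gramM_pos ht).ne'))
      (by simp only [zero_smul, add_zero])
    refine (h1 i j).congr_deriv ?_
    have h3 := congrFun (congrFun h2 i) j
    rw [Matrix.of_apply] at h3
    rw [h3, Matrix.neg_apply, Matrix.add_apply, Matrix.mul_apply, Matrix.mul_apply,
      ← Finset.sum_add_distrib]
    rfl
  · have h1 := hasDerivAt_sqrt_det (G := fun t => gramM c (y + t • u))
      (S := Matrix.of fun i j => matOf (stdB n) (hermConn J Γ DJ u) i j) (hGd u)
      (by simpa using det_gramM_pos hy) (by simp only [zero_smul, add_zero])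
    refine h1.congr_deriv ?_
    rw [htr, zero_smul, add_zero]
    rfl
  · exact torsR_hermConn hJ hDJ hΓ hN hgJ hgN hgr hf (gram_comm c y)
  · exact torsJ_hermConn hJ hDJ hΓ hN hgJ hgN hgr hf (gram_comm c y)
      (fun r w => gram_sum_right _ _ _ _ _ _)

end AlmostHermitianStructure

end LocalConnection

/-! ### Local formulas for the components of `d` -/

section LocalFormulas

theorem HasD.unique {E : Type*} [NormedAddCommGroup E] [NormedSpace ℝ E] {a : ℝ → Fib E}
    {a' a'' : Fib E} (h : HasD a a') (h' : HasD a a'') : a' = a'' :=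
  Fib.ext_apply fun k w => (h k w).unique (h' k w)

theorem wedgeLeft_oneFib_apply_of_ne {E : Type*} [NormedAddCommGroup E] [NormedSpace ℝ E] {p m : ℕ}
    (β : E [⋀^Fin p]→L[ℝ] ℂ) (hm : m ≠ p) : wedgeLeft β (oneFib E) m = 0 := by
  rcases lt_or_ge m p with h | h
  · exact wedgeLeft_apply_of_lt h _ _
  · obtain ⟨l, rfl⟩ := Nat.exists_eq_add_of_le h
    cases l with
    | zero => exact absurd rfl hm
    | succ l =>
      rw [wedgeLeft_apply_of_eq (l := l + 1) rfl]
      change wedge rfl β ((0 : Fib E) (l + 1)) = 0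
      rw [← wedgeLeft_apply_of_eq rfl, map_zero]
      rfl

variable {n : ℕ} {M : Type*} [TopologicalSpace M] [ChartedSpace (Model n) M]
  [RiemannianBundle (fun x : M => TangentSpace (𝓡 (2 * n)) x)] [IsManifold (𝓡 (2 * n)) ∞ M]

namespace AlmostHermitianStructure

variable (A : AlmostHermitianStructure n M)

/-- `B` is the matrix at `y` of a Hermitian connection with totally skew-symmetric torsion of
type `(3,0) + (0,3)`, in the chart at `c`. -/
structure IsHermConn {c : M} {y : Model n} (hy : y ∈ chartTarget c)
    (B : Model n →L[ℝ] Model n →L[ℝ] Model n) : Prop where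
  hasDerivAt_J : ∀ u v, HasDerivAt (fun t : ℝ => A.chartJ c (y + t • u) v)
    (A.chartJ c y (B u v) - B u (A.chartJ c y v)) 0
  isParallelInv : ∀ u, IsParallelInv (stdB n) (B u) fun t => gamma c (y + t • u)
  hasDerivAt_vol : ∀ u, HasDerivAt (fun t : ℝ => vol c (y + t • u))
    (LinearMap.trace ℝ (Model n) (B u).toLinearMap * vol c y) 0
  torsR_skew : ∀ i j k, torsR (frame hy) B i j k = -torsR (frame hy) B i k j
  torsJ_skew : ∀ i j k, torsJ (frame hy) (A.chartJ c y) B i j k =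
    -torsJ (frame hy) (A.chartJ c y) B i k j

/-- The covariant derivative of a form in a chart. -/
def nab (B : Model n →L[ℝ] Model n →L[ℝ] Model n) (c : M) (α : Form n M) (y u : Model n) :
    Fib (Model n) :=
  dd (rep c α) y u - rho (stdB n) (B u) (rep c α y)

variable {A} {c : M} {y : Model n} {hy : y ∈ chartTarget c}
  {B : Model n →L[ℝ] Model n →L[ℝ] Model n}

theorem hasNab_rep {α : Form n M} (hα : IsSmooth α) (hy : y ∈ chartTarget c) (u : Model n) :
    HasNab (stdB n) (B u) (fun t : ℝ => rep c α (y + t • u)) (nab B c α y u) := by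
  have h := (isSmooth_iff.mp hα c).hasD (isOpen_chartTarget c) hy u
  rw [HasNab, zero_smul, add_zero, nab, sub_add_cancel]
  exact h

theorem rho_sum_smul {ι κ E : Type*} [NormedAddCommGroup E] [NormedSpace ℝ E]
    [FiniteDimensional ℝ E] [Fintype ι] (b : Module.Basis ι ℝ E) (s : Finset κ) (r : κ → ℝ)
    (S : κ → E →L[ℝ] E) : rho b (∑ i ∈ s, r i • S i) = ∑ i ∈ s, (r i : ℂ) • rho b (S i) := by
  simp only [rho, Finset.smul_sum]
  rw [Finset.sum_comm]
  refine Finset.sum_congr rfl fun j _ => ?_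
  have : (coordC b j).comp (∑ i ∈ s, r i • S i) =
      ∑ i ∈ s, (r i : ℂ) • (coordC b j).comp (S i) := by
    ext v
    simp only [ContinuousLinearMap.comp_apply, sum_apply, smul_apply, map_sum, map_smul]
    rfl
  rw [this, eps_sum, Finset.sum_mul]
  exact Finset.sum_congr rfl fun i _ => by rw [eps_smul, smul_mul_assoc]

theorem nab_eq_sum (f : Module.Basis (Fin (2 * n)) ℝ (Model n)) (α : Form n M) (u : Model n) :
    nab B c α y u = ∑ j, coordC f j u • nab B c α y (f j) := by
  have h1 : dd (rep c α) y u = ∑ j, coordC f j u • dd (rep c α) y (f j) := by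
    refine Fib.ext_apply fun k w => ?_
    rw [Fib.sum_apply_apply]
    conv_lhs => rw [← f.sum_repr u, dd, map_sum]
    simp only [map_smul]
    exact ContinuousAlternatingMap.sum_apply _ _
  have h2 : rho (stdB n) (B u) = ∑ j, coordC f j u • rho (stdB n) (B (f j)) := by
    conv_lhs => rw [← f.sum_repr u, map_sum]
    simp only [map_smul, rho_sum_smul]
    rfl
  simp only [nab, smul_sub, Finset.sum_sub_distrib]
  rw [← h1, h2, LinearMap.sum_apply]
  rfl

theorem IsHermConn.hasNab_typeEnd (hB : A.IsHermConn hy B) {α : Form n M} (hα : IsSmooth α)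
    (p : ℤ) (u : Model n) :
    HasNab (stdB n) (B u) (fun t : ℝ => typeEnd (A.chartJ c (y + t • u)) p (rep c α (y + t • u)))
      (typeEnd (A.chartJ c y) p (nab B c α y u)) := by
  have h := HasNab.typeEnd (J := fun t : ℝ => A.chartJ c (y + t • u)) (fun v => by
    simpa only [zero_smul, add_zero] using hB.hasDerivAt_J u v) p (hasNab_rep (B := B) hα hy u)
  simpa only [zero_smul, add_zero] using h

variable [IsContMDiffRiemannianBundle (𝓡 (2 * n)) ∞ (EuclideanSpace ℝ (Fin (2 * n)))
      (fun x : M => TangentSpace (𝓡 (2 * n)) x)]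

/-- Replace partial by covariant derivatives in d = Σ ε^j ∂_j. The type projection passes through
the covariant derivative since J is parallel; the connection matrices remain as the second sum,
which is the torsion operator. -/
theorem IsHermConn.extDerivF_typeEnd (hB : A.IsHermConn hy B) {α : Form n M} (hα : IsSmooth α)
    (p : ℤ) : extDerivF (fun z => typeEnd (A.chartJ c z) p (rep c α z)) y =
      ∑ j, epsB (frame hy) j (typeEnd (A.chartJ c y) p (nab B c α y (frame hy j))) +
      ∑ j, epsB (frame hy) j (rho (frame hy) (B (frame hy j))
        (typeEnd (A.chartJ c y) p (rep c α y))) := by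
  rw [extDerivF_eq (frame hy), ← Finset.sum_add_distrib]
  refine Finset.sum_congr rfl fun j _ => ?_
  rw [← map_add]
  refine congrArg _ ?_
  have hs : SmoothF (chartTarget c) fun z => typeEnd (A.chartJ c z) p (rep c α z) :=
    (isSmooth_iff.mp hα c).typeEnd (A.contDiffOn_chartJ c) p
  refine (hs.hasD (isOpen_chartTarget c) hy _).unique ?_
  have h := hB.hasNab_typeEnd hα p (frame hy j)
  rw [HasNab, zero_smul, add_zero, rho_eq_rho (stdB n) (frame hy)] at h
  exact h

/-- The four pieces shift p by 1, 0, 2 and −1, so selecting bidegree (a,b) picks at most one of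
them. The first order pieces are then rewritten in the standard basis, which does not vary with the
point. -/
theorem IsHermConn.rep_dPart (hB : A.IsHermConn hy B) {α : Form n M} (hα : IsSmooth α) (a b : ℤ)
    (hab : a + b = 1) : rep c (A.dPart a b α) y =
      (if a = 1 then ∑ j, epsT Complex.I (A.chartJ c y) (coordC (stdB n) j)
        (nab B c α y (stdB n j)) else 0) +
      (if a = 0 then ∑ j, epsT (-Complex.I) (A.chartJ c y) (coordC (stdB n) j)
        (nab B c α y (stdB n j)) else 0) +
      (if a = 2 then torsOp (frame hy) (A.chartJ c y) B Complex.I (rep c α y) else 0) +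
      (if a = -1 then torsOp (frame hy) (A.chartJ c y) B (-Complex.I) (rep c α y) else 0) := by
  refine Fib.ext_apply fun k w => ?_
  rw [A.rep_dPart a b hab hα hy]
  simp only [hB.extDerivF_typeEnd hα]
  rw [sum_typeEnd_extd (frame hy) (A.chartJ c y) B (A.chartJ_chartJ hy) (A.matOf_chartJ_swap hy)
    hB.torsR_skew hB.torsJ_skew]
  have h : ∀ r, ∑ j, epsT r (A.chartJ c y) (coordC (frame hy) j) (nab B c α y (frame hy j)) =
      ∑ j, epsT r (A.chartJ c y) (coordC (stdB n) j) (nab B c α y (stdB n j)) :=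
    sum_epsT_eq (nab B c α y) (nab_eq_sum (frame hy) α)
  rw [h, h]

theorem IsHermConn.rep_mu (hB : A.IsHermConn hy B) {α : Form n M} (hα : IsSmooth α) :
    rep c (A.mu α) y = torsOp (frame hy) (A.chartJ c y) B Complex.I (rep c α y) := by
  rw [mu, hB.rep_dPart hα 2 (-1) (by norm_num)]
  norm_num

theorem IsHermConn.rep_mubar (hB : A.IsHermConn hy B) {α : Form n M} (hα : IsSmooth α) :
    rep c (A.mubar α) y = torsOp (frame hy) (A.chartJ c y) B (-Complex.I) (rep c α y) := by
  rw [mubar, hB.rep_dPart hα (-1) 2 (by norm_num)]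
  norm_num

theorem IsHermConn.rep_del (hB : A.IsHermConn hy B) {α : Form n M} (hα : IsSmooth α) :
    rep c (A.del α) y = ∑ j, epsT Complex.I (A.chartJ c y) (coordC (stdB n) j)
        (nab B c α y (stdB n j)) := by
  rw [del, hB.rep_dPart hα 1 0 (by norm_num)]
  norm_num

theorem IsHermConn.rep_delbar (hB : A.IsHermConn hy B) {α : Form n M} (hα : IsSmooth α) :
    rep c (A.delbar α) y = ∑ j, epsT (-Complex.I) (A.chartJ c y) (coordC (stdB n) j)
        (nab B c α y (stdB n j)) := by
  rw [delbar, hB.rep_dPart hα 0 1 (by norm_num)]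
  norm_num

theorem fundamentalForm_frame (hy : y ∈ chartTarget c) (i j : Fin (2 * n)) :
    rep c A.fundamentalForm y 2 ![frame hy i, frame hy j] =
      matC (frame hy) (A.chartJ c y) j i := by
  rw [A.rep_fundamentalForm c hy, matC, A.matOf_chartJ hy]
  rfl

theorem rep_fundamentalForm_eq :
    rep c A.fundamentalForm y = wedgeLeft (rep c A.fundamentalForm y 2) (oneFib (Model n)) := by
  refine Fib.ext fun k => ?_
  by_cases hk : k = 2
  · subst hk
    exact (wedgeLeft_oneFib_apply _).symm
  · rw [wedgeLeft_oneFib_apply_of_ne _ hk, rep_apply, chartRep, A.fundamentalForm_apply_eq_zero hk]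
    rfl

theorem rep_lefschetz (hy : y ∈ chartTarget c) (α : Form n M) : rep c (A.lefschetz α) y =
    lefL (matC (frame hy) (A.chartJ c y)) (epsB (frame hy)) (rep c α y) := by
  rw [lefschetz, rep_mulLeft (p := 2) fun k hk => A.fundamentalForm_apply_eq_zero hk]
  rw [wedgeLeft_eq_lefL _ (fundamentalForm_frame hy)]

theorem isSmooth_lefschetz {α : Form n M} (hα : IsSmooth α) : IsSmooth (A.lefschetz α) :=
  isSmooth_mulLeft (p := 2) (fun _ hk => A.fundamentalForm_apply_eq_zero hk)
    A.isSmooth_fundamentalForm hα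

theorem dPart_fundamentalForm_apply_eq_zero (a b : ℤ) {k : ℕ} (hk : k ≠ 3) :
    A.dPart a b A.fundamentalForm k = 0 :=
  A.dPart_apply_eq_zero a b (p := 2) (fun _ hk => A.fundamentalForm_apply_eq_zero hk) hk

theorem isSmooth_mulLeft_dPart (a b : ℤ) {α : Form n M} (hα : IsSmooth α) :
    IsSmooth (mulLeft (A.dPart a b A.fundamentalForm) α) :=
  isSmooth_mulLeft (p := 3) (fun _ hk => dPart_fundamentalForm_apply_eq_zero a b hk)
    (A.isSmooth_dPart _ _ A.isSmooth_fundamentalForm) hα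

theorem wedgeLeft_torsOp_fundamentalForm (B : Model n →L[ℝ] Model n →L[ℝ] Model n) {r : ℂ}
    (hr : r * r = -1) :
    wedgeLeft (torsOp (frame hy) (A.chartJ c y) B r (rep c A.fundamentalForm y) 3) =
      -(r / 2) • tri (torsC (frame hy) (A.chartJ c y) B r) (epsB (frame hy)) (epsB (frame hy))
        (epsB (frame hy)) :=
  wedgeLeft_torsOp (A.chartJ_chartJ hy) (A.matOf_chartJ_swap hy) B hr _
    (fundamentalForm_frame hy) _ rep_fundamentalForm_eq

theorem IsHermConn.rep_mulLeft_mu (hB : A.IsHermConn hy B) (α : Form n M) :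
    rep c (mulLeft (A.mu A.fundamentalForm) α) y =
      (-(Complex.I / 2) • tri (torsC (frame hy) (A.chartJ c y) B Complex.I) (epsB (frame hy))
        (epsB (frame hy)) (epsB (frame hy)) : Module.End ℂ (Fib (Model n))) (rep c α y) := by
  have h : ∀ k ≠ 3, A.mu A.fundamentalForm k = 0 := fun k hk =>
    dPart_fundamentalForm_apply_eq_zero 2 (-1) hk
  rw [rep_mulLeft h,
    hB.rep_mu A.isSmooth_fundamentalForm,
    wedgeLeft_torsOp_fundamentalForm B Complex.I_mul_I]

theorem IsHermConn.rep_mulLeft_mubar (hB : A.IsHermConn hy B) (α : Form n M) :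
    rep c (mulLeft (A.mubar A.fundamentalForm) α) y =
      (-(-Complex.I / 2) • tri (torsC (frame hy) (A.chartJ c y) B (-Complex.I)) (epsB (frame hy))
        (epsB (frame hy)) (epsB (frame hy)) : Module.End ℂ (Fib (Model n))) (rep c α y) := by
  have h : ∀ k ≠ 3, A.mubar A.fundamentalForm k = 0 := fun k hk =>
    dPart_fundamentalForm_apply_eq_zero (-1) 2 hk
  rw [rep_mulLeft h,
    hB.rep_mubar A.isSmooth_fundamentalForm,
    wedgeLeft_torsOp_fundamentalForm B (by rw [neg_mul_neg, Complex.I_mul_I])]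

variable (A)

/-- The dual Lefschetz operator, in terms of an orthonormal basis. -/
def lamOp : Operator n M := fun α k x =>
  ((1 / 2 : ℂ) • ∑ i, iota (A.J x (onb n x i)) (iota (onb n x i) (fib α x))) k

theorem rep_lamOp {c : M} {y : Model n} (hy : y ∈ chartTarget c) (α : Form n M) :
    rep c (A.lamOp α) y = lefΛ (matC (frame hy) (A.chartJ c y)) (iotaB (frame hy)) (rep c α y) := by
  have h1 : rep c (A.lamOp α) y = pull (dpar c y) ((1 / 2 : ℂ) • ∑ i,
    iota (A.J (par c y) (onb n (par c y) i)) (iota (onb n (par c y) i) (fib α (par c y)))) := rfl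
  rw [h1, map_smul, map_sum, lefΛ, LinearMap.smul_apply, LinearMap.sum_apply]
  congr 1
  refine Finset.sum_congr rfl fun i _ => ?_
  rw [← dpar_frame hy i]
  refine Eq.trans (congrArg (fun v => pull (dpar c y)
    (iota v (iota (dpar c y (frame hy i)) (fib α (par c y))))) (A.dpar_chartJ hy (frame hy i)).symm)
    ?_
  rw [pull_iota, pull_iota, iota_J_basis (frame hy)]
  rfl

theorem rep_lamOp_eq_lam {c : M} {y : Model n} (hy : y ∈ chartTarget c) (α : Form n M) :
    rep c (A.lamOp α) y = lam (stdB n) (gamma c y) (A.chartJ c y) (rep c α y) := by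
  rw [A.rep_lamOp hy, (isFrame_gamma hy).lam_eq]

theorem isSmooth_lamOp {α : Form n M} (hα : IsSmooth α) : IsSmooth (A.lamOp α) :=
  isSmooth_iff.mpr fun c => ((isSmooth_iff.mp hα c).lam (contDiffOn_gamma c)
    (A.contDiffOn_chartJ c)).congr fun _ hz => A.rep_lamOp_eq_lam hz α

end AlmostHermitianStructure

end LocalFormulas

/-! ### The local divergence identity -/

section LocalDivergence

variable {n : ℕ} {M : Type*} [TopologicalSpace M] [ChartedSpace (Model n) M]
  [RiemannianBundle (fun x : M => TangentSpace (𝓡 (2 * n)) x)] [IsManifold (𝓡 (2 * n)) ∞ M]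
  [IsContMDiffRiemannianBundle (𝓡 (2 * n)) ∞ (EuclideanSpace ℝ (Fin (2 * n)))
      (fun x : M => TangentSpace (𝓡 (2 * n)) x)]

namespace AlmostHermitianStructure

theorem exists_isHermConn [T2Space M] (A : AlmostHermitianStructure n M) (hA : A.IsNearlyKahler)
    {c : M} {y : Model n} (hy : y ∈ chartTarget c) : ∃ B, A.IsHermConn hy B := by
  obtain ⟨B, h1, h2, h3, h4, h5⟩ := A.exists_hermitian_connection hA hy
  exact ⟨B, h1, h2, h3, h4, h5⟩

variable {A : AlmostHermitianStructure n M} {c : M} {y : Model n} {hy : y ∈ chartTarget c}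
  {B : Model n →L[ℝ] Model n →L[ℝ] Model n}

/-- Λ is built from J and the inverse metric, both parallel. The formula for Λ in charts is
available only on the target, hence the comparison of the two curves near 0. -/
theorem IsHermConn.nab_lamOp (hB : A.IsHermConn hy B) {α : Form n M} (hα : IsSmooth α)
    (u : Model n) :
    nab B c (A.lamOp α) y u = lam (stdB n) (gamma c y) (A.chartJ c y) (nab B c α y u) := by
  have h1 := HasNab.lam (J := fun t : ℝ => A.chartJ c (y + t • u)) (fun v => by
    simpa only [zero_smul, add_zero] using hB.hasDerivAt_J u v) (hB.isParallelInv u)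
    (hasNab_rep (B := B) hα hy u)
  have h2 := hasNab_rep (B := B) (A.isSmooth_lamOp hα) hy u
  have h3 : ∀ᶠ t : ℝ in nhds 0, y + t • u ∈ chartTarget c := by
    have h4 : ContinuousAt (fun t : ℝ => y + t • u) 0 := by fun_prop
    exact h4.eventually ((isOpen_chartTarget c).mem_nhds (by simpa using hy))
  have h4 : HasD (fun t : ℝ => rep c (A.lamOp α) (y + t • u))
      (lam (stdB n) (gamma c (y + (0 : ℝ) • u)) (A.chartJ c (y + (0 : ℝ) • u)) (nab B c α y u) +
        rho (stdB n) (B u) (lam (stdB n) (gamma c (y + (0 : ℝ) • u))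
          (A.chartJ c (y + (0 : ℝ) • u)) (rep c α (y + (0 : ℝ) • u)))) := by
    intro k w
    refine (h1 k w).congr_of_eventuallyEq ?_
    filter_upwards [h3] with t ht
    rw [A.rep_lamOp_eq_lam ht]
  have h5 := h2.unique h4
  simp only [zero_smul, add_zero] at h5
  rw [A.rep_lamOp_eq_lam hy] at h5
  exact add_right_cancel h5

/-- The components of the vector field whose divergence compares `∂` or `∂̄` with its adjoint. -/
def flux (A : AlmostHermitianStructure n M) (r : ℂ) (c : M) (α β : Form n M) (j : Fin (2 * n))
    (z : Model n) : ℂ :=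
  hermG (stdB n) (gamma c z) (epsT r (A.chartJ c z) (coordC (stdB n) j) (rep c α z)) (rep c β z)

theorem contDiffOn_flux (r : ℂ) (c : M) {α β : Form n M} (hα : IsSmooth α) (hβ : IsSmooth β)
    (j : Fin (2 * n)) : ContDiffOn ℝ ∞ (A.flux r c α β j) (chartTarget c) :=
  SmoothF.hermG (contDiffOn_gamma c)
    ((isSmooth_iff.mp hα c).epsT (A.contDiffOn_chartJ c) r (coordC (stdB n) j))
    (isSmooth_iff.mp hβ c)

theorem contDiffOn_vol_mul_flux (r : ℂ) (c : M) {α β : Form n M} (hα : IsSmooth α)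
    (hβ : IsSmooth β) (j : Fin (2 * n)) :
    ContDiffOn ℝ ∞ (fun z => (vol c z : ℂ) * A.flux r c α β j z) (chartTarget c) :=
  (Complex.ofRealCLM.contDiff.comp_contDiffOn (contDiffOn_vol c)).mul
    (contDiffOn_flux r c hα hβ j)

theorem sum_br_apply {R V κ : Type*} [CommRing R] [AddCommGroup V] [Module R V] [Fintype κ]
    (Λ : Module.End R V) (P : κ → Module.End R V) (x : κ → V) :
    ∑ j, br Λ (P j) (x j) = Λ (∑ j, P j (x j)) - ∑ j, P j (Λ (x j)) := by
  rw [map_sum, ← Finset.sum_sub_distrib]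
  rfl

theorem IsHermConn.sum_fderiv_flux (hB : A.IsHermConn hy B) {r : ℂ} (hr : r * r = -1)
    (hrc : conj r = -r) {α β : Form n M} (hα : IsSmooth α) (hβ : IsSmooth β) :
    ∑ j, fderiv ℝ (fun z => (vol c z : ℂ) * A.flux r c α β j z) y (stdB n j) =
      vol c y * (hermG (stdB n) (gamma c y)
        (∑ j, epsT r (A.chartJ c y) (coordC (stdB n) j) (nab B c α y (stdB n j))) (rep c β y) -
        hermG (stdB n) (gamma c y) (rep c α y)
          (r • ∑ j, br (lam (stdB n) (gamma c y) (A.chartJ c y))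
            (epsT (-r) (A.chartJ c y) (coordC (stdB n) j)) (nab B c β y (stdB n j)))) := by
  obtain ⟨D, hD, hsum⟩ := divergence_identity (b := stdB n) (f := frame hy) (J := A.chartJ c y)
    (A.chartJ_chartJ hy) (A.matOf_chartJ_swap hy) B (isFrame_gamma hy) hB.torsR_skew hr hrc
    (fun j t => A.chartJ c (y + t • stdB n j)) (fun j t => gamma c (y + t • stdB n j))
    (fun j t => rep c α (y + t • stdB n j)) (fun j t => rep c β (y + t • stdB n j))
    (rep c α y) (rep c β y) (fun j => nab B c α y (stdB n j)) (fun j => nab B c β y (stdB n j))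
    (fun j => by simp only [zero_smul, add_zero]) (fun j => by simp only [zero_smul, add_zero])
    (fun j => by simp only [zero_smul, add_zero]) (fun j => by simp only [zero_smul, add_zero])
    (fun j v => hB.hasDerivAt_J _ v) (fun j => hB.isParallelInv _)
    (fun j => hasNab_rep hα hy _) (fun j => hasNab_rep hβ hy _)
  rw [← hsum, Finset.mul_sum]
  refine Finset.sum_congr rfl fun j _ => ?_
  have h1 : HasDerivAt (fun t : ℝ => (vol c (y + t • stdB n j) : ℂ) *
      A.flux r c α β j (y + t • stdB n j)) _ 0 := ((hB.hasDerivAt_vol _).ofReal_comp).mul (hD j)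
  have h2 := hasDerivAt_line (φ := fun z => (vol c z : ℂ) * A.flux r c α β j z)
    ((((contDiffOn_vol_mul_flux (A := A) r c hα hβ j).differentiableOn (by simp)).differentiableAt
      ((isOpen_chartTarget c).mem_nhds hy)).hasFDerivAt) (stdB n j)
  rw [h2.unique h1]
  simp only [zero_smul, add_zero, flux]
  push_cast
  ring

/-- Since Λ commutes with covariant differentiation, the sum of the brackets [Λ, e^{0,1}∧] over the
covariant derivatives of β is [Λ,∂̄]β. -/
theorem sum_fderiv_flux_del [T2Space M] (hA : A.IsNearlyKahler) {α β : Form n M}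
    (hα : IsSmooth α) (hβ : IsSmooth β) {c : M} {y : Model n} (hy : y ∈ chartTarget c) :
    ∑ j, fderiv ℝ (fun z => (vol c z : ℂ) * A.flux Complex.I c α β j z) y (stdB n j) =
      vol c y * (hermInner (A.del α) β (par c y) - hermInner α
        (Complex.I • (A.lamOp (A.delbar β) - A.delbar (A.lamOp β))) (par c y)) := by
  obtain ⟨B, hB⟩ := A.exists_isHermConn hA hy
  rw [hB.sum_fderiv_flux Complex.I_mul_I Complex.conj_I hα hβ, hermInner_par hy, hermInner_par hy,
    hB.rep_del hα, rep_smul, rep_sub, A.rep_lamOp_eq_lam hy, hB.rep_delbar hβ,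
    hB.rep_delbar (A.isSmooth_lamOp hβ), sum_br_apply]
  simp only [hB.nab_lamOp hβ]

theorem sum_fderiv_flux_delbar [T2Space M] (hA : A.IsNearlyKahler) {α β : Form n M}
    (hα : IsSmooth α) (hβ : IsSmooth β) {c : M} {y : Model n} (hy : y ∈ chartTarget c) :
    ∑ j, fderiv ℝ (fun z => (vol c z : ℂ) * A.flux (-Complex.I) c α β j z) y (stdB n j) =
      vol c y * (hermInner (A.delbar α) β (par c y) - hermInner α
        (-Complex.I • (A.lamOp (A.del β) - A.del (A.lamOp β))) (par c y)) := by
  obtain ⟨B, hB⟩ := A.exists_isHermConn hA hy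
  rw [hB.sum_fderiv_flux (by rw [neg_mul_neg, Complex.I_mul_I]) (by rw [map_neg, Complex.conj_I])
    hα hβ, hermInner_par hy, hermInner_par hy, hB.rep_delbar hα, rep_smul, rep_sub,
    A.rep_lamOp_eq_lam hy, hB.rep_del hβ, hB.rep_del (A.isSmooth_lamOp hβ), sum_br_apply, neg_neg]
  simp only [hB.nab_lamOp hβ]

end AlmostHermitianStructure

end LocalDivergence

/-! ### Integrals in charts -/

section ChartIntegrals

open MeasureTheory

theorem continuous_indicator_of_compact {E F : Type*} [TopologicalSpace E] [T2Space E]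
    [TopologicalSpace F] [Zero F] {T C : Set E} {g : E → F} (hT : IsOpen T) (hC : IsCompact C)
    (hCT : C ⊆ T) (hg : ContinuousOn g T) (h0 : ∀ z ∈ T, z ∉ C → g z = 0) :
    Continuous (T.indicator g) := by
  refine continuous_iff_continuousAt.mpr fun x => ?_
  by_cases hx : x ∈ T
  · refine (hg.continuousAt (hT.mem_nhds hx)).congr ?_
    filter_upwards [hT.mem_nhds hx] with z hz using (Set.indicator_of_mem hz g).symm
  · refine (continuousAt_const (y := (0 : F))).congr ?_
    filter_upwards [hC.isClosed.isOpen_compl.mem_nhds fun h => hx (hCT h)] with z hz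
    by_cases hzT : z ∈ T
    · rw [Set.indicator_of_mem hzT, h0 z hzT hz]
    · rw [Set.indicator_of_notMem hzT]

/-- Extension by zero is smooth: off the open set there is a neighbourhood missing the compact set,
and the extended function vanishes on it. -/
theorem contDiff_indicator_of_compact {E F : Type*} [NormedAddCommGroup E] [NormedSpace ℝ E]
    [NormedAddCommGroup F] [NormedSpace ℝ F] {T C : Set E} {g : E → F} (hT : IsOpen T)
    (hC : IsCompact C) (hCT : C ⊆ T) (hg : ContDiffOn ℝ ∞ g T)
    (h0 : ∀ z ∈ T, z ∉ C → g z = 0) : ContDiff ℝ ∞ (T.indicator g) := by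
  refine contDiff_iff_contDiffAt.mpr fun x => ?_
  by_cases hx : x ∈ T
  · refine (hg.contDiffAt (hT.mem_nhds hx)).congr_of_eventuallyEq ?_
    filter_upwards [hT.mem_nhds hx] with z hz using Set.indicator_of_mem hz g
  · refine (contDiffAt_const (c := (0 : F))).congr_of_eventuallyEq ?_
    filter_upwards [hC.isClosed.isOpen_compl.mem_nhds fun h => hx (hCT h)] with z hz
    by_cases hzT : z ∈ T
    · rw [Set.indicator_of_mem hzT, h0 z hzT hz]
    · rw [Set.indicator_of_notMem hzT]

theorem hasCompactSupport_indicator {E F : Type*} [TopologicalSpace E] [T2Space E] [Zero F]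
    {T C : Set E} {g : E → F} (hC : IsCompact C) (h0 : ∀ z ∈ T, z ∉ C → g z = 0) :
    HasCompactSupport (T.indicator g) := by
  refine HasCompactSupport.intro hC fun z hz => ?_
  by_cases hzT : z ∈ T
  · rw [Set.indicator_of_mem hzT, h0 z hzT hz]
  · rw [Set.indicator_of_notMem hzT]

theorem integral_fderiv_eq_zero {E : Type*} [NormedAddCommGroup E] [NormedSpace ℝ E]
    [FiniteDimensional ℝ E] [MeasurableSpace E] [BorelSpace E] (μ : Measure E)
    [μ.IsAddHaarMeasure] {g : E → ℂ} (hg : ContDiff ℝ ∞ g) (hc : HasCompactSupport g) (v : E) :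
    ∫ x, fderiv ℝ g x v ∂μ = 0 := by
  have h1 : Continuous fun x => fderiv ℝ g x v :=
    (hg.continuous_fderiv (by simp)).clm_apply continuous_const
  have h2 : HasCompactSupport fun x => fderiv ℝ g x v := hc.fderiv_apply ℝ v
  -- Integration by parts against the constant function 1.
  have h := integral_mul_fderiv_eq_neg_fderiv_mul_of_integrable (μ := μ) (f := fun _ : E => (1 : ℂ))
    (g := g) (v := v) (by simp) (by simpa using h1.integrable_of_hasCompactSupport h2)
    (by simpa using hg.continuous.integrable_of_hasCompactSupport hc)
    (fun _ _ => differentiableAt_const _) (fun x _ => (hg.differentiable (by simp)) x)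
  simpa using h

theorem setIntegral_fderiv_eq_zero {E : Type*} [NormedAddCommGroup E] [NormedSpace ℝ E]
    [FiniteDimensional ℝ E] [MeasurableSpace E] [BorelSpace E] (μ : Measure E)
    [μ.IsAddHaarMeasure] {T C : Set E} {g : E → ℂ} (hT : IsOpen T)
    (hC : IsCompact C) (hCT : C ⊆ T) (hg : ContDiffOn ℝ ∞ g T)
    (h0 : ∀ z ∈ T, z ∉ C → g z = 0) (v : E) :
    IntegrableOn (fun x => fderiv ℝ g x v) T μ ∧ ∫ x in T, fderiv ℝ g x v ∂μ = 0 := by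
  have hs := contDiff_indicator_of_compact hT hC hCT hg h0
  have hc := hasCompactSupport_indicator (T := T) hC h0
  have h1 : Set.EqOn (fun x => fderiv ℝ g x v) (fun x => fderiv ℝ (T.indicator g) x v) T := by
    intro x hx
    have : T.indicator g =ᶠ[nhds x] g := by
      filter_upwards [hT.mem_nhds hx] with z hz using Set.indicator_of_mem hz g
    simp only [this.fderiv_eq]
  have h2 : Continuous fun x => fderiv ℝ (T.indicator g) x v :=
    (hs.continuous_fderiv (by simp)).clm_apply continuous_const
  have h3 : HasCompactSupport fun x => fderiv ℝ (T.indicator g) x v := hc.fderiv_apply ℝ v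
  constructor
  · exact ((h2.integrable_of_hasCompactSupport h3).integrableOn).congr_fun h1.symm hT.measurableSet
  · rw [setIntegral_congr_fun hT.measurableSet h1, setIntegral_eq_integral_of_forall_compl_eq_zero,
      integral_fderiv_eq_zero μ hs hc]
    intro x hx
    have h4 : x ∉ tsupport (T.indicator g) := fun h => hx (hCT
      (closure_minimal (fun z hz => by
        by_contra hzC
        refine hz ?_
        by_cases hzT : z ∈ T
        · rw [Set.indicator_of_mem hzT, h0 z hzT hzC]
        · rw [Set.indicator_of_notMem hzT]) hC.isClosed h))
    have h5 : fderiv ℝ (T.indicator g) x = 0 :=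
      image_eq_zero_of_notMem_tsupport fun h => h4 (tsupport_fderiv_subset ℝ h)
    rw [h5]
    rfl

variable {n : ℕ} {M : Type*} [TopologicalSpace M] [ChartedSpace (Model n) M]
  [RiemannianBundle (fun x : M => TangentSpace (𝓡 (2 * n)) x)]

theorem hermInner_eq_zero_left {α β : Form n M} {x : M} (h : ∀ k, α k x = 0) :
    hermInner α β x = 0 := by
  simp [hermInner, h]

/-- The integral over the domain of a chart. -/
def chartInt (c : M) (h : M → ℂ) : ℂ :=
  ∫ y in chartTarget (n := n) c, (vol c y : ℂ) * h (par c y)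

variable [IsManifold (𝓡 (2 * n)) ∞ M]

theorem continuousOn_par (c : M) : ContinuousOn (par (n := n) c) (chartTarget c) :=
  continuousOn_extChartAt_symm c

theorem chart_par {c : M} {y : Model n} (hy : y ∈ chartTarget c) :
    extChartAt (𝓡 (2 * n)) c (par c y) = y :=
  (extChartAt (𝓡 (2 * n)) c).right_inv hy

theorem par_chart_of_mem {c x : M} (hx : x ∈ (chartAt (Model n) c).source) :
    par c (extChartAt (𝓡 (2 * n)) c x) = x :=
  (extChartAt (𝓡 (2 * n)) c).left_inv (by rwa [extChartAt_source])

theorem par_mem_chart_source {c : M} {y : Model n} (hy : y ∈ chartTarget c) :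
    par c y ∈ (chartAt (Model n) c).source := by
  rw [← extChartAt_source (𝓡 (2 * n))]
  exact par_mem_source hy

theorem isCompact_chart_image {c : M} {K : Set M} (hK : IsCompact K)
    (hKc : K ⊆ (chartAt (Model n) c).source) : IsCompact (extChartAt (𝓡 (2 * n)) c '' K) :=
  hK.image_of_continuousOn ((continuousOn_extChartAt c).mono (by rwa [extChartAt_source]))

theorem chart_image_subset {c : M} {K : Set M} (hKc : K ⊆ (chartAt (Model n) c).source) :
    extChartAt (𝓡 (2 * n)) c '' K ⊆ chartTarget c := by
  rintro _ ⟨x, hx, rfl⟩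
  exact (extChartAt (𝓡 (2 * n)) c).map_source (by rw [extChartAt_source]; exact hKc hx)

theorem par_notMem_of_notMem_image {c : M} {K : Set M} {y : Model n} (hy : y ∈ chartTarget c)
    (h : y ∉ extChartAt (𝓡 (2 * n)) c '' K) : par c y ∉ K := fun hK =>
  h ⟨par c y, hK, chart_par hy⟩

theorem gram_trans {c c' : M} {y : Model n} (hy : y ∈ chartTarget c)
    (hy' : par c y ∈ (extChartAt (𝓡 (2 * n)) c').source) (v w : Model n) :
    gram c y v w = gram c' (trans c c' y) (fderiv ℝ (trans c c') y v)
      (fderiv ℝ (trans c c') y w) := by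
  have h1 : ∀ (x x' : M) (_ : x = x') (v w : Model n),
      (inner ℝ (show TangentSpace (𝓡 (2 * n)) x from v) (show TangentSpace (𝓡 (2 * n)) x from w) : ℝ) =
        inner ℝ (show TangentSpace (𝓡 (2 * n)) x' from v)
          (show TangentSpace (𝓡 (2 * n)) x' from w) := by
    rintro x _ rfl v w
    rfl
  refine Eq.trans (h1 _ _ (par_trans hy').symm (dpar c y v) (dpar c y w)) ?_
  exact congrArg₂ (fun v w : Model n => (inner ℝ
    (show TangentSpace (𝓡 (2 * n)) (par c' (trans c c' y)) from v)
    (show TangentSpace (𝓡 (2 * n)) (par c' (trans c c' y)) from w) : ℝ))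
    (dpar_fderiv_trans hy hy' v).symm (dpar_fderiv_trans hy hy' w).symm

theorem vol_trans {c c' : M} {y : Model n} (hy : y ∈ chartTarget c)
    (hy' : par c y ∈ (extChartAt (𝓡 (2 * n)) c').source) :
    vol c y = |(fderiv ℝ (trans c c') y).det| * vol c' (trans c c' y) := by
  set D := LinearMap.toMatrix (stdB n) (stdB n) (fderiv ℝ (trans c c') y).toLinearMap with hD
  have h1 : gramM c y = D.transpose * gramM c' (trans c c' y) * D := by
    ext i j
    have h2 : ∀ i, fderiv ℝ (trans c c') y (stdB n i) = ∑ k, D k i • stdB n k := fun i => by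
      rw [← (stdB n).sum_repr (fderiv ℝ (trans c c') y (stdB n i))]
      simp only [hD, LinearMap.toMatrix_apply]
      rfl
    change gram c y (stdB n i) (stdB n j) = _
    rw [gram_trans hy hy', h2, h2, gram_sum_right, Matrix.mul_apply]
    refine Finset.sum_congr rfl fun k _ => ?_
    rw [gram_sum_left, Matrix.mul_apply, mul_comm]
    rfl
  have h3 : (fderiv ℝ (trans c c') y).det = D.det := by
    rw [hD, LinearMap.det_toMatrix]
  rw [vol, h1, Matrix.det_mul, Matrix.det_mul, Matrix.det_transpose, h3, vol,
    ← Real.sqrt_sq_eq_abs, ← Real.sqrt_mul (sq_nonneg _)]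
  congr 1
  ring

/-- Change of variables along the transition map. Its Jacobian is absorbed by the density, and the
hypothesis discards everything outside the overlap. -/
theorem chartInt_eq_chartInt (c c' : M) {h : M → ℂ}
    (hc : ∀ x, h x ≠ 0 → x ∈ (chartAt (Model n) c).source ∧ x ∈ (chartAt (Model n) c').source) :
    chartInt (n := n) c h = chartInt (n := n) c' h := by
  have key : ∀ c c' : M, IsOpen (chartTarget (n := n) c ∩ par c ⁻¹' (chartAt (Model n) c').source) :=
    fun c c' => (continuousOn_par c).isOpen_inter_preimage (isOpen_chartTarget c)
      (chartAt (Model n) c').open_source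
  have hsub : ∀ c c' : M, (∀ x, h x ≠ 0 → x ∈ (chartAt (Model n) c').source) →
      chartInt (n := n) c h = ∫ y in chartTarget (n := n) c ∩ par c ⁻¹' (chartAt (Model n) c').source,
        (vol c y : ℂ) * h (par c y) := by
    intro c c' hc
    refine setIntegral_eq_of_subset_of_forall_sdiff_eq_zero (isOpen_chartTarget c).measurableSet
      Set.inter_subset_left fun y hy => ?_
    have : h (par c y) = 0 := by
      by_contra h0
      exact hy.2 ⟨hy.1, hc _ h0⟩
    rw [this, mul_zero]
  rw [hsub c c' fun x hx => (hc x hx).2, hsub c' c fun x hx => (hc x hx).1]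
  set S := chartTarget (n := n) c ∩ par c ⁻¹' (chartAt (Model n) c').source with hS
  have hS' : ∀ y ∈ S, par c y ∈ (extChartAt (𝓡 (2 * n)) c').source := fun y hy => by
    rw [extChartAt_source]
    exact hy.2
  have himg : trans c c' '' S =
      chartTarget (n := n) c' ∩ par c' ⁻¹' (chartAt (Model n) c).source := by
    ext z
    constructor
    · rintro ⟨y, hy, rfl⟩
      refine ⟨trans_mem (hS' y hy), ?_⟩
      rw [Set.mem_preimage, par_trans (hS' y hy)]
      exact par_mem_chart_source hy.1
    · rintro ⟨hz, hz'⟩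
      refine ⟨extChartAt (𝓡 (2 * n)) c (par c' z), ⟨?_, ?_⟩, ?_⟩
      · exact (extChartAt (𝓡 (2 * n)) c).map_source (by rw [extChartAt_source]; exact hz')
      · rw [Set.mem_preimage, par_chart_of_mem hz']
        exact par_mem_chart_source hz
      · rw [trans, par_chart_of_mem hz', chart_par hz]
  have hinj : Set.InjOn (trans c c') S := by
    intro y hy z hz hyz
    have h1 := congrArg (par c') hyz
    rw [par_trans (hS' y hy), par_trans (hS' z hz)] at h1
    rw [← chart_par hy.1, h1, chart_par hz.1]
  rw [← himg, integral_image_eq_integral_abs_det_fderiv_smul volume (key c c').measurableSet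
    (fun y hy => (((contDiffAt_trans hy.1 (hS' y hy)).differentiableAt
      (by simp)).hasFDerivAt).hasFDerivWithinAt) hinj]
  refine setIntegral_congr_fun (key c c').measurableSet fun y hy => ?_
  rw [par_trans (hS' y hy), vol_trans hy.1 (hS' y hy), Complex.real_smul, ← mul_assoc]
  push_cast
  rfl

end ChartIntegrals

/-! ### Integration by parts -/

section Integral

open MeasureTheory

variable {n : ℕ} {M : Type*} [TopologicalSpace M] [T2Space M] [ChartedSpace (Model n) M]
  [IsManifold (𝓡 (2 * n)) ∞ M] [RiemannianBundle (fun x : M => TangentSpace (𝓡 (2 * n)) x)]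

/-- Continuous functions which vanish outside a given compact set. -/
def IsCc (K : Set M) (f : M → ℂ) : Prop := Continuous f ∧ IsCompact K ∧ ∀ x ∉ K, f x = 0

namespace IsCc

variable {K K' : Set M} {f g : M → ℂ}

theorem sub (hf : IsCc K f) (hg : IsCc K g) : IsCc K (fun x => f x - g x) :=
  ⟨hf.1.sub hg.1, hf.2.1, fun x hx => by simp only [hf.2.2 x hx, hg.2.2 x hx, sub_zero]⟩

theorem sum {ι : Type*} {s : Finset ι} {f : ι → M → ℂ} (hK : IsCompact K)
    (hf : ∀ i ∈ s, IsCc K (f i)) : IsCc K (fun x => ∑ i ∈ s, f i x) :=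
  ⟨continuous_finsetSum _ fun i hi => (hf i hi).1, hK,
    fun x hx => Finset.sum_eq_zero fun i hi => (hf i hi).2.2 x hx⟩

theorem mul_left (hf : IsCc K f) (hg : Continuous g) (hK' : IsClosed K') (h : ∀ x ∉ K', g x = 0) :
    IsCc (K ∩ K') (fun x => g x * f x) := by
  refine ⟨hg.mul hf.1, hf.2.1.inter_right hK', fun x hx => ?_⟩
  by_cases hxK : x ∈ K
  · simp only [h x fun h' => hx ⟨hxK, h'⟩, zero_mul]
  · simp only [hf.2.2 x hxK, mul_zero]

variable [IsContMDiffRiemannianBundle (𝓡 (2 * n)) ∞ (EuclideanSpace ℝ (Fin (2 * n)))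
    (fun x : M => TangentSpace (𝓡 (2 * n)) x)]

theorem integrableOn (hf : IsCc K f) {c : M} (hKc : K ⊆ (chartAt (Model n) c).source) :
    IntegrableOn (fun y : Model n => (vol c y : ℂ) * f (par c y)) (chartTarget c) := by
  have h0 : ∀ z ∈ chartTarget c, z ∉ extChartAt (𝓡 (2 * n)) c '' K →
      (vol c z : ℂ) * f (par c z) = 0 := fun z hz hzK => by
    rw [hf.2.2 _ (par_notMem_of_notMem_image hz hzK), mul_zero]
  have hc : ContinuousOn (fun y : Model n => (vol c y : ℂ) * f (par c y)) (chartTarget c) :=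
    (Complex.continuous_ofReal.comp_continuousOn (contDiffOn_vol c).continuousOn).mul
      (hf.1.comp_continuousOn (continuousOn_par c))
  have hcomp := isCompact_chart_image hf.2.1 hKc
  have h := (continuous_indicator_of_compact (isOpen_chartTarget c) hcomp
    (chart_image_subset hKc) hc h0).integrable_of_hasCompactSupport (μ := volume)
      (hasCompactSupport_indicator hcomp h0)
  exact (integrable_indicator_iff (isOpen_chartTarget c).measurableSet).mp h

theorem chartInt_sub (hf : IsCc K f) (hg : IsCc K g) {c : M}
    (hKc : K ⊆ (chartAt (Model n) c).source) :
    chartInt (n := n) c (fun x => f x - g x) = chartInt (n := n) c f - chartInt (n := n) c g := by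
  simp only [chartInt, mul_sub]
  exact integral_sub (hf.integrableOn hKc) (hg.integrableOn hKc)

theorem chartInt_sum {ι : Type*} {s : Finset ι} {f : ι → M → ℂ} (hf : ∀ i ∈ s, IsCc K (f i)) {c : M}
    (hKc : K ⊆ (chartAt (Model n) c).source) :
    chartInt (n := n) c (fun x => ∑ i ∈ s, f i x) = ∑ i ∈ s, chartInt (n := n) c (f i) := by
  simp only [chartInt, Finset.mul_sum]
  exact integral_finsetSum _ fun i hi => (hf i hi).integrableOn hKc

end IsCc

variable [SigmaCompactSpace M]

variable (n M) in
/-- The partition of unity which defines the integral. -/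
def pou : SmoothPartitionOfUnity M (𝓡 (2 * n)) M Set.univ :=
  (SmoothPartitionOfUnity.exists_isSubordinate_chartAt_source (𝓡 (2 * n)) M).choose

theorem tsupport_pou_subset (c : M) : tsupport (pou n M c) ⊆ (chartAt (Model n) c).source :=
  (SmoothPartitionOfUnity.exists_isSubordinate_chartAt_source (𝓡 (2 * n)) M).choose_spec c

theorem pou_eq_zero {c x : M} (hx : x ∉ tsupport (pou n M c)) : pou n M c x = 0 :=
  image_eq_zero_of_notMem_tsupport hx

theorem continuous_pou (c : M) : Continuous fun x => (pou n M c x : ℂ) :=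
  Complex.continuous_ofReal.comp (pou n M c).contMDiff.continuous

theorem IsCc.pou_mul {K : Set M} {f : M → ℂ} (hf : IsCc K f) (c : M) :
    IsCc (K ∩ tsupport (pou n M c)) (fun x => (pou n M c x : ℂ) * f x) :=
  hf.mul_left (continuous_pou c) (isClosed_tsupport _) fun x hx => by
    rw [pou_eq_zero hx, Complex.ofReal_zero]

theorem integral_eq_finsum (f : M → ℂ) : NearlyKahler.integral (n := n) f =
    ∑ᶠ c : M, chartInt (n := n) c (fun x => (pou n M c x : ℂ) * f x) := by
  refine finsum_congr fun c => ?_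
  refine integral_congr_ae (Filter.Eventually.of_forall fun y => ?_)
  have : vol (n := n) c y = Real.sqrt (Matrix.det (Matrix.of fun a b : Fin (2 * n) =>
      gram c y (EuclideanSpace.single a 1) (EuclideanSpace.single b 1))) := by
    rw [vol, gramM]
    simp only [stdB_apply]
  change (((pou n M c (par c y) * Real.sqrt (Matrix.det (Matrix.of fun a b : Fin (2 * n) =>
      gram c y (EuclideanSpace.single a 1) (EuclideanSpace.single b 1))) : ℝ) : ℂ)) * f (par c y) = _
  rw [← this]
  push_cast
  ring

/-- By local finiteness only finitely many members of the partition are nonzero somewhere on a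
compact set, so the `finsum` becomes a finite sum, uniformly in f. -/
theorem exists_finset_pou {K : Set M} (hK : IsCompact K) : ∃ s : Finset M,
    (∀ x ∈ K, ∑ c ∈ s, (pou n M c x : ℂ) = 1) ∧ ∀ f : M → ℂ, (∀ x ∉ K, f x = 0) →
      NearlyKahler.integral (n := n) f =
        ∑ c ∈ s, chartInt (n := n) c (fun x => (pou n M c x : ℂ) * f x) := by
  have hfin := (pou n M).locallyFinite.finite_nonempty_inter_compact hK
  have hs : ∀ c ∉ hfin.toFinset, ∀ x ∈ K, pou n M c x = 0 := by
    intro c hc x hx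
    by_contra h
    exact hc (hfin.mem_toFinset.mpr ⟨x, h, hx⟩)
  refine ⟨hfin.toFinset, fun x hx => ?_, fun f hf => ?_⟩
  · have h1 := (pou n M).sum_eq_one (Set.mem_univ x)
    rw [finsum_eq_sum_of_support_subset (s := hfin.toFinset)] at h1
    · exact_mod_cast h1
    · intro c hc
      by_contra h
      exact hc (hs c h x hx)
  · rw [integral_eq_finsum, finsum_eq_sum_of_support_subset]
    intro c hc
    by_contra h
    refine hc ?_
    have : (fun x => (pou n M c x : ℂ) * f x) = fun _ => 0 := by
      funext x
      by_cases hx : x ∈ K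
      · rw [hs c h x hx, Complex.ofReal_zero, zero_mul]
      · rw [hf x hx, mul_zero]
    simp only [this]
    simp [chartInt]

variable [IsContMDiffRiemannianBundle (𝓡 (2 * n)) ∞ (EuclideanSpace ℝ (Fin (2 * n)))
    (fun x : M => TangentSpace (𝓡 (2 * n)) x)] {K : Set M} {f g : M → ℂ}

theorem IsCc.integral_sub (hf : IsCc K f) (hg : IsCc K g) :
    NearlyKahler.integral (n := n) (fun x => f x - g x) =
      NearlyKahler.integral (n := n) f - NearlyKahler.integral (n := n) g := by
  obtain ⟨s, -, hs⟩ := exists_finset_pou (n := n) hf.2.1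
  rw [hs _ hf.2.2, hs _ hg.2.2, hs _ (hf.sub hg).2.2, ← Finset.sum_sub_distrib]
  refine Finset.sum_congr rfl fun c _ => ?_
  rw [← (hf.pou_mul c).chartInt_sub (hg.pou_mul c)
    (Set.inter_subset_right.trans (tsupport_pou_subset c))]
  simp only [mul_sub]

theorem IsCc.integral_sum {ι : Type*} {t : Finset ι} {f : ι → M → ℂ} (hK : IsCompact K)
    (hf : ∀ i ∈ t, IsCc K (f i)) : NearlyKahler.integral (n := n) (fun x => ∑ i ∈ t, f i x) =
      ∑ i ∈ t, NearlyKahler.integral (n := n) (f i) := by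
  obtain ⟨s, -, hs⟩ := exists_finset_pou (n := n) hK
  rw [hs _ (IsCc.sum hK hf).2.2, Finset.sum_congr rfl fun i hi => hs _ (hf i hi).2.2,
    Finset.sum_comm]
  refine Finset.sum_congr rfl fun c _ => ?_
  rw [← IsCc.chartInt_sum (fun i hi => (hf i hi).pou_mul c)
    (Set.inter_subset_right.trans (tsupport_pou_subset c))]
  simp only [Finset.mul_sum]

/-- Each summand is supported in two charts and may be computed in c; there the partition functions
add up to 1 on K. -/
theorem IsCc.integral_eq_chartInt (hf : IsCc K f) {c : M}
    (hKc : K ⊆ (chartAt (Model n) c).source) :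
    NearlyKahler.integral (n := n) f = chartInt (n := n) c f := by
  obtain ⟨s, hs1, hs⟩ := exists_finset_pou (n := n) hf.2.1
  have h1 : ∀ x, f x ≠ 0 → x ∈ K := fun x hx => by
    by_contra h
    exact hx (hf.2.2 x h)
  have h2 : ∀ c', IsCc K (fun x => (pou n M c' x : ℂ) * f x) := fun c' =>
    ⟨(hf.pou_mul c').1, hf.2.1, fun x hx => by simp only [hf.2.2 x hx, mul_zero]⟩
  rw [hs _ hf.2.2, Finset.sum_congr rfl fun c' _ => chartInt_eq_chartInt c' c fun x hx =>
    ⟨tsupport_pou_subset c' (by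
      by_contra h
      exact hx (by rw [pou_eq_zero h, Complex.ofReal_zero, zero_mul])),
      hKc (h1 x (right_ne_zero_of_mul hx))⟩, ← IsCc.chartInt_sum (fun c' _ => h2 c') hKc]
  congr 1
  funext x
  by_cases hx : x ∈ K
  · rw [← Finset.sum_mul, hs1 x hx, one_mul]
  · simp only [hf.2.2 x hx, mul_zero, Finset.sum_const_zero]

theorem continuous_of_charts {X : Type*} [TopologicalSpace X] {h : M → X}
    (hh : ∀ c, ContinuousOn (fun y : Model n => h (par c y)) (chartTarget c)) : Continuous h := by
  refine continuous_iff_continuousAt.mpr fun x => ?_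
  have h1 : ContinuousAt (fun y : Model n => h (par x y)) (extChartAt (𝓡 (2 * n)) x x) :=
    (hh x).continuousAt ((isOpen_chartTarget x).mem_nhds (chart_mem_chartTarget x))
  refine (h1.comp (continuousAt_extChartAt x)).congr ?_
  filter_upwards [extChartAt_source_mem_nhds (I := 𝓡 (2 * n)) x] with z hz
  exact congrArg h ((extChartAt (𝓡 (2 * n)) x).left_inv hz)

theorem continuous_hermInner {α β : Form n M} (hα : IsSmooth α) (hβ : IsSmooth β) :
    Continuous (hermInner α β) :=
  continuous_of_charts fun c => (contDiffOn_hermInner hα hβ c).continuousOn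

theorem isCc_hermInner_left {α β : Form n M} (hα : IsSmooth α) (hβ : IsSmooth β)
    (hK : IsCompact K) (h : ∀ x ∉ K, ∀ k, α k x = 0) : IsCc K (hermInner α β) :=
  ⟨continuous_hermInner hα hβ, hK, fun x hx => hermInner_eq_zero_left (h x hx)⟩

end Integral

/-! ### Metric adjoints -/

section MetricAdjoints

open MeasureTheory

variable {n : ℕ} {M : Type*} [TopologicalSpace M] [ChartedSpace (Model n) M]

theorem isSmooth_zero : IsSmooth (0 : Form n M) := isSmooth_iff.mpr fun _ _ _ => contDiffOn_const

theorem IsSmooth.add {α β : Form n M} (hα : IsSmooth α) (hβ : IsSmooth β) : IsSmooth (α + β) :=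
  isSmooth_iff.mpr fun c => (isSmooth_iff.mp hα c).add (isSmooth_iff.mp hβ c)

theorem IsSmooth.const_smul (z : ℂ) {α : Form n M} (hα : IsSmooth α) : IsSmooth (z • α) :=
  isSmooth_iff.mpr fun c => (isSmooth_iff.mp hα c).const_smul z

theorem IsSmooth.sub {α β : Form n M} (hα : IsSmooth α) (hβ : IsSmooth β) : IsSmooth (α - β) := by
  refine isSmooth_iff.mpr fun c => ((isSmooth_iff.mp hα c).add
    ((isSmooth_iff.mp hβ c).const_smul (-1))).congr fun z _ => ?_
  rw [rep_sub, neg_one_smul, sub_eq_add_neg]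

theorem IsSmooth.sum {ι : Type*} {s : Finset ι} {α : ι → Form n M} (h : ∀ i ∈ s, IsSmooth (α i)) :
    IsSmooth (∑ i ∈ s, α i) := by
  classical
  induction s using Finset.induction_on with
  | empty => exact isSmooth_zero
  | insert i s hi ih =>
    rw [Finset.sum_insert hi]
    exact (h i (Finset.mem_insert_self _ _)).add
      (ih fun j hj => h j (Finset.mem_insert_of_mem hj))

/-- The product of a function and a form. -/
def cut (φ : M → ℝ) (α : Form n M) : Form n M := fun k x => (φ x : ℂ) • α k x

theorem rep_cut (φ : M → ℝ) (α : Form n M) (c : M) (y : Model n) :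
    rep c (cut φ α) y = (φ (par c y) : ℂ) • rep c α y := rfl

theorem cut_apply (φ : M → ℝ) (α : Form n M) (k : ℕ) (x : M)
    (w : Fin k → TangentSpace (𝓡 (2 * n)) x) : cut φ α k x w = φ x * α k x w := rfl

theorem cut_eq_zero_left {φ : M → ℝ} {x : M} (h : φ x = 0) (α : Form n M) (k : ℕ) :
    cut φ α k x = 0 := by
  ext w
  rw [cut_apply, h, Complex.ofReal_zero, zero_mul]
  rfl

theorem cut_eq_zero_right (φ : M → ℝ) {α : Form n M} {x : M} {k : ℕ} (h : α k x = 0) :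
    cut φ α k x = 0 := by
  ext w
  rw [cut_apply, h]
  exact mul_zero _

theorem dd_add {E : Type*} [NormedAddCommGroup E] [NormedSpace ℝ E] [FiniteDimensional ℝ E]
    {U : Set E} (hU : IsOpen U) {a a' : E → Fib E} (ha : SmoothF U a) (ha' : SmoothF U a') {y : E}
    (hy : y ∈ U) (u : E) : dd (fun z => a z + a' z) y u = dd a y u + dd a' y u := by
  refine Fib.ext fun k => ?_
  have h := fderiv_add (ha.differentiableAt hU hy k) (ha'.differentiableAt hU hy k)
  exact DFunLike.congr_fun h u

theorem dd_const_smul {E : Type*} [NormedAddCommGroup E] [NormedSpace ℝ E] [FiniteDimensional ℝ E]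
    {U : Set E} (hU : IsOpen U) {a : E → Fib E} (ha : SmoothF U a) {y : E}
    (hy : y ∈ U) (z : ℂ) (u : E) : dd (fun x => z • a x) y u = z • dd a y u := by
  refine Fib.ext fun k => ?_
  have h := fderiv_const_smul (ha.differentiableAt hU hy k) z
  exact DFunLike.congr_fun h u

variable [IsManifold (𝓡 (2 * n)) ∞ M]

theorem isSmooth_cut {φ : M → ℝ} (hφ : ContMDiff (𝓡 (2 * n)) 𝓘(ℝ, ℝ) ∞ φ) {α : Form n M}
    (hα : IsSmooth α) : IsSmooth (cut φ α) := by
  refine isSmooth_iff.mpr fun c => SmoothF.smul (φ := fun y => (φ (par c y) : ℂ)) ?_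
    (isSmooth_iff.mp hα c)
  refine Complex.ofRealCLM.contDiff.comp_contDiffOn (f := fun y => φ (par c y)) fun y hy => ?_
  exact ((hφ.contMDiffAt.comp y (contMDiffAt_par hy)).contDiffAt).contDiffWithinAt

theorem sum_cut {ι : Type*} {s : Finset ι} {φ : ι → M → ℝ} {K : Set M} {α : Form n M}
    (h : ∀ x ∈ K, ∑ i ∈ s, (φ i x : ℂ) = 1) (h0 : ∀ x ∉ K, ∀ k, α k x = 0) :
    ∑ i ∈ s, cut (φ i) α = α := by
  refine form_ext_rep fun c y hy => ?_
  rw [rep_sum]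
  simp only [rep_cut]
  rw [← Finset.sum_smul]
  by_cases hK : par c y ∈ K
  · rw [h _ hK, one_smul]
  · have h1 : rep c α y = 0 := rep_congr (β := 0) fun k => h0 _ hK k
    rw [h1, smul_zero]

theorem apply_eq_zero_of_rep {α : Form n M} {c : M} {y : Model n} (hy : y ∈ chartTarget c)
    (h : rep c α y = 0) (k : ℕ) : α k (par c y) = 0 := by
  have h1 : fib α (par c y) = 0 := pull_injective (dpar c y) (dpar_dchart hy) (by
    rw [map_zero]
    exact h)
  exact congrFun h1 k

theorem extd_add {α β : Form n M} (hα : IsSmooth α) (hβ : IsSmooth β) :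
    extd (α + β) = extd α + extd β := by
  refine form_ext_rep fun c y hy => ?_
  rw [rep_add, rep_extd_eq (stdB n) (hα.add hβ) hy, rep_extd_eq (stdB n) hα hy,
    rep_extd_eq (stdB n) hβ hy, ← Finset.sum_add_distrib]
  refine Finset.sum_congr rfl fun j _ => ?_
  rw [← map_add]
  exact congrArg _ (dd_add (isOpen_chartTarget c) (isSmooth_iff.mp hα c) (isSmooth_iff.mp hβ c) hy _)

theorem extd_smul (z : ℂ) {α : Form n M} (hα : IsSmooth α) : extd (z • α) = z • extd α := by
  refine form_ext_rep fun c y hy => ?_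
  rw [rep_smul, rep_extd_eq (stdB n) (hα.const_smul z) hy, rep_extd_eq (stdB n) hα hy,
    Finset.smul_sum]
  refine Finset.sum_congr rfl fun j _ => ?_
  rw [← map_smul]
  exact congrArg _ (dd_const_smul (isOpen_chartTarget c) (isSmooth_iff.mp hα c) hy _ _)

variable [RiemannianBundle (fun x : M => TangentSpace (𝓡 (2 * n)) x)]

theorem hermInner_add_left (α α' β : Form n M) (x : M) :
    hermInner (α + α') β x = hermInner α β x + hermInner α' β x := by
  simp only [hermInner, ← Finset.sum_add_distrib, ← mul_add]
  refine Finset.sum_congr rfl fun k _ => ?_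
  congr 1
  exact Finset.sum_congr rfl fun i _ => add_mul _ _ _

theorem hermInner_sum_left {ι : Type*} (s : Finset ι) (α : ι → Form n M) (β : Form n M) (x : M) :
    hermInner (∑ i ∈ s, α i) β x = ∑ i ∈ s, hermInner (α i) β x := by
  classical
  induction s using Finset.induction_on with
  | empty => simpa using hermInner_eq_zero_left fun k => rfl
  | insert i s hi ih => rw [Finset.sum_insert hi, Finset.sum_insert hi, hermInner_add_left, ih]

theorem hermInner_sub_right (α β β' : Form n M) (x : M) :
    hermInner α (β - β') x = hermInner α β x - hermInner α β' x := by
  simp only [hermInner, ← Finset.sum_sub_distrib, ← mul_sub]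
  refine Finset.sum_congr rfl fun k _ => ?_
  congr 1
  refine Finset.sum_congr rfl fun i _ => ?_
  rw [← map_sub]
  rfl

theorem hermInner_cut_left (φ : M → ℝ) (α β : Form n M) (x : M) :
    hermInner (cut φ α) β x = φ x * hermInner α β x := by
  simp only [hermInner, Finset.mul_sum]
  refine Finset.sum_congr rfl fun k _ => Finset.sum_congr rfl fun i _ => ?_
  rw [cut_apply]
  ring

theorem hermInner_self_par {c : M} {y : Model n} (hy : y ∈ chartTarget c) (α : Form n M) :
    ∃ r : ℝ, 0 ≤ r ∧ hermInner α α (par c y) = r := by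
  rw [hermInner_par hy, ← (isFrame_gamma hy).herm_eq]
  exact herm_self _ _

theorem apply_eq_zero_of_hermInner_self {α : Form n M} {x : M} (h : hermInner α α x = 0) (k : ℕ) :
    α k x = 0 := by
  have hy := chart_mem_chartTarget (n := n) x
  have h1 : hermInner α α (par x (extChartAt (𝓡 (2 * n)) x x)) = 0 := by rw [par_chart, h]
  rw [hermInner_par hy, ← (isFrame_gamma hy).herm_eq] at h1
  have h2 := apply_eq_zero_of_rep hy (eq_zero_of_herm_self _ _ h1) k
  rwa [par_chart] at h2

namespace AlmostHermitianStructure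

variable (A : AlmostHermitianStructure n M)

theorem typeProj_add (p q : ℤ) (α β : Form n M) :
    A.typeProj p q (α + β) = A.typeProj p q α + A.typeProj p q β := by
  refine form_ext_rep fun c y hy => Fib.ext fun k => ?_
  change rep c (A.typeProj p q (α + β)) y k =
    rep c (A.typeProj p q α) y k + rep c (A.typeProj p q β) y k
  rw [A.rep_typeProj p q _ hy, A.rep_typeProj p q _ hy,
    A.rep_typeProj p q _ hy, rep_add, map_add]
  split_ifs
  · rfl
  · exact (add_zero _).symm

theorem typeProj_smul (p q : ℤ) (z : ℂ) (α : Form n M) :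
    A.typeProj p q (z • α) = z • A.typeProj p q α := by
  refine form_ext_rep fun c y hy => Fib.ext fun k => ?_
  change rep c (A.typeProj p q (z • α)) y k = z • rep c (A.typeProj p q α) y k
  rw [A.rep_typeProj p q _ hy, A.rep_typeProj p q _ hy, rep_smul, map_smul]
  split_ifs
  · rfl
  · exact (smul_zero (A := Model n [⋀^Fin k]→L[ℝ] ℂ) z).symm

theorem dPart_eq_zero_of_eventually (a b : ℤ) (hab : a + b = 1) {α : Form n M} (hα : IsSmooth α)
    [IsContMDiffRiemannianBundle (𝓡 (2 * n)) ∞ (EuclideanSpace ℝ (Fin (2 * n)))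
      (fun x : M => TangentSpace (𝓡 (2 * n)) x)] {K : Set M} (hK : IsClosed K)
    (h0 : ∀ x ∉ K, ∀ k, α k x = 0) (x : M) (hx : x ∉ K) (k : ℕ) : A.dPart a b α k x = 0 := by
  have hy := chart_mem_chartTarget (n := n) x
  suffices h : rep x (A.dPart a b α) (extChartAt (𝓡 (2 * n)) x x) = 0 by
    have := apply_eq_zero_of_rep hy h k
    rwa [par_chart] at this
  refine Fib.ext_apply fun k w => ?_
  rw [A.rep_dPart a b hab hα hy]
  have h1 : ∀ᶠ z in nhds (extChartAt (𝓡 (2 * n)) x x), rep x α z = 0 := by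
    have h2 : ContinuousAt (par (n := n) x) (extChartAt (𝓡 (2 * n)) x x) :=
      (continuousOn_par x).continuousAt ((isOpen_chartTarget x).mem_nhds hy)
    filter_upwards [h2.preimage_mem_nhds (hK.isOpen_compl.mem_nhds (by rwa [par_chart]))] with z hz
    exact rep_congr (β := 0) fun k => h0 _ hz k
  refine Finset.sum_eq_zero fun r _ => ?_
  have h3 : extDerivF (fun z => typeEnd (A.chartJ x z) (r - a) (rep x α z))
      (extChartAt (𝓡 (2 * n)) x x) = 0 := by
    rw [extDerivF_eq (stdB n)]
    refine Finset.sum_eq_zero fun j _ => ?_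
    have h4 : dd (fun z => typeEnd (A.chartJ x z) (r - a) (rep x α z))
        (extChartAt (𝓡 (2 * n)) x x) (stdB n j) = 0 := by
      refine Fib.ext fun k => ?_
      have h5 : (fun z => typeEnd (A.chartJ x z) (r - a) (rep x α z) k) =ᶠ[nhds
          (extChartAt (𝓡 (2 * n)) x x)] fun _ => 0 := by
        filter_upwards [h1] with z hz
        rw [hz, map_zero]
        rfl
      rw [dd, h5.fderiv_eq, fderiv_const_apply]
      rfl
    rw [h4, map_zero]
  rw [h3, map_zero]
  rfl

variable [IsContMDiffRiemannianBundle (𝓡 (2 * n)) ∞ (EuclideanSpace ℝ (Fin (2 * n)))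
      (fun x : M => TangentSpace (𝓡 (2 * n)) x)]

theorem dPart_add (a b : ℤ) {α β : Form n M} (hα : IsSmooth α) (hβ : IsSmooth β) :
    A.dPart a b (α + β) = A.dPart a b α + A.dPart a b β := by
  refine form_ext_rep fun c y hy => Fib.ext_apply fun k w => ?_
  change _ = rep c (A.dPart a b α) y k w + rep c (A.dPart a b β) y k w
  rw [A.rep_dPart_apply, A.rep_dPart_apply, A.rep_dPart_apply, ← Finset.sum_add_distrib]
  refine Finset.sum_congr rfl fun r _ => ?_
  rw [typeProj_add, extd_add (A.isSmooth_typeProj _ _ hα) (A.isSmooth_typeProj _ _ hβ),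
    typeProj_add]
  rfl

theorem dPart_smul (a b : ℤ) (z : ℂ) {α : Form n M} (hα : IsSmooth α) :
    A.dPart a b (z • α) = z • A.dPart a b α := by
  refine form_ext_rep fun c y hy => Fib.ext_apply fun k w => ?_
  change _ = z * rep c (A.dPart a b α) y k w
  rw [A.rep_dPart_apply, A.rep_dPart_apply, Finset.mul_sum]
  refine Finset.sum_congr rfl fun r _ => ?_
  rw [typeProj_smul, extd_smul z (A.isSmooth_typeProj _ _ hα), typeProj_smul]
  rfl

theorem dPart_sum (a b : ℤ) {ι : Type*} (s : Finset ι) {α : ι → Form n M}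
    (hα : ∀ i, IsSmooth (α i)) :
    A.dPart a b (∑ i ∈ s, α i) = ∑ i ∈ s, A.dPart a b (α i) := by
  classical
  induction s using Finset.induction_on with
  | empty =>
    rw [Finset.sum_empty, Finset.sum_empty]
    have h1 : A.dPart a b 0 + A.dPart a b 0 = A.dPart a b 0 := by
      rw [← A.dPart_add a b isSmooth_zero isSmooth_zero, add_zero]
    exact add_eq_left.mp h1
  | insert i s hi ih =>
    rw [Finset.sum_insert hi, Finset.sum_insert hi,
      A.dPart_add a b (hα i) (IsSmooth.sum fun j _ => hα j), ih]

variable [T2Space M] [SigmaCompactSpace M]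

/-- Cut α by the partition of unity. Each piece has compact support inside one chart, where the
pointwise defect of adjointness is the divergence of the flux and integrates to zero; the defect is
additive in α, so the pieces sum up. -/
theorem isMetricAdjoint_dPart (a b : ℤ) (hab : a + b = 1) (r : ℂ) {Q : Operator n M}
    (hQ : ∀ β, IsSmooth β → IsSmooth (Q β))
    (hdiv : ∀ {α β : Form n M}, IsSmooth α → IsSmooth β → ∀ {c : M} {y : Model n},
      y ∈ chartTarget c →
      ∑ j, fderiv ℝ (fun z => (vol c z : ℂ) * A.flux r c α β j z) y (stdB n j) =
        vol c y * (hermInner (A.dPart a b α) β (par c y) - hermInner α (Q β) (par c y))) :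
    IsMetricAdjoint (A.dPart a b) Q := by
  refine ⟨hQ, fun α β hα ⟨K, hK, hαK⟩ hβ => ?_⟩
  obtain ⟨s, hs, -⟩ := exists_finset_pou (n := n) hK
  have hcut : ∀ c, IsSmooth (cut (pou n M c) α) := fun c => isSmooth_cut (pou n M c).contMDiff hα
  have hsum : ∑ c ∈ s, cut (pou n M c) α = α := sum_cut hs hαK
  have hdiff : ∀ {α : Form n M}, IsSmooth α → ∀ {K : Set M}, IsCompact K →
      (∀ x ∉ K, ∀ k, α k x = 0) →
      IsCc K (fun x => hermInner (A.dPart a b α) β x - hermInner α (Q β) x) := by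
    intro α hα K hK hαK
    exact (isCc_hermInner_left (A.isSmooth_dPart a b hα) hβ hK
      (A.dPart_eq_zero_of_eventually a b hab hα hK.isClosed hαK)).sub
      (isCc_hermInner_left hα (hQ β hβ) hK hαK)
  have hcutK : ∀ c, ∀ x ∉ K ∩ tsupport (pou n M c), ∀ k, cut (pou n M c) α k x = 0 := by
    intro c x hx k
    by_cases hxK : x ∈ K
    · exact cut_eq_zero_left (pou_eq_zero fun h => hx ⟨hxK, h⟩) _ _
    · exact cut_eq_zero_right _ (hαK x hxK k)
  have hzero : ∀ c, NearlyKahler.integral (n := n) (fun x =>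
      hermInner (A.dPart a b (cut (pou n M c) α)) β x - hermInner (cut (pou n M c) α) (Q β) x) =
      0 := by
    intro c
    have hKc : IsCompact (K ∩ tsupport (pou n M c)) := hK.inter_right (isClosed_tsupport _)
    have hsub : K ∩ tsupport (pou n M c) ⊆ (chartAt (Model n) c).source :=
      Set.inter_subset_right.trans (tsupport_pou_subset c)
    rw [(hdiff (hcut c) hKc (hcutK c)).integral_eq_chartInt hsub, chartInt]
    -- The flux is linear in the cut form, so it vanishes outside a compact subset of the chart
    -- target. Each of its partial derivatives therefore has zero integral.
    have h1 : ∀ j, IntegrableOn (fun y => fderiv ℝ (fun z => (vol c z : ℂ) *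
        A.flux r c (cut (pou n M c) α) β j z) y (stdB n j)) (chartTarget c) volume ∧
        ∫ y in chartTarget c, fderiv ℝ (fun z => (vol c z : ℂ) *
          A.flux r c (cut (pou n M c) α) β j z) y (stdB n j) = 0 := by
      intro j
      refine setIntegral_fderiv_eq_zero volume (isOpen_chartTarget c)
        (isCompact_chart_image hKc hsub) (chart_image_subset hsub)
        (contDiffOn_vol_mul_flux r c (hcut c) hβ j) (fun z hz hzK => ?_) _
      have h2 : rep c (cut (pou n M c) α) z = 0 := rep_congr (β := 0) fun k =>
        hcutK c _ (par_notMem_of_notMem_image hz hzK) k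
      simp only [flux, h2, map_zero, LinearMap.zero_apply, mul_zero]
    rw [← setIntegral_congr_fun (isOpen_chartTarget c).measurableSet
      fun y hy => hdiv (hcut c) hβ hy, integral_finsetSum _ fun j _ => (h1 j).1]
    exact Finset.sum_eq_zero fun j _ => (h1 j).2
  have h3 := (isCc_hermInner_left (A.isSmooth_dPart a b hα) hβ hK
      (A.dPart_eq_zero_of_eventually a b hab hα hK.isClosed hαK)).integral_sub (n := n)
      (isCc_hermInner_left hα (hQ β hβ) hK hαK)
  refine sub_eq_zero.mp (h3.symm.trans ?_)
  have h4 : (fun x => hermInner (A.dPart a b α) β x - hermInner α (Q β) x) = fun x =>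
      ∑ c ∈ s, (hermInner (A.dPart a b (cut (pou n M c) α)) β x -
        hermInner (cut (pou n M c) α) (Q β) x) := by
    funext x
    conv_lhs => rw [← hsum, A.dPart_sum a b s hcut, hermInner_sum_left, hermInner_sum_left]
    rw [Finset.sum_sub_distrib]
  rw [h4, IsCc.integral_sum hK fun c _ => hdiff (hcut c) hK fun x hx k =>
    cut_eq_zero_right _ (hαK x hx k)]
  exact Finset.sum_eq_zero fun c _ => hzero c

end AlmostHermitianStructure

variable [T2Space M] [SigmaCompactSpace M]

theorem isMetricAdjoint_of_pointwise {P Q : Operator n M}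
    (hQ : ∀ β, IsSmooth β → IsSmooth (Q β))
    (h : ∀ α β, IsSmooth α → IsSmooth β → ∀ c, ∀ y ∈ chartTarget (n := n) c,
      hermInner (P α) β (par c y) = hermInner α (Q β) (par c y)) : IsMetricAdjoint P Q := by
  refine ⟨hQ, fun α β hα _ hβ => congrArg _ (funext fun x => ?_)⟩
  have := h α β hα hβ x _ (chart_mem_chartTarget x)
  rwa [par_chart] at this

variable [IsContMDiffRiemannianBundle (𝓡 (2 * n)) ∞ (EuclideanSpace ℝ (Fin (2 * n)))
      (fun x : M => TangentSpace (𝓡 (2 * n)) x)]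

/-- The integrand is χ|γ|² times the density: continuous, nonnegative and of compact support. A
vanishing integral forces it to vanish at x, where χ = 1 and the density is positive. -/
theorem eq_zero_of_integral_cut {γ : Form n M} (hγ : IsSmooth γ) (x : M)
    (χ : SmoothBumpFunction (𝓡 (2 * n)) x)
    (h : NearlyKahler.integral (n := n) (hermInner (cut χ γ) γ) = 0) (k : ℕ) : γ k x = 0 := by
  have hsub : tsupport χ ⊆ (chartAt (Model n) x).source := χ.tsupport_subset_chartAt_source
  have hcc : IsCc (tsupport χ) (hermInner (cut χ γ) γ) :=
    isCc_hermInner_left (isSmooth_cut χ.contMDiff hγ) hγ χ.hasCompactSupport fun z hz k =>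
      cut_eq_zero_left (image_eq_zero_of_notMem_tsupport hz) _ _
  rw [hcc.integral_eq_chartInt hsub, chartInt] at h
  set F : Model n → ℝ := fun y => vol x y * (hermInner (cut χ γ) γ (par x y)).re with hF
  have hcut : ∀ y ∈ chartTarget (n := n) x, ∃ r : ℝ, 0 ≤ r ∧
      hermInner (cut χ γ) γ (par x y) = r := by
    intro y hy
    obtain ⟨r, hr, hr'⟩ := hermInner_self_par hy γ
    exact ⟨χ (par x y) * r, mul_nonneg χ.nonneg hr, by rw [hermInner_cut_left, hr']; push_cast; rfl⟩
  have h1 : ∫ y in chartTarget (n := n) x, F y = 0 := by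
    have h2 : ∫ y in chartTarget (n := n) x, (F y : ℂ) = 0 := by
      rw [← h]
      refine setIntegral_congr_fun (isOpen_chartTarget x).measurableSet fun y hy => ?_
      obtain ⟨r, -, hr⟩ := hcut y hy
      simp only [hF, hr, Complex.ofReal_re, Complex.ofReal_mul]
    rw [integral_complex_ofReal] at h2
    exact_mod_cast h2
  have h0 : ∀ z ∈ chartTarget x, z ∉ extChartAt (𝓡 (2 * n)) x '' tsupport χ → F z = 0 :=
    fun z hz hzK => by
      simp only [hF, hcc.2.2 _ (par_notMem_of_notMem_image hz hzK), Complex.zero_re, mul_zero]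
  have hcomp := isCompact_chart_image (n := n) hcc.2.1 hsub
  have hcont : Continuous ((chartTarget x).indicator F) :=
    continuous_indicator_of_compact (isOpen_chartTarget x) hcomp (chart_image_subset hsub)
      ((contDiffOn_vol x).continuousOn.mul (Complex.continuous_re.comp_continuousOn
        (hcc.1.comp_continuousOn (continuousOn_par x)))) h0
  have hnn : 0 ≤ (chartTarget x).indicator F := by
    intro y
    refine Set.indicator_nonneg (fun z hz => ?_) y
    obtain ⟨r, hr, hr'⟩ := hcut z hz
    simp only [hF, hr', Complex.ofReal_re]
    exact mul_nonneg (vol_pos hz).le hr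
  have hx := chart_mem_chartTarget (n := n) x
  rw [← integral_indicator (isOpen_chartTarget x).measurableSet] at h1
  have h2 : (chartTarget x).indicator F (extChartAt (𝓡 (2 * n)) x x) = 0 := by
    by_contra hne
    exact (hcont.integral_pos_of_hasCompactSupport_nonneg_nonzero (μ := volume)
      (hasCompactSupport_indicator hcomp h0) hnn hne).ne' h1
  rw [Set.indicator_of_mem hx] at h2
  have h3 := (mul_eq_zero.mp h2).resolve_left (vol_pos hx).ne'
  obtain ⟨r, -, hr⟩ := hcut _ hx
  rw [hr, Complex.ofReal_re] at h3
  rw [h3, Complex.ofReal_zero, hermInner_cut_left, par_chart, χ.eq_one, Complex.ofReal_one,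
    one_mul] at hr
  exact apply_eq_zero_of_hermInner_self hr k

/-- Test both adjoints against their own difference, multiplied by a bump function to make it
compactly supported. -/
theorem IsMetricAdjoint.unique {P Q Q' : Operator n M} (h : IsMetricAdjoint P Q)
    (h' : IsMetricAdjoint P Q') {β : Form n M} (hβ : IsSmooth β) : Q β = Q' β := by
  have hγ : IsSmooth (Q β - Q' β) := (h.1 β hβ).sub (h'.1 β hβ)
  rw [← sub_eq_zero]
  funext k x
  obtain ⟨χ⟩ : Nonempty (SmoothBumpFunction (𝓡 (2 * n)) x) := inferInstance
  refine eq_zero_of_integral_cut hγ x χ ?_ k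
  have hs : IsSmooth (cut χ (Q β - Q' β)) := isSmooth_cut χ.contMDiff hγ
  have hc : ∀ z ∉ tsupport χ, ∀ k, cut χ (Q β - Q' β) k z = 0 := fun z hz k =>
    cut_eq_zero_left (image_eq_zero_of_notMem_tsupport hz) _ _
  have h1 := (h.2 _ β hs ⟨_, χ.hasCompactSupport, hc⟩ hβ).symm.trans
    (h'.2 _ β hs ⟨_, χ.hasCompactSupport, hc⟩ hβ)
  have h2 := (isCc_hermInner_left hs (h.1 β hβ) χ.hasCompactSupport hc).integral_sub (n := n)
    (isCc_hermInner_left hs (h'.1 β hβ) χ.hasCompactSupport hc)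
  rw [h1, sub_self] at h2
  exact (congrArg _ (funext fun z => hermInner_sub_right _ _ _ _)).trans h2

theorem metricAdjoint_apply {P Q : Operator n M} (h : IsMetricAdjoint P Q) {β : Form n M}
    (hβ : IsSmooth β) : metricAdjoint P β = Q β := by
  have h1 : ∃ Q, IsMetricAdjoint P Q := ⟨Q, h⟩
  rw [metricAdjoint, dif_pos h1]
  exact h1.choose_spec.unique h hβ

end MetricAdjoints

/-! ### The algebra of operators on smooth forms -/

section BidegreeRelation

variable {R : Type*} [Ring R]

/-- The four operators shift the type by 1, 0, 2 and −1. Between the projections of index r + 1 and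
r, only products with total shift 1 survive in the square: pq, qp, mm' and m'm. -/
theorem acomm_add_acomm_eq_zero {Pi : ℤ → R} {s : Finset ℤ} (hPi : ∑ r ∈ s, Pi r = 1)
    (horth : ∀ a b, Pi a * Pi b = if a = b then Pi a else 0) {p q m m' : R}
    (hp : ∀ r, Pi r * p = p * Pi (r - 1)) (hq : ∀ r, Pi r * q = q * Pi (r - 0))
    (hm : ∀ r, Pi r * m = m * Pi (r - 2)) (hm' : ∀ r, Pi r * m' = m' * Pi (r - -1))
    (h : (p + q + m + m') * (p + q + m + m') = 0) : acomm p q + acomm m m' = 0 := by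
  have hmul : ∀ {x y : R} {a b : ℤ}, (∀ r, Pi r * x = x * Pi (r - a)) →
      (∀ r, Pi r * y = y * Pi (r - b)) → ∀ r, Pi (r + 1) * (x * y) * Pi r =
        if a + b = 1 then x * y * Pi r else 0 := by
    intro x y a b hx hy r
    rw [← mul_assoc, hx, mul_assoc x, hy, ← mul_assoc, mul_assoc (x * y), horth]
    by_cases hab : a + b = 1
    · rw [if_pos hab, if_pos (by omega), show r + 1 - a - b = r by omega]
    · rw [if_neg hab, if_neg (by omega), mul_zero]
  have key : ∀ r, (acomm p q + acomm m m') * Pi r = 0 := by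
    intro r
    have h1 := congrArg (fun x => Pi (r + 1) * x * Pi r) h
    simp only [mul_add, add_mul, mul_zero, zero_mul] at h1
    simp only [hmul hp hp, hmul hp hq, hmul hp hm, hmul hp hm', hmul hq hp, hmul hq hq, hmul hq hm,
      hmul hq hm', hmul hm hp, hmul hm hq, hmul hm hm, hmul hm hm', hmul hm' hp, hmul hm' hq,
      hmul hm' hm, hmul hm' hm'] at h1
    norm_num at h1
    simp only [acomm, add_mul]
    rw [← h1]
    abel
  rw [← mul_one (acomm p q + acomm m m'), ← hPi, Finset.mul_sum]
  exact Finset.sum_eq_zero fun r _ => key r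

end BidegreeRelation

/-! ### The endomorphism ring of the space of smooth forms. -/

section SmoothForms

variable {n : ℕ} {M : Type*} [TopologicalSpace M] [ChartedSpace (Model n) M]

variable (n M) in
/-- The space of smooth complex-valued forms. -/
def smoothForms : Submodule ℂ (Form n M) where
  carrier := {α | IsSmooth α}
  add_mem' ha hb := IsSmooth.add ha hb
  zero_mem' := isSmooth_zero
  smul_mem' z _ ha := IsSmooth.const_smul z ha

variable (n M) in
/-- The type of smooth complex-valued forms. -/
def SmoothForm : Type _ := smoothForms n M

set_option synthInstance.maxHeartbeats 400000 in
instance : AddCommGroup (SmoothForm n M) := Submodule.addCommGroup (smoothForms n M)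

set_option synthInstance.maxHeartbeats 400000 in
instance : Module ℂ (SmoothForm n M) := Submodule.module (smoothForms n M)

/-- A smooth form, as an element of the space of smooth forms. -/
def SmoothForm.mk (α : Form n M) (h : IsSmooth α) : SmoothForm n M := ⟨α, h⟩

/-- The form underlying an element of the space of smooth forms. -/
def SmoothForm.val (α : SmoothForm n M) : Form n M := Subtype.val α

theorem SmoothForm.isSmooth (α : SmoothForm n M) : IsSmooth α.val := Subtype.property α

theorem SmoothForm.ext {α β : SmoothForm n M} (h : α.val = β.val) : α = β := Subtype.ext h

theorem SmoothForm.mk_val (α : SmoothForm n M) : SmoothForm.mk α.val α.isSmooth = α := rfl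

theorem rep_val_sum {ι : Type*} (s : Finset ι) (α : ι → SmoothForm n M) (c : M) (y : Model n) :
    rep c (∑ i ∈ s, α i).val y = ∑ i ∈ s, rep c (α i).val y := by
  classical
  induction s using Finset.induction_on with
  | empty => rfl
  | insert i s hi ih =>
    rw [Finset.sum_insert hi, Finset.sum_insert hi, ← ih]
    rfl

/-- The restriction to smooth forms of an operator. -/
def opEnd (P : Operator n M) (hs : ∀ α, IsSmooth α → IsSmooth (P α))
    (ha : ∀ α β, IsSmooth α → IsSmooth β → P (α + β) = P α + P β)
    (hm : ∀ (z : ℂ) α, IsSmooth α → P (z • α) = z • P α) : Module.End ℂ (SmoothForm n M) where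
  toFun α := .mk (P α.val) (hs _ α.isSmooth)
  map_add' α β := SmoothForm.ext (ha _ _ α.isSmooth β.isSmooth)
  map_smul' z α := SmoothForm.ext (hm z _ α.isSmooth)

/-- `P` restricts to `T` on smooth forms. -/
def Restricts (P : Operator n M) (T : Module.End ℂ (SmoothForm n M)) : Prop :=
  ∀ α : SmoothForm n M, P α.val = (T α).val

open Classical in
/-- The extension by zero of an operator on smooth forms. -/
def extendOp (T : Module.End ℂ (SmoothForm n M)) : Operator n M := fun α =>
  if h : IsSmooth α then (T (.mk α h)).val else 0

theorem extendOp_apply (T : Module.End ℂ (SmoothForm n M)) {α : Form n M} (h : IsSmooth α) :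
    extendOp T α = (T (.mk α h)).val := dif_pos h

theorem isSmooth_extendOp (T : Module.End ℂ (SmoothForm n M)) (α : Form n M) (h : IsSmooth α) :
    IsSmooth (extendOp T α) := by
  rw [extendOp_apply T h]
  exact (T (.mk α h)).isSmooth

namespace Restricts

variable {P Q : Operator n M} {S T : Module.End ℂ (SmoothForm n M)}

theorem add (hP : Restricts P S) (hQ : Restricts Q T) : Restricts (P + Q) (S + T) := fun α => by
  change P α.val + Q α.val = _
  rw [hP, hQ]
  rfl

theorem sub (hP : Restricts P S) (hQ : Restricts Q T) : Restricts (P - Q) (S - T) := fun α => by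
  change P α.val - Q α.val = _
  rw [hP, hQ]
  rfl

theorem gradedComm_even (hP : Restricts P S) (hQ : Restricts Q T) {p q : ℤ} (hpq : Even (p * q)) :
    Restricts (gradedComm p q P Q) (br S T) := fun α => by
  change P (Q α.val) - ((-1 : ℂ) ^ (p * q)) • Q (P α.val) = _
  rw [hpq.neg_one_zpow, hQ, hP, hP, hQ, one_smul]
  rfl

theorem gradedComm_odd (hP : Restricts P S) (hQ : Restricts Q T) {p q : ℤ} (hpq : Odd (p * q)) :
    Restricts (gradedComm p q P Q) (acomm S T) := fun α => by
  change P (Q α.val) - ((-1 : ℂ) ^ (p * q)) • Q (P α.val) = _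
  rw [hpq.neg_one_zpow, hQ, hP, hP, hQ]
  refine (congrArg (fun z => (S (T α)).val - z) (neg_one_smul ℂ (T (S α)).val)).trans ?_
  exact sub_neg_eq_add _ _

end Restricts

/-- `P` acts on the fibre at a point of a chart by `T`. -/
def ActsBy (P : Module.End ℂ (SmoothForm n M)) (c : M) (y : Model n)
    (T : Module.End ℂ (Fib (Model n))) : Prop :=
  ∀ α : SmoothForm n M, rep c (P α).val y = T (rep c α.val y)

namespace ActsBy

variable {P Q : Module.End ℂ (SmoothForm n M)} {c : M} {y : Model n}
  {S T : Module.End ℂ (Fib (Model n))}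

theorem one : ActsBy (1 : Module.End ℂ (SmoothForm n M)) c y 1 := fun _ => rfl

theorem zero : ActsBy (0 : Module.End ℂ (SmoothForm n M)) c y 0 := fun _ => rfl

theorem add (hP : ActsBy P c y S) (hQ : ActsBy Q c y T) : ActsBy (P + Q) c y (S + T) := fun α => by
  rw [LinearMap.add_apply, LinearMap.add_apply, ← hP, ← hQ]
  rfl

theorem sub (hP : ActsBy P c y S) (hQ : ActsBy Q c y T) : ActsBy (P - Q) c y (S - T) := fun α => by
  rw [LinearMap.sub_apply, LinearMap.sub_apply, ← hP, ← hQ]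
  rfl

theorem mul (hP : ActsBy P c y S) (hQ : ActsBy Q c y T) : ActsBy (P * Q) c y (S * T) := fun α => by
  rw [Module.End.mul_apply, Module.End.mul_apply, hP, hQ]

theorem smul (z : ℂ) (hP : ActsBy P c y S) : ActsBy (z • P) c y (z • S) := fun α => by
  rw [LinearMap.smul_apply, LinearMap.smul_apply, ← hP]
  rfl

theorem sum {ι : Type*} (s : Finset ι) {P : ι → Module.End ℂ (SmoothForm n M)}
    {S : ι → Module.End ℂ (Fib (Model n))} (h : ∀ i ∈ s, ActsBy (P i) c y (S i)) :
    ActsBy (∑ i ∈ s, P i) c y (∑ i ∈ s, S i) := by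
  classical
  induction s using Finset.induction_on with
  | empty => exact zero
  | insert i s hi ih =>
    rw [Finset.sum_insert hi, Finset.sum_insert hi]
    exact (h i (Finset.mem_insert_self _ _)).add
      (ih fun j hj => h j (Finset.mem_insert_of_mem hj))

theorem br (hP : ActsBy P c y S) (hQ : ActsBy Q c y T) : ActsBy (br P Q) c y (br S T) :=
  (hP.mul hQ).sub (hQ.mul hP)

theorem acomm (hP : ActsBy P c y S) (hQ : ActsBy Q c y T) : ActsBy (acomm P Q) c y (acomm S T) :=
  (hP.mul hQ).add (hQ.mul hP)

end ActsBy

variable [IsManifold (𝓡 (2 * n)) ∞ M]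

/-- Reduces identities between operators of order zero to identities in the exterior algebra at a
single point. -/
theorem end_ext {P Q : Module.End ℂ (SmoothForm n M)}
    (h : ∀ c, ∀ y ∈ chartTarget (n := n) c, ∃ T, ActsBy P c y T ∧ ActsBy Q c y T) : P = Q :=
  LinearMap.ext fun α => SmoothForm.ext (form_ext_rep fun c y hy => by
    obtain ⟨T, h1, h2⟩ := h c y hy
    rw [h1, h2])

variable [RiemannianBundle (fun x : M => TangentSpace (𝓡 (2 * n)) x)] [T2Space M]
  [SigmaCompactSpace M]

theorem isMetricAdjoint_of_isAdj {P : Operator n M} {S T : Module.End ℂ (SmoothForm n M)}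
    (hP : Restricts P S)
    (h : ∀ c y, ∀ hy : y ∈ chartTarget (n := n) c, ∃ U V, ActsBy S c y U ∧ ActsBy T c y V ∧
      IsAdj (herm (frame hy)) U V) : IsMetricAdjoint P (extendOp T) := by
  refine isMetricAdjoint_of_pointwise (isSmooth_extendOp T) fun α β hα hβ c y hy => ?_
  obtain ⟨U, V, hU, hV, hUV⟩ := h c y hy
  have h1 : P α = (S (.mk α hα)).val := hP (.mk α hα)
  rw [hermInner_par hy, hermInner_par hy, ← (isFrame_gamma hy).herm_eq, h1, hU, extendOp_apply T hβ,
    hV]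
  exact hUV _ _

variable [IsContMDiffRiemannianBundle (𝓡 (2 * n)) ∞ (EuclideanSpace ℝ (Fin (2 * n)))
      (fun x : M => TangentSpace (𝓡 (2 * n)) x)]

theorem restricts_metricAdjoint {P : Operator n M} {T : Module.End ℂ (SmoothForm n M)}
    (h : IsMetricAdjoint P (extendOp T)) : Restricts (metricAdjoint P) T := fun α => by
  rw [metricAdjoint_apply h α.isSmooth, extendOp_apply T α.isSmooth, SmoothForm.mk_val]

theorem restricts_laplacian {P : Operator n M} {S T : Module.End ℂ (SmoothForm n M)}
    (h : IsMetricAdjoint P (extendOp T)) (hP : Restricts P S) {p : ℤ} (hp : Odd p) :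
    Restricts (laplacian p P) (acomm T S) :=
  (restricts_metricAdjoint h).gradedComm_odd hP (hp.neg.mul hp)

end SmoothForms

/-! ### The components of `d` in the algebra of operators -/

section OperatorAlgebra

variable {n : ℕ} {M : Type*} [TopologicalSpace M] [ChartedSpace (Model n) M]
  [RiemannianBundle (fun x : M => TangentSpace (𝓡 (2 * n)) x)] [IsManifold (𝓡 (2 * n)) ∞ M]

namespace AlmostHermitianStructure

variable (A : AlmostHermitianStructure n M)

/-- The projection of forms to their parts of type `(p, ·)`, in all degrees. -/
def typeOp (p : ℤ) : Operator n M := fun α k x => typePart (A.J x) p (α k x)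

theorem rep_typeOp (p : ℤ) (α : Form n M) {c : M} {y : Model n} (hy : y ∈ chartTarget c) :
    rep c (A.typeOp p α) y = typeEnd (A.chartJ c y) p (rep c α y) :=
  pull_typeEnd (dpar c y) (A.dpar_chartJ hy) p (fib α (par c y))

variable [IsContMDiffRiemannianBundle (𝓡 (2 * n)) ∞ (EuclideanSpace ℝ (Fin (2 * n)))
      (fun x : M => TangentSpace (𝓡 (2 * n)) x)]

theorem isSmooth_typeOp (p : ℤ) {α : Form n M} (hα : IsSmooth α) : IsSmooth (A.typeOp p α) :=
  isSmooth_iff.mpr fun c => ((isSmooth_iff.mp hα c).typeEnd (A.contDiffOn_chartJ c) p).congr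
    fun _ hz => A.rep_typeOp p α hz

/-- An operator on smooth forms which acts in charts by linear maps of the fibres. -/
def fibreEnd (P : Operator n M) (hs : ∀ α, IsSmooth α → IsSmooth (P α))
    (h : ∀ c, ∀ y ∈ chartTarget (n := n) c, ∃ T : Module.End ℂ (Fib (Model n)),
      ∀ α, rep c (P α) y = T (rep c α y)) : Module.End ℂ (SmoothForm n M) :=
  opEnd P hs
    (fun α β _ _ => form_ext_rep fun c y hy => by
      obtain ⟨T, hT⟩ := h c y hy
      rw [hT, rep_add, rep_add, hT, hT, map_add])
    (fun z α _ => form_ext_rep fun c y hy => by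
      obtain ⟨T, hT⟩ := h c y hy
      rw [hT, rep_smul, rep_smul, hT, map_smul])

/-- `typeOp` on smooth forms. -/
def typeS (p : ℤ) : Module.End ℂ (SmoothForm n M) :=
  fibreEnd (A.typeOp p) (fun _ h => A.isSmooth_typeOp p h)
    fun _ _ hy => ⟨_, fun α => A.rep_typeOp p α hy⟩

variable (n M) in
/-- The exterior derivative on smooth forms. -/
def extdS : Module.End ℂ (SmoothForm n M) :=
  opEnd extd (fun _ h => isSmooth_extd h) (fun _ _ => extd_add) fun z _ => extd_smul z

/-- `dPart` on smooth forms. -/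
def dPartS (a b : ℤ) : Module.End ℂ (SmoothForm n M) :=
  opEnd (A.dPart a b) (fun _ h => A.isSmooth_dPart a b h) (fun _ _ => A.dPart_add a b)
    fun z _ => A.dPart_smul a b z

/-- `lefschetz` on smooth forms. -/
def lefschetzS : Module.End ℂ (SmoothForm n M) :=
  fibreEnd A.lefschetz (fun _ h => A.isSmooth_lefschetz h)
    fun _ _ hy => ⟨_, fun α => A.rep_lefschetz hy α⟩

/-- `lamOp` on smooth forms. -/
def lamS : Module.End ℂ (SmoothForm n M) :=
  fibreEnd A.lamOp (fun _ h => A.isSmooth_lamOp h) fun _ _ hy => ⟨_, fun α => A.rep_lamOp hy α⟩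

/-- Left multiplication by a component of `dω`, on smooth forms. -/
def mulS (a b : ℤ) : Module.End ℂ (SmoothForm n M) :=
  fibreEnd (mulLeft (A.dPart a b A.fundamentalForm)) (fun _ h => A.isSmooth_mulLeft_dPart a b h)
    fun c y _ => ⟨_, fun α => rep_mulLeft
      (fun _ hk => A.dPart_fundamentalForm_apply_eq_zero a b hk) α c y⟩

variable {A}

theorem actsBy_typeS (p : ℤ) {c : M} {y : Model n} (hy : y ∈ chartTarget c) :
    ActsBy (A.typeS p) c y (typeEnd (A.chartJ c y) p) := fun α => A.rep_typeOp p α.val hy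

theorem actsBy_lefschetzS {c : M} {y : Model n} (hy : y ∈ chartTarget c) :
    ActsBy A.lefschetzS c y (lefL (matC (frame hy) (A.chartJ c y)) (epsB (frame hy))) :=
  fun α => A.rep_lefschetz hy α.val

theorem actsBy_lamS {c : M} {y : Model n} (hy : y ∈ chartTarget c) :
    ActsBy A.lamS c y (lefΛ (matC (frame hy) (A.chartJ c y)) (iotaB (frame hy))) :=
  fun α => A.rep_lamOp hy α.val

theorem typeS_mul_typeS (p q : ℤ) :
    A.typeS p * A.typeS q = if p = q then A.typeS p else 0 := by
  refine end_ext fun c y hy => ⟨_, (actsBy_typeS p hy).mul (actsBy_typeS q hy), ?_⟩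
  rw [typeEnd_mul_typeEnd (A.chartJ_chartJ hy)]
  split_ifs
  · exact actsBy_typeS p hy
  · exact ActsBy.zero

theorem fib_apply_eq_zero {k : ℕ} (hk : 2 * n < k) (a : Fib (Model n)) : a k = 0 :=
  form_eq_zero_of_card_lt (stdB n) (by simpa using hk) _

/-- Types beyond the degree and degrees beyond 2n contribute nothing. Thus one finite range of types
serves all degrees simultaneously, and the projections sum to the identity. -/
theorem sum_Icc_typeEnd_two_mul (J : Model n →L[ℝ] Model n) (P : ℤ → Fib (Model n)) (k : ℕ)
    (w : Fin k → Model n) : ∑ r ∈ Finset.Icc (0 : ℤ) (2 * n : ℕ), typeEnd J r (P r) k w =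
      ∑ r ∈ Finset.Icc (0 : ℤ) k, typeEnd J r (P r) k w := by
  rcases le_or_gt k (2 * n) with hk | hk
  · refine (Finset.sum_subset (Finset.Icc_subset_Icc_right (by exact_mod_cast hk))
      fun r _ hr => ?_).symm
    rw [typeEnd_eq_zero J r (P r) k (by rw [Finset.mem_Icc] at hr; omega)]
    rfl
  · have h (r : ℤ) : typeEnd J r (P r) k w = 0 :=
      congrArg (fun a : Model n [⋀^Fin k]→L[ℝ] ℂ => a w) (fib_apply_eq_zero hk (typeEnd J r (P r)))
    simp only [h, Finset.sum_const_zero]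

theorem sum_typeS : ∑ r ∈ Finset.Icc (0 : ℤ) (2 * n : ℕ), A.typeS r = 1 := by
  refine end_ext fun c y hy => ⟨_, ActsBy.sum _ fun r _ => actsBy_typeS r hy, ?_⟩
  convert ActsBy.one
  refine LinearMap.ext fun a => Fib.ext_apply fun k w => ?_
  rw [LinearMap.sum_apply, Fib.sum_apply_apply, sum_Icc_typeEnd_two_mul _ (fun _ => a),
    ← ContinuousAlternatingMap.sum_apply, sum_Icc_typeEnd_apply]
  rfl

theorem typeS_eq_zero {r : ℤ} (hr : r ∉ Finset.Icc (0 : ℤ) (2 * n : ℕ)) : A.typeS r = 0 := by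
  rw [← mul_one (A.typeS r), ← sum_typeS (A := A), Finset.mul_sum]
  refine Finset.sum_eq_zero fun s hs => ?_
  rw [typeS_mul_typeS, if_neg]
  rintro rfl
  exact hr hs

omit [RiemannianBundle fun x : M => TangentSpace (𝓡 (2 * n)) x] [IsContMDiffRiemannianBundle
  (𝓡 (2 * n)) ∞ (EuclideanSpace ℝ (Fin (2 * n))) (fun x : M => TangentSpace (𝓡 (2 * n)) x)]
  [TopologicalSpace M] [ChartedSpace (Model n) M] [IsManifold (𝓡 (2 * n)) ∞ M] in
theorem extDerivF_zero (a : Model n → Fib (Model n)) (y : Model n) : extDerivF a y 0 = 0 := rfl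

theorem val_typeS (p : ℤ) (α : SmoothForm n M) : (A.typeS p α).val = A.typeOp p α.val := rfl

omit [RiemannianBundle fun x : M => TangentSpace (𝓡 (2 * n)) x] [IsContMDiffRiemannianBundle
  (𝓡 (2 * n)) ∞ (EuclideanSpace ℝ (Fin (2 * n))) (fun x : M => TangentSpace (𝓡 (2 * n)) x)] in
theorem val_extdS (α : SmoothForm n M) : (extdS n M α).val = extd α.val := rfl

/-- The second index of the type is forced by the degree: d raises the degree by one and a + b = 1.
Recording p alone is therefore enough. -/
theorem dPartS_eq (a b : ℤ) (hab : a + b = 1) : A.dPartS a b =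
    ∑ r ∈ Finset.Icc (0 : ℤ) (2 * n : ℕ), A.typeS r * extdS n M * A.typeS (r - a) := by
  refine LinearMap.ext fun α => SmoothForm.ext (form_ext_rep fun c y hy =>
    Fib.ext_apply fun k w => ?_)
  have h2 : ∀ r, rep c ((A.typeS r * extdS n M * A.typeS (r - a)) α).val y =
      typeEnd (A.chartJ c y) r
        (extDerivF (fun z => typeEnd (A.chartJ c z) (r - a) (rep c α.val z)) y) := fun r => by
    rw [Module.End.mul_apply, Module.End.mul_apply, actsBy_typeS r hy, val_extdS, val_typeS,
      rep_extd (A.isSmooth_typeOp (r - a) α.isSmooth) hy]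
    refine congrArg _ ?_
    refine funext fun k => ?_
    cases k with
    | zero => exact (extDerivF_zero _ _).trans (extDerivF_zero _ _).symm
    | succ k =>
      refine extDerivF_congr_degree ?_
      filter_upwards [(isOpen_chartTarget c).mem_nhds hy] with z hz
      rw [A.rep_typeOp _ _ hz]
  rw [LinearMap.sum_apply, rep_val_sum, Fib.sum_apply_apply]
  simp only [h2]
  rw [sum_Icc_typeEnd_two_mul]
  exact A.rep_dPart a b hab α.isSmooth hy k w

/-- By orthogonality of the projections, both sides reduce to the single term of index r. Outside
the range of types both sides are zero. -/
theorem typeS_mul_dPartS (a b : ℤ) (hab : a + b = 1) (r : ℤ) :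
    A.typeS r * A.dPartS a b = A.dPartS a b * A.typeS (r - a) := by
  have h1 : A.typeS r * A.dPartS a b = A.typeS r * extdS n M * A.typeS (r - a) := by
    rw [dPartS_eq a b hab, Finset.mul_sum]
    by_cases hr : r ∈ Finset.Icc (0 : ℤ) (2 * n : ℕ)
    · rw [Finset.sum_eq_single_of_mem r hr fun s _ hs => by
        rw [← mul_assoc, ← mul_assoc, typeS_mul_typeS, if_neg hs.symm, zero_mul, zero_mul],
        ← mul_assoc, ← mul_assoc, typeS_mul_typeS, if_pos rfl]
    · rw [typeS_eq_zero hr, zero_mul, zero_mul]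
      exact Finset.sum_eq_zero fun _ _ => zero_mul _
  rw [h1, dPartS_eq a b hab, Finset.sum_mul]
  by_cases hr : r ∈ Finset.Icc (0 : ℤ) (2 * n : ℕ)
  · rw [Finset.sum_eq_single_of_mem r hr fun s _ hs => by
      rw [mul_assoc, typeS_mul_typeS, if_neg (by omega), mul_zero],
      mul_assoc _ (A.typeS (r - a)), typeS_mul_typeS, if_pos rfl]
  · rw [typeS_eq_zero hr, zero_mul, zero_mul]
    refine (Finset.sum_eq_zero fun s hs => ?_).symm
    rw [mul_assoc, typeS_mul_typeS, if_neg (fun h => hr (by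
      rw [show r = s by omega]; exact hs)), mul_zero]

theorem extdS_mul_extdS : extdS n M * extdS n M = 0 :=
  LinearMap.ext fun α => SmoothForm.ext (extd_extd α.isSmooth)

section Nearly

variable {c : M} {y : Model n} {hy : y ∈ chartTarget c}
  {B : Model n →L[ℝ] Model n →L[ℝ] Model n}

theorem IsHermConn.rep_extd (hB : A.IsHermConn hy B) {α : Form n M} (hα : IsSmooth α) :
    rep c (extd α) y = rep c (A.del α) y + rep c (A.delbar α) y + rep c (A.mu α) y +
      rep c (A.mubar α) y := by
  rw [rep_extd_eq (frame hy) hα hy, hB.rep_del hα, hB.rep_delbar hα, hB.rep_mu hα, hB.rep_mubar hα,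
    add_assoc, ← LinearMap.add_apply, ← sum_eps_rho,
    ← sum_epsT_eq (b := stdB n) (nab B c α y) (nab_eq_sum (frame hy) α) Complex.I,
    ← sum_epsT_eq (b := stdB n) (nab B c α y) (nab_eq_sum (frame hy) α) (-Complex.I), ← Finset.sum_add_distrib,
    LinearMap.sum_apply, ← Finset.sum_add_distrib]
  refine Finset.sum_congr rfl fun j _ => ?_
  rw [← LinearMap.add_apply, epsT_add_epsT, Module.End.mul_apply, ← map_add]
  refine congrArg _ ?_
  rw [← rho_eq_rho (stdB n) (frame hy), nab, sub_add_cancel]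

theorem IsHermConn.actsBy_mu (hB : A.IsHermConn hy B) :
    ActsBy (A.dPartS 2 (-1)) c y (torsOp (frame hy) (A.chartJ c y) B Complex.I) :=
  fun α => hB.rep_mu α.isSmooth

theorem IsHermConn.actsBy_mubar (hB : A.IsHermConn hy B) :
    ActsBy (A.dPartS (-1) 2) c y (torsOp (frame hy) (A.chartJ c y) B (-Complex.I)) :=
  fun α => hB.rep_mubar α.isSmooth

theorem IsHermConn.actsBy_mul_mu (hB : A.IsHermConn hy B) :
    ActsBy (A.mulS 2 (-1)) c y (-(Complex.I / 2) • tri (torsC (frame hy) (A.chartJ c y) B Complex.I)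
      (epsB (frame hy)) (epsB (frame hy)) (epsB (frame hy))) :=
  fun α => hB.rep_mulLeft_mu α.val

theorem IsHermConn.actsBy_mul_mubar (hB : A.IsHermConn hy B) :
    ActsBy (A.mulS (-1) 2) c y
      (-(-Complex.I / 2) • tri (torsC (frame hy) (A.chartJ c y) B (-Complex.I))
        (epsB (frame hy)) (epsB (frame hy)) (epsB (frame hy))) :=
  fun α => hB.rep_mulLeft_mubar α.val

end Nearly

variable [T2Space M] (hA : A.IsNearlyKahler)

include hA

/-- The local formula for d consists of the two halves of Σ e^j ∧ ∇'_j and the two halves of the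
torsion operator, so no other component exists. -/
theorem extdS_eq :
    extdS n M = A.dPartS 1 0 + A.dPartS 0 1 + A.dPartS 2 (-1) + A.dPartS (-1) 2 := by
  refine LinearMap.ext fun α => SmoothForm.ext (form_ext_rep fun c y hy => ?_)
  obtain ⟨B, hB⟩ := A.exists_isHermConn hA hy
  exact hB.rep_extd α.isSmooth

/-- The (1,1) component of d² = 0. -/
theorem acomm_del_delbar :
    acomm (A.dPartS 1 0) (A.dPartS 0 1) + acomm (A.dPartS 2 (-1)) (A.dPartS (-1) 2) = 0 :=
  acomm_add_acomm_eq_zero sum_typeS typeS_mul_typeS (typeS_mul_dPartS 1 0 (by norm_num))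
    (typeS_mul_dPartS 0 1 (by norm_num)) (typeS_mul_dPartS 2 (-1) (by norm_num))
    (typeS_mul_dPartS (-1) 2 (by norm_num)) (by rw [← extdS_eq hA, extdS_mul_extdS])

end AlmostHermitianStructure

end OperatorAlgebra

/-! ### Nearly Kähler relations -/

section LefschetzRelations

variable {n : ℕ} {M : Type*} [TopologicalSpace M] [ChartedSpace (Model n) M]
  [RiemannianBundle (fun x : M => TangentSpace (𝓡 (2 * n)) x)] [IsManifold (𝓡 (2 * n)) ∞ M]
  [IsContMDiffRiemannianBundle (𝓡 (2 * n)) ∞ (EuclideanSpace ℝ (Fin (2 * n)))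
      (fun x : M => TangentSpace (𝓡 (2 * n)) x)]

namespace AlmostHermitianStructure

variable {A : AlmostHermitianStructure n M}

section Frame

variable {c : M} {y : Model n} (hy : y ∈ chartTarget c)

theorem matC_frame_swap (i j : Fin (2 * n)) :
    matC (frame hy) (A.chartJ c y) i j = -matC (frame hy) (A.chartJ c y) j i :=
  matC_swap (A.matOf_chartJ_swap hy) i j

theorem sum_matC_frame (i j : Fin (2 * n)) :
    ∑ l, matC (frame hy) (A.chartJ c y) i l * matC (frame hy) (A.chartJ c y) l j =
      if i = j then -1 else 0 :=
  sum_matC_mul_matC _ _ (A.chartJ_chartJ hy) i j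

variable {hy} {B : Model n →L[ℝ] Model n →L[ℝ] Model n} (hB : A.IsHermConn hy B)

include hB

theorem IsHermConn.torsC_swap_right (r : ℂ) (i j k : Fin (2 * n)) :
    torsC (frame hy) (A.chartJ c y) B r i j k = -torsC (frame hy) (A.chartJ c y) B r i k j :=
  NearlyKahler.torsC_swap_right _ _ _ hB.torsR_skew hB.torsJ_skew r i j k

end Frame

theorem weight_lamS : br (br A.lefschetzS A.lamS) A.lamS = (-2 : ℂ) • A.lamS := by
  refine end_ext fun c y hy => ⟨_, ((actsBy_lefschetzS hy).br (actsBy_lamS hy)).br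
    (actsBy_lamS hy), ?_⟩
  rw [weight_lefΛ (iotaB_mul_iotaB _) (iotaB_mul_epsB _) (matC_frame_swap hy) (sum_matC_frame hy)]
  exact (actsBy_lamS hy).smul _

variable [T2Space M] (hA : A.IsNearlyKahler)

include hA

theorem weight_mul_mu :
    br (br A.lefschetzS A.lamS) (A.mulS 2 (-1)) = (3 : ℂ) • A.mulS 2 (-1) := by
  refine end_ext fun c y hy => ?_
  obtain ⟨B, hB⟩ := A.exists_isHermConn hA hy
  refine ⟨_, ((actsBy_lefschetzS hy).br (actsBy_lamS hy)).br hB.actsBy_mul_mu, ?_⟩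
  rw [br_smul, weight_tri (epsB_mul_epsB _) (iotaB_mul_epsB _) (matC_frame_swap hy)
    (sum_matC_frame hy), smul_comm]
  exact hB.actsBy_mul_mu.smul _

theorem weight_mul_mubar :
    br (br A.lefschetzS A.lamS) (A.mulS (-1) 2) = (3 : ℂ) • A.mulS (-1) 2 := by
  refine end_ext fun c y hy => ?_
  obtain ⟨B, hB⟩ := A.exists_isHermConn hA hy
  refine ⟨_, ((actsBy_lefschetzS hy).br (actsBy_lamS hy)).br hB.actsBy_mul_mubar, ?_⟩
  rw [br_smul, weight_tri (epsB_mul_epsB _) (iotaB_mul_epsB _) (matC_frame_swap hy)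
    (sum_matC_frame hy), smul_comm]
  exact hB.actsBy_mul_mubar.smul _

theorem br_lefschetzS_mul_mu : br A.lefschetzS (A.mulS 2 (-1)) = 0 := by
  refine end_ext fun c y hy => ?_
  obtain ⟨B, hB⟩ := A.exists_isHermConn hA hy
  refine ⟨_, (actsBy_lefschetzS hy).br hB.actsBy_mul_mu, ?_⟩
  rw [br_smul, br_lefL_tri (epsB_mul_epsB _), smul_zero]
  exact ActsBy.zero

theorem br_lefschetzS_mul_mubar : br A.lefschetzS (A.mulS (-1) 2) = 0 := by
  refine end_ext fun c y hy => ?_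
  obtain ⟨B, hB⟩ := A.exists_isHermConn hA hy
  refine ⟨_, (actsBy_lefschetzS hy).br hB.actsBy_mul_mubar, ?_⟩
  rw [br_smul, br_lefL_tri (epsB_mul_epsB _), smul_zero]
  exact ActsBy.zero

theorem acomm_mul_mu_mul_mubar : acomm (A.mulS 2 (-1)) (A.mulS (-1) 2) = 0 := by
  refine end_ext fun c y hy => ?_
  obtain ⟨B, hB⟩ := A.exists_isHermConn hA hy
  refine ⟨_, hB.actsBy_mul_mu.acomm hB.actsBy_mul_mubar, ?_⟩
  rw [acomm_smul_left, acomm_smul_right, acomm_tri _ _ _ (epsB_mul_epsB _), smul_zero, smul_zero]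
  exact ActsBy.zero

/-- The inverse reading of `br_lefΛ_torsion`: Λ turns the three exterior factors of μω into
contractions one at a time, which gives −3μ. -/
theorem mu_eq : A.dPartS 2 (-1) = -(1 / 3 : ℂ) • br A.lamS (A.mulS 2 (-1)) := by
  refine end_ext fun c y hy => ?_
  obtain ⟨B, hB⟩ := A.exists_isHermConn hA hy
  refine ⟨_, hB.actsBy_mu, ?_⟩
  have h := ((actsBy_lamS (A := A) hy).br hB.actsBy_mul_mu).smul (-(1 / 3 : ℂ))
  rw [br_lefΛ_torsion _ (matC_frame_swap hy) (torsC_swap_left _ _ _ _) (hB.torsC_swap_right _)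
    (torsC_mul_matC _ _ _ (A.chartJ_chartJ hy) Complex.I_mul_I) Complex.I_mul_I, smul_smul] at h
  rw [show -(1 / 3 : ℂ) * -3 = 1 by norm_num, one_smul] at h
  exact h

theorem mubar_eq : A.dPartS (-1) 2 = -(1 / 3 : ℂ) • br A.lamS (A.mulS (-1) 2) := by
  refine end_ext fun c y hy => ?_
  obtain ⟨B, hB⟩ := A.exists_isHermConn hA hy
  refine ⟨_, hB.actsBy_mubar, ?_⟩
  have h := ((actsBy_lamS (A := A) hy).br hB.actsBy_mul_mubar).smul (-(1 / 3 : ℂ))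
  have hI : -Complex.I * -Complex.I = -1 := by rw [neg_mul_neg, Complex.I_mul_I]
  rw [br_lefΛ_torsion _ (matC_frame_swap hy) (torsC_swap_left _ _ _ _) (hB.torsC_swap_right _)
    (torsC_mul_matC _ _ _ (A.chartJ_chartJ hy) hI) hI, smul_smul] at h
  rw [show -(1 / 3 : ℂ) * -3 = 1 by norm_num, one_smul] at h
  exact h

variable [SigmaCompactSpace M]

omit hA in
theorem isMetricAdjoint_lefschetz : IsMetricAdjoint A.lefschetz (extendOp A.lamS) :=
  isMetricAdjoint_of_isAdj (S := A.lefschetzS) (fun _ => rfl) fun _ _ hy =>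
    ⟨_, _, actsBy_lefschetzS hy, actsBy_lamS hy,
      isAdj_lefL _ (conj_matC _ _)⟩

/-- Adjunction conjugates the torsion tensor, so the (0,3) part enters; the scalar is d/6 of
`isAdj_tri_three` with d = −i. -/
theorem isMetricAdjoint_mul_mu : IsMetricAdjoint (mulLeft (A.mu A.fundamentalForm))
    (extendOp (-(Complex.I / 6) • br A.lamS (br A.lamS (br A.lamS (A.mulS (-1) 2))))) :=
  isMetricAdjoint_of_isAdj (S := A.mulS 2 (-1)) (fun _ => rfl) fun c y hy => by
    obtain ⟨B, hB⟩ := A.exists_isHermConn hA hy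
    rw [← neg_div]
    have hI : -Complex.I * -Complex.I = -1 := by rw [neg_mul_neg, Complex.I_mul_I]
    refine ⟨_, _, hB.actsBy_mul_mu, ((actsBy_lamS hy).br ((actsBy_lamS hy).br
      ((actsBy_lamS hy).br hB.actsBy_mul_mubar))).smul _, ?_⟩
    exact isAdj_tri_three _ (matC_frame_swap hy) (torsC_swap_left _ _ _ _)
      (hB.torsC_swap_right _) (torsC_swap_left _ _ _ _) (hB.torsC_swap_right _)
      (torsC_mul_matC _ _ _ (A.chartJ_chartJ hy) hI) hI (conj_torsC _ _ _ Complex.conj_I)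
      Complex.conj_I

theorem isMetricAdjoint_mul_mubar : IsMetricAdjoint (mulLeft (A.mubar A.fundamentalForm))
    (extendOp ((Complex.I / 6) • br A.lamS (br A.lamS (br A.lamS (A.mulS 2 (-1)))))) :=
  isMetricAdjoint_of_isAdj (S := A.mulS (-1) 2) (fun _ => rfl) fun c y hy => by
    obtain ⟨B, hB⟩ := A.exists_isHermConn hA hy
    have hI : conj (-Complex.I) = Complex.I := by rw [map_neg, Complex.conj_I, neg_neg]
    refine ⟨_, _, hB.actsBy_mul_mubar, ((actsBy_lamS hy).br ((actsBy_lamS hy).br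
      ((actsBy_lamS hy).br hB.actsBy_mul_mu))).smul _, ?_⟩
    exact isAdj_tri_three _ (matC_frame_swap hy) (torsC_swap_left _ _ _ _)
      (hB.torsC_swap_right _) (torsC_swap_left _ _ _ _) (hB.torsC_swap_right _)
      (torsC_mul_matC _ _ _ (A.chartJ_chartJ hy) Complex.I_mul_I) Complex.I_mul_I
      (conj_torsC _ _ _ hI) hI

theorem isMetricAdjoint_mu : IsMetricAdjoint A.mu
    (extendOp (-(Complex.I / 6) • br A.lamS (br A.lamS (A.mulS (-1) 2)))) :=
  isMetricAdjoint_of_isAdj (S := A.dPartS 2 (-1)) (fun _ => rfl) fun c y hy => by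
    obtain ⟨B, hB⟩ := A.exists_isHermConn hA hy
    rw [← neg_div]
    have hI : -Complex.I * -Complex.I = -1 := by rw [neg_mul_neg, Complex.I_mul_I]
    refine ⟨_, _, hB.actsBy_mu, ((actsBy_lamS hy).br
      ((actsBy_lamS hy).br hB.actsBy_mul_mubar)).smul _, ?_⟩
    exact isAdj_tri_two _ (matC_frame_swap hy) (torsC_swap_left _ _ _ _)
      (hB.torsC_swap_right _) (torsC_swap_left _ _ _ _) (hB.torsC_swap_right _)
      (torsC_mul_matC _ _ _ (A.chartJ_chartJ hy) hI) hI (conj_torsC _ _ _ Complex.conj_I)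
      Complex.conj_I

theorem isMetricAdjoint_mubar : IsMetricAdjoint A.mubar
    (extendOp ((Complex.I / 6) • br A.lamS (br A.lamS (A.mulS 2 (-1))))) :=
  isMetricAdjoint_of_isAdj (S := A.dPartS (-1) 2) (fun _ => rfl) fun c y hy => by
    obtain ⟨B, hB⟩ := A.exists_isHermConn hA hy
    have hI : conj (-Complex.I) = Complex.I := by rw [map_neg, Complex.conj_I, neg_neg]
    refine ⟨_, _, hB.actsBy_mubar, ((actsBy_lamS hy).br
      ((actsBy_lamS hy).br hB.actsBy_mul_mu)).smul _, ?_⟩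
    exact isAdj_tri_two _ (matC_frame_swap hy) (torsC_swap_left _ _ _ _)
      (hB.torsC_swap_right _) (torsC_swap_left _ _ _ _) (hB.torsC_swap_right _)
      (torsC_mul_matC _ _ _ (A.chartJ_chartJ hy) Complex.I_mul_I) Complex.I_mul_I
      (conj_torsC _ _ _ hI) hI

/-- The Kähler identity ∂* = i[Λ,∂̄] survives without correction because the torsion has no trace
and Λ is parallel. -/
theorem isMetricAdjoint_del : IsMetricAdjoint A.del
    (extendOp (Complex.I • br A.lamS (A.dPartS 0 1))) :=
  A.isMetricAdjoint_dPart 1 0 (by norm_num) Complex.I (isSmooth_extendOp _)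
    fun {α β} hα hβ {c y} hy => by
      rw [extendOp_apply _ hβ]
      exact sum_fderiv_flux_del hA hα hβ hy

theorem isMetricAdjoint_delbar : IsMetricAdjoint A.delbar
    (extendOp (-Complex.I • br A.lamS (A.dPartS 1 0))) :=
  A.isMetricAdjoint_dPart 0 1 (by norm_num) (-Complex.I) (isSmooth_extendOp _)
    fun {α β} hα hβ {c y} hy => by
      rw [extendOp_apply _ hβ]
      exact sum_fderiv_flux_delbar hA hα hβ hy

end AlmostHermitianStructure

end LefschetzRelations

/-! ### The identities for Laplacians -/

section FinalIdentities

variable {n : ℕ} {M : Type*} [TopologicalSpace M] [T2Space M] [SigmaCompactSpace M]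
  [ChartedSpace (Model n) M]
  [RiemannianBundle (fun x : M => TangentSpace (𝓡 (2 * n)) x)] [IsManifold (𝓡 (2 * n)) ∞ M]
  [IsContMDiffRiemannianBundle (𝓡 (2 * n)) ∞ (EuclideanSpace ℝ (Fin (2 * n)))
      (fun x : M => TangentSpace (𝓡 (2 * n)) x)]

namespace AlmostHermitianStructure

variable {A : AlmostHermitianStructure n M} (hA : A.IsNearlyKahler)

theorem restricts_dPart (a b : ℤ) : Restricts (A.dPart a b) (A.dPartS a b) := fun _ => rfl

theorem restricts_lefschetz : Restricts A.lefschetz A.lefschetzS := fun _ => rfl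

theorem restricts_mulLeft (a b : ℤ) :
    Restricts (mulLeft (A.dPart a b A.fundamentalForm)) (A.mulS a b) := fun _ => rfl

include hA

theorem restricts_laplacian_mul_mu : Restricts (laplacian 3 (mulLeft (A.mu A.fundamentalForm)))
    (acomm (-(Complex.I / 6) • br A.lamS (br A.lamS (br A.lamS (A.mulS (-1) 2))))
      (A.mulS 2 (-1))) :=
  restricts_laplacian (isMetricAdjoint_mul_mu hA) (restricts_mulLeft _ _) (by decide)

theorem restricts_laplacian_mul_mubar :
    Restricts (laplacian 3 (mulLeft (A.mubar A.fundamentalForm)))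
      (acomm ((Complex.I / 6) • br A.lamS (br A.lamS (br A.lamS (A.mulS 2 (-1)))))
        (A.mulS (-1) 2)) :=
  restricts_laplacian (isMetricAdjoint_mul_mubar hA) (restricts_mulLeft _ _) (by decide)

/-- Graded commutators of two odd operators are anticommutators, and those involving an even degree
are commutators. After this translation the statement is `acomm_mubar_mu` in the ring of
endomorphisms of smooth forms. -/
theorem gradedComm_mubar_mu (α : SmoothForm n M) : gradedComm 1 1 A.mubar A.mu α.val =
    (Complex.I / 9) • gradedComm 0 2 (laplacian 3 (mulLeft (A.mu A.fundamentalForm)) -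
      laplacian 3 (mulLeft (A.mubar A.fundamentalForm))) A.lefschetz α.val := by
  have h1 : Restricts (gradedComm 1 1 A.mubar A.mu) (acomm (A.dPartS (-1) 2) (A.dPartS 2 (-1))) :=
    (restricts_dPart (-1) 2).gradedComm_odd (restricts_dPart 2 (-1)) (by decide)
  have h2 := ((restricts_laplacian_mul_mu hA).sub
    (restricts_laplacian_mul_mubar hA)).gradedComm_even (p := 0) (q := 2)
      (restricts_lefschetz (A := A)) (by decide)
  rw [h1, h2, mu_eq hA, mubar_eq hA, acomm_mubar_mu weight_lamS (weight_mul_mu hA)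
    (weight_mul_mubar hA) (br_lefschetzS_mul_mu hA) (br_lefschetzS_mul_mubar hA)
    (acomm_mul_mu_mul_mubar hA)]
  rfl

theorem gradedComm_lam_mu (α : SmoothForm n M) :
    gradedComm (-2) 4 (metricAdjoint A.lefschetz)
      (gradedComm 1 3 A.mu (mulLeft (A.mubar A.fundamentalForm))) α.val =
    (-(Complex.I / 3)) • gradedComm 0 2 (laplacian 3 (mulLeft (A.mu A.fundamentalForm)) +
      laplacian 3 (mulLeft (A.mubar A.fundamentalForm))) A.lefschetz α.val := by
  have h1 : Restricts (gradedComm 1 3 A.mu (mulLeft (A.mubar A.fundamentalForm)))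
      (acomm (A.dPartS 2 (-1)) (A.mulS (-1) 2)) :=
    (restricts_dPart 2 (-1)).gradedComm_odd (restricts_mulLeft (-1) 2) (by decide)
  have h2 := (restricts_metricAdjoint (isMetricAdjoint_lefschetz (A := A))).gradedComm_even
    (p := -2) (q := 4) h1 (by decide)
  have h3 := ((restricts_laplacian_mul_mu hA).add
    (restricts_laplacian_mul_mubar hA)).gradedComm_even (p := 0) (q := 2)
      (restricts_lefschetz (A := A)) (by decide)
  rw [h2, h3, mu_eq hA, br_acomm_mu weight_lamS (weight_mul_mu hA)
    (weight_mul_mubar hA) (br_lefschetzS_mul_mu hA) (br_lefschetzS_mul_mubar hA)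
    (acomm_mul_mu_mul_mubar hA)]
  rfl

/-- Here and in the next two lemmas the same operator [Λ,{E₁,F₁}] appears, with the scalars i/2,
i/18 and −i/9. Their ratios are the constants −2 and −2/9 of the theorem. -/
theorem restricts_laplacian_mul_diff :
    Restricts (laplacian 3 (mulLeft (A.mu A.fundamentalForm)) -
      laplacian 3 (mulLeft (A.mubar A.fundamentalForm)))
      ((Complex.I / 2) • br A.lamS (acomm (br A.lamS (A.mulS 2 (-1)))
        (br A.lamS (A.mulS (-1) 2)))) := by
  have h := (restricts_laplacian_mul_mu hA).sub (restricts_laplacian_mul_mubar hA)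
  rwa [laplacian_diff_string (acomm_mul_mu_mul_mubar hA)] at h

theorem restricts_laplacian_mu_diff :
    Restricts (laplacian 1 A.mu - laplacian 1 A.mubar)
      ((Complex.I / 18) • br A.lamS (acomm (br A.lamS (A.mulS 2 (-1)))
        (br A.lamS (A.mulS (-1) 2)))) := by
  have h := (restricts_laplacian (p := 1) (isMetricAdjoint_mu hA) (restricts_dPart 2 (-1))
    (by decide)).sub (restricts_laplacian (p := 1) (isMetricAdjoint_mubar hA)
      (restricts_dPart (-1) 2) (by decide))
  rwa [mu_eq hA, mubar_eq hA, laplacian_diff_mu] at h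

theorem restricts_laplacian_del_diff :
    Restricts (laplacian 1 A.del - laplacian 1 A.delbar)
      (-(Complex.I / 9) • br A.lamS (acomm (br A.lamS (A.mulS 2 (-1)))
        (br A.lamS (A.mulS (-1) 2)))) := by
  have h := (restricts_laplacian (p := 1) (isMetricAdjoint_del hA) (restricts_dPart 1 0)
    (by decide)).sub (restricts_laplacian (p := 1) (isMetricAdjoint_delbar hA)
      (restricts_dPart 0 1) (by decide))
  have h0 := acomm_del_delbar hA
  rw [mu_eq hA, mubar_eq hA] at h0
  rwa [laplacian_diff_del _ _ h0] at h

theorem laplacian_del_sub_laplacian_delbar_mu (α : SmoothForm n M) :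
    (laplacian 1 A.del - laplacian 1 A.delbar) α.val =
      (-2 : ℂ) • (laplacian 1 A.mu - laplacian 1 A.mubar) α.val := by
  rw [restricts_laplacian_del_diff hA, restricts_laplacian_mu_diff hA,
    show -(Complex.I / 9) = (-2) * (Complex.I / 18) by ring, mul_smul]
  rfl

theorem laplacian_del_sub_laplacian_delbar_mul (α : SmoothForm n M) :
    (laplacian 1 A.del - laplacian 1 A.delbar) α.val =
      (-(2 / 9) : ℂ) • (laplacian 3 (mulLeft (A.mu A.fundamentalForm)) -
        laplacian 3 (mulLeft (A.mubar A.fundamentalForm))) α.val := by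
  rw [restricts_laplacian_del_diff hA, restricts_laplacian_mul_diff hA,
    show -(Complex.I / 9) = (-(2 / 9)) * (Complex.I / 2) by ring, mul_smul]
  rfl

end AlmostHermitianStructure

end FinalIdentities

end NearlyKahler

end

/-- On a nearly Kähler manifold `(M, g, J)` of dimension `2n`, with `Δ_P = [P^*, P]`:
`[μ̄, μ] = (i/9) [Δ_{L_{μω}} - Δ_{L_{μ̄ω}}, L]`,
`[Λ, [μ, L_{μ̄ω}]] = -(i/3) [Δ_{L_{μω}} + Δ_{L_{μ̄ω}}, L]`, and
`Δ_∂ - Δ_∂̄ = -2 (Δ_μ - Δ_μ̄) = -(2/9) (Δ_{L_{μω}} - Δ_{L_{μ̄ω}})`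
as operators on smooth complex-valued forms. The first part of the conclusion says that all the
metric adjoints which occur here exist. -/
theorem proposition4p3 (n : ℕ) (M : Type*) [TopologicalSpace M] [T2Space M] [SigmaCompactSpace M]
    [ChartedSpace (EuclideanSpace ℝ (Fin (2 * n))) M]
    [IsManifold (𝓡 (2 * n)) ∞ M]
    [RiemannianBundle (fun x : M => TangentSpace (𝓡 (2 * n)) x)]
    [IsContMDiffRiemannianBundle (𝓡 (2 * n)) ∞ (EuclideanSpace ℝ (Fin (2 * n)))
      (fun x : M => TangentSpace (𝓡 (2 * n)) x)]
    (A : NearlyKahler.AlmostHermitianStructure n M) (hA : A.IsNearlyKahler) :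
    let L : NearlyKahler.Operator n M := A.lefschetz
    let Lambda : NearlyKahler.Operator n M := NearlyKahler.metricAdjoint L
    let Lmu : NearlyKahler.Operator n M := NearlyKahler.mulLeft (A.mu A.fundamentalForm)
    let Lmubar : NearlyKahler.Operator n M := NearlyKahler.mulLeft (A.mubar A.fundamentalForm)
    (∀ P ∈ [L, Lmu, Lmubar, A.mu, A.mubar, A.del, A.delbar],
      ∃ Q, NearlyKahler.IsMetricAdjoint P Q) ∧
    ∀ α : NearlyKahler.Form n M, NearlyKahler.IsSmooth α →
      NearlyKahler.gradedComm 1 1 A.mubar A.mu α =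
        (Complex.I / 9) • NearlyKahler.gradedComm 0 2
          (NearlyKahler.laplacian 3 Lmu - NearlyKahler.laplacian 3 Lmubar) L α ∧
      NearlyKahler.gradedComm (-2) 4 Lambda (NearlyKahler.gradedComm 1 3 A.mu Lmubar) α =
        (-(Complex.I / 3)) • NearlyKahler.gradedComm 0 2
          (NearlyKahler.laplacian 3 Lmu + NearlyKahler.laplacian 3 Lmubar) L α ∧
      (NearlyKahler.laplacian 1 A.del - NearlyKahler.laplacian 1 A.delbar) α =
        (-2 : ℂ) • (NearlyKahler.laplacian 1 A.mu - NearlyKahler.laplacian 1 A.mubar) α ∧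
      (NearlyKahler.laplacian 1 A.del - NearlyKahler.laplacian 1 A.delbar) α =
        (-(2 / 9) : ℂ) •
          (NearlyKahler.laplacian 3 Lmu - NearlyKahler.laplacian 3 Lmubar) α := by
  refine ⟨?_, fun α hα => ?_⟩
  · simp only [List.forall_mem_cons]
    exact ⟨⟨_, NearlyKahler.AlmostHermitianStructure.isMetricAdjoint_lefschetz⟩,
      ⟨_, NearlyKahler.AlmostHermitianStructure.isMetricAdjoint_mul_mu hA⟩,
      ⟨_, NearlyKahler.AlmostHermitianStructure.isMetricAdjoint_mul_mubar hA⟩,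
      ⟨_, NearlyKahler.AlmostHermitianStructure.isMetricAdjoint_mu hA⟩,
      ⟨_, NearlyKahler.AlmostHermitianStructure.isMetricAdjoint_mubar hA⟩,
      ⟨_, NearlyKahler.AlmostHermitianStructure.isMetricAdjoint_del hA⟩,
      ⟨_, NearlyKahler.AlmostHermitianStructure.isMetricAdjoint_delbar hA⟩,
      List.forall_mem_nil _⟩
  · exact ⟨NearlyKahler.AlmostHermitianStructure.gradedComm_mubar_mu hA (.mk α hα),
      NearlyKahler.AlmostHermitianStructure.gradedComm_lam_mu hA (.mk α hα),
      NearlyKahler.AlmostHermitianStructure.laplacian_del_sub_laplacian_delbar_mu hA (.mk α hα),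
      NearlyKahler.AlmostHermitianStructure.laplacian_del_sub_laplacian_delbar_mul hA (.mk α hα)⟩
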